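/- Let $p\ge 1$ be an odd integer, let $\theta$ be the Heaviside function ($\theta(t)=1$ for $t>0$ and $0$ otherwise), and put $u_j=\frac{p}{2\pi}\sin\frac{\pi j}{p}$, $u'_j=\frac{p}{2\pi}\sin\frac{\pi (j-1/2)}{p}$. Consider the two kernels $$H^{\mathrm{M}(p)}(x,y)=-\sum_{j=1}^{(p-1)/2}(-1)^j\cos\tfrac{\pi j}{p}\bigl(e^{-u_j(x+y)}\theta(x+y)+e^{-u_j(x-y)}\theta(x-y)\bigr)+\sum_{j=0}^{(p-1)/2}(-1)^j\cos\tfrac{\pi j}{p}\bigl(e^{u_j(x+y)}\theta(-x-y)+e^{u_j(x-y)}\theta(y-x)\bigr),$$ $$H^{\mathrm{SM}(p)}(x,y)=\frac1{2\pi}\sum_{j=1}^{(p-1)/2}(-1)^j\cos^2\tfrac{\pi(j-1/2)}{p}\bigl(e^{-u'_j(x+y)}\theta(x+y)-e^{-u'_j(x-y)}\theta(x-y)+e^{u'_j(x+y)}\theta(-x-y)-e^{u'_j(x-y)}\theta(y-x)\bigr)+\delta_{p,1}\bigl(\delta(x-y)-\delta(x+y)\bigr).$$ **Volumes.** For the $(2,p)$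 minimal string put $R(x,y,z)=\frac12\int_0^x(H(z,t+y)+H(z,t-y))\,dt$, $D(x,y,z)=\int_0^xH(y+z,t)\,dt$ with $H=H^{\mathrm{M}(p)}$, $V_{0,3}=1$ and $V_{1,1}(L)=\frac{\pi^2}{12}(1-\frac1{p^2})+\frac{L^2}{48}$. For the $(2,2p-2)$ minimal superstring put $R(x,y,z)=\frac12(H(z,x+y)+H(z,x-y))$, $D(x,y,z)=H(y+z,x)$ with $H=H^{\mathrm{SM}(p)}$, $V_{0,3}=0$ and $V_{1,1}=\frac18$. In both cases, with $K=\{2,\dots,n\}$, the volumes $V_{g,n}$ for $2g-2+n>1$ are defined by $$L_1V_{g,n}(L_1,\dots,L_n)=\sum_{m=2}^n\int_0^\infty xR(L_1,L_m,x)V_{g,n-1}(x,L_{K\setminus m})\,dx+\frac12\int_0^\infty\!\!\int_0^\infty xyD(L_1,x,y)P_{g,n}(x,y,L_K)\,dx\,dy,$$ $$P_{g,n}(x,y,L_K)=V_{g-1,n+1}(x,y,L_K)+\sum_{h+h'=g,\ J\sqcup J'=K}V_{h,1+|J|}(x,L_J)V_{h',1+|J'|}(y,L_{J'}),$$ where only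 stable terms ($2h-2+1+|J|>0$ and $2h'-2+1+|J'|>0$) occur. With $f^{\mathrm{MV}}(\ell)=1/(e^\ell-1)$, the twisted volumes are $$V_{g,n}[f^{\mathrm{MV}}](L)=\sum_{\Gamma}\frac1{|\mathrm{Aut}\,\Gamma|}\int_{\mathbb R_+^{E_\Gamma}}\prod_{v}V_{h(v),k(v)}\bigl((\ell_e)_{e\ni v},(L_\lambda)_{\lambda\ni v}\bigr)\prod_{e\in E_\Gamma}f^{\mathrm{MV}}(\ell_e)\,\ell_e\,d\ell_e,$$ the sum being over isomorphism classes of stable graphs $\Gamma$ of genus $g$ with $n$ labelled legs, where $h(v)$ and $k(v)$ are the genus and the valence of the vertex $v$. **Spectral curves.** Let $\mathsf x(z)=z^2/2$, $\mathsf y^{\mathrm{M}(p)}(z)=\frac{(-1)^{(p-1)/2}}{2\pi}T_p(\frac{2\pi}{p}z)$, $\mathsf y^{\mathrm{SM}(p)}(z)=\frac{(-1)^{(p-1)/2}}{z}U_{p-1}(\frac{2\pi}{p}z)$ with $T_p,U_{p-1}$ the Chebyshev polynomials of the first and second kind, and $$B[f^{\mathrm{MV}}](z_1,z_2)=\Bigl(\frac1{(z_1-z_2)^2}+\frac12\sum_{m\in\mathbb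 Z\setminus 0}\frac1{(z_1-z_2+m)^2}\Bigr)dz_1\otimes dz_2,\qquad B(z_1,z_2)=\frac{dz_1\otimes dz_2}{(z_1-z_2)^2}.$$ For $\mathsf y=\mathsf y^{\mathrm{M}(p)}$ or $\mathsf y^{\mathrm{SM}(p)}$ let $\omega_{g,n}=W_{g,n}[f^{\mathrm{MV}}]\,dz_1\otimes\cdots\otimes dz_n$ be given by $\omega_{0,2}=B[f^{\mathrm{MV}}]$ and, for $2g-2+n>0$, by the Chekhov–Eynard–Orantin topological recursion $$\omega_{g,n}(z_1,z_K)=\operatorname*{Res}_{w=0}\frac{\int_w^{-w}B[f^{\mathrm{MV}}](\cdot,z_1)}{2(\mathsf y(w)-\mathsf y(-w))\,w\,dw}\Bigl(\omega_{g-1,n+1}(w,-w,z_K)+\sum_{h+h'=g,\ J\sqcup J'=K}^{\text{no }(0,1)}\omega_{h,1+|J|}(w,z_J)\,\omega_{h',1+|J'|}(-w,z_{J'})\Bigr).$$ Let $\xi_a[f^{\mathrm{MV}}](z)=\operatorname{Res}_{w=0}w^{-2a-2}dw\int_0^wB[f^{\mathrm{MV}}](\cdot,z)$ and $\xi_a(z)=\operatorname{Res}_{w=0}w^{-2a-2}dw\int_0^wB(\cdot,z)=z^{-2a-2}dz$.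 The twist-elimination map $\mathcal E[z_1,\dots,z_n]$, defined on the span of the symmetric tensors of the $\xi_a[f^{\mathrm{MV}}]$, replaces each $\xi_{a}[f^{\mathrm{MV}}](z_i)$ by $\xi_{a}(z_i)$; it acts on the coefficient function $W_{g,n}[f^{\mathrm{MV}}]$ accordingly. **Theorem.** For each of the two models and all $g\ge0$, $n\ge1$ with $2g-2+n>0$: the form $W_{g,n}[f^{\mathrm{MV}}]\,dz_1\otimes\cdots\otimes dz_n$ lies in the span of the symmetric tensors of the $\xi_a[f^{\mathrm{MV}}]$, and for all $z_1,\dots,z_n$ with positive real part the following integral converges absolutely and $$\int_{\mathbb R_+^n}V_{g,n}[f^{\mathrm{MV}}](L_1,\dots,L_n)\,e^{-\sum_iz_iL_i}\prod_{i=1}^nL_i\,dL_i=\mathcal E[z_1,\dots,z_n]\{W_{g,n}[f^{\mathrm{MV}}]\}(z_1,\dots,z_n).$$ Moreover the kernels are matched with the spectral curves as follows. Near $z=0$ there are expansions $1/\mathsf y^{\mathrm{M}(p)}(z)=\sum_{\ell\ge0}s_\ell z^{2\ell-1}$ and $1/\mathsf y^{\mathrm{SM}(p)}(z)=\sum_{\ell\ge0}s'_\ell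 z^{2\ell+1}$ with real coefficients, and for all $k\ge0$ and $t\in\mathbb R$ $$\int_0^\infty\frac{x^{2k+1}}{(2k+1)!}H^{\mathrm{M}(p)}(x,t)\,dx=\sum_{\ell=0}^{k+1}s_\ell\frac{t^{2k+2-2\ell}}{(2k+2-2\ell)!},\qquad\int_0^\infty\frac{x^{2k+1}}{(2k+1)!}H^{\mathrm{SM}(p)}(x,t)\,dx=\sum_{\ell=0}^{k}s'_\ell\frac{t^{2k+1-2\ell}}{(2k+1-2\ell)!}.$$ -/

import Mathlib

open MeasureTheory Filter Topology

noncomputable section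

namespace TwistedTR

/-! ### Shared notation -/

/-- For a tuple `z = (z_i)_{i : Fin n}` and `J ⊆ Fin n`, the tuple `z_J`, listed in increasing order
of the index. -/
def subTuple {α : Type*} {n : ℕ} (z : Fin n → α) (J : Finset (Fin n)) : Fin J.card → α :=
  fun i => z (J.orderEmbOfFin rfl i)

/-- `2g - 2 + n > 0`. -/
def Stable (g n : ℕ) : Prop := 2 < 2 * g + n

instance (g n : ℕ) : Decidable (Stable g n) := inferInstanceAs (Decidable (_ < _))

/-! ### Topological recursion of Andersen, Borot and Orantin (Mirzakhani type) -/

/-- Initial data of the recursion. The functions `R` and `D` (which may be distributions in the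
integrated variables) are recorded through the integrals against them:
`intR L₁ L₂ φ = ∫_{ℝ₊} R(L₁, L₂, x) φ(x) dx` and
`intD L₁ Φ = ∫_{ℝ₊²} D(L₁, x, y) Φ(x, y) dx dy`. -/
structure ABOData where
  A : ℝ → ℝ → ℝ → ℝ
  VD : ℝ → ℝ
  intR : ℝ → ℝ → (ℝ → ℝ) → ℝ
  intD : ℝ → (ℝ → ℝ → ℝ) → ℝ

/-- The volume `V_{g,n}(L₁, …, Lₙ)` (with `L₁ = L 0`), defined by
`V_{0,3} = A`, `V_{1,1} = VD` and, for `2g - 2 + n > 1`,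
`L₁ V_{g,n}(L) = ∑_m ∫ x R(L₁, L_m, x) V_{g,n-1}(x, L_{K∖m}) dx
  + (1/2) ∫∫ x y D(L₁, x, y) P_{g,n}(x, y, L_K) dx dy`.
The unstable ones are set to `0`. Because of the division by `L₁`, only the values with
`0 < L₁` are meaningful. -/
def vol (𝒟 : ABOData) : (g n : ℕ) → (Fin n → ℝ) → ℝ
  | _, 0, _ => 0
  | g, n + 1, L =>
    if h : g = 0 ∧ n = 2 then
      𝒟.A (L 0) (L ⟨1, by omega⟩) (L ⟨2, by omega⟩)
    else if g = 1 ∧ n = 0 then 𝒟.VD (L 0)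
    else if ¬ Stable g (n + 1) then 0
    else
      (L 0)⁻¹ *
        ((∑ m : Fin n, 𝒟.intR (L 0) (Fin.tail L m) fun x =>
            x * vol 𝒟 g (({m}ᶜ : Finset (Fin n)).card + 1)
              (Fin.cons x (subTuple (Fin.tail L) {m}ᶜ)))
        + (1 / 2) * 𝒟.intD (L 0) fun x y =>
            x * y *
              ((if hg : g = 0 then 0 else
                  vol 𝒟 (g - 1) (n + 2) (Fin.cons x (Fin.cons y (Fin.tail L))))
              + ∑ h : Fin (g + 1), ∑ J : Finset (Fin n),
                  if hs : Stable h.1 (J.card + 1) ∧ Stable (g - h.1) (Jᶜ.card + 1) then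
                    vol 𝒟 h.1 (J.card + 1) (Fin.cons x (subTuple (Fin.tail L) J))
                      * vol 𝒟 (g - h.1) (Jᶜ.card + 1) (Fin.cons y (subTuple (Fin.tail L) Jᶜ))
                  else 0))
termination_by g n _ => 2 * g + n
decreasing_by
  · have h1 := Finset.card_add_card_compl ({m} : Finset (Fin n))
    simp only [Finset.card_singleton, Fintype.card_fin] at h1
    omega
  · omega
  all_goals
    have h1 := Finset.card_add_card_compl J
    have _h2 := h.2
    simp only [Fintype.card_fin] at h1
    unfold Stable at hs
    omega

/-! ### The two models -/

/-- Heaviside step function. -/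
def heaviside (t : ℝ) : ℝ := if 0 < t then 1 else 0

/-- `u_j = (p / 2π) sin(π j / p)`. -/
def uM (p j : ℕ) : ℝ := p / (2 * Real.pi) * Real.sin (Real.pi / p * j)

/-- The kernel `H^{M(p)}(x, y)` of the `(2,p)` minimal string. -/
def HM (p : ℕ) (x y : ℝ) : ℝ :=
  - ∑ j ∈ Finset.Icc 1 ((p - 1) / 2), (-1) ^ j * Real.cos (Real.pi / p * j) *
      (Real.exp (-uM p j * (x + y)) * heaviside (x + y)
        + Real.exp (-uM p j * (x - y)) * heaviside (x - y))
  + ∑ j ∈ Finset.Icc 0 ((p - 1) / 2), (-1) ^ j * Real.cos (Real.pi / p * j) *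
      (Real.exp (uM p j * (x + y)) * heaviside (-x - y)
        + Real.exp (uM p j * (x - y)) * heaviside (y - x))

/-- Bosonic `R(x, y, z) = (1/2) ∫_0^x (H(z, t + y) + H(z, t - y)) dt`. -/
def RM (p : ℕ) (x y z : ℝ) : ℝ :=
  (1 / 2) * ∫ t in (0 : ℝ)..x, (HM p z (t + y) + HM p z (t - y))

/-- Bosonic `D(x, y, z) = ∫_0^x H(y + z, t) dt`. -/
def DM (p : ℕ) (x y z : ℝ) : ℝ := ∫ t in (0 : ℝ)..x, HM p (y + z) t

/-- Initial data of the `(2,p)` minimal string. -/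
def minimalString (p : ℕ) : ABOData where
  A _ _ _ := 1
  VD L := Real.pi ^ 2 / 12 * (1 - 1 / (p : ℝ) ^ 2) + L ^ 2 / 48
  intR L₁ L₂ φ := ∫ x in Set.Ioi (0 : ℝ), RM p L₁ L₂ x * φ x
  intD L₁ Φ := ∫ x in Set.Ioi (0 : ℝ), ∫ y in Set.Ioi (0 : ℝ), DM p L₁ x y * Φ x y

/-- `u'_j = (p / 2π) sin(π (j - 1/2) / p)`. -/
def uSM (p j : ℕ) : ℝ := p / (2 * Real.pi) * Real.sin (Real.pi / p * (j - 1 / 2))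

/-- The part of the kernel `H^{SM(p)}(x, y)` of the `(2,2p-2)` minimal superstring that is a
function. The kernel itself is `HSM p x y + δ_{p,1} (δ(x - y) - δ(x + y))`. -/
def HSM (p : ℕ) (x y : ℝ) : ℝ :=
  1 / (2 * Real.pi) * ∑ j ∈ Finset.Icc 1 ((p - 1) / 2),
    (-1) ^ j * Real.cos (Real.pi / p * (j - 1 / 2)) ^ 2 *
      (Real.exp (-uSM p j * (x + y)) * heaviside (x + y)
        - Real.exp (-uSM p j * (x - y)) * heaviside (x - y)
        + Real.exp (uSM p j * (x + y)) * heaviside (-x - y)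
        - Real.exp (uSM p j * (x - y)) * heaviside (y - x))

/-- `∫_{ℝ₊} φ(y) H^{SM(p)}(a + y, t) dy`, including the delta functions that are present
for `p = 1`: as distributions in `y`, `δ(a + y - t)` and `δ(a + y + t)` are the Dirac measures at
`t - a` and `-t - a`. -/
def kerIntSM (p : ℕ) (φ : ℝ → ℝ) (a t : ℝ) : ℝ :=
  (∫ y in Set.Ioi (0 : ℝ), φ y * HSM p (a + y) t)
    + if p = 1 then
        (∫ y in Set.Ioi (0 : ℝ), φ y ∂(Measure.dirac (t - a)))
          - ∫ y in Set.Ioi (0 : ℝ), φ y ∂(Measure.dirac (-t - a))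
      else 0

/-- Initial data of the `(2,2p-2)` minimal superstring, where
`R(x, y, z) = (1/2) (H(z, x + y) + H(z, x - y))` and `D(x, y, z) = H(y + z, x)`. -/
def minimalSuperstring (p : ℕ) : ABOData where
  A _ _ _ := 0
  VD _ := 1 / 8
  intR L₁ L₂ φ := (1 / 2) * (kerIntSM p φ 0 (L₁ + L₂) + kerIntSM p φ 0 (L₁ - L₂))
  intD L₁ Φ := ∫ x in Set.Ioi (0 : ℝ), kerIntSM p (fun y => Φ x y) x L₁

/-! ### Stable graphs and twisted volumes -/

/-- A stable graph of type `(g, n)`: vertices `Fin N` decorated by genera, edges `Fin k`, each edge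
`e` made of the two half-edges `(e, false)` and `(e, true)`, and `n` labelled legs. -/
structure StableGraph (g n : ℕ) where
  N : ℕ
  k : ℕ
  genus : Fin N → ℕ
  ends : Fin k × Bool → Fin N
  leg : Fin n → Fin N
  nonempty : 0 < N
  connected : ∀ u v : Fin N,
    Relation.ReflTransGen (fun a b => ∃ e s, ends (e, s) = a ∧ ends (e, !s) = b) u v
  stable : ∀ v, Stable (genus v)
    ((Finset.univ.filter fun h => ends h = v).card + (Finset.univ.filter fun i => leg i = v).card)
  genus_eq : ∑ v, genus v + k + 1 = g + N

namespace StableGraph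

variable {g n : ℕ}

/-- Isomorphisms of stable graphs: bijections of vertices and of half-edges that preserve edges,
incidence, legs (with labels) and genera. -/
structure Iso (Γ Δ : StableGraph g n) where
  vert : Fin Γ.N ≃ Fin Δ.N
  half : Fin Γ.k × Bool ≃ Fin Δ.k × Bool
  flip : ∀ h, half (h.1, !h.2) = ((half h).1, !(half h).2)
  ends : ∀ h, Δ.ends (half h) = vert (Γ.ends h)
  leg : ∀ i, Δ.leg i = vert (Γ.leg i)
  genus : ∀ v, Δ.genus (vert v) = Γ.genus v

def Iso.refl (Γ : StableGraph g n) : Iso Γ Γ :=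
  ⟨Equiv.refl _, Equiv.refl _, fun _ => rfl, fun _ => rfl, fun _ => rfl, fun _ => rfl⟩

def Iso.symm {Γ Δ : StableGraph g n} (f : Iso Γ Δ) : Iso Δ Γ where
  vert := f.vert.symm
  half := f.half.symm
  flip h := by
    rw [Equiv.symm_apply_eq, f.flip]
    simp
  ends h := by
    have := f.ends (f.half.symm h)
    rw [Equiv.apply_symm_apply] at this
    rw [this, Equiv.symm_apply_apply]
  leg i := by rw [f.leg, Equiv.symm_apply_apply]
  genus v := by
    have := f.genus (f.vert.symm v)
    rw [Equiv.apply_symm_apply] at this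
    exact this.symm

def Iso.trans {Γ Δ Θ : StableGraph g n} (f : Iso Γ Δ) (f' : Iso Δ Θ) : Iso Γ Θ where
  vert := f.vert.trans f'.vert
  half := f.half.trans f'.half
  flip h := by
    simp only [Equiv.trans_apply, f.flip]
    exact f'.flip (f.half h)
  ends h := by simp only [Equiv.trans_apply, f'.ends, f.ends]
  leg i := by simp only [Equiv.trans_apply, f'.leg, f.leg]
  genus v := by simp only [Equiv.trans_apply, f'.genus, f.genus]

instance isoSetoid (g n : ℕ) : Setoid (StableGraph g n) where
  r Γ Δ := Nonempty (Iso Γ Δ)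
  iseqv := ⟨fun Γ => ⟨Iso.refl Γ⟩, fun ⟨f⟩ => ⟨f.symm⟩, fun ⟨f⟩ ⟨f'⟩ => ⟨f.trans f'⟩⟩

/-- The order of the automorphism group of `Γ`. -/
def autCard (Γ : StableGraph g n) : ℕ := Nat.card (Iso Γ Γ)

/-- The lengths of the half-edges and legs at the vertex `v`. -/
def lengths (Γ : StableGraph g n) (ℓ : Fin Γ.k → ℝ) (L : Fin n → ℝ) (v : Fin Γ.N) : List ℝ :=
  (((List.finRange Γ.k).product [false, true]).filter fun h => Γ.ends h = v).map (fun h => ℓ h.1)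
    ++ ((List.finRange n).filter fun i => Γ.leg i = v).map L

/-- `∫_{ℝ₊^E} ∏_v V_{h(v),k(v)}((ℓ_e)_{e ∈ E(v)}, (L_λ)_{λ ∈ Λ(v)}) ∏_e f(ℓ_e) ℓ_e dℓ_e`. -/
def weight (𝒟 : ABOData) (f : ℝ → ℝ) (Γ : StableGraph g n) (L : Fin n → ℝ) : ℝ :=
  ∫ ℓ in Set.univ.pi fun _ : Fin Γ.k => Set.Ioi (0 : ℝ),
    (∏ v, vol 𝒟 (Γ.genus v) (Γ.lengths ℓ L v).length (Γ.lengths ℓ L v).get)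
      * ∏ e, f (ℓ e) * ℓ e

/-- There are finitely many stable graphs of each type, so that the sum over isomorphism classes
below is a finite sum. -/
instance (g n : ℕ) : Finite (StableGraph g n) := by
  have key : ∀ Γ : StableGraph g n, Γ.N < 2 * g + n + 1 ∧ Γ.k < 3 * g + n + 1 ∧
      ∀ v, Γ.genus v < 2 * g + n + 1 := by
    intro Γ
    have hE : ∑ v, (Finset.univ.filter fun h => Γ.ends h = v).card = 2 * Γ.k := by
      have := Finset.card_eq_sum_card_fiberwise (s := (Finset.univ : Finset (Fin Γ.k × Bool)))
        (t := Finset.univ) (f := Γ.ends) (fun _ _ => Finset.mem_coe.2 (Finset.mem_univ _))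
      rw [← this]; simp [mul_comm]
    have hL : ∑ v, (Finset.univ.filter fun i => Γ.leg i = v).card = n := by
      have := Finset.card_eq_sum_card_fiberwise (s := (Finset.univ : Finset (Fin n)))
        (t := Finset.univ) (f := Γ.leg) (fun _ _ => Finset.mem_coe.2 (Finset.mem_univ _))
      rw [← this]; simp
    have hst := Γ.stable
    have hg := Γ.genus_eq
    unfold Stable at hst
    set a : Fin Γ.N → ℕ := fun v => (Finset.univ.filter fun h => Γ.ends h = v).card with ha
    set b : Fin Γ.N → ℕ := fun v => (Finset.univ.filter fun i => Γ.leg i = v).card with hb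
    have hsum : ∑ v : Fin Γ.N, 3 ≤ ∑ v, (2 * Γ.genus v + (a v + b v)) :=
      Finset.sum_le_sum fun v _ => hst v
    have hsplit : ∑ v, (2 * Γ.genus v + (a v + b v)) = 2 * ∑ v, Γ.genus v + (2 * Γ.k + n) := by
      rw [Finset.sum_add_distrib, Finset.sum_add_distrib, ← Finset.mul_sum, hE, hL]
    simp only [Finset.sum_const, Finset.card_univ, Fintype.card_fin, smul_eq_mul] at hsum
    have hpos := Γ.nonempty
    refine ⟨by omega, by omega, fun v => ?_⟩
    have h1 : ∑ w ∈ Finset.univ.erase v, 3 ≤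
        ∑ w ∈ Finset.univ.erase v, (2 * Γ.genus w + (a w + b w)) :=
      Finset.sum_le_sum fun v _ => hst v
    have h2 := Finset.add_sum_erase Finset.univ (fun w => 2 * Γ.genus w + (a w + b w))
      (Finset.mem_univ v)
    simp only [Finset.sum_const, Finset.card_erase_of_mem (Finset.mem_univ v), Finset.card_univ,
      Fintype.card_fin, smul_eq_mul] at h1
    beta_reduce at h2
    omega
  refine Finite.of_injective (β := Σ N : Fin (2 * g + n + 1), Σ k : Fin (3 * g + n + 1),
    (Fin N → Fin (2 * g + n + 1)) × (Fin k × Bool → Fin N) × (Fin n → Fin N)) (fun Γ =>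
    ⟨⟨Γ.N, (key Γ).1⟩, ⟨Γ.k, (key Γ).2.1⟩, fun v => ⟨Γ.genus v, (key Γ).2.2 v⟩, Γ.ends, Γ.leg⟩) ?_
  rintro ⟨N, k, a, b, c, _, _, _, _⟩ ⟨N', k', a', b', c', _, _, _, _⟩ h
  rw [Sigma.mk.inj_iff] at h
  obtain ⟨h0, h⟩ := h
  obtain rfl : N = N' := congrArg Fin.val h0
  rw [heq_eq_eq, Sigma.mk.inj_iff] at h
  obtain ⟨h0, h⟩ := h
  obtain rfl : k = k' := congrArg Fin.val h0
  rw [heq_eq_eq, Prod.mk.injEq, Prod.mk.injEq] at h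
  obtain ⟨h1, rfl, rfl⟩ := h
  have : a = a' := by
    funext v
    simpa using congrArg Fin.val (congrFun h1 v)
  subst this
  rfl

end StableGraph

/-- The twisted volume `V_{g,n}[f](L₁, …, Lₙ)`: the sum over isomorphism classes of stable graphs,
weighted by `1 / |Aut Γ|`. -/
def twistedVol (𝒟 : ABOData) (f : ℝ → ℝ) (g n : ℕ) (L : Fin n → ℝ) : ℝ :=
  ∑ᶠ c : Quotient (StableGraph.isoSetoid g n),
    ((c.out.autCard : ℝ))⁻¹ * c.out.weight 𝒟 f L

/-- The Masur-Veech type twist `f^MV(ℓ) = 1 / (e^ℓ - 1)`. -/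
def fMV (ℓ : ℝ) : ℝ := 1 / (Real.exp ℓ - 1)

/-! ### Laplace transform -/

/-- The integrand `f(L) e^{-∑ z_i L_i} ∏ L_i` of the Laplace transform. -/
def laplaceIntegrand {n : ℕ} (f : (Fin n → ℝ) → ℝ) (z : Fin n → ℂ) (L : Fin n → ℝ) : ℂ :=
  (f L : ℂ) * Complex.exp (-∑ i, z i * (L i : ℂ)) * ∏ i, (L i : ℂ)

/-- The open orthant of positive lengths. -/
def orthant (n : ℕ) : Set (Fin n → ℝ) := Set.univ.pi fun _ => Set.Ioi 0

/-- `𝓛{f}(z₁, …, zₙ) = ∫_{ℝ₊ⁿ} f(L) e^{-∑ z_i L_i} ∏ L_i dL_i`. -/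
def laplace {n : ℕ} (f : (Fin n → ℝ) → ℝ) (z : Fin n → ℂ) : ℂ :=
  ∫ L in orthant n, laplaceIntegrand f z L

/-! ### Topological recursion of Chekhov, Eynard and Orantin on curves with `x(z) = z² / 2` -/

/-- The residue at `0` of a function with an isolated singularity at `0`. -/
def residue0 (f : ℂ → ℂ) : ℂ :=
  limUnder (𝓝[>] (0 : ℝ)) fun r => (2 * Real.pi * Complex.I)⁻¹ * ∮ w in C(0, r), f w

/-- `∫_a^b B(·, z)` along the segment from `a` to `b`, where `B(z₁, z₂) dz₁ ⊗ dz₂` is a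
bidifferential. -/
def segInt (B : ℂ → ℂ → ℂ) (a b z : ℂ) : ℂ :=
  (b - a) * ∫ s in (0 : ℝ)..1, B (a + s * (b - a)) z

/-- The recursion kernel `K(z, w) = ∫_w^{w̄} B(·, z) / (2 (y(w) dx(w) - y(w̄) dx(w̄)))`, as the
coefficient of `dz / dw`. Here `w̄ = -w` and `dx = w dw`, so `dx(w̄) = (-w)(-dw)`. -/
def recKernel (y : ℂ → ℂ) (B : ℂ → ℂ → ℂ) (z w : ℂ) : ℂ :=
  segInt B w (-w) z / (2 * (y w * w - y (-w) * ((-w) * (-1))))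

/-- The correlation functions `W_{g,n}(z₁, …, zₙ)`, `ω_{g,n} = W_{g,n} dz₁ ⊗ ⋯ ⊗ dzₙ`, of the
spectral curve `(ℙ¹; z²/2, y, B)`, whose only ramification point is `0`:
`ω_{0,2} = B` and, for `2g - 2 + n > 0`,
`ω_{g,n}(z₁, z_K) = Res_{w=0} K(z₁, w) (ω_{g-1,n+1}(w, w̄, z_K)
  + ∑_{no (0,1)} ω_{h,1+|J|}(w, z_J) ω_{h',1+|J'|}(w̄, z_{J'}))`.
The sign in front of the bracket comes from `dw̄ = -dw`. -/
def ceoW (y : ℂ → ℂ) (B : ℂ → ℂ → ℂ) : (g n : ℕ) → (Fin n → ℂ) → ℂ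
  | _, 0, _ => 0
  | g, n + 1, z =>
    if h : g = 0 ∧ n = 1 then B (z 0) (z ⟨1, by omega⟩)
    else if ¬ Stable g (n + 1) then 0
    else
      residue0 fun w =>
        recKernel y B (z 0) w *
          (-((if hg : g = 0 then 0 else
                ceoW y B (g - 1) (n + 2) (Fin.cons w (Fin.cons (-w) (Fin.tail z))))
            + ∑ h : Fin (g + 1), ∑ J : Finset (Fin n),
                if hs : ¬ (h.1 = 0 ∧ J.card = 0) ∧ ¬ (g - h.1 = 0 ∧ Jᶜ.card = 0) then
                  ceoW y B h.1 (J.card + 1) (Fin.cons w (subTuple (Fin.tail z) J))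
                    * ceoW y B (g - h.1) (Jᶜ.card + 1) (Fin.cons (-w) (subTuple (Fin.tail z) Jᶜ))
                else 0))
termination_by g n _ => 2 * g + n
decreasing_by
  · omega
  all_goals
    have h1 := Finset.card_add_card_compl J
    have _h2 := h.2
    simp only [Fintype.card_fin] at h1
    omega

/-- `y^{M(p)}(z) = ((-1)^{(p-1)/2} / 2π) T_p(2π z / p)`. -/
def yM (p : ℕ) (z : ℂ) : ℂ :=
  (-1) ^ ((p - 1) / 2) / (2 * Real.pi) *
    (Polynomial.Chebyshev.T ℂ (p : ℤ)).eval (2 * Real.pi / p * z)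

/-- `y^{SM(p)}(z) = ((-1)^{(p-1)/2} / z) U_{p-1}(2π z / p)`. -/
def ySM (p : ℕ) (z : ℂ) : ℂ :=
  (-1) ^ ((p - 1) / 2) / z *
    (Polynomial.Chebyshev.U ℂ ((p : ℤ) - 1)).eval (2 * Real.pi / p * z)

/-- `B(z₁, z₂) = 1 / (z₁ - z₂)²`. -/
def B₀ (z₁ z₂ : ℂ) : ℂ := 1 / (z₁ - z₂) ^ 2

/-- The function `ζ_H(2d; z) = z^{-2d} + (1/2) ∑_{m ∈ ℤ, m ≠ 0} (z + m)^{-2d}`. -/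
def zetaH (d : ℕ) (z : ℂ) : ℂ :=
  1 / z ^ (2 * d) + (1 / 2) * ∑' m : {m : ℤ // m ≠ 0}, 1 / (z + (m.1 : ℂ)) ^ (2 * d)

/-- The twisted bidifferential `B[f^MV](z₁, z₂) = ζ_H(2; z₁ - z₂)`. -/
def BMV (z₁ z₂ : ℂ) : ℂ := zetaH 1 (z₁ - z₂)

/-! ### Twist elimination -/

/-- The one-form `ξ_a(z) = Res_{w=0} w^{-2a-2} dw ∫_0^w B(·, z)` attached to `B`. -/
def xi (B : ℂ → ℂ → ℂ) (a : ℕ) (z : ℂ) : ℂ :=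
  residue0 fun w => 1 / w ^ (2 * a + 2) * segInt B 0 w z

/-- `W` equals `∑_a F_a ∏_i ξ_{a_i}[f^MV](z_i)`, with finitely many nonzero coefficients,
symmetric in `a₁, …, aₙ`, away from the poles of the one-forms `ξ_a[f^MV]`, which are
the integers. -/
def TwistExpansion {n : ℕ} (F : (Fin n → ℕ) →₀ ℂ) (W : (Fin n → ℂ) → ℂ) : Prop :=
  (∀ (σ : Equiv.Perm (Fin n)) (a : Fin n → ℕ), F (a ∘ σ) = F a) ∧
  ∀ z : Fin n → ℂ, (∀ (i : Fin n) (m : ℤ), z i ≠ m) →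
    W z = F.sum fun a c => c * ∏ i, xi BMV (a i) (z i)

/-- `W` belongs to the span of the symmetric tensors of the `ξ_a[f^MV]`. -/
def InTwistSpan {n : ℕ} (W : (Fin n → ℂ) → ℂ) : Prop := ∃ F, TwistExpansion F W

open Classical in
/-- The twist-elimination map `𝓔[z_I]`, which replaces the basis element `ξ_a[f^MV](z_i)` by
`ξ_a(z_i)` for `i ∈ I`. The `ξ_a[f^MV]` are linearly independent, so the coefficients of the
expansion are unique. -/
def twistElim {n : ℕ} (I : Finset (Fin n)) (W : (Fin n → ℂ) → ℂ) (z : Fin n → ℂ) : ℂ :=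
  if h : InTwistSpan W then
    h.choose.sum fun a c =>
      c * ∏ i, if i ∈ I then xi B₀ (a i) (z i) else xi BMV (a i) (z i)
  else 0

end TwistedTR

end

open TwistedTR

noncomputable section

open Finset (sum_congr range mul_sum sum_comm sum_add_distrib sum_eq_zero univ Icc mem_range sum_mul mem_univ sum_eq_single_of_mem prod_congr sum_insert mem_compl sum_sub_distrib)
open PowerSeries (coeff)

namespace TwistedTR

theorem sum_congr₂ {ι κ M : Type*} [AddCommMonoid M] {s : Finset ι} {t : ι → Finset κ} {f g : ι → κ → M}
    (h : ∀ i ∈ s, ∀ j ∈ t i, f i j = g i j) : ∑ i ∈ s, ∑ j ∈ t i, f i j = ∑ i ∈ s, ∑ j ∈ t i, g i j :=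
  sum_congr rfl fun i hi => sum_congr rfl (h i hi)

/-! ### The ring of functions on multisets -/

/-- Functions on finite multisets of elements of `ι`, thought of as formal power series in variables
indexed by `ι` through their Taylor coefficients. -/
@[ext] structure Fock (ι R : Type*) where
  /-- The values of the function. -/
  toFun : Multiset ι → R

namespace Fock

variable {ι R S : Type*}

instance : CoeFun (Fock ι R) fun _ => Multiset ι → R := ⟨toFun⟩

@[simp] theorem mk_apply (f : Multiset ι → R) (K : Multiset ι) : (mk f : Fock ι R) K = f K := rfl

theorem ext_apply {f g : Fock ι R} (h : ∀ K, f K = g K) : f = g := Fock.ext (funext h)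

/-- The shift `K ↦ f (M + K)`. -/
def shift (M : Multiset ι) (f : Fock ι R) : Fock ι R := ⟨fun K => f (M + K)⟩

@[simp] theorem shift_apply (M K : Multiset ι) (f : Fock ι R) : shift M f K = f (M + K) := rfl

variable [CommRing R] [CommRing S]

instance : Add (Fock ι R) := ⟨fun f g => ⟨fun K => f K + g K⟩⟩

instance : Zero (Fock ι R) := ⟨⟨fun _ => 0⟩⟩

instance : Neg (Fock ι R) := ⟨fun f => ⟨fun K => -f K⟩⟩

instance : Sub (Fock ι R) := ⟨fun f g => ⟨fun K => f K - g K⟩⟩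

instance : SMul R (Fock ι R) := ⟨fun r f => ⟨fun K => r * f K⟩⟩

@[simp] theorem add_apply (f g : Fock ι R) (K : Multiset ι) : (f + g) K = f K + g K := rfl

@[simp] theorem sub_apply (f g : Fock ι R) (K : Multiset ι) : (f - g) K = f K - g K := rfl

@[simp] theorem zero_apply (K : Multiset ι) : (0 : Fock ι R) K = 0 := rfl

@[simp] theorem smul_apply (r : R) (f : Fock ι R) (K : Multiset ι) : (r • f) K = r * f K := rfl

instance : Mul (Fock ι R) :=
  ⟨fun f g => ⟨fun K => (K.antidiagonal.map fun p => f p.1 * g p.2).sum⟩⟩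

theorem mul_apply (f g : Fock ι R) (K : Multiset ι) :
    (f * g) K = (K.antidiagonal.map fun p => f p.1 * g p.2).sum := rfl

theorem mul_apply_zero (f g : Fock ι R) : (f * g) 0 = f 0 * g 0 := by
  simp [mul_apply]

theorem mul_apply_cons (f g : Fock ι R) (a : ι) (K : Multiset ι) :
    (f * g) (a ::ₘ K) = (shift {a} f * g + f * shift {a} g) K := by
  simp only [mul_apply, add_apply, Multiset.antidiagonal_cons, Multiset.map_add, Multiset.sum_add,
    Multiset.map_map, Function.comp_def, Prod.map_fst, Prod.map_snd, id_eq, shift_apply,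
    Multiset.singleton_add]
  rw [add_comm]

theorem mul_comm' (f g : Fock ι R) : f * g = g * f := by
  refine ext_apply fun K => ?_
  rw [mul_apply, mul_apply, ← Multiset.map_swap_antidiagonal, Multiset.map_map]
  simp [Function.comp_def, mul_comm]

theorem add_mul' (f g h : Fock ι R) : (f + g) * h = f * h + g * h := by
  refine ext_apply fun K => ?_
  simp [mul_apply, add_mul, Multiset.sum_map_add]

theorem mul_assoc' (f g h : Fock ι R) : f * g * h = f * (g * h) := by
  have key : ∀ (K : Multiset ι) (f g h : Fock ι R), (f * g * h) K = (f * (g * h)) K := by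
    intro K
    induction K using Multiset.induction with
    | empty => intro f g h; simp [mul_apply_zero, mul_assoc]
    | cons a K ih =>
      intro f g h
      have h1 : shift {a} (f * g) = shift {a} f * g + f * shift {a} g := by
        refine ext_apply fun K => ?_; rw [← mul_apply_cons, shift_apply, Multiset.singleton_add]
      have h2 : shift {a} (g * h) = shift {a} g * h + g * shift {a} h := by
        refine ext_apply fun K => ?_; rw [← mul_apply_cons, shift_apply, Multiset.singleton_add]
      rw [mul_apply_cons, mul_apply_cons, h1, h2, add_mul', mul_comm' f (_ + _), add_mul',
        mul_comm' _ f, mul_comm' _ f]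
      simp only [add_apply, ih]
      ring
  exact ext_apply fun K => key K f g h

instance : One (Fock ι R) := ⟨⟨fun K => if K.card = 0 then 1 else 0⟩⟩

theorem one_apply (K : Multiset ι) : (1 : Fock ι R) K = if K.card = 0 then 1 else 0 := rfl

theorem one_mul' (f : Fock ι R) : 1 * f = f := by
  have key : ∀ (K : Multiset ι) (f : Fock ι R), (1 * f) K = f K := by
    intro K
    induction K using Multiset.induction with
    | empty => intro f; simp [mul_apply_zero, one_apply]
    | cons a K ih =>
      intro f
      have h1 : shift {a} (1 : Fock ι R) = 0 := by refine ext_apply fun K => ?_; simp [one_apply]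
      have h0 : (0 : Fock ι R) * f = 0 := by refine ext_apply fun K => ?_; simp [mul_apply]
      rw [mul_apply_cons, h1, h0, add_apply, zero_apply, zero_add, ih, shift_apply, Multiset.singleton_add]
  exact ext_apply fun K => key K f

instance : CommRing (Fock ι R) where
  add_assoc f g h := ext_apply fun K => add_assoc _ _ _
  zero_add f := ext_apply fun K => zero_add _
  add_zero f := ext_apply fun K => add_zero _
  add_comm f g := ext_apply fun K => add_comm _ _
  neg_add_cancel f := ext_apply fun K => neg_add_cancel _
  sub_eq_add_neg f g := ext_apply fun K => sub_eq_add_neg _ _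
  nsmul := nsmulRec
  zsmul := zsmulRec
  mul_assoc := mul_assoc'
  mul_comm := mul_comm'
  one_mul := one_mul'
  mul_one f := by rw [mul_comm', one_mul']
  left_distrib f g h := by rw [mul_comm', add_mul', mul_comm' f, mul_comm' f]
  right_distrib := add_mul'
  zero_mul f := by refine ext_apply fun K => ?_; simp [mul_apply]
  mul_zero f := by refine ext_apply fun K => ?_; simp [mul_apply]

/-- Evaluation at a multiset as an additive homomorphism. -/
def evalHom (K : Multiset ι) : Fock ι R →+ R where
  toFun f := f K
  map_zero' := rfl
  map_add' _ _ := rfl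

@[simp] theorem sum_apply {α : Type*} (s : Finset α) (f : α → Fock ι R) (K : Multiset ι) :
    (∑ i ∈ s, f i) K = ∑ i ∈ s, f i K := map_sum (evalHom K) f s

theorem smul_mul' (r : R) (f g : Fock ι R) : r • f * g = r • (f * g) := by
  refine ext_apply fun K => ?_
  simp [mul_apply, mul_assoc, Multiset.sum_map_mul_left]

instance : Module R (Fock ι R) where
  one_smul f := ext_apply fun K => one_mul _
  mul_smul r s f := ext_apply fun K => mul_assoc _ _ _
  smul_zero r := ext_apply fun K => mul_zero _
  smul_add r f g := ext_apply fun K => mul_add _ _ _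
  add_smul r s f := ext_apply fun K => add_mul _ _ _
  zero_smul f := ext_apply fun K => zero_mul _

instance : Algebra R (Fock ι R) :=
  Algebra.ofModule smul_mul' fun r f g => by rw [mul_comm, smul_mul', mul_comm]

/-- The partial derivative `(∂_a f) K = f (a ::ₘ K)`. -/
def der (a : ι) : Derivation R (Fock ι R) (Fock ι R) :=
  Derivation.mk' { toFun := shift {a}, map_add' := fun _ _ => rfl, map_smul' := fun _ _ => rfl }
    fun f g => ext_apply fun K => by
      have := mul_apply_cons f g a K
      rw [mul_comm (shift {a} f)] at this
      rw [← Multiset.singleton_add] at this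
      exact this.trans (add_comm _ _)

@[simp] theorem der_apply (a : ι) (f : Fock ι R) (K : Multiset ι) : der a f K = f (a ::ₘ K) := by
  change f ({a} + K) = _
  rw [Multiset.singleton_add]

theorem der_comm (a b : ι) (f : Fock ι R) : der a (der b f) = der b (der a f) := by
  refine ext_apply fun K => ?_
  simp [Multiset.cons_swap]

theorem der_mul (a : ι) (f g : Fock ι R) : der a (f * g) = f * der a g + der a f * g := by
  rw [Derivation.leibniz, smul_eq_mul, smul_eq_mul, mul_comm g]

theorem shift_zero (f : Fock ι R) : shift 0 f = f := by refine ext_apply fun K => ?_; simp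

theorem shift_cons (a : ι) (M : Multiset ι) (f : Fock ι R) :
    shift (a ::ₘ M) f = der a (shift M f) := by
  refine ext_apply fun K => ?_; simp

theorem shift_singleton (a : ι) (f : Fock ι R) : shift {a} f = der a f := by
  refine ext_apply fun K => ?_; simp

/-- The linear form `∑ₐ bₐ xₐ`. -/
def lin (b : ι → R) : Fock ι R := ⟨fun K => if K.card = 1 then (K.map b).sum else 0⟩

theorem der_lin (a : ι) (b : ι → R) : der a (lin b) = b a • (1 : Fock ι R) := by
  refine ext_apply fun K => ?_
  simp only [lin, der_apply, Multiset.card_cons, Nat.add_eq_right, Multiset.map_cons,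
    Multiset.sum_cons, smul_apply, one_apply]
  split_ifs with h
  · rw [Multiset.card_eq_zero] at h; simp [h]
  · simp

theorem lin_apply_zero (b : ι → R) : lin b 0 = 0 := by simp [lin]

/-- A function on multisets is determined by its value at `0` and its derivatives. -/
theorem eq_of_der {f g : Fock ι R} (h0 : f 0 = g 0) (h : ∀ a, der a f = der a g) : f = g := by
  refine ext_apply fun K => ?_
  induction K using Multiset.induction with
  | empty => exact h0
  | cons a K _ => simpa using congrArg (fun f => f.toFun K) (h a)

theorem lin_mul_apply (b : ι → R) (f : Fock ι R) [DecidableEq ι] (K : Multiset ι) :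
    (lin b * f) K = (K.map fun m => b m * f (K.erase m)).sum := by
  induction K using Multiset.induction generalizing f with
  | empty => simp [mul_apply_zero, lin_apply_zero]
  | cons a K ih =>
    rw [← der_apply, der_mul, der_lin, add_apply, ih, smul_mul_assoc, one_mul, smul_apply,
      Multiset.map_cons, Multiset.sum_cons, Multiset.erase_cons_head, add_comm]
    congr 2
    refine Multiset.map_congr rfl fun m hm => ?_
    rw [der_apply]
    by_cases hma : a = m
    · subst hma; rw [Multiset.erase_cons_head, Multiset.cons_erase hm]
    · rw [Multiset.erase_cons_tail _ (fun h => hma h)]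

/-- Change of coefficient ring. -/
def map (φ : R →+* S) : Fock ι R →+* Fock ι S where
  toFun f := ⟨fun K => φ (f K)⟩
  map_one' := by refine ext_apply fun K => ?_; simp only [one_apply]; split_ifs <;> simp
  map_mul' f g := by
    refine ext_apply fun K => ?_; simp [mul_apply, map_multiset_sum, Multiset.map_map, Function.comp_def]
  map_zero' := by refine ext_apply fun K => ?_; simp
  map_add' f g := by refine ext_apply fun K => ?_; simp

@[simp] theorem map_apply (φ : R →+* S) (f : Fock ι R) (K : Multiset ι) : map φ f K = φ (f K) := rfl

theorem map_der (φ : R →+* S) (a : ι) (f : Fock ι R) : map φ (der a f) = der a (map φ f) := by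
  refine ext_apply fun K => ?_; simp

theorem map_shift (φ : R →+* S) (M : Multiset ι) (f : Fock ι R) :
    map φ (shift M f) = shift M (map φ f) := by
  refine ext_apply fun K => ?_; simp

theorem map_lin (φ : R →+* S) (b : ι → R) :
    map φ (lin b : Fock ι R) = lin (fun i => φ (b i)) := by
  refine ext_apply fun K => ?_
  simp only [lin, map_apply]
  split_ifs <;> simp [map_multiset_sum, Multiset.map_map, Function.comp_def]

theorem map_smul (φ : R →+* S) (r : R) (f : Fock ι R) : map φ (r • f) = φ r • map φ f := by
  refine ext_apply fun K => ?_; simp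

theorem der_prod {α : Type*} [DecidableEq α] (a : ι) (s : Finset α) (f : α → Fock ι R) :
    der a (∏ i ∈ s, f i) = ∑ i ∈ s, ∏ j ∈ s, if j = i then der a (f j) else f j := by
  induction s using Finset.induction with
  | empty => simp
  | insert i s hi ih =>
    rw [Finset.prod_insert hi, der_mul, ih, sum_insert hi, Finset.prod_insert hi, if_pos rfl,
      add_comm, mul_sum]
    congr 1
    · congr 1
      refine prod_congr rfl fun j hj => ?_
      rw [if_neg (by rintro rfl; exact hi hj)]
    · refine sum_congr rfl fun j hj => ?_
      rw [Finset.prod_insert hi, if_neg (by rintro rfl; exact hi hj)]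

theorem prod_apply_zero {α : Type*} (s : Finset α) (f : α → Fock ι R) :
    (∏ i ∈ s, f i) 0 = ∏ i ∈ s, f i 0 := by
  classical
  induction s using Finset.induction with
  | empty => simp [one_apply]
  | insert i s hi ih => rw [Finset.prod_insert hi, Finset.prod_insert hi, mul_apply_zero, ih]

end Fock


/-! ### Symmetry of solutions of Airy structures -/

section AirySymmetry

variable {R 𝔸 : Type*} [CommRing R] [CommRing 𝔸] [Algebra R 𝔸]

/-- The first order operator `g ↦ β_{ac} g + h ∑ C_{ace} ∂_e g + ∑ C_{ace} f_e g`, written as the sum of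
a derivation and a multiplication. -/
def airyDer (d : ℕ → Derivation R 𝔸 𝔸) (s : Finset ℕ) (h : 𝔸) (C : ℕ → ℕ → ℕ → 𝔸) (a c : ℕ) :
    Derivation R 𝔸 𝔸 := ∑ e ∈ s, (h * C a c e) • d e

theorem airyDer_apply (d : ℕ → Derivation R 𝔸 𝔸) (s : Finset ℕ) (h : 𝔸) (C : ℕ → ℕ → ℕ → 𝔸)
    (a c : ℕ) (g : 𝔸) : airyDer d s h C a c g = ∑ e ∈ s, h * C a c e * d e g := by
  simp only [airyDer]
  induction s using Finset.induction with
  | empty => simp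
  | insert i s hi ih => rw [sum_insert hi, sum_insert hi, Derivation.add_apply, ih,
      Derivation.smul_apply, smul_eq_mul]

theorem airyDer_comm (d : ℕ → Derivation R 𝔸 𝔸) (hd : ∀ a b g, d a (d b g) = d b (d a g))
    (s : Finset ℕ) (h : 𝔸) (hh : ∀ i, d i h = 0) (C : ℕ → ℕ → ℕ → 𝔸)
    (hC : ∀ i a b c, d i (C a b c) = 0) (a c b e : ℕ) (g : 𝔸) :
    airyDer d s h C a c (airyDer d s h C b e g) = airyDer d s h C b e (airyDer d s h C a c g) := by
  simp only [airyDer_apply, map_sum, Derivation.leibniz, smul_eq_mul, hh, hC, mul_zero, add_zero,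
    mul_sum, Finset.sum_const_zero]
  rw [sum_comm]
  refine sum_congr₂ fun i _ j _ => ?_
  rw [hd]; ring

theorem airy_symmetric (d : ℕ → Derivation R 𝔸 𝔸) (hd : ∀ a b g, d a (d b g) = d b (d a g))
    (s : Finset ℕ) (x h : 𝔸) (hx : ∀ i, d i x = 0) (hh : ∀ i, d i h = 0) (h2 : 2 * h = 1)
    {n : ℕ} (hxn : x ^ n = 0) (f α Dt : ℕ → 𝔸) (β : ℕ → ℕ → 𝔸) (B C : ℕ → ℕ → ℕ → 𝔸)
    (hB : ∀ i a b c, d i (B a b c) = 0) (hC : ∀ i a b c, d i (C a b c) = 0)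
    (hDt : ∀ i a, d i (Dt a) = 0) (hβ : ∀ a b c, d b (β a c) = B a b c)
    (hα : ∀ a b, d b (α a) = d a (α b)) (hCs : ∀ a c e, C a c e = C a e c)
    (rel1 : ∀ a b, ∑ c ∈ s, β a c * d c (α b) - ∑ c ∈ s, β b c * d c (α a)
      + ∑ c ∈ s, (B a b c - B b a c) * α c = 0)
    (rel2 : ∀ a b, h * ∑ c ∈ s, ∑ e ∈ s, C a c e * d e (d c (α b))
      - h * ∑ c ∈ s, ∑ e ∈ s, C b c e * d e (d c (α a)) + ∑ c ∈ s, (B a b c - B b a c) * Dt c = 0)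
    (rel3 : ∀ a b, ∀ e ∈ s, f e * (∑ c ∈ s, C a c e * d c (α b) + ∑ c ∈ s, β a c * B b c e
      - ∑ c ∈ s, C b c e * d c (α a) - ∑ c ∈ s, β b c * B a c e
      + ∑ c ∈ s, (B a b c - B b a c) * β c e) = 0)
    (rel4 : ∀ a b, ∀ e ∈ s, ∀ e' ∈ s, ∀ g, g = f e * f e' ∨ g = d e' (f e) →
      (∑ c ∈ s, C a c e * B b c e' + ∑ c ∈ s, C a c e' * B b c e
      - ∑ c ∈ s, C b c e * B a c e' - ∑ c ∈ s, C b c e' * B a c e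
      + ∑ c ∈ s, (B a b c - B b a c) * C c e e') * g = 0)
    (hf : ∀ a, f a = x * (α a + Dt a + ∑ c ∈ s, β a c * f c
      + h * ∑ c ∈ s, ∑ e ∈ s, C a c e * (d e (f c) + f c * f e)))
    (a b : ℕ) : d b (f a) = d a (f b) := by
  set m : ℕ → ℕ → 𝔸 := fun a c => β a c + ∑ e ∈ s, C a c e * f e with hm
  set O : ℕ → ℕ → 𝔸 → 𝔸 := fun a c g => airyDer d s h C a c g + m a c * g with hO
  have hA : ∀ a b, d b (f a) = x * (d b (α a) + ∑ c ∈ s, B a b c * f c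
      + ∑ c ∈ s, O a c (d b (f c))) := by
    intro a b
    conv_lhs => rw [hf]
    have e1 : ∑ c ∈ s, ∑ e ∈ s, C a c e * (f c * d b (f e))
        = ∑ c ∈ s, ∑ e ∈ s, C a c e * (f e * d b (f c)) := by
      rw [sum_comm]
      exact sum_congr₂ fun i _ j _ => by rw [hCs]
    have e2 : d b (h * ∑ c ∈ s, ∑ e ∈ s, C a c e * (d e (f c) + f c * f e))
        = ∑ c ∈ s, ∑ e ∈ s, h * C a c e * d e (d b (f c))
          + ∑ c ∈ s, ∑ e ∈ s, C a c e * (f e * d b (f c)) := by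
      have e3 : ∑ c ∈ s, ∑ e ∈ s, h * C a c e * d e (d b (f c))
          = h * ∑ c ∈ s, ∑ e ∈ s, C a c e * d b (d e (f c)) := by
        simp only [mul_sum, mul_assoc, hd b]
      have e4 : d b (∑ c ∈ s, ∑ e ∈ s, C a c e * (d e (f c) + f c * f e))
          = ∑ c ∈ s, ∑ e ∈ s, C a c e * d b (d e (f c))
            + (∑ c ∈ s, ∑ e ∈ s, C a c e * (f c * d b (f e))
            + ∑ c ∈ s, ∑ e ∈ s, C a c e * (f e * d b (f c))) := by
        simp only [map_sum, Derivation.leibniz, smul_eq_mul, hC, mul_zero, add_zero, map_add,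
          mul_add, sum_add_distrib]
      rw [Derivation.leibniz, hh, smul_zero, add_zero, smul_eq_mul, e4, e3, e1]
      linear_combination (∑ c ∈ s, ∑ e ∈ s, C a c e * (f e * d b (f c))) * h2
    rw [Derivation.leibniz, smul_eq_mul, smul_eq_mul, hx, mul_zero, add_zero, map_add, map_add,
      map_add, hDt, e2]
    simp only [map_sum, Derivation.leibniz, smul_eq_mul, hβ, hO, hm, airyDer_apply, add_mul,
      sum_add_distrib, sum_mul, mul_assoc]
    congr 1
    simp only [mul_comm (f _) (B _ _ _)]
    abel
  have hcomm : ∀ a c b e g, O a c (O b e g) - O b e (O a c g)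
      = (h * ∑ i ∈ s, C a c i * B b i e) * g - (h * ∑ i ∈ s, C b e i * B a i c) * g
        + h * ∑ i ∈ s, ∑ j ∈ s, C a c i * C b e j * ((d i (f j) - d j (f i)) * g) := by
    intro a c b e g
    have e1 : ∀ a c b e, airyDer d s h C a c (m b e) = h * ∑ i ∈ s, C a c i * B b i e
        + h * ∑ i ∈ s, ∑ j ∈ s, C a c i * C b e j * d i (f j) := by
      intro a c b e
      simp only [hm, airyDer_apply, map_add, map_sum, hβ, Derivation.leibniz, smul_eq_mul, hC,
        mul_zero, add_zero, mul_add, sum_add_distrib, mul_sum, mul_assoc,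
        Finset.sum_const_zero, add_right_inj]
      rw [sum_comm]
      exact sum_congr₂ fun i _ j _ => by ring
    have e2 : h * ∑ i ∈ s, ∑ j ∈ s, C b e i * C a c j * d i (f j)
        = h * ∑ i ∈ s, ∑ j ∈ s, C a c i * C b e j * d j (f i) := by
      rw [sum_comm]
      congr 1
      exact sum_congr₂ fun i _ j _ => by ring
    have e3 : h * ∑ i ∈ s, ∑ j ∈ s, C a c i * C b e j * ((d i (f j) - d j (f i)) * g)
        = (h * ∑ i ∈ s, ∑ j ∈ s, C a c i * C b e j * d i (f j)
          - h * ∑ i ∈ s, ∑ j ∈ s, C a c i * C b e j * d j (f i)) * g := by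
      simp only [mul_sum, sum_mul, ← sum_sub_distrib]
      exact sum_congr₂ fun i _ j _ => by ring
    simp only [hO, map_add, Derivation.leibniz, smul_eq_mul, e1]
    rw [airyDer_comm d hd s h hh C hC a c b e, e3, ← e2]
    ring
  have step : ∀ z : 𝔸, (∀ i, d i z = 0) →
      (∀ a b, z * x * d b (f a) = z * x * d a (f b)) → ∀ a b, z * d b (f a) = z * d a (f b) := by
    intro z hz hy a b
    have hyO : ∀ a c g, z * x * O a c g = O a c (z * x * g) := by
      intro a c g
      simp only [hO, airyDer_apply, Derivation.leibniz, smul_eq_mul, hz, hx, mul_zero, add_zero,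
        mul_add, mul_sum]
      congr 1
      · exact sum_congr rfl fun i _ => by ring
      · ring
    have hOadd : ∀ a c g g', O a c (g + g') = O a c g + O a c g' := by
      intro a c g g'
      simp only [hO, map_add]; ring
    have hOsum : ∀ a c (g : ℕ → 𝔸), O a c (∑ i ∈ s, g i) = ∑ i ∈ s, O a c (g i) := by
      intro a c g
      simp only [hO, map_sum, mul_sum, sum_add_distrib]
    have hOx : ∀ a c g, O a c (x * g) = x * O a c g := by
      intro a c g
      simp only [hO, airyDer_apply, Derivation.leibniz, smul_eq_mul, hx, mul_zero, add_zero,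
        mul_add, mul_sum]
      congr 1
      · exact sum_congr rfl fun i _ => by ring
      · ring
    have h1 : ∀ a b, z * d b (f a) = z * x * (d b (α a)) + z * x * ∑ c ∈ s, B a b c * f c
        + z * x * (x * ((∑ c ∈ s, O a c (d c (α b) + ∑ e ∈ s, B b c e * f e))
          + ∑ c ∈ s, ∑ e ∈ s, O a c (O b e (d c (f e))))) := by
      intro a b
      have e1 : z * x * ∑ c ∈ s, O a c (d b (f c)) = z * x * ∑ c ∈ s, O a c (d c (f b)) := by
        rw [mul_sum, mul_sum]
        exact sum_congr rfl fun c _ => by rw [hyO, hyO, hy]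
      have e2 : ∑ c ∈ s, O a c (d c (f b)) = x * ((∑ c ∈ s, O a c (d c (α b)
          + ∑ e ∈ s, B b c e * f e)) + ∑ c ∈ s, ∑ e ∈ s, O a c (O b e (d c (f e)))) := by
        rw [← sum_add_distrib, mul_sum]
        refine sum_congr rfl fun c _ => ?_
        rw [hA b c, hOx, hOadd, hOsum]
      rw [hA a b, ← mul_assoc, mul_add, mul_add, e1, e2]
    have hUU : z * x * ∑ c ∈ s, ∑ e ∈ s, O b c (O a e (d c (f e)))
        = z * x * ∑ c ∈ s, ∑ e ∈ s, O b e (O a c (d c (f e))) := by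
      rw [sum_comm]
      simp only [mul_sum]
      exact sum_congr₂ fun c _ e _ => by
        rw [hyO, hyO, hyO, hyO, hy]
    have hU : z * x * ∑ c ∈ s, ∑ e ∈ s, O a c (O b e (d c (f e)))
        - z * x * ∑ c ∈ s, ∑ e ∈ s, O b c (O a e (d c (f e)))
        = z * x * (h * ∑ e ∈ s, ∑ e' ∈ s,
          (∑ c ∈ s, C a c e' * B b c e - ∑ c ∈ s, C b c e * B a c e') * d e' (f e)) := by
      have e1 : ∀ c e, z * x * (h * ∑ i ∈ s, ∑ j ∈ s, C a c i * C b e j *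
          ((d i (f j) - d j (f i)) * d c (f e))) = 0 := by
        intro c e
        simp only [mul_sum]
        refine sum_eq_zero fun i _ => sum_eq_zero fun j _ => ?_
        linear_combination (h * (C a c i * C b e j) * d c (f e)) * hy j i
      rw [hUU, ← mul_sub, ← sum_sub_distrib]
      simp only [← sum_sub_distrib, hcomm]
      rw [sum_comm]
      simp only [mul_sum s _ (z * x), mul_sum s _ h]
      refine sum_congr₂ fun e _ c _ => ?_
      have e2 := e1 c e
      simp only [mul_sum s _ h] at e2
      rw [mul_add, e2, add_zero]
      simp only [hCs a c, hCs b e, sum_sub_distrib, ← mul_sum]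
      ring
    have hF : ∀ φ : ℕ → 𝔸, ∑ c ∈ s, φ c * f c = x * (∑ c ∈ s, φ c * α c + ∑ c ∈ s, φ c * Dt c
        + ∑ e ∈ s, f e * ∑ c ∈ s, φ c * β c e
        + h * (∑ e ∈ s, ∑ e' ∈ s, (∑ c ∈ s, φ c * C c e e') * (f e * f e')
          + ∑ e ∈ s, ∑ e' ∈ s, (∑ c ∈ s, φ c * C c e e') * d e' (f e))) := by
      intro φ
      have e1 : ∑ e ∈ s, f e * ∑ c ∈ s, φ c * β c e = ∑ c ∈ s, φ c * ∑ e ∈ s, β c e * f e := by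
        simp only [mul_sum]
        rw [sum_comm]
        exact sum_congr₂ fun i _ j _ => by ring
      have e2 : ∑ e ∈ s, ∑ e' ∈ s, (∑ c ∈ s, φ c * C c e e') * (f e * f e')
          + ∑ e ∈ s, ∑ e' ∈ s, (∑ c ∈ s, φ c * C c e e') * d e' (f e)
          = ∑ c ∈ s, φ c * ∑ e ∈ s, ∑ e' ∈ s, C c e e' * (d e' (f e) + f e * f e') := by
        simp only [← sum_add_distrib, mul_sum, sum_mul]
        symm
        rw [sum_comm]
        refine sum_congr rfl fun i _ => ?_
        rw [sum_comm]
        exact sum_congr₂ fun j _ c _ => by ring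
      rw [e1, e2, mul_sum s _ h, ← sum_add_distrib, ← sum_add_distrib,
        ← sum_add_distrib, mul_sum s _ x]
      refine sum_congr rfl fun c _ => ?_
      conv_lhs => rw [hf c]
      ring
    have hT : ∀ a b, ∑ c ∈ s, O a c (d c (α b) + ∑ e ∈ s, B b c e * f e)
        = ∑ c ∈ s, β a c * d c (α b) + h * ∑ c ∈ s, ∑ e ∈ s, C a c e * d e (d c (α b))
          + ∑ e ∈ s, f e * ∑ c ∈ s, C a c e * d c (α b)
          + ∑ e ∈ s, f e * ∑ c ∈ s, β a c * B b c e
          + h * ∑ e ∈ s, ∑ e' ∈ s, (∑ c ∈ s, C a c e' * B b c e) * d e' (f e)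
          + ∑ e ∈ s, ∑ e' ∈ s, (∑ c ∈ s, C a c e * B b c e') * (f e * f e') := by
      intro a b
      have q1 : h * ∑ e ∈ s, ∑ e' ∈ s, (∑ c ∈ s, C a c e' * B b c e) * d e' (f e)
          = ∑ c ∈ s, ∑ e' ∈ s, h * C a c e' * ∑ e ∈ s, B b c e * d e' (f e) := by
        simp only [mul_sum, sum_mul]
        symm
        rw [sum_comm]
        rw [sum_comm (f := fun e e' => ∑ c ∈ s, h * (C a c e' * B b c e * d e' (f e)))]
        refine sum_congr rfl fun i _ => ?_
        rw [sum_comm]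
        exact sum_congr₂ fun j _ c _ => by ring
      have q2 : ∑ e ∈ s, f e * ∑ c ∈ s, C a c e * d c (α b)
          = ∑ c ∈ s, (∑ e ∈ s, C a c e * f e) * d c (α b) := by
        simp only [mul_sum, sum_mul]
        rw [sum_comm]
        exact sum_congr₂ fun j _ c _ => by ring
      have q3 : ∑ e ∈ s, f e * ∑ c ∈ s, β a c * B b c e
          = ∑ c ∈ s, β a c * ∑ e ∈ s, B b c e * f e := by
        simp only [mul_sum]
        rw [sum_comm]
        exact sum_congr₂ fun j _ c _ => by ring
      have q4 : ∑ e ∈ s, ∑ e' ∈ s, (∑ c ∈ s, C a c e * B b c e') * (f e * f e')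
          = ∑ c ∈ s, (∑ e ∈ s, C a c e * f e) * ∑ e ∈ s, B b c e * f e := by
        simp only [mul_sum, sum_mul]
        symm
        rw [sum_comm]
        rw [sum_comm (s := s) (t := s) (f := fun e e' =>
          ∑ c ∈ s, C a c e * B b c e' * (f e * f e'))]
        refine sum_congr rfl fun i _ => ?_
        rw [sum_comm]
        exact sum_congr₂ fun j _ c _ => by ring
      rw [q1, q2, q3, q4, mul_sum s _ h, ← sum_add_distrib, ← sum_add_distrib,
        ← sum_add_distrib, ← sum_add_distrib, ← sum_add_distrib]
      refine sum_congr rfl fun c _ => ?_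
      have q5 : ∑ e ∈ s, h * C a c e * (d e (d c (α b)) + ∑ j ∈ s, B b c j * d e (f j))
          = h * ∑ e ∈ s, C a c e * d e (d c (α b))
            + ∑ e' ∈ s, h * C a c e' * ∑ e ∈ s, B b c e * d e' (f e) := by
        simp only [mul_add, sum_add_distrib, mul_sum s _ h, mul_assoc]
      simp only [hO, hm, airyDer_apply, map_add, map_sum, Derivation.leibniz, smul_eq_mul, hB,
        mul_zero, add_zero]
      rw [q5]
      ring
    have hS : ∀ a b, ∑ e ∈ s, ∑ e' ∈ s, (∑ c ∈ s, C a c e' * B b c e) * (f e * f e')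
        = ∑ e ∈ s, ∑ e' ∈ s, (∑ c ∈ s, C a c e * B b c e') * (f e * f e') := by
      intro a b
      rw [sum_comm]
      exact sum_congr₂ fun i _ j _ => by ring
    have hS' : ∀ a b, z * x * ∑ e ∈ s, ∑ e' ∈ s, (∑ c ∈ s, C a c e' * B b c e) * d e' (f e)
        = z * x * ∑ e ∈ s, ∑ e' ∈ s, (∑ c ∈ s, C a c e * B b c e') * d e' (f e) := by
      intro a b
      rw [sum_comm]
      simp only [mul_sum s _ (z * x)]
      exact sum_congr₂ fun i _ j _ => by
        linear_combination (∑ c ∈ s, C a c i * B b c j) * hy j i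
    have r3 := sum_eq_zero (rel3 a b)
    have r4 : ∀ g : ℕ → ℕ → 𝔸, (∀ e e', g e e' = f e * f e' ∨ g e e' = d e' (f e)) →
        ∑ e ∈ s, ∑ e' ∈ s, (∑ c ∈ s, C a c e * B b c e') * g e e'
        + ∑ e ∈ s, ∑ e' ∈ s, (∑ c ∈ s, C a c e' * B b c e) * g e e'
        - ∑ e ∈ s, ∑ e' ∈ s, (∑ c ∈ s, C b c e * B a c e') * g e e'
        - ∑ e ∈ s, ∑ e' ∈ s, (∑ c ∈ s, C b c e' * B a c e) * g e e'
        + ∑ e ∈ s, ∑ e' ∈ s, (∑ c ∈ s, (B a b c - B b a c) * C c e e') * g e e' = 0 := by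
      intro g hg
      have := sum_eq_zero fun e he => sum_eq_zero fun e' he' =>
        rel4 a b e he e' he' _ (hg e e')
      rw [← this]
      simp only [sub_mul, add_mul, sum_add_distrib, sum_sub_distrib]
    have r4f := r4 (fun e e' => f e * f e') fun _ _ => Or.inl rfl
    have r4g := r4 (fun e e' => d e' (f e)) fun _ _ => Or.inr rfl
    beta_reduce at r4f r4g
    have hF' := hF fun c => B a b c - B b a c
    have hφ : ∑ c ∈ s, B a b c * f c - ∑ c ∈ s, B b a c * f c
        = ∑ c ∈ s, (B a b c - B b a c) * f c := by
      simp only [sub_mul, sum_sub_distrib]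
    simp only [mul_add, mul_sub, sum_add_distrib, sum_sub_distrib] at r3
    simp only [sub_mul, sum_sub_distrib] at hU
    rw [h1 a b, h1 b a, hT a b, hT b a, hα a b]
    beta_reduce at hF'
    linear_combination z * x * hφ + z * x * hF' + x * hU + z * x * x * (rel1 a b + rel2 a b + r3
      + h * r4f + h * r4g) - z * x * x * h * hS a b + z * x * x * h * hS b a
      - z * x * x * (∑ e ∈ s, ∑ e' ∈ s, (∑ c ∈ s, C a c e * B b c e') * (f e * f e')) * h2
      + z * x * x * (∑ e ∈ s, ∑ e' ∈ s, (∑ c ∈ s, C b c e * B a c e') * (f e * f e')) * h2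
      + x * h * hS' a b
  have hxd : ∀ k i, d i (x ^ k) = 0 := by
    intro k i
    rw [Derivation.leibniz_pow, hx, smul_zero, smul_zero]
  have final : ∀ k, k ≤ n → ∀ a b, x ^ (n - k) * d b (f a) = x ^ (n - k) * d a (f b) := by
    intro k
    induction k with
    | zero => intro _ a b; simp [hxn]
    | succ k ih =>
      intro hk
      refine step _ (hxd _) ?_
      have := ih (by omega)
      rwa [show n - k = n - (k + 1) + 1 by omega, pow_succ] at this
  simpa using final n le_rfl a b

end AirySymmetry

section TwistFlow

variable {R 𝔸 : Type*} [CommRing R] [CommRing 𝔸] [Algebra R 𝔸]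

/-- If `G` flows under the quadratic form `u` and the tensors of an Airy structure are twisted
accordingly, then the defect of the recursion satisfies a linear equation. -/
theorem twist_flow (d : ℕ → Derivation R 𝔸 𝔸) (hd : ∀ a b g, d a (d b g) = d b (d a g))
    (δ : Derivation R 𝔸 𝔸) (hδ : ∀ a g, δ (d a g) = d a (δ g)) (s : Finset ℕ) (x h : 𝔸)
    (hx : ∀ i, d i x = 0) (hδx : δ x = 0) (hh : ∀ i, d i h = 0) (hδh : δ h = 0) (h2 : 2 * h = 1)
    (u : ℕ → ℕ → 𝔸) (hu : ∀ i a b, d i (u a b) = 0) (hus : ∀ a b, u a b = u b a)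
    (G : 𝔸) (hG : δ G = h * ∑ b ∈ s, ∑ c ∈ s, u b c * (d b (d c G) + d b G * d c G))
    (α Dt : ℕ → 𝔸) (β : ℕ → ℕ → 𝔸) (A B C : ℕ → ℕ → ℕ → 𝔸)
    (hB : ∀ i a b c, d i (B a b c) = 0) (hC : ∀ i a b c, d i (C a b c) = 0)
    (hDt : ∀ i a, d i (Dt a) = 0) (hβ : ∀ a b c, d b (β a c) = B a b c)
    (hα : ∀ a b c, d c (d b (α a)) = A a b c)
    (hδα : ∀ a, δ (α a) = 0) (hδβ : ∀ a c, δ (β a c) = ∑ e ∈ s, d e (α a) * u e c)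
    (hδC : ∀ a c e, δ (C a c e) = ∑ b ∈ s, (B a b c * u b e + B a b e * u b c))
    (hδD : ∀ a, δ (Dt a) = h * ∑ b ∈ s, ∑ c ∈ s, u b c * A a c b)
    (E : ℕ → 𝔸) (hE : ∀ a, E a = d a G - x * (α a + Dt a + ∑ c ∈ s, β a c * d c G
      + h * ∑ c ∈ s, ∑ e ∈ s, C a c e * (d e (d c G) + d c G * d e G))) (a : ℕ) :
    δ (E a) = ∑ b ∈ s, ∑ c ∈ s, u b c * (h * d b (d c (E a)) + d b (E a) * d c G) := by
  set H : 𝔸 → 𝔸 := fun g => ∑ b ∈ s, ∑ c ∈ s, u b c * (h * d b (d c g) + d b g * d c G) with hH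
  have Hadd : ∀ g g', H (g + g') = H g + H g' := by
    intro g g'
    simp only [hH, map_add, ← sum_add_distrib]
    exact sum_congr₂ fun b _ c _ => by ring
  have Hsub : ∀ g g', H (g - g') = H g - H g' := by
    intro g g'
    simp only [hH, map_sub, ← sum_sub_distrib]
    exact sum_congr₂ fun b _ c _ => by ring
  have Hsum : ∀ g : ℕ → 𝔸, H (∑ i ∈ s, g i) = ∑ i ∈ s, H (g i) := by
    intro g
    have H0 : H 0 = 0 := by simp [hH]
    exact map_sum (⟨⟨H, H0⟩, Hadd⟩ : 𝔸 →+ 𝔸) g s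
  have Hmul : ∀ f g, H (f * g) = f * H g + g * H f + ∑ b ∈ s, ∑ c ∈ s, u b c * (d b f * d c g) := by
    intro f g
    have e1 : ∑ b ∈ s, ∑ c ∈ s, u b c * (d b f * d c g)
        = h * ∑ b ∈ s, ∑ c ∈ s, u b c * (d b f * d c g)
          + h * ∑ b ∈ s, ∑ c ∈ s, u b c * (d c f * d b g) := by
      rw [sum_comm (f := fun b c => u b c * (d c f * d b g))]
      simp only [hus]
      linear_combination (-∑ b ∈ s, ∑ c ∈ s, u b c * (d b f * d c g)) * h2
    rw [e1]
    simp only [hH, mul_sum, ← sum_add_distrib]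
    refine sum_congr₂ fun b _ c _ => ?_
    simp only [Derivation.leibniz, smul_eq_mul, map_add]
    ring
  have Hconst : ∀ k g, (∀ i, d i k = 0) → H (k * g) = k * H g := by
    intro k g hk
    simp only [hH, mul_sum]
    refine sum_congr₂ fun b _ c _ => ?_
    simp only [Derivation.leibniz, smul_eq_mul, hk, mul_zero, add_zero]
    ring
  have HG : ∀ a, δ (d a G) = H (d a G) := by
    intro a
    have e1 : ∑ b ∈ s, ∑ c ∈ s, u b c * (d b G * d c (d a G))
        = ∑ b ∈ s, ∑ c ∈ s, u b c * (d b (d a G) * d c G) := by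
      rw [sum_comm]
      exact sum_congr₂ fun b _ c _ => by rw [hus]; ring
    have e2 : d a (δ G) = h * ∑ b ∈ s, ∑ c ∈ s, u b c * d b (d c (d a G))
        + h * ∑ b ∈ s, ∑ c ∈ s, u b c * (d b G * d c (d a G))
        + h * ∑ b ∈ s, ∑ c ∈ s, u b c * (d b (d a G) * d c G) := by
      rw [hG]
      simp only [map_sum, Derivation.leibniz, smul_eq_mul, hh, hu, mul_zero, add_zero, map_add,
        mul_sum, ← sum_add_distrib]
      exact sum_congr₂ fun b _ c _ => by
        rw [hd a b, hd a c, hd a b]; ring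
    have e3 : H (d a G) = h * ∑ b ∈ s, ∑ c ∈ s, u b c * d b (d c (d a G))
        + ∑ b ∈ s, ∑ c ∈ s, u b c * (d b (d a G) * d c G) := by
      simp only [hH, mul_sum, ← sum_add_distrib]
      exact sum_congr₂ fun b _ c _ => by ring
    rw [hδ, e2, e3, e1]
    linear_combination (∑ b ∈ s, ∑ c ∈ s, u b c * (d b (d a G) * d c G)) * h2
  have HQ : ∀ c e, H (d e (d c G) + d c G * d e G) = δ (d e (d c G) + d c G * d e G) := by
    intro c e
    have e1 : d e (H (d c G)) = H (d e (d c G))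
        + ∑ b ∈ s, ∑ b' ∈ s, u b b' * (d b (d c G) * d b' (d e G)) := by
      simp only [hH, map_sum, Derivation.leibniz, smul_eq_mul, hh, hu, mul_zero, add_zero, map_add,
        ← sum_add_distrib]
      exact sum_congr₂ fun b _ c _ => by
        rw [hd e b, hd e b, hd e c, hd e c]; ring
    rw [Hadd, Hmul, map_add, hδ, HG, e1, Derivation.leibniz, HG, HG, smul_eq_mul, smul_eq_mul]
    ring
  have Hα : H (α a) = δ (Dt a) + ∑ c ∈ s, δ (β a c) * d c G := by
    rw [hδD]
    simp only [hH, hδβ, hα, mul_sum, sum_mul]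
    rw [sum_comm (f := fun i j => d j (α a) * u j i * d i G)]
    simp only [← sum_add_distrib]
    exact sum_congr₂ fun b _ c _ => by ring
  have HD : H (Dt a) = 0 := by simp [hH, hDt]
  have Hβ : ∀ c, H (β a c * d c G) = β a c * δ (d c G)
      + ∑ b ∈ s, ∑ e ∈ s, u b e * B a b c * (d e (d c G) + d c G * d e G) := by
    intro c
    rw [Hmul, ← HG, add_assoc]
    congr 1
    simp only [hH, hβ, hB, mul_sum, ← sum_add_distrib]
    exact sum_congr₂ fun b _ c _ => by ring
  have HC : h * ∑ c ∈ s, ∑ e ∈ s, δ (C a c e) * (d e (d c G) + d c G * d e G)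
      = ∑ c ∈ s, ∑ b ∈ s, ∑ e ∈ s, u b e * B a b c * (d e (d c G) + d c G * d e G) := by
    have e1 : ∑ c ∈ s, ∑ b ∈ s, ∑ e ∈ s, u b e * B a b c * (d e (d c G) + d c G * d e G)
        = ∑ c ∈ s, ∑ e ∈ s, (∑ b ∈ s, u b e * B a b c) * (d e (d c G) + d c G * d e G) := by
      refine sum_congr rfl fun c _ => ?_
      rw [sum_comm]
      simp only [sum_mul]
    have e2 : ∑ c ∈ s, ∑ e ∈ s, (∑ b ∈ s, u b c * B a b e) * (d e (d c G) + d c G * d e G)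
        = ∑ c ∈ s, ∑ e ∈ s, (∑ b ∈ s, u b e * B a b c) * (d e (d c G) + d c G * d e G) := by
      rw [sum_comm]
      refine sum_congr₂ fun c _ e _ => ?_
      rw [hd c e]; ring
    have e3 : ∑ c ∈ s, ∑ e ∈ s, δ (C a c e) * (d e (d c G) + d c G * d e G)
        = ∑ c ∈ s, ∑ e ∈ s, (∑ b ∈ s, u b e * B a b c) * (d e (d c G) + d c G * d e G)
          + ∑ c ∈ s, ∑ e ∈ s, (∑ b ∈ s, u b c * B a b e) * (d e (d c G) + d c G * d e G) := by
      simp only [hδC, ← sum_add_distrib, ← add_mul]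
      refine sum_congr₂ fun c _ e _ => ?_
      congr 1
      exact sum_congr rfl fun b _ => by ring
    rw [e1, e3, e2]
    linear_combination (∑ c ∈ s, ∑ e ∈ s, (∑ b ∈ s, u b e * B a b c) *
      (d e (d c G) + d c G * d e G)) * h2
  change δ (E a) = H (E a)
  have e1 : H (h * ∑ c ∈ s, ∑ e ∈ s, C a c e * (d e (d c G) + d c G * d e G))
      = h * ∑ c ∈ s, ∑ e ∈ s, C a c e * δ (d e (d c G) + d c G * d e G) := by
    rw [Hconst _ _ hh, Hsum]
    congr 1
    refine sum_congr rfl fun c _ => ?_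
    rw [Hsum]
    exact sum_congr rfl fun e _ => by rw [Hconst _ _ (fun i => hC i a c e), HQ]
  have e2 : δ (h * ∑ c ∈ s, ∑ e ∈ s, C a c e * (d e (d c G) + d c G * d e G))
      = h * ∑ c ∈ s, ∑ e ∈ s, C a c e * δ (d e (d c G) + d c G * d e G)
        + h * ∑ c ∈ s, ∑ e ∈ s, δ (C a c e) * (d e (d c G) + d c G * d e G) := by
    rw [Derivation.leibniz, hδh, smul_zero, add_zero, smul_eq_mul, ← mul_add]
    simp only [map_sum, Derivation.leibniz _ (C _ _ _), smul_eq_mul, ← sum_add_distrib]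
    congr 1
    exact sum_congr₂ fun b _ c _ => by ring
  have e3 : δ (∑ c ∈ s, β a c * d c G)
      = ∑ c ∈ s, β a c * δ (d c G) + ∑ c ∈ s, δ (β a c) * d c G := by
    simp only [map_sum, Derivation.leibniz, smul_eq_mul, ← sum_add_distrib]
    exact sum_congr rfl fun b _ => by ring
  rw [hE, map_sub, Hsub, HG, Derivation.leibniz, hδx, smul_zero, add_zero, smul_eq_mul,
    Hconst _ _ hx, map_add, map_add, map_add, Hadd, Hadd, Hadd, hδα, Hα, HD, e1, e2, e3, Hsum, HC]
  simp only [Hβ, sum_add_distrib]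
  ring

end TwistFlow


/-! ### The tensors of the recursion -/

/-- Extension of a sequence by `0` to negative indices. -/
def extZ (σ : ℕ → ℝ) (n : ℤ) : ℝ := if 0 ≤ n then σ n.toNat else 0

theorem extZ_neg (σ : ℕ → ℝ) {n : ℤ} (h : n < 0) : extZ σ n = 0 := by
  rw [extZ, if_neg (by omega)]

theorem extZ_natCast (σ : ℕ → ℝ) (n : ℕ) : extZ σ n = σ n := by simp [extZ]

def tensA (σ : ℕ → ℝ) (a b c : ℕ) : ℝ := if a = 0 ∧ b = 0 ∧ c = 0 then σ 0 else 0

def tensB (σ : ℕ → ℝ) (a b c : ℕ) : ℝ := (2 * b + 1) * extZ σ (c + 1 - a - b)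

def tensC (σ : ℕ → ℝ) (a c e : ℕ) : ℝ := extZ σ (c + e + 2 - a)

def tensD (σ : ℕ → ℝ) (a : ℕ) : ℝ := extZ σ (1 - a) / 8

theorem tensC_symm (σ : ℕ → ℝ) (a c e : ℕ) : tensC σ a c e = tensC σ a e c := by
  rw [tensC, tensC, add_comm (c : ℤ)]

/-- The weighted convolution `∑_{i + j = N} w(i) σ_i σ_j`. -/
def wconv (σ : ℕ → ℝ) (N : ℤ) (w : ℤ → ℝ) : ℝ :=
  ∑ i ∈ Finset.Ico 0 (N + 1), w i * (extZ σ i * extZ σ (N - i))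

theorem sum_Ico_eq_wconv (σ : ℕ → ℝ) (N : ℤ) (w : ℤ → ℝ) {L U : ℤ} (hL : L ≤ 0) (hU : N < U) :
    ∑ i ∈ Finset.Ico L U, w i * (extZ σ i * extZ σ (N - i)) = wconv σ N w := by
  refine (Finset.sum_subset (Finset.Ico_subset_Ico hL (by omega)) fun i hi hi' => ?_).symm
  simp only [Finset.mem_Ico, not_and, not_lt] at hi hi'
  rcases lt_or_ge i 0 with h | h
  · rw [extZ_neg σ h]; simp
  · rw [extZ_neg σ (n := N - i) (by have := hi' h; omega)]; simp

theorem wconv_reflect (σ : ℕ → ℝ) (N : ℤ) (w : ℤ → ℝ) :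
    wconv σ N (fun i => w (N - i)) = wconv σ N w := by
  refine Finset.sum_bij' (fun i _ => N - i) (fun i _ => N - i) ?_ ?_ ?_ ?_ ?_
  · intro i hi; simp only [Finset.mem_Ico] at hi ⊢; omega
  · intro i hi; simp only [Finset.mem_Ico] at hi ⊢; omega
  · intro i _; ring
  · intro i _; ring
  · intro i _
    rw [show N - (N - i) = i by ring]; ring

theorem wconv_add (σ : ℕ → ℝ) (N : ℤ) (w w' : ℤ → ℝ) :
    wconv σ N (fun i => w i + w' i) = wconv σ N w + wconv σ N w' := by
  simp only [wconv, add_mul, sum_add_distrib]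

theorem wconv_smul (σ : ℕ → ℝ) (N : ℤ) (r : ℝ) (w : ℤ → ℝ) :
    wconv σ N (fun i => r * w i) = r * wconv σ N w := by
  simp only [wconv, mul_assoc, mul_sum]

theorem wconv_const (σ : ℕ → ℝ) (N : ℤ) (r : ℝ) :
    wconv σ N (fun _ => r) = r * wconv σ N (fun _ => 1) := by
  rw [← wconv_smul, mul_one]

theorem sum_Ico_add_sum_Ico (g : ℤ → ℝ) {a b c : ℤ} (hab : a ≤ b) (hbc : b ≤ c) :
    ∑ i ∈ Finset.Ico a b, g i + ∑ i ∈ Finset.Ico b c, g i = ∑ i ∈ Finset.Ico a c, g i := by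
  rw [← Finset.Ico_union_Ico_eq_Ico hab hbc,
    Finset.sum_union (Finset.Ico_disjoint_Ico_consecutive a b c)]

theorem sum_range_eq_sum_Ico (D : ℕ) (g : ℤ → ℝ) (t : ℤ) :
    ∑ c ∈ range D, g c = ∑ i ∈ Finset.Ico t (D + t), g (i - t) := by
  refine Finset.sum_bij' (fun c _ => (c : ℤ) + t) (fun i _ => (i - t).toNat) ?_ ?_ ?_ ?_ ?_
  · intro c hc; simp only [mem_range, Finset.mem_Ico] at hc ⊢; omega
  · intro i hi; simp only [mem_range, Finset.mem_Ico] at hi ⊢; omega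
  · intro c _; simp
  · intro i hi; simp only [Finset.mem_Ico] at hi; omega
  · intro c _; simp

theorem sum_range_eq_sum_Ico_sub (D : ℕ) (g : ℤ → ℝ) (t : ℤ) :
    ∑ c ∈ range D, g c = ∑ i ∈ Finset.Ico (t - D) t, g (t - 1 - i) := by
  refine Finset.sum_bij' (fun c _ => t - 1 - (c : ℤ)) (fun i _ => (t - 1 - i).toNat) ?_ ?_ ?_ ?_ ?_
  · intro c hc; simp only [mem_range, Finset.mem_Ico] at hc ⊢; omega
  · intro i hi; simp only [mem_range, Finset.mem_Ico] at hi ⊢; omega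
  · intro c _; simp
  · intro i hi; simp only [Finset.mem_Ico] at hi; omega
  · intro c _; simp

theorem sum_tensB_sub_mul (σ : ℕ → ℝ) {a b D : ℕ} (q : ℤ) (hD : q < D) :
    ∑ c ∈ range D, (tensB σ a b c - tensB σ b a c) * extZ σ (q - c)
      = (2 * b - 2 * a) * wconv σ (q + 1 - a - b) (fun _ => 1) := by
  rcases eq_or_ne a b with rfl | hab
  · simp
  have h1 := sum_range_eq_sum_Ico D (fun c => (2 * b - 2 * a : ℝ) *
    (1 * (extZ σ (c + 1 - a - b) * extZ σ (q - c)))) (1 - a - b)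
  have h2 : ∀ c : ℕ, (tensB σ a b c - tensB σ b a c) * extZ σ (q - c)
      = (2 * b - 2 * a : ℝ) * (1 * (extZ σ ((c : ℤ) + 1 - a - b) * extZ σ (q - c))) := by
    intro c
    simp only [tensB]
    rw [show (c : ℤ) + 1 - b - a = c + 1 - a - b by ring]
    ring
  simp only [h2]
  rw [h1, ← mul_sum, ← sum_Ico_eq_wconv (L := 1 - a - b) (U := D + (1 - a - b)) _ _ _
    (by omega) (by omega)]
  congr 1
  refine sum_congr rfl fun i _ => ?_
  ring_nf

theorem tens_relation_C (σ : ℕ → ℝ) (a b e e' D : ℕ) (hD : e + e' + 3 ≤ D) :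
    ∑ c ∈ range D, tensC σ a c e * tensB σ b c e'
      + ∑ c ∈ range D, tensC σ a c e' * tensB σ b c e
      - ∑ c ∈ range D, tensC σ b c e * tensB σ a c e'
      - ∑ c ∈ range D, tensC σ b c e' * tensB σ a c e
      + ∑ c ∈ range D, (tensB σ a b c - tensB σ b a c) * tensC σ c e e' = 0 := by
  set N : ℤ := e + e' + 3 - a - b with hN
  have key : ∀ e e' : ℕ, (e : ℤ) + e' + 3 - a - b = N → e + e' + 3 ≤ D →
      ∑ c ∈ range D, tensC σ a c e * tensB σ b c e'
      - ∑ c ∈ range D, tensC σ b c e' * tensB σ a c e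
      = wconv σ N (fun i => 2 * i + (2 * a - 2 * e - 3)) := by
    intro e e' hN' hD'
    have h1 := sum_range_eq_sum_Ico D (fun c => extZ σ (c + e + 2 - a) *
      ((2 * c + 1) * extZ σ (e' + 1 - b - c))) (e + 2 - a)
    have h2 := sum_range_eq_sum_Ico_sub D (fun c => extZ σ (c + e' + 2 - b) *
      ((2 * c + 1) * extZ σ (e + 1 - a - c))) (e + 2 - a)
    simp only [Int.cast_natCast] at h1 h2
    simp only [tensC, tensB]
    rw [← sum_Ico_eq_wconv (L := e + 2 - a - D) (U := D + (e + 2 - a)) _ _ _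
      (by omega) (by omega), ← sum_Ico_add_sum_Ico _ (b := (e + 2 - a : ℤ)) (by omega)
      (by omega), h1, h2, sub_eq_neg_add, ← Finset.sum_neg_distrib]
    congr 1
    · refine sum_congr rfl fun i _ => ?_
      rw [show (e : ℤ) + 2 - a - 1 - i + e' + 2 - b = N - i by rw [← hN']; ring,
        show (e : ℤ) + 1 - a - (e + 2 - a - 1 - i) = i by ring]
      push_cast; ring
    · refine sum_congr rfl fun i _ => ?_
      rw [show (e' : ℤ) + 1 - b - (i - (e + 2 - a)) = N - i by rw [← hN']; ring,
        show i - ((e : ℤ) + 2 - a) + e + 2 - a = i by ring]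
      push_cast; ring
  have h1 := key e e' rfl hD
  have h2 := key e' e (by rw [hN]; ring) (by omega)
  have h3 := sum_tensB_sub_mul σ (a := a) (b := b) (D := D) (e + e' + 2) (by omega)
  have h4 := wconv_reflect σ N (fun i => (i : ℝ))
  have e1 : wconv σ N (fun i => 2 * i + (2 * a - 2 * e - 3 : ℝ)) = 2 * wconv σ N (fun i => (i : ℝ))
      + (2 * a - 2 * e - 3) * wconv σ N (fun _ => 1) := by
    rw [wconv_add, wconv_smul, wconv_const]
  have e2 : wconv σ N (fun i => 2 * i + (2 * a - 2 * e' - 3 : ℝ)) = 2 * wconv σ N (fun i => (i : ℝ))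
      + (2 * a - 2 * e' - 3) * wconv σ N (fun _ => 1) := by
    rw [wconv_add, wconv_smul, wconv_const]
  have e3 : wconv σ N (fun i => ((N - i : ℤ) : ℝ)) = -1 * wconv σ N (fun i => (i : ℝ))
      + N * wconv σ N (fun _ => 1) := by
    rw [← wconv_smul, ← wconv_smul, ← wconv_add]
    congr 1; funext i; push_cast; ring
  have e4 : (N : ℝ) = e + e' + 3 - a - b := by rw [hN]; push_cast; ring
  rw [show (e : ℤ) + e' + 2 + 1 - a - b = N by rw [hN]; ring] at h3
  simp only [← show ∀ c : ℕ, tensC σ c e e' = extZ σ (e + e' + 2 - c) from fun c => rfl] at h3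
  rw [e4] at e3
  linear_combination h1 + h2 + h3 + e1 + e2 + 2 * (e3 - h4)

theorem tens_relation_B (σ : ℕ → ℝ) (a b m e D : ℕ) (hD : e + 2 ≤ D) :
    ∑ c ∈ range D, tensC σ a c e * tensA σ b c m
      + ∑ c ∈ range D, tensB σ a m c * tensB σ b c e
      - ∑ c ∈ range D, tensC σ b c e * tensA σ a c m
      - ∑ c ∈ range D, tensB σ b m c * tensB σ a c e
      + ∑ c ∈ range D, (tensB σ a b c - tensB σ b a c) * tensB σ c m e = 0 := by
  set N : ℤ := e + 2 - a - b - m with hN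
  have hA : ∀ a b : ℕ, (e : ℤ) + 2 - a - b - m = N →
      ∑ c ∈ range D, tensC σ a c e * tensA σ b c m
        = if b = 0 ∧ m = 0 then extZ σ 0 * extZ σ N else 0 := by
    intro a b hN'
    rw [sum_eq_single_of_mem 0 (by simp; omega)]
    · simp only [tensA, true_and, tensC]
      split_ifs with h
      · obtain ⟨rfl, rfl⟩ := h
        rw [← hN', show extZ σ 0 = σ 0 from extZ_natCast σ 0]
        simp only [Nat.cast_zero, zero_add, sub_zero]
        rw [mul_comm]
      · simp
    · intro c _ hc; simp [tensA, hc]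
  have key : ∀ a b : ℕ, (e : ℤ) + 2 - a - b - m = N →
      ∑ c ∈ range D, tensB σ a m c * tensB σ b c e
      = (2 * m + 1) * (wconv σ N (fun i => 2 * i + (2 * a + 2 * m - 1))
        + if a = 0 ∧ m = 0 then extZ σ 0 * extZ σ N else 0) := by
    intro a b hN'
    have h1 := sum_range_eq_sum_Ico D (fun c => (2 * m + 1 : ℝ) * ((2 * c + 1) *
      (extZ σ (c + 1 - a - m) * extZ σ (e + 1 - b - c)))) (1 - a - m)
    simp only [Int.cast_natCast] at h1
    have h2 : ∀ c : ℕ, tensB σ a m c * tensB σ b c e = (2 * m + 1 : ℝ) * ((2 * c + 1) *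
      (extZ σ (c + 1 - a - m) * extZ σ (e + 1 - b - c))) := by
      intro c; simp only [tensB]; ring
    simp only [h2]
    rw [h1, ← mul_sum]
    congr 1
    have h3 : ∀ i : ℤ, (2 * ((i - (1 - a - m) : ℤ) : ℝ) + 1) *
        (extZ σ (i - (1 - a - m) + 1 - a - m) * extZ σ (e + 1 - b - (i - (1 - a - m))))
        = (2 * i + (2 * a + 2 * m - 1)) * (extZ σ i * extZ σ (N - i)) := by
      intro i
      rw [show i - (1 - a - m) + 1 - a - m = (i : ℤ) by ring,
        show (e : ℤ) + 1 - b - (i - (1 - a - m)) = N - i by rw [← hN']; ring]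
      push_cast; ring
    simp only [h3]
    split_ifs with h
    · obtain ⟨rfl, rfl⟩ := h
      simp only [Nat.cast_zero, sub_zero, mul_zero, add_zero]
      rw [← sum_Ico_eq_wconv (L := 0) (U := D + 1) _ _ _ le_rfl
        (by omega), ← sum_Ico_add_sum_Ico _ (a := 0) (b := 1) (by omega) (by omega),
        show Finset.Ico (0 : ℤ) 1 = {0} from rfl, Finset.sum_singleton]
      simp only [sub_zero, Int.cast_zero, mul_zero]
      ring
    · rw [add_zero]
      exact sum_Ico_eq_wconv _ _ _ (by omega) (by omega)
  have h1 := key a b rfl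
  have h2 := key b a (by rw [hN]; ring)
  have h3 := sum_tensB_sub_mul σ (a := a) (b := b) (D := D) (e + 1 - m) (by omega)
  have e1 : ∀ r : ℝ, wconv σ N (fun i => 2 * i + r) = 2 * wconv σ N (fun i => (i : ℝ))
      + r * wconv σ N (fun _ => 1) := by
    intro r
    rw [wconv_add, wconv_smul, wconv_const]
  have h4 : ∑ c ∈ range D, (tensB σ a b c - tensB σ b a c) * tensB σ c m e
      = (2 * m + 1) * ((2 * b - 2 * a) * wconv σ N (fun _ => 1)) := by
    rw [show (e : ℤ) + 1 - m + 1 - a - b = N by rw [hN]; ring] at h3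
    rw [← h3, mul_sum]
    refine sum_congr rfl fun c _ => ?_
    rw [show tensB σ c m e = (2 * m + 1) * extZ σ (e + 1 - m - c) by
      rw [tensB, show (e : ℤ) + 1 - m - c = e + 1 - c - m by ring]]
    ring
  rw [hA a b rfl, hA b a (by rw [hN]; ring), h1, h2, h4, e1, e1]
  by_cases hm : m = 0
  · subst hm
    split_ifs <;> simp <;> ring
  · simp only [hm, and_false, if_false]; ring


/-! ### The recursion in the ring of functions on multisets -/

section Solution

variable {R S : Type*} [CommRing R] [CommRing S]

/-- The constant function with value `ρ r` at the empty multiset. -/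
def kst (ρ : ℝ →+* R) : ℝ →+* Fock ℕ R := (algebraMap R (Fock ℕ R)).comp ρ

theorem kst_eq_smul (ρ : ℝ →+* R) (r : ℝ) : kst ρ r = ρ r • (1 : Fock ℕ R) := by
  rw [kst, RingHom.comp_apply, Algebra.algebraMap_eq_smul_one]

theorem der_kst (ρ : ℝ →+* R) (a : ℕ) (r : ℝ) : Fock.der a (kst ρ r) = 0 :=
  Derivation.map_algebraMap _ _

theorem kst_mul (ρ : ℝ →+* R) (r : ℝ) (f : Fock ℕ R) : kst ρ r * f = ρ r • f := by
  rw [kst_eq_smul, smul_mul_assoc, one_mul]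

theorem map_kst (φ : R →+* S) (ρ : ℝ →+* R) (r : ℝ) :
    Fock.map φ (kst ρ r) = kst (φ.comp ρ) r := by
  rw [kst_eq_smul, kst_eq_smul, Fock.map_smul, map_one]; rfl

/-- The coordinate function `x₀`. -/
def xZero : Fock ℕ R := Fock.lin fun m => if m = 0 then 1 else 0

def tAlpha (ρ : ℝ →+* R) (σ : ℕ → ℝ) (a : ℕ) : Fock ℕ R :=
  if a = 0 then kst ρ (σ 0 / 2) * xZero ^ 2 else 0

def tBeta (ρ : ℝ →+* R) (σ : ℕ → ℝ) (a c : ℕ) : Fock ℕ R :=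
  Fock.lin fun m => ρ (tensB σ a m c)

theorem map_tAlpha (φ : R →+* S) (ρ : ℝ →+* R) (σ : ℕ → ℝ) (a : ℕ) :
    Fock.map φ (tAlpha ρ σ a) = tAlpha (φ.comp ρ) σ a := by
  simp only [tAlpha]
  split_ifs
  · simp only [map_mul, map_kst, map_pow, xZero, Fock.map_lin]
    congr; funext i; split_ifs <;> simp
  · simp

theorem map_tBeta (φ : R →+* S) (ρ : ℝ →+* R) (σ : ℕ → ℝ) (a c : ℕ) :
    Fock.map φ (tBeta ρ σ a c) = tBeta (φ.comp ρ) σ a c := by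
  simp [tBeta, Fock.map_lin]

theorem der_tBeta (ρ : ℝ →+* R) (σ : ℕ → ℝ) (a b c : ℕ) :
    Fock.der b (tBeta ρ σ a c) = kst ρ (tensB σ a b c) := by
  rw [tBeta, Fock.der_lin, kst_eq_smul]

theorem der_xZero (b : ℕ) : Fock.der b (xZero : Fock ℕ R) = if b = 0 then 1 else 0 := by
  rw [xZero, Fock.der_lin]; split_ifs <;> simp

theorem der_tAlpha (ρ : ℝ →+* R) (σ : ℕ → ℝ) (a b : ℕ) :
    Fock.der b (tAlpha ρ σ a) = if a = 0 ∧ b = 0 then kst ρ (σ 0) * xZero else 0 := by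
  simp only [tAlpha]
  by_cases ha : a = 0
  · have : kst ρ (σ 0) = 2 * kst ρ (σ 0 / 2) := by
      rw [← map_ofNat (kst ρ) 2, ← map_mul]; congr 1; ring
    subst ha
    simp only [if_true, pow_two, Fock.der_mul, der_kst, zero_mul, add_zero, der_xZero, true_and]
    split_ifs
    · rw [this]; ring
    · simp
  · simp [ha]

theorem der_der_tAlpha (ρ : ℝ →+* R) (σ : ℕ → ℝ) (a b c : ℕ) :
    Fock.der c (Fock.der b (tAlpha ρ σ a)) = kst ρ (tensA σ a b c) := by
  rw [der_tAlpha]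
  simp only [tensA]
  by_cases h : a = 0 ∧ b = 0
  · simp only [h, and_self, if_true, true_and, Fock.der_mul, der_kst, der_xZero]
    split_ifs <;> simp
  · rw [if_neg h, if_neg (by tauto)]; simp

/-- `f` solves the recursion with expansion parameter `x`, its indices being cut off at `D`. -/
def IsAirySol (ρ : ℝ →+* R) (σ : ℕ → ℝ) (D : ℕ) (x : R) (f : ℕ → Fock ℕ R) : Prop :=
  ∀ a, f a = x • (tAlpha ρ σ a + kst ρ (tensD σ a)
    + ∑ c ∈ range D, tBeta ρ σ a c * f c
    + kst ρ (1 / 2) * ∑ c ∈ range D, ∑ e ∈ range D,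
        kst ρ (tensC σ a c e) * (Fock.der e (f c) + f c * f e))

theorem IsAirySol.map {ρ : ℝ →+* R} {σ : ℕ → ℝ} {D : ℕ} {x : R} {f : ℕ → Fock ℕ R}
    (hf : IsAirySol ρ σ D x f) (φ : R →+* S) :
    IsAirySol (φ.comp ρ) σ D (φ x) fun a => Fock.map φ (f a) := by
  intro a
  beta_reduce
  conv_lhs => rw [hf a]
  simp only [Fock.map_smul, map_add, map_tAlpha, map_kst, map_sum, map_mul, map_tBeta, Fock.map_der]

theorem tBeta_zero_mul (ρ : ℝ →+* R) (σ : ℕ → ℝ) {a : ℕ} (ha : a ≠ 0) :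
    tBeta ρ σ a 0 = kst ρ (extZ σ (1 - a)) * xZero := by
  rw [tBeta, kst_mul, xZero]
  refine Fock.eq_of_der (by simp [Fock.lin_apply_zero]) fun m => ?_
  rw [Derivation.map_smul, Fock.der_lin, Fock.der_lin, smul_smul]
  congr 1
  split_ifs with h
  · subst h; simp [tensB]
  · rw [tensB, extZ_neg _ (by omega)]; simp

theorem tens_relation_alpha (ρ : ℝ →+* R) (σ : ℕ → ℝ) (a b D : ℕ) (hD : 0 < D) :
    ∑ c ∈ range D, tBeta ρ σ a c * Fock.der c (tAlpha ρ σ b)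
      - ∑ c ∈ range D, tBeta ρ σ b c * Fock.der c (tAlpha ρ σ a)
      + ∑ c ∈ range D, (kst ρ (tensB σ a b c) - kst ρ (tensB σ b a c)) * tAlpha ρ σ c = 0 := by
  have h0 : 0 ∈ range D := by simpa using hD
  have e1 : ∀ a b, ∑ c ∈ range D, tBeta ρ σ a c * Fock.der c (tAlpha ρ σ b)
      = tBeta ρ σ a 0 * Fock.der 0 (tAlpha ρ σ b) := by
    intro a b
    refine sum_eq_single_of_mem 0 h0 fun c _ hc => ?_
    rw [der_tAlpha, if_neg (by tauto), mul_zero]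
  have e2 : ∑ c ∈ range D, (kst ρ (tensB σ a b c) - kst ρ (tensB σ b a c)) * tAlpha ρ σ c
      = (kst ρ (tensB σ a b 0) - kst ρ (tensB σ b a 0)) * tAlpha ρ σ 0 := by
    refine sum_eq_single_of_mem 0 h0 fun c _ hc => ?_
    rw [tAlpha, if_neg hc, mul_zero]
  rw [e1, e1, e2]
  have key : ∀ a, a ≠ 0 → tBeta ρ σ a 0 * Fock.der 0 (tAlpha ρ σ 0)
      + (kst ρ (tensB σ a 0 0) - kst ρ (tensB σ 0 a 0)) * tAlpha ρ σ 0 = 0 := by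
    intro a ha
    have e3 : kst ρ (σ 0) = 2 * kst ρ (σ 0 / 2) := by
      rw [← map_ofNat (kst ρ) 2, ← map_mul]; congr 1; ring
    have e4 : kst ρ (tensB σ a 0 0) - kst ρ (tensB σ 0 a 0) = -2 * kst ρ (a * extZ σ (1 - a)) := by
      rw [← map_ofNat (kst ρ) 2, ← map_neg, ← map_mul, ← map_sub]
      congr 1; simp [tensB]; ring
    have e5 : (a : ℝ) * extZ σ (1 - a) = extZ σ (1 - a) := by
      rcases eq_or_ne a 1 with rfl | h
      · simp
      · rw [extZ_neg _ (by omega)]; simp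
    rw [tBeta_zero_mul _ _ ha, der_tAlpha, tAlpha, if_pos ⟨rfl, rfl⟩, if_pos rfl, e4, e5, e3]
    ring
  rcases Nat.eq_zero_or_pos a with rfl | ha <;> rcases Nat.eq_zero_or_pos b with rfl | hb
  · ring
  · have := key b (by omega)
    rw [der_tAlpha ρ σ b, if_neg (by omega)]
    linear_combination -this
  · have := key a (by omega)
    rw [der_tAlpha ρ σ a, if_neg (by omega)]
    linear_combination this
  · rw [der_tAlpha, der_tAlpha, if_neg (by omega), if_neg (by omega), tensB, tensB,
      extZ_neg _ (by omega), extZ_neg _ (by omega)]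
    simp

theorem tens_relation_D (ρ : ℝ →+* R) (σ : ℕ → ℝ) (a b D : ℕ) (hD : 1 < D) :
    kst ρ (1 / 2) * ∑ c ∈ range D, ∑ e ∈ range D,
        kst ρ (tensC σ a c e) * Fock.der e (Fock.der c (tAlpha ρ σ b))
      - kst ρ (1 / 2) * ∑ c ∈ range D, ∑ e ∈ range D,
        kst ρ (tensC σ b c e) * Fock.der e (Fock.der c (tAlpha ρ σ a))
      + ∑ c ∈ range D, (kst ρ (tensB σ a b c) - kst ρ (tensB σ b a c)) * kst ρ (tensD σ c)
      = 0 := by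
  simp only [der_der_tAlpha, ← map_sub, ← map_mul, ← map_sum, ← map_add]
  rw [← map_zero (kst ρ)]
  congr 1
  have e1 : ∀ a b, ∑ c ∈ range D, ∑ e ∈ range D, tensC σ a c e * tensA σ b c e
      = if b = 0 then extZ σ (2 - a) * σ 0 else 0 := by
    intro a b
    rw [sum_eq_single_of_mem 0 (by simp; omega), sum_eq_single_of_mem 0 (by simp; omega)]
    · simp [tensA, tensC]
    · intro c _ hc; simp [tensA, hc]
    · intro c _ hc; simp [tensA, hc]
  have e2 : ∑ c ∈ range D, (tensB σ a b c - tensB σ b a c) * tensD σ c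
      = (2 * b - 2 * a) * (extZ σ (1 - a - b) * σ 1 + extZ σ (2 - a - b) * σ 0) / 8 := by
    rw [← Finset.sum_subset (s₁ := range 2) (by simpa using by omega)]
    · simp only [Finset.sum_range_succ, Finset.sum_range_zero, tensB, tensD, zero_add,
        Nat.cast_zero, Nat.cast_one, sub_zero, sub_self]
      have e3 := extZ_natCast σ 0
      have e4 := extZ_natCast σ 1
      rw [Nat.cast_zero] at e3
      rw [Nat.cast_one] at e4
      rw [e3, e4, show (1 : ℤ) - b - a = 1 - a - b by ring,
        show (1 : ℤ) + 1 - b - a = 2 - a - b by ring, show (1 : ℤ) + 1 - a - b = 2 - a - b by ring]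
      ring
    · intro c _ hc
      rw [tensD, extZ_neg σ (n := 1 - c) (by simp at hc; omega)]; simp
  rw [e1, e1, e2]
  have h1 := extZ_natCast σ 1
  have h0 := extZ_natCast σ 0
  rw [Nat.cast_one] at h1
  rw [Nat.cast_zero] at h0
  have key : ∀ a : ℕ, a ≠ 0 → 2 * (extZ σ (2 - a) * σ 0)
      = a * (extZ σ (1 - a) * σ 1 + extZ σ (2 - a) * σ 0) := by
    intro a ha
    rcases Nat.lt_or_ge a 3 with h | h
    · obtain rfl | rfl : a = 1 ∨ a = 2 := by omega
      · norm_num [h1, h0]; ring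
      · norm_num [h0, extZ_neg σ (n := -1) (by norm_num)]
    · rw [extZ_neg _ (by omega), extZ_neg _ (by omega)]; ring
  rcases Nat.eq_zero_or_pos a with rfl | ha <;> rcases Nat.eq_zero_or_pos b with rfl | hb
  · simp
  · have := key b (by omega)
    rw [if_neg (by omega), if_pos rfl]
    simp only [Nat.cast_zero, sub_zero]
    linear_combination -this / 4
  · have := key a (by omega)
    rw [if_pos rfl, if_neg (by omega)]
    simp only [Nat.cast_zero, sub_zero]
    linear_combination this / 4
  · rw [if_neg (by omega), if_neg (by omega), extZ_neg σ (n := 1 - a - b) (by omega)]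
    by_cases hab : a = b
    · subst hab; ring
    · rw [extZ_neg σ (n := 2 - a - b) (by omega)]; ring

theorem tens_relation_beta (ρ : ℝ →+* R) (σ : ℕ → ℝ) (a b e D : ℕ) (hD : e + 2 ≤ D) :
    ∑ c ∈ range D, kst ρ (tensC σ a c e) * Fock.der c (tAlpha ρ σ b)
      + ∑ c ∈ range D, tBeta ρ σ a c * kst ρ (tensB σ b c e)
      - ∑ c ∈ range D, kst ρ (tensC σ b c e) * Fock.der c (tAlpha ρ σ a)
      - ∑ c ∈ range D, tBeta ρ σ b c * kst ρ (tensB σ a c e)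
      + ∑ c ∈ range D, (kst ρ (tensB σ a b c) - kst ρ (tensB σ b a c)) * tBeta ρ σ c e
      = 0 := by
  refine Fock.eq_of_der ?_ fun m => ?_
  · have h1 : ∀ a c, (tBeta ρ σ a c) 0 = 0 := fun a c => Fock.lin_apply_zero _
    have h2 : ∀ a b, (Fock.der b (tAlpha ρ σ a)) 0 = 0 := by
      intro a b
      rw [der_tAlpha]
      split_ifs
      · simp [Fock.mul_apply_zero, xZero, Fock.lin_apply_zero]
      · rfl
    simp [Fock.mul_apply_zero, h1, h2, -Fock.der_apply]
  · have := tens_relation_B σ a b m e D hD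
    rw [map_zero, ← map_zero (kst ρ), ← this]
    simp only [map_add, map_sub, map_sum, Fock.der_mul, der_kst, der_tBeta, der_der_tAlpha, map_mul,
      zero_mul, mul_zero, add_zero, zero_add, sub_self]

/-- The solution of the recursion is the gradient of a function. -/
theorem IsAirySol.symmetric {ρ : ℝ →+* R} {σ : ℕ → ℝ} {D : ℕ} {x : R} {f : ℕ → Fock ℕ R}
    (hf : IsAirySol ρ σ D x f) {n M : ℕ} (hx : x ^ n = 0) (hM : M + 3 ≤ D)
    (h0 : ∀ e, M ≤ e → f e = 0) (h1 : ∀ e e', M ≤ e + e' → Fock.der e' (f e) = 0)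
    (h2 : ∀ e e', M ≤ e + e' → f e * f e' = 0) (a b : ℕ) :
    Fock.der b (f a) = Fock.der a (f b) := by
  refine airy_symmetric (R := R) (n := n) Fock.der Fock.der_comm (range D)
    (algebraMap R (Fock ℕ R) x) (kst ρ (1 / 2)) (fun i => Derivation.map_algebraMap _ _)
    (fun i => der_kst _ _ _) ?_ (by rw [← map_pow, hx, map_zero]) f (tAlpha ρ σ)
    (fun a => kst ρ (tensD σ a)) (tBeta ρ σ) (fun a b c => kst ρ (tensB σ a b c))
    (fun a b c => kst ρ (tensC σ a b c)) (fun _ _ _ _ => der_kst _ _ _)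
    (fun _ _ _ _ => der_kst _ _ _) (fun _ _ => der_kst _ _ _) (fun _ _ _ => der_tBeta _ _ _ _ _)
    ?_ (fun a c e => by rw [tensC_symm]) (fun a b => tens_relation_alpha ρ σ a b D (by omega))
    (fun a b => tens_relation_D ρ σ a b D (by omega)) ?_ ?_ ?_ a b
  · rw [← map_ofNat (kst ρ) 2, ← map_mul]; norm_num
  · intro a b
    rw [der_tAlpha, der_tAlpha]
    simp only [and_comm]
  · intro a b e _
    by_cases he : M ≤ e
    · rw [h0 e he, zero_mul]
    · rw [tens_relation_beta ρ σ a b e D (by omega), mul_zero]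
  · intro a b e _ e' _ g hg
    by_cases he : M ≤ e + e'
    · have : g = 0 := by
        rcases hg with rfl | rfl
        · exact h2 e e' he
        · exact h1 e e' he
      rw [this, mul_zero]
    · have := tens_relation_C σ a b e e' D (by omega)
      simp only [← map_sub, ← map_mul, ← map_sum, ← map_add]
      rw [this, map_zero, zero_mul]
  · intro a
    conv_lhs => rw [hf a]
    rw [Algebra.smul_def]

end Solution


/-! ### Existence of the solution -/

/-- The coefficients of the solution of the recursion. -/
def airyF (σ : ℕ → ℝ) (D : ℕ) : ℕ → ℕ → Multiset ℕ → ℝ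
  | 0, _, _ => 0
  | χ + 1, a, K =>
    (if χ = 0 then (tAlpha (RingHom.id ℝ) σ a + kst (RingHom.id ℝ) (tensD σ a)) K else 0)
    + ∑ c ∈ range D, (K.map fun m => tensB σ a m c * airyF σ D χ c (K.erase m)).sum
    + 1 / 2 * ∑ c ∈ range D, ∑ e ∈ range D, tensC σ a c e *
        (airyF σ D χ c (e ::ₘ K) + (K.antidiagonal.map fun p =>
          ∑ i : Fin (χ + 1), airyF σ D i c p.1 * airyF σ D (χ - i) e p.2).sum)
termination_by χ => χ

theorem multiset_sum_eq_zero {α : Type*} {s : Multiset α} {f : α → ℝ} (h : ∀ x ∈ s, f x = 0) :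
    (s.map f).sum = 0 := by
  rw [Multiset.map_congr rfl h]; simp

theorem xZero_sq_apply {R : Type*} [CommRing R] {K : Multiset ℕ}
    (h : ¬ (K.card = 2 ∧ K.sum = 0)) : ((xZero : Fock ℕ R) ^ 2) K = 0 := by
  rw [pow_two]
  nth_rewrite 1 [xZero]
  rw [Fock.lin_mul_apply]
  rw [Multiset.map_congr rfl (g := fun _ => (0 : R)), Multiset.map_const', Multiset.sum_replicate,
    smul_zero]
  intro m hm
  split_ifs with hm0
  · subst hm0
    rw [one_mul, xZero, Fock.lin, Fock.mk_apply]
    split_ifs with hc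
    · obtain ⟨j, hj⟩ := Multiset.card_eq_one.1 hc
      rw [hj, Multiset.map_singleton, Multiset.sum_singleton]
      split_ifs with hj0
      · exfalso
        subst hj0
        have := Multiset.cons_erase hm
        rw [hj] at this
        apply h
        rw [← this]; simp
      · rfl
    · rfl
  · rw [zero_mul]

theorem tAlpha_apply {R : Type*} [CommRing R] (ρ : ℝ →+* R) (σ : ℕ → ℝ) {a : ℕ} {K : Multiset ℕ}
    (h : ¬ (a = 0 ∧ K.card = 2 ∧ K.sum = 0)) : (tAlpha ρ σ a) K = 0 := by
  rw [tAlpha]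
  split_ifs with ha
  · rw [kst_mul, Fock.smul_apply, xZero_sq_apply (by tauto), mul_zero]
  · rfl

theorem kst_apply {R : Type*} [CommRing R] (ρ : ℝ →+* R) (r : ℝ) (K : Multiset ℕ) :
    (kst ρ r) K = if K.card = 0 then ρ r else 0 := by
  rw [kst_eq_smul, Fock.smul_apply, Fock.one_apply]; split_ifs <;> simp

theorem tens_base_apply (σ : ℕ → ℝ) {a : ℕ} {K : Multiset ℕ}
    (h : 2 ≤ a + K.sum ∨ ¬ ∃ h, 2 = 2 * h + K.card) :
    (tAlpha (RingHom.id ℝ) σ a + kst (RingHom.id ℝ) (tensD σ a)) K = 0 := by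
  have h1 : (tAlpha (RingHom.id ℝ) σ a) K = 0 := tAlpha_apply _ _ fun h' => by
    rcases h with h | h
    · omega
    · exact h ⟨0, by omega⟩
  have h2 : (kst (RingHom.id ℝ) (tensD σ a)) K = 0 := by
    rw [kst_apply]
    split_ifs with hK
    · rw [Multiset.card_eq_zero] at hK
      subst hK
      rcases h with h | h
      · rw [tensD, extZ_neg _ (by simp at h; omega)]; simp
      · exact absurd ⟨1, by simp⟩ h
    · rfl
  rw [Fock.add_apply, h1, h2, add_zero]

/-- The coefficients vanish beyond the dimension and for the wrong parity. -/
theorem airyF_eq_zero (σ : ℕ → ℝ) (D : ℕ) (χ a : ℕ) (K : Multiset ℕ)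
    (h : 2 * χ ≤ a + K.sum ∨ ¬ ∃ h, χ + 1 = 2 * h + K.card) : airyF σ D χ a K = 0 := by
  induction χ using Nat.strong_induction_on generalizing a K with
  | _ χ ih =>
    rcases χ with _ | χ
    · rw [airyF]
    rw [airyF]
    have h1 : (if χ = 0 then (tAlpha (RingHom.id ℝ) σ a + kst (RingHom.id ℝ) (tensD σ a)) K
        else 0) = 0 := by
      split_ifs with hχ
      · subst hχ; exact tens_base_apply σ (by simpa using h)
      · rfl
    have h2 : ∀ c ∈ range D,
        (K.map fun m => tensB σ a m c * airyF σ D χ c (K.erase m)).sum = 0 := by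
      intro c _
      refine multiset_sum_eq_zero fun m hm => ?_
      by_cases hB : (c : ℤ) + 1 - a - m < 0
      · rw [tensB, extZ_neg _ hB]; ring
      · have e1 := congrArg Multiset.sum (Multiset.cons_erase hm)
        have e2 := congrArg Multiset.card (Multiset.cons_erase hm)
        rw [Multiset.sum_cons] at e1
        rw [Multiset.card_cons] at e2
        rw [ih χ (by omega), mul_zero]
        refine h.imp (fun h => by omega) fun h ⟨t, ht⟩ => h ⟨t, by omega⟩
    have h3 : ∀ c ∈ range D, ∀ e ∈ range D, tensC σ a c e *
        (airyF σ D χ c (e ::ₘ K) + (K.antidiagonal.map fun p =>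
          ∑ i : Fin (χ + 1), airyF σ D i c p.1 * airyF σ D (χ - i) e p.2).sum) = 0 := by
      intro c _ e _
      by_cases hC : (c : ℤ) + e + 2 - a < 0
      · rw [tensC, extZ_neg _ hC, zero_mul]
      · rw [ih χ (by omega), zero_add, multiset_sum_eq_zero, mul_zero]
        · intro p hp
          have hp' := Multiset.mem_antidiagonal.1 hp
          have e1 := congrArg Multiset.sum hp'
          have e2 := congrArg Multiset.card hp'
          rw [Multiset.sum_add] at e1
          rw [Multiset.card_add] at e2
          refine sum_eq_zero fun i _ => ?_
          have hi := i.2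
          by_cases hi1 : (2 * (i : ℕ) ≤ c + p.1.sum ∨ ¬ ∃ h, (i : ℕ) + 1 = 2 * h + p.1.card)
          · rw [ih i (by omega) _ _ hi1, zero_mul]
          · rw [ih (χ - i) (by omega), mul_zero]
            simp only [not_or, not_not] at hi1
            obtain ⟨hi1, t, ht⟩ := hi1
            refine h.imp (fun h => by omega) fun h ⟨t', ht'⟩ => h ⟨t + t', by omega⟩
        · rw [Multiset.sum_cons, Multiset.card_cons]
          refine h.imp (fun h => by omega) fun h ⟨t, ht⟩ => h ⟨t + 1, by omega⟩
    rw [h1, sum_eq_zero h2, sum_eq_zero fun c hc => sum_eq_zero (h3 c hc)]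
    simp

/-- The generating series of the solution. -/
def airyP (σ : ℕ → ℝ) (D a : ℕ) : Fock ℕ (PowerSeries ℝ) :=
  ⟨fun K => PowerSeries.mk fun χ => airyF σ D χ a K⟩

theorem coeff_airyP (σ : ℕ → ℝ) (D a χ : ℕ) (K : Multiset ℕ) :
    coeff χ (airyP σ D a K) = airyF σ D χ a K := by
  rw [airyP, Fock.mk_apply, PowerSeries.coeff_mk]

theorem isAirySol_airyP (σ : ℕ → ℝ) (D : ℕ) :
    IsAirySol (PowerSeries.C (R := ℝ)) σ D PowerSeries.X (airyP σ D) := by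
  intro a
  refine Fock.ext_apply fun K => PowerSeries.ext fun χ => ?_
  rw [coeff_airyP, Fock.smul_apply]
  rcases χ with _ | χ
  · rw [airyF]; simp
  have e0 : (PowerSeries.C (R := ℝ)).comp (RingHom.id ℝ) = PowerSeries.C := by
    ext; simp
  have h1 : coeff χ ((tAlpha PowerSeries.C σ a + kst PowerSeries.C (tensD σ a)) K)
      = if χ = 0 then (tAlpha (RingHom.id ℝ) σ a + kst (RingHom.id ℝ) (tensD σ a)) K else 0 := by
    have : tAlpha PowerSeries.C σ a + kst PowerSeries.C (tensD σ a) = Fock.map PowerSeries.C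
        (tAlpha (RingHom.id ℝ) σ a + kst (RingHom.id ℝ) (tensD σ a)) := by
      rw [map_add, map_tAlpha, map_kst, e0]
    rw [this, Fock.map_apply, PowerSeries.coeff_C]
  have h2 : ∀ c, coeff χ ((tBeta PowerSeries.C σ a c * airyP σ D c) K)
      = (K.map fun m => tensB σ a m c * airyF σ D χ c (K.erase m)).sum := by
    intro c
    rw [tBeta, Fock.lin_mul_apply, map_multiset_sum, Multiset.map_map]
    congr 1
    refine Multiset.map_congr rfl fun m _ => ?_
    rw [Function.comp_apply, PowerSeries.coeff_C_mul, coeff_airyP]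
  have h3 : ∀ c e, coeff χ ((kst PowerSeries.C (tensC σ a c e) *
      (Fock.der e (airyP σ D c) + airyP σ D c * airyP σ D e)) K)
      = tensC σ a c e * (airyF σ D χ c (e ::ₘ K) + (K.antidiagonal.map fun p =>
          ∑ i : Fin (χ + 1), airyF σ D i c p.1 * airyF σ D (χ - i) e p.2).sum) := by
    intro c e
    rw [kst_mul, Fock.smul_apply, PowerSeries.coeff_C_mul, Fock.add_apply, map_add, Fock.der_apply,
      coeff_airyP, Fock.mul_apply, map_multiset_sum, Multiset.map_map]
    congr 3
    refine Multiset.map_congr rfl fun p _ => ?_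
    rw [Function.comp_apply, PowerSeries.coeff_mul, Finset.Nat.sum_antidiagonal_eq_sum_range_succ
      (fun i j => coeff i (airyP σ D c p.1) * coeff j (airyP σ D e p.2)), Finset.sum_range]
    simp only [coeff_airyP]
  rw [PowerSeries.coeff_succ_X_mul, airyF, ← h1, Fock.add_apply _ (kst _ _ * _),
    Fock.add_apply _ (∑ _ ∈ _, _), map_add, map_add, kst_mul, Fock.smul_apply, PowerSeries.coeff_C_mul]
  simp only [Fock.sum_apply, map_sum, h2, h3]

/-! ### Truncation -/

/-- Power series modulo `X ^ (N + 1)`. -/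
abbrev TruncSeries (N : ℕ) : Type :=
  PowerSeries ℝ ⧸ Ideal.span {(PowerSeries.X : PowerSeries ℝ) ^ (N + 1)}

/-- The projection to truncated power series. -/
abbrev truncMk (N : ℕ) : PowerSeries ℝ →+* TruncSeries N := Ideal.Quotient.mk _

theorem truncMk_eq_iff {N : ℕ} {f g : PowerSeries ℝ} :
    truncMk N f = truncMk N g ↔ ∀ χ ≤ N, coeff χ f = coeff χ g := by
  rw [Ideal.Quotient.eq, Ideal.mem_span_singleton, PowerSeries.X_pow_dvd_iff]
  simp only [map_sub, sub_eq_zero, Nat.lt_succ_iff]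

theorem truncMk_eq_zero_iff {N : ℕ} {f : PowerSeries ℝ} :
    truncMk N f = 0 ↔ ∀ χ ≤ N, coeff χ f = 0 := by
  rw [← map_zero (truncMk N), truncMk_eq_iff]; simp

theorem truncMk_X_pow (N : ℕ) : truncMk N PowerSeries.X ^ (N + 1) = 0 := by
  rw [← map_pow, Ideal.Quotient.eq_zero_iff_mem]
  exact Ideal.mem_span_singleton_self _

theorem airyF_cons_symm (σ : ℕ → ℝ) {D N χ : ℕ} (hD : 2 * N + 3 ≤ D) (hχ : χ ≤ N) (a b : ℕ)
    (K : Multiset ℕ) : airyF σ D χ a (b ::ₘ K) = airyF σ D χ b (a ::ₘ K) := by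
  have h := ((isAirySol_airyP σ D).map (truncMk N)).symmetric (n := N + 1) (M := 2 * N)
    (truncMk_X_pow N) hD ?_ ?_ ?_ a b
  · rw [← Fock.map_der, ← Fock.map_der] at h
    have := congrArg (fun f => f.toFun K) h
    simp only [Fock.map_apply, Fock.der_apply, truncMk_eq_iff, coeff_airyP] at this
    exact this χ hχ
  · intro e he
    refine Fock.ext_apply fun K => ?_
    rw [Fock.map_apply, Fock.zero_apply, truncMk_eq_zero_iff]
    intro χ hχ
    rw [coeff_airyP, airyF_eq_zero _ _ _ _ _ (Or.inl (by omega))]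
  · intro e e' he
    refine Fock.ext_apply fun K => ?_
    rw [← Fock.map_der, Fock.map_apply, Fock.zero_apply, truncMk_eq_zero_iff]
    intro χ hχ
    rw [Fock.der_apply, coeff_airyP, airyF_eq_zero _ _ _ _ _ (Or.inl _)]
    rw [Multiset.sum_cons]; omega
  · intro e e' he
    refine Fock.ext_apply fun K => ?_
    rw [← map_mul, Fock.map_apply, Fock.zero_apply, truncMk_eq_zero_iff]
    intro χ hχ
    rw [Fock.mul_apply, map_multiset_sum, Multiset.map_map]
    refine multiset_sum_eq_zero fun p _ => ?_
    rw [Function.comp_apply, PowerSeries.coeff_mul]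
    refine sum_eq_zero fun ij hij => ?_
    rw [Finset.HasAntidiagonal.mem_antidiagonal] at hij
    rw [coeff_airyP, coeff_airyP]
    rcases Nat.lt_or_ge e (2 * ij.1) with h1 | h1
    · rw [airyF_eq_zero _ _ ij.2 _ _ (Or.inl (by omega)), mul_zero]
    · rw [airyF_eq_zero _ _ ij.1 _ _ (Or.inl (by omega)), zero_mul]

open Classical in
/-- The potential of the solution, up to order `N`. -/
def airyZ (σ : ℕ → ℝ) (D N : ℕ) : Fock ℕ (PowerSeries ℝ) :=
  ⟨fun K => PowerSeries.mk fun χ => if h : χ ≤ N ∧ ∃ a, a ∈ K then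
    airyF σ D χ h.2.choose (K.erase h.2.choose) else 0⟩

theorem coeff_airyZ_cons (σ : ℕ → ℝ) {D N χ : ℕ} (hD : 2 * N + 3 ≤ D) (a : ℕ) (K : Multiset ℕ) :
    coeff χ (airyZ σ D N (a ::ₘ K)) = if χ ≤ N then airyF σ D χ a K else 0 := by
  classical
  rw [airyZ, Fock.mk_apply, PowerSeries.coeff_mk]
  by_cases hχ : χ ≤ N
  · have h : χ ≤ N ∧ ∃ b, b ∈ a ::ₘ K := ⟨hχ, a, Multiset.mem_cons_self _ _⟩
    rw [dif_pos h, if_pos hχ]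
    have hb := h.2.choose_spec
    generalize h.2.choose = b at hb
    by_cases hab : b = a
    · subst hab; rw [Multiset.erase_cons_head]
    · have hbK : b ∈ K := (Multiset.mem_cons.1 hb).resolve_left hab
      rw [Multiset.erase_cons_tail _ (fun h => hab h.symm), airyF_cons_symm σ hD hχ,
        Multiset.cons_erase hbK]
  · rw [dif_neg (fun h => hχ h.1), if_neg hχ]

theorem airyZ_zero (σ : ℕ → ℝ) (D N : ℕ) : airyZ σ D N 0 = 0 := by
  ext χ
  rw [airyZ, Fock.mk_apply, PowerSeries.coeff_mk, dif_neg (by simp)]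
  simp

theorem map_der_airyZ (σ : ℕ → ℝ) {D N : ℕ} (hD : 2 * N + 3 ≤ D) (a : ℕ) :
    Fock.map (truncMk N) (Fock.der a (airyZ σ D N)) = Fock.map (truncMk N) (airyP σ D a) := by
  refine Fock.ext_apply fun K => ?_
  rw [Fock.map_apply, Fock.map_apply, truncMk_eq_iff]
  intro χ hχ
  rw [Fock.der_apply, coeff_airyZ_cons σ hD, if_pos hχ, coeff_airyP]

theorem coeff_airyZ_eq_zero (σ : ℕ → ℝ) {D N χ : ℕ} (hD : 2 * N + 3 ≤ D) {K : Multiset ℕ}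
    (h : 2 * N ≤ K.sum ∨ ¬ ∃ h, χ + 2 = 2 * h + K.card) : coeff χ (airyZ σ D N K) = 0 := by
  induction K using Multiset.induction with
  | empty => rw [airyZ_zero]; simp
  | cons a K _ =>
    rw [coeff_airyZ_cons σ hD]
    split_ifs with hχ
    · refine airyF_eq_zero _ _ _ _ _ ?_
      rw [Multiset.sum_cons, Multiset.card_cons] at h
      exact h.imp (fun h => by omega) fun h ⟨t, ht⟩ => h ⟨t, by omega⟩
    · rfl

theorem coeff_zero_airyZ (σ : ℕ → ℝ) {D N : ℕ} (hD : 2 * N + 3 ≤ D) (K : Multiset ℕ) :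
    coeff 0 (airyZ σ D N K) = 0 := by
  induction K using Multiset.induction with
  | empty => rw [airyZ_zero]; simp
  | cons a K _ => rw [coeff_airyZ_cons σ hD, airyF]; simp


/-! ### Sums over connected graphs with labelled vertices and edges -/

section GraphSum

variable {V V' E E' R : Type*} {D : ℕ}

/-- An oriented edge whose ends carry an index below `D`. -/
abbrev DecEdge (V : Type*) (D : ℕ) := (V × Fin D) × (V × Fin D)

/-- A set of vertices is a union of connected components. -/
def EdgeClosed (ε : E → DecEdge V D) (A : Set V) : Prop := ∀ e, (ε e).1.1 ∈ A ↔ (ε e).2.1 ∈ A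

/-- There are no proper unions of connected components. -/
def EdgeConnected (ε : E → DecEdge V D) : Prop :=
  ∀ A : Set V, EdgeClosed ε A → A = ∅ ∨ A = Set.univ

/-- `S` and its complement are the connected components. -/
def EdgeSplit (ε : E → DecEdge V D) (S : Set V) : Prop :=
  EdgeClosed ε S ∧ (∀ A, A ⊆ S → EdgeClosed ε A → A = ∅ ∨ A = S) ∧
    ∀ A, A ⊆ Sᶜ → EdgeClosed ε A → A = ∅ ∨ A = Sᶜ

theorem EdgeClosed.compl {ε : E → DecEdge V D} {A : Set V} (h : EdgeClosed ε A) :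
    EdgeClosed ε Aᶜ := fun e => not_congr (h e)

theorem EdgeClosed.inter {ε : E → DecEdge V D} {A B : Set V} (h : EdgeClosed ε A)
    (h' : EdgeClosed ε B) : EdgeClosed ε (A ∩ B) := fun e => and_congr (h e) (h' e)

theorem edgeConnected_option_iff (ε : Option E → DecEdge V D) :
    EdgeConnected ε ↔ EdgeConnected (fun e => ε (some e)) ∨
      ∃ S : Set V, (ε none).1.1 ∈ S ∧ (ε none).2.1 ∉ S ∧ EdgeSplit (fun e => ε (some e)) S := by
  have hcl : ∀ A, EdgeClosed ε A ↔
      EdgeClosed (fun e => ε (some e)) A ∧ ((ε none).1.1 ∈ A ↔ (ε none).2.1 ∈ A) :=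
    fun A => ⟨fun h => ⟨fun e => h (some e), h none⟩, fun h e => by
      cases e with
      | none => exact h.2
      | some e => exact h.1 e⟩
  constructor
  · intro h
    by_contra! hcon
    obtain ⟨h1, h2⟩ := hcon
    simp only [EdgeConnected, not_forall] at h1
    obtain ⟨A, hA, hA'⟩ := h1
    have key : ∃ S, EdgeClosed (fun e => ε (some e)) S ∧ (ε none).1.1 ∈ S ∧ (ε none).2.1 ∉ S := by
      by_cases hx : (ε none).1.1 ∈ A <;> by_cases hy : (ε none).2.1 ∈ A
      · exact absurd (h A ((hcl A).2 ⟨hA, by tauto⟩)) hA'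
      · exact ⟨A, hA, hx, hy⟩
      · exact ⟨Aᶜ, hA.compl, hx, fun h => h hy⟩
      · exact absurd (h A ((hcl A).2 ⟨hA, by tauto⟩)) hA'
    obtain ⟨S, hS, hx, hy⟩ := key
    refine h2 S hx hy ⟨hS, fun B hBS hB => ?_, fun B hBS hB => ?_⟩
    · by_cases hxB : (ε none).1.1 ∈ B
      · right
        have := h (S ∩ Bᶜ) ((hcl _).2 ⟨hS.inter hB.compl, by simp [hxB, hy]⟩)
        rcases this with h' | h'
        · refine hBS.antisymm fun v hv => ?_
          by_contra hvB
          have : v ∈ S ∩ Bᶜ := ⟨hv, hvB⟩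
          rw [h'] at this; exact this
        · have : (ε none).2.1 ∈ S ∩ Bᶜ := h' ▸ Set.mem_univ _
          exact absurd this.1 hy
      · left
        rcases h B ((hcl _).2 ⟨hB, fun h => absurd h hxB, fun h => absurd (hBS h) hy⟩) with h' | h'
        · exact h'
        · exact absurd (h' ▸ Set.mem_univ _) hxB
    · by_cases hyB : (ε none).2.1 ∈ B
      · right
        have := h (Sᶜ ∩ Bᶜ) ((hcl _).2 ⟨hS.compl.inter hB.compl, by simp [hyB, hx]⟩)
        rcases this with h' | h'
        · refine hBS.antisymm fun v hv => ?_
          by_contra hvB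
          have : v ∈ Sᶜ ∩ Bᶜ := ⟨hv, hvB⟩
          rw [h'] at this; exact this
        · have : (ε none).1.1 ∈ Sᶜ ∩ Bᶜ := h' ▸ Set.mem_univ _
          exact absurd hx this.1
      · left
        rcases h B ((hcl _).2 ⟨hB, fun h => absurd hx (hBS h), fun h => absurd h hyB⟩) with h' | h'
        · exact h'
        · exact absurd (h' ▸ Set.mem_univ _) hyB
  · rintro (h | ⟨S, hx, hy, hS, h1, h2⟩) A hA
    · exact h A ((hcl A).1 hA).1
    · obtain ⟨hA, hxy⟩ := (hcl A).1 hA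
      have hu : A = (A ∩ S) ∪ (A ∩ Sᶜ) := by rw [← Set.inter_union_distrib_left]; simp
      rcases h1 (A ∩ S) Set.inter_subset_right (hA.inter hS) with h | h <;>
      rcases h2 (A ∩ Sᶜ) Set.inter_subset_right (hA.inter hS.compl) with h' | h'
      · left; rw [hu, h, h']; simp
      · exfalso
        have h3 : (ε none).2.1 ∈ A ∩ Sᶜ := by rw [h']; exact hy
        have h4 : (ε none).1.1 ∈ A ∩ S := ⟨hxy.2 h3.1, hx⟩
        rw [h] at h4; exact h4
      · exfalso
        have h3 : (ε none).1.1 ∈ A ∩ S := by rw [h]; exact hx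
        have h4 : (ε none).2.1 ∈ A ∩ Sᶜ := ⟨hxy.1 h3.1, hy⟩
        rw [h'] at h4; exact h4
      · right; rw [hu, h, h']; simp

theorem EdgeSplit.unique {ε : E → DecEdge V D} {S S' : Set V} {x : V} (h : EdgeSplit ε S)
    (h' : EdgeSplit ε S') (hx : x ∈ S) (hx' : x ∈ S') : S = S' := by
  have h1 := h.2.1 (S ∩ S') Set.inter_subset_left (h.1.inter h'.1)
  have h2 := h'.2.1 (S ∩ S') Set.inter_subset_right (h.1.inter h'.1)
  have hne : S ∩ S' ≠ ∅ := fun h => by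
    have : x ∈ S ∩ S' := ⟨hx, hx'⟩
    rw [h] at this; exact this
  rw [← h1.resolve_left hne]
  exact h2.resolve_left hne

theorem EdgeSplit.not_connected {ε : E → DecEdge V D} {S : Set V} {x y : V} (h : EdgeSplit ε S)
    (hx : x ∈ S) (hy : y ∉ S) : ¬ EdgeConnected ε := by
  intro hc
  rcases hc S h.1 with h' | h'
  · rw [h'] at hx; exact hx
  · exact hy (h' ▸ Set.mem_univ _)

variable [Fintype V] [Fintype V'] [Fintype E] [Fintype E'] [CommRing R]

open Classical in
/-- The indices carried by an edge at a vertex. -/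
def edgeDeco (q : DecEdge V D) (v : V) : Multiset ℕ :=
  (if q.1.1 = v then {(q.1.2 : ℕ)} else 0) + if q.2.1 = v then {(q.2.2 : ℕ)} else 0

/-- The indices at a vertex. -/
def vertexDeco (ε : E → DecEdge V D) (v : V) : Multiset ℕ := ∑ e, edgeDeco (ε e) v

/-- The contribution of a graph. -/
def graphTerm (u : ℕ → ℕ → R) (Z : Fock ℕ R) (ε : E → DecEdge V D) : Fock ℕ R :=
  (∏ e, u (ε e).1.2 (ε e).2.2) • ∏ v, Fock.shift (vertexDeco ε v) Z

variable (V E D) in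
open Classical in
/-- The sum over connected graphs with vertices `V` and edges `E`. -/
def graphSum (u : ℕ → ℕ → R) (Z : Fock ℕ R) : Fock ℕ R :=
  ∑ ε : E → DecEdge V D, if EdgeConnected ε then graphTerm u Z ε else 0

open Classical in
theorem graphSum_eq (u : ℕ → ℕ → R) (Z : Fock ℕ R) [i : DecidableEq E] :
    graphSum V E D u Z
      = ∑ ε : E → DecEdge V D, if EdgeConnected ε then graphTerm u Z ε else 0 := by
  rw [graphSum]; congr!

theorem sum_decEdge {M : Type*} [AddCommMonoid M] (f : DecEdge V D → M) :
    ∑ q, f q = ∑ a, ∑ b, ∑ x, ∑ y, f ((x, a), (y, b)) := by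
  simp only [Fintype.sum_prod_type]
  rw [sum_comm]
  refine sum_congr rfl fun a _ => ?_
  rw [sum_comm]
  rw [sum_comm]
  rw [sum_congr rfl fun x _ => sum_comm, sum_comm]

theorem graphSum_congr (u : ℕ → ℕ → R) (Z : Fock ℕ R) (eV : V ≃ V') (eE : E ≃ E') :
    graphSum V E D u Z = graphSum V' E' D u Z := by
  classical
  set j : DecEdge V D ≃ DecEdge V' D := (eV.prodCongr (.refl _)).prodCongr (eV.prodCongr (.refl _))
    with hj
  refine Fintype.sum_equiv (Equiv.arrowCongr eE j) _ _ fun ε => ?_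
  have h1 : EdgeConnected ε ↔ EdgeConnected (Equiv.arrowCongr eE j ε) := by
    have hcl : ∀ A : Set V', EdgeClosed (Equiv.arrowCongr eE j ε) A ↔ EdgeClosed ε (eV ⁻¹' A) := by
      intro A
      simp only [EdgeClosed, Equiv.arrowCongr_apply, Function.comp_apply, hj]
      rw [← eE.symm.forall_congr_right]
      rfl
    constructor
    · intro h A hA
      rcases h _ ((hcl A).1 hA) with h | h
      · left; rwa [Set.preimage_eq_empty_iff, eV.range_eq_univ, Set.disjoint_univ] at h
      · right; rwa [Set.preimage_eq_univ_iff, eV.range_eq_univ, Set.univ_subset_iff] at h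
    · intro h A hA
      have hA' : A = eV ⁻¹' (eV.symm ⁻¹' A) := by rw [← Set.preimage_comp]; simp
      rcases h _ ((hcl (eV.symm ⁻¹' A)).2 (hA' ▸ hA)) with h | h
      · left; rw [hA', h]; rfl
      · right; rw [hA', h]; rfl
  have h2 : graphTerm u Z ε = graphTerm u Z (Equiv.arrowCongr eE j ε) := by
    rw [graphTerm, graphTerm]
    congr 1
    · refine Fintype.prod_equiv eE _ _ fun e => ?_
      simp [hj]
    · refine Fintype.prod_equiv eV _ _ fun v => ?_
      congr 1
      refine Fintype.sum_equiv eE _ _ fun e => ?_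
      simp [hj, edgeDeco]
  rw [← h2]
  exact if_congr h1 rfl rfl

open Classical in
theorem der_prod_shift (Z : Fock ℕ R) (s : Finset V) (M : V → Multiset ℕ) (a : ℕ) :
    Fock.der a (∏ v ∈ s, Fock.shift (M v) Z)
      = ∑ x ∈ s, ∏ v ∈ s, Fock.shift ((if x = v then {a} else 0) + M v) Z := by
  rw [Fock.der_prod]
  refine sum_congr rfl fun x _ => prod_congr rfl fun v _ => ?_
  by_cases h : v = x
  · rw [if_pos h, if_pos h.symm, Multiset.singleton_add, Fock.shift_cons]
  · rw [if_neg h, if_neg (fun h' => h h'.symm), zero_add]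

theorem sum_edgeDeco_eq (Z : Fock ℕ R) (M : V → Multiset ℕ) (a b : Fin D) :
    ∑ x : V, ∑ y : V, ∏ v, Fock.shift (edgeDeco ((x, a), (y, b)) v + M v) Z
      = Fock.der (a : ℕ) (Fock.der (b : ℕ) (∏ v, Fock.shift (M v) Z)) := by
  classical
  rw [der_prod_shift, map_sum]
  simp only [der_prod_shift]
  rw [sum_comm]
  refine sum_congr₂ fun x _ y _ =>
    prod_congr rfl fun v _ => ?_
  rw [edgeDeco, add_assoc]

theorem sum_edgeDeco_split [DecidableEq V] (Z : Fock ℕ R) (M : V → Multiset ℕ) (a b : Fin D)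
    (S : Finset V) :
    ∑ x ∈ S, ∑ y ∈ Sᶜ, ∏ v, Fock.shift (edgeDeco ((x, a), (y, b)) v + M v) Z
      = Fock.der (a : ℕ) (∏ v ∈ S, Fock.shift (M v) Z) * Fock.der (b : ℕ) (∏ v ∈ Sᶜ, Fock.shift (M v) Z) := by
  rw [der_prod_shift, der_prod_shift, Finset.sum_mul_sum]
  refine sum_congr₂ fun x hx y hy => ?_
  rw [← Finset.prod_mul_prod_compl S]
  congr 1
  · refine prod_congr rfl fun v hv => ?_
    rw [edgeDeco, if_neg (c := y = v)]
    · rw [add_zero]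
    · rintro rfl; exact (mem_compl.1 hy) hv
  · refine prod_congr rfl fun v hv => ?_
    rw [edgeDeco, if_neg (c := x = v)]
    · rw [zero_add]
    · rintro rfl; exact (mem_compl.1 hv) hx

/-- The inclusion of edges between vertices of `S`. -/
def DecEdge.incl {S : Finset V} (q : DecEdge S D) : DecEdge V D :=
  ((q.1.1, q.1.2), (q.2.1, q.2.2))

theorem DecEdge.incl_injective {S : Finset V} :
    Function.Injective (DecEdge.incl : DecEdge S D → DecEdge V D) := by
  rintro ⟨⟨a, b⟩, ⟨c, d⟩⟩ ⟨⟨a', b'⟩, ⟨c', d'⟩⟩ h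
  simp only [DecEdge.incl, Prod.mk.injEq, Subtype.coe_inj] at h
  obtain ⟨⟨rfl, rfl⟩, rfl, rfl⟩ := h
  rfl

section Restrict

variable {S : Finset V} {T : Finset E} {ε : E → DecEdge V D} {ε₁ : T → DecEdge S D}

theorem edgeConnected_restrict_iff (h1 : ∀ e : T, ε e = (ε₁ e).incl)
    (h2 : ∀ e ∉ T, (ε e).1.1 ∉ S ∧ (ε e).2.1 ∉ S) :
    (∀ A : Set V, A ⊆ S → EdgeClosed ε A → A = ∅ ∨ A = S) ↔ EdgeConnected ε₁ := by
  have hcl : ∀ A : Set V, A ⊆ S → (EdgeClosed ε A ↔ EdgeClosed ε₁ (Subtype.val ⁻¹' A)) := by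
    intro A hA
    constructor
    · intro h e
      have := h e
      rw [h1] at this
      exact this
    · intro h e
      by_cases he : e ∈ T
      · have := h1 ⟨e, he⟩
        simp only at this
        rw [this]
        exact h ⟨e, he⟩
      · exact iff_of_false (fun h => (h2 e he).1 (hA h)) (fun h => (h2 e he).2 (hA h))
  constructor
  · intro h A hA
    have hsub : (Subtype.val '' A : Set V) ⊆ S := by rintro _ ⟨x, -, rfl⟩; exact x.2
    rcases h _ hsub ((hcl _ hsub).2 (by rwa [Set.preimage_image_eq _ Subtype.val_injective]))
      with h | h
    · left; simpa using h
    · right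
      ext x
      simp only [Set.mem_univ, iff_true]
      have : (x : V) ∈ Subtype.val '' A := by rw [h]; exact x.2
      obtain ⟨y, hy, hxy⟩ := this
      rwa [Subtype.val_injective hxy] at hy
  · intro h A hA hcA
    rcases h _ ((hcl A hA).1 hcA) with h | h
    · left
      ext x
      simp only [Set.mem_empty_iff_false, iff_false]
      intro hx
      have : (⟨x, hA hx⟩ : S) ∈ (Subtype.val ⁻¹' A : Set S) := hx
      rw [h] at this
      exact this
    · right
      refine hA.antisymm fun x hx => ?_
      have : (⟨x, hx⟩ : S) ∈ (Subtype.val ⁻¹' A : Set S) := by rw [h]; trivial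
      exact this

omit [Fintype V] in
theorem vertexDeco_restrict (h1 : ∀ e : T, ε e = (ε₁ e).incl)
    (h2 : ∀ e ∉ T, (ε e).1.1 ∉ S ∧ (ε e).2.1 ∉ S) (v : S) :
    vertexDeco ε v = vertexDeco ε₁ v := by
  classical
  rw [vertexDeco, vertexDeco, ← Finset.sum_add_sum_compl T]
  rw [sum_eq_zero (s := Tᶜ), add_zero, ← Finset.sum_coe_sort]
  · refine sum_congr rfl fun e _ => ?_
    rw [h1]
    simp only [edgeDeco, DecEdge.incl, Subtype.coe_inj]
    congr!
  · intro e he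
    have := h2 e (mem_compl.1 he)
    rw [edgeDeco, if_neg (fun h => this.1 (by rw [h]; exact v.2)),
      if_neg (fun h => this.2 (by rw [h]; exact v.2)), add_zero]

omit [Fintype V] in
theorem graphTerm_restrict (u : ℕ → ℕ → R) (Z : Fock ℕ R) (h1 : ∀ e : T, ε e = (ε₁ e).incl)
    (h2 : ∀ e ∉ T, (ε e).1.1 ∉ S ∧ (ε e).2.1 ∉ S) :
    (∏ e ∈ T, u (ε e).1.2 (ε e).2.2) • ∏ v ∈ S, Fock.shift (vertexDeco ε v) Z
      = graphTerm u Z ε₁ := by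
  rw [graphTerm, ← Finset.prod_coe_sort]
  congr 1
  · refine Fintype.prod_congr _ _ fun e => ?_
    rw [h1]; rfl
  · rw [← Finset.prod_coe_sort]
    exact Fintype.prod_congr _ _ fun v => by rw [vertexDeco_restrict h1 h2]

end Restrict

open Classical in
theorem sum_edgeSplit (u : ℕ → ℕ → R) (Z : Fock ℕ R) (S : Finset V) (a b : ℕ) :
    ∑ ε : E → DecEdge V D, (if EdgeSplit ε (S : Set V) then
        (∏ e, u (ε e).1.2 (ε e).2.2) •
          (Fock.der a (∏ v ∈ S, Fock.shift (vertexDeco ε v) Z)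
            * Fock.der b (∏ v ∈ Sᶜ, Fock.shift (vertexDeco ε v) Z)) else 0)
      = ∑ T : Finset E, Fock.der a (graphSum S T D u Z)
          * Fock.der b (graphSum (Sᶜ : Finset V) (Tᶜ : Finset E) D u Z) := by
  set F : (E → DecEdge V D) → Fock ℕ R := fun ε => if EdgeSplit ε (S : Set V) then
        (∏ e, u (ε e).1.2 (ε e).2.2) •
          (Fock.der a (∏ v ∈ S, Fock.shift (vertexDeco ε v) Z)
            * Fock.der b (∏ v ∈ Sᶜ, Fock.shift (vertexDeco ε v) Z)) else 0 with hF
  have hsplit : ∑ ε, F ε = ∑ T : Finset E, ∑ ε,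
      if T = univ.filter (fun e => (ε e).1.1 ∈ S) then F ε else 0 := by
    rw [sum_comm]
    refine sum_congr rfl fun ε _ => ?_
    rw [Finset.sum_ite_eq' univ, if_pos (mem_univ _)]
  rw [hsplit]
  refine sum_congr rfl fun T _ => ?_
  rw [graphSum_eq, graphSum_eq, map_sum, map_sum, Finset.sum_mul_sum, ← Finset.sum_product',
    Finset.univ_product_univ]
  symm
  set glue : (T → DecEdge S D) × ((Tᶜ : Finset E) → DecEdge (Sᶜ : Finset V) D) → E → DecEdge V D :=
    fun p e => if h : e ∈ T then (p.1 ⟨e, h⟩).incl else (p.2 ⟨e, mem_compl.2 h⟩).incl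
    with hglue
  have g1 : ∀ p (e : T), glue p e = (p.1 e).incl := fun p e => by
    simp only [hglue, dif_pos e.2]
  have g2 : ∀ p (e : (Tᶜ : Finset E)), glue p e = (p.2 e).incl := fun p e => by
    simp only [hglue, dif_neg (mem_compl.1 e.2)]
  have g3 : ∀ p, ∀ e ∉ T, (glue p e).1.1 ∉ S ∧ (glue p e).2.1 ∉ S := fun p e he => by
    have := g2 p ⟨e, mem_compl.2 he⟩
    simp only at this
    rw [this]
    exact ⟨mem_compl.1 (p.2 ⟨e, _⟩).1.1.2, mem_compl.1 (p.2 ⟨e, _⟩).2.1.2⟩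
  have g4 : ∀ p, ∀ e ∈ T, (glue p e).1.1 ∈ S ∧ (glue p e).2.1 ∈ S := fun p e he => by
    have := g1 p ⟨e, he⟩
    simp only at this
    rw [this]
    exact ⟨(p.1 ⟨e, _⟩).1.1.2, (p.1 ⟨e, _⟩).2.1.2⟩
  have g5 : ∀ p, ∀ e ∉ Tᶜ, (glue p e).1.1 ∉ Sᶜ ∧ (glue p e).2.1 ∉ Sᶜ := fun p e he => by
    simpa using g4 p e (by simpa using he)
  have g6 : ∀ p, T = univ.filter (fun e => (glue p e).1.1 ∈ S) := fun p => by
    ext e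
    simp only [Finset.mem_filter, mem_univ, true_and]
    exact ⟨fun h => (g4 p e h).1, fun h => by_contra fun h' => (g3 p e h').1 h⟩
  have g7 : ∀ p, EdgeClosed (glue p) (S : Set V) := fun p e => by
    by_cases he : e ∈ T
    · exact iff_of_true (g4 p e he).1 (g4 p e he).2
    · exact iff_of_false (g3 p e he).1 (g3 p e he).2
  refine Fintype.sum_of_injective glue ?_ _ _ ?_ ?_
  · rintro p p' h
    refine Prod.ext (funext fun e => ?_) (funext fun e => ?_)
    · apply DecEdge.incl_injective; rw [← g1, ← g1, h]
    · apply DecEdge.incl_injective; rw [← g2, ← g2, h]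
  · intro ε hε
    by_contra hne
    apply hε
    have hT : T = univ.filter (fun e => (ε e).1.1 ∈ S) := by
      by_contra h; exact hne (if_neg h)
    rw [if_pos hT] at hne
    have hsp : EdgeSplit ε (S : Set V) := by
      by_contra h; exact hne (if_neg h)
    have m1 : ∀ e, e ∈ T ↔ (ε e).1.1 ∈ S := fun e => by rw [hT]; simp
    have m2 : ∀ e, e ∈ T ↔ (ε e).2.1 ∈ S := fun e => (m1 e).trans (hsp.1 e)
    refine ⟨(fun e => ((⟨(ε e).1.1, (m1 e).1 e.2⟩, (ε e).1.2), (⟨(ε e).2.1, (m2 e).1 e.2⟩, (ε e).2.2)),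
      fun e => ((⟨(ε e).1.1, mem_compl.2 fun h => mem_compl.1 e.2 ((m1 e).2 h)⟩,
        (ε e).1.2), (⟨(ε e).2.1, mem_compl.2 fun h => mem_compl.1 e.2 ((m2 e).2 h)⟩,
        (ε e).2.2))), funext fun e => ?_⟩
    by_cases he : e ∈ T
    · exact g1 _ ⟨e, he⟩
    · exact g2 _ ⟨e, mem_compl.2 he⟩
  · rintro p
    rw [if_pos (g6 p)]
    have c1 := edgeConnected_restrict_iff (g1 p) (g3 p)
    have c2 := edgeConnected_restrict_iff (g2 p) (g5 p)
    have hiff : EdgeSplit (glue p) (S : Set V) ↔ EdgeConnected p.1 ∧ EdgeConnected p.2 := by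
      rw [← c1, ← c2, EdgeSplit, Finset.coe_compl]
      exact and_iff_right (g7 p)
    simp only [hF]
    by_cases h1 : EdgeConnected p.1 <;> by_cases h2 : EdgeConnected p.2
    · rw [if_pos h1, if_pos h2, if_pos (hiff.2 ⟨h1, h2⟩), ← graphTerm_restrict u Z (g1 p) (g3 p),
        ← graphTerm_restrict u Z (g2 p) (g5 p), ← Finset.prod_mul_prod_compl T]
      simp only [map_smul, Derivation.map_smul, smul_mul_smul_comm]
    · rw [if_neg h2, if_neg (fun h => h2 (hiff.1 h).2), map_zero, mul_zero]
    · rw [if_neg h1, if_neg (fun h => h1 (hiff.1 h).1), map_zero, zero_mul]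
    · rw [if_neg h1, if_neg (fun h => h1 (hiff.1 h).1), map_zero, zero_mul]

open Classical in
theorem graphSum_option (u : ℕ → ℕ → R) (Z : Fock ℕ R) :
    graphSum V (Option E) D u Z = ∑ a : Fin D, ∑ b : Fin D, u a b •
      (Fock.der (a : ℕ) (Fock.der (b : ℕ) (graphSum V E D u Z))
        + ∑ S : Finset V, ∑ T : Finset E, Fock.der (a : ℕ) (graphSum S T D u Z)
          * Fock.der (b : ℕ) (graphSum (Sᶜ : Finset V) (Tᶜ : Finset E) D u Z)) := by
  have hdec : ∀ (q : DecEdge V D) (ε : E → DecEdge V D) (ε' : Option E → DecEdge V D),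
      ε' none = q → (∀ e, ε' (some e) = ε e) →
      (if EdgeConnected ε' then graphTerm u Z ε' else 0)
        = u q.1.2 q.2.2 • ((if EdgeConnected ε then (∏ e, u (ε e).1.2 (ε e).2.2) •
            ∏ v, Fock.shift (edgeDeco q v + vertexDeco ε v) Z else 0)
          + ∑ S : Finset V, if q.1.1 ∈ S ∧ q.2.1 ∈ Sᶜ then (if EdgeSplit ε (S : Set V) then
            (∏ e, u (ε e).1.2 (ε e).2.2) •
              ∏ v, Fock.shift (edgeDeco q v + vertexDeco ε v) Z else 0) else 0) := by
    rintro q ε ε' rfl he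
    obtain rfl : (fun e => ε' (some e)) = ε := funext he
    have ht : graphTerm u Z ε' = u (ε' none).1.2 (ε' none).2.2 •
        ((∏ e, u (ε' (some e)).1.2 (ε' (some e)).2.2) • ∏ v, Fock.shift
          (edgeDeco (ε' none) v + vertexDeco (fun e => ε' (some e)) v) Z) := by
      rw [graphTerm, Fintype.prod_option, mul_smul]
      simp only [vertexDeco, Fintype.sum_option]
    rw [edgeConnected_option_iff]
    by_cases hc : EdgeConnected fun e => ε' (some e)
    · rw [if_pos (Or.inl hc), if_pos hc, sum_eq_zero, add_zero, ht]
      intro S _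
      split_ifs with h1 h2
      · exact absurd hc (h2.not_connected (by simpa using h1.1) (by simpa using h1.2))
      · rfl
      · rfl
    · rw [if_neg hc, zero_add]
      by_cases hS : ∃ S : Set V, (ε' none).1.1 ∈ S ∧ (ε' none).2.1 ∉ S ∧
          EdgeSplit (fun e => ε' (some e)) S
      · rw [if_pos (Or.inr hS)]
        obtain ⟨S, hx, hy, hsp⟩ := hS
        rw [Finset.sum_eq_single S.toFinset, if_pos (by simpa using ⟨hx, hy⟩),
          if_pos (by simpa using hsp), ht]
        · intro S' _ hne
          split_ifs with h1 h2
          · exfalso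
            apply hne
            have := h2.unique hsp (by simpa using h1.1) hx
            rw [← Finset.coe_inj, this, Set.coe_toFinset]
          · rfl
          · rfl
        · exact fun h => absurd (mem_univ _) h
      · rw [if_neg (fun h => h.elim hc hS), sum_eq_zero, smul_zero]
        intro S _
        split_ifs with h1 h2
        · exact absurd ⟨(S : Set V), by simpa using h1.1, by simpa using h1.2, h2⟩ hS
        · rfl
        · rfl
  have h0 : graphSum V (Option E) D u Z = ∑ p : DecEdge V D × (E → DecEdge V D), _ :=
    (graphSum_eq u Z).trans <| Fintype.sum_equiv
      (Equiv.piOptionEquivProd (β := fun _ => DecEdge V D)) _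
      (fun p => u p.1.1.2 p.1.2.2 • ((if EdgeConnected p.2 then
          (∏ e, u (p.2 e).1.2 (p.2 e).2.2) •
            ∏ v, Fock.shift (edgeDeco p.1 v + vertexDeco p.2 v) Z else 0)
          + ∑ S : Finset V, if p.1.1.1 ∈ S ∧ p.1.2.1 ∈ Sᶜ then
            (if EdgeSplit p.2 (S : Set V) then (∏ e, u (p.2 e).1.2 (p.2 e).2.2) •
              ∏ v, Fock.shift (edgeDeco p.1 v + vertexDeco p.2 v) Z else 0) else 0))
      (fun ε' => hdec (ε' none) (fun e => ε' (some e)) ε' rfl fun _ => rfl)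
  rw [h0, Fintype.sum_prod_type, sum_decEdge]
  refine sum_congr₂ fun a _ b _ => ?_
  simp only [← Finset.smul_sum]
  congr 1
  simp only [sum_add_distrib]
  congr 1
  · rw [sum_congr rfl fun x _ => sum_comm, sum_comm, graphSum_eq, map_sum,
      map_sum]
    refine sum_congr rfl fun ε _ => ?_
    split_ifs with h
    · rw [graphTerm, Derivation.map_smul, Derivation.map_smul, ← sum_edgeDeco_eq]
      simp only [Finset.smul_sum]
    · simp
  · rw [sum_congr₂ fun x _ y _ => sum_comm,
      sum_congr rfl fun x _ => sum_comm, sum_comm]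
    refine sum_congr rfl fun S _ => ?_
    rw [← sum_edgeSplit, sum_congr rfl fun x _ => sum_comm, sum_comm]
    refine sum_congr rfl fun ε _ => ?_
    split_ifs with h
    · rw [← sum_edgeDeco_split, Finset.smul_sum, ← Finset.univ_inter S, ← Finset.sum_ite_mem,
        Finset.univ_inter]
      refine sum_congr rfl fun x _ => ?_
      by_cases hx : x ∈ S
      · rw [if_pos hx, Finset.smul_sum, ← Finset.univ_inter Sᶜ, ← Finset.sum_ite_mem,
          Finset.univ_inter]
        exact sum_congr rfl fun y _ => by simp only [hx, true_and]
      · rw [if_neg hx]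
        exact sum_eq_zero fun y _ => if_neg fun h => hx h.1
    · simp

end GraphSum


/-! ### The flow of the graph sums -/

section Flow

variable {R : Type*} [CommRing R]

theorem graphSum_fin_card {V E : Type*} [Fintype V] [Fintype E] {D : ℕ} (u : ℕ → ℕ → R)
    (Z : Fock ℕ R) {N k : ℕ} (hV : Fintype.card V = N) (hE : Fintype.card E = k) :
    graphSum V E D u Z = graphSum (Fin N) (Fin k) D u Z :=
  graphSum_congr u Z (Fintype.equivFinOfCardEq hV) (Fintype.equivFinOfCardEq hE)

theorem sum_finset_card_compl {M : Type*} [AddCommMonoid M] (N : ℕ) (f : ℕ → ℕ → M) :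
    ∑ S : Finset (Fin N), f S.card Sᶜ.card
      = ∑ p ∈ Finset.HasAntidiagonal.antidiagonal N, N.choose p.1 • f p.1 p.2 := by
  have h := Finset.sum_powerset_apply_card (fun m => f m (N - m)) (x := (univ : Finset (Fin N)))
  rw [Finset.powerset_univ, Finset.card_univ, Fintype.card_fin] at h
  rw [Finset.Nat.sum_antidiagonal_eq_sum_range_succ (fun i j => N.choose i • f i j), ← h]
  exact sum_congr rfl fun S _ => by rw [Finset.card_compl, Fintype.card_fin]

theorem graphSum_option_eq {V E : Type*} [Fintype V] [Fintype E] [DecidableEq V] [DecidableEq E]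
    {D : ℕ} (u : ℕ → ℕ → R) (Z : Fock ℕ R) :
    graphSum V (Option E) D u Z = ∑ a : Fin D, ∑ b : Fin D, u a b •
      (Fock.der (a : ℕ) (Fock.der (b : ℕ) (graphSum V E D u Z))
        + ∑ S : Finset V, ∑ T : Finset E, Fock.der (a : ℕ) (graphSum S T D u Z)
          * Fock.der (b : ℕ) (graphSum (Sᶜ : Finset V) (Tᶜ : Finset E) D u Z)) := by
  convert graphSum_option u Z

theorem graphSum_fin_succ (D : ℕ) (u : ℕ → ℕ → R) (Z : Fock ℕ R) (N k : ℕ) :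
    graphSum (Fin N) (Fin (k + 1)) D u Z = ∑ a : Fin D, ∑ b : Fin D, u a b •
      (Fock.der (a : ℕ) (Fock.der (b : ℕ) (graphSum (Fin N) (Fin k) D u Z))
        + ∑ p ∈ Finset.HasAntidiagonal.antidiagonal N, ∑ q ∈ Finset.HasAntidiagonal.antidiagonal k,
          (N.choose p.1 * k.choose q.1) • (Fock.der (a : ℕ) (graphSum (Fin p.1) (Fin q.1) D u Z)
            * Fock.der (b : ℕ) (graphSum (Fin p.2) (Fin q.2) D u Z))) := by
  rw [← graphSum_fin_card (V := Fin N) (E := Option (Fin k)) u Z (by simp) (by simp),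
    graphSum_option_eq]
  refine sum_congr₂ fun a _ b _ => ?_
  congr 2
  have h : ∀ (S : Finset (Fin N)) (T : Finset (Fin k)),
      Fock.der (a : ℕ) (graphSum S T D u Z)
          * Fock.der (b : ℕ) (graphSum (Sᶜ : Finset (Fin N)) (Tᶜ : Finset (Fin k)) D u Z)
      = Fock.der (a : ℕ) (graphSum (Fin S.card) (Fin T.card) D u Z)
          * Fock.der (b : ℕ) (graphSum (Fin Sᶜ.card) (Fin Tᶜ.card) D u Z) := fun S T => by
    rw [graphSum_fin_card u Z (Fintype.card_coe S) (Fintype.card_coe T),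
      graphSum_fin_card u Z (Fintype.card_coe Sᶜ) (Fintype.card_coe Tᶜ)]
  simp only [h]
  rw [sum_finset_card_compl N fun i j => ∑ T : Finset (Fin k),
    Fock.der (a : ℕ) (graphSum (Fin i) (Fin T.card) D u Z)
          * Fock.der (b : ℕ) (graphSum (Fin j) (Fin Tᶜ.card) D u Z)]
  refine sum_congr rfl fun p _ => ?_
  rw [sum_finset_card_compl k fun i j => Fock.der (a : ℕ) (graphSum (Fin p.1) (Fin i) D u Z)
          * Fock.der (b : ℕ) (graphSum (Fin p.2) (Fin j) D u Z), Finset.smul_sum]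
  exact sum_congr rfl fun q _ => by rw [mul_smul]

/-- The inverse of the number of labellings of the vertices and the half-edges. -/
def graphCoef (N k : ℕ) : ℝ := ((N.factorial * (k.factorial * 2 ^ k) : ℕ) : ℝ)⁻¹

theorem graphCoef_succ {N i j k m l : ℕ} (hN : i + j = N) (hk : m + l = k) :
    (k + 1) * graphCoef N (k + 1) * (N.choose i * k.choose m : ℕ)
      = 1 / 2 * (graphCoef i m * graphCoef j l) := by
  subst hN hk
  simp only [graphCoef]
  have h1 := Nat.add_choose_mul_factorial_mul_factorial i j
  have h2 := Nat.add_choose_mul_factorial_mul_factorial m l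
  have h1' : ((i + j).choose i : ℝ) = (i + j).factorial / (i.factorial * j.factorial) := by
    rw [eq_div_iff (by positivity), ← h1, Nat.choose_symm_add]; push_cast; ring
  have h2' : ((m + l).choose m : ℝ) = (m + l).factorial / (m.factorial * l.factorial) := by
    rw [eq_div_iff (by positivity), ← h2, Nat.choose_symm_add]; push_cast; ring
  push_cast [Nat.factorial_succ]
  rw [h1', h2']
  field_simp
  ring

/-- The sum over connected graphs with less than `B` vertices and `k` edges, divided by the number
of labellings. -/
def graphPart (ρ : ℝ →+* R) (D B : ℕ) (u : ℕ → ℕ → R) (Z : Fock ℕ R) (k : ℕ) : Fock ℕ R :=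
  ∑ N ∈ range B, ρ (graphCoef N k) • graphSum (Fin N) (Fin k) D u Z

theorem sum_range_mul_range {M : Type*} [AddCommMonoid M] (B : ℕ) (f : ℕ → ℕ → M)
    (h : ∀ i j, B ≤ i + j → f i j = 0) :
    ∑ i ∈ range B, ∑ j ∈ range B, f i j
      = ∑ N ∈ range B, ∑ p ∈ Finset.HasAntidiagonal.antidiagonal N, f p.1 p.2 := by
  rw [sum_congr rfl fun N _ => Finset.Nat.sum_antidiagonal_eq_sum_range_succ f N,
    Finset.sum_range_diag_flip B f]
  refine sum_congr rfl fun i _ => (Finset.sum_subset ?_ fun j _ hj => h i j ?_).symm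
  · exact Finset.range_subset_range.2 (by omega)
  · simp only [mem_range] at hj; omega

theorem graphPart_succ (ρ : ℝ →+* R) (D B : ℕ) (u : ℕ → ℕ → R) (Z : Fock ℕ R)
    (h0 : ∀ i j m l, B ≤ i + j → ∀ a b, Fock.der a (graphSum (Fin i) (Fin m) D u Z)
      * Fock.der b (graphSum (Fin j) (Fin l) D u Z) = 0) (k : ℕ) :
    ρ (k + 1) • graphPart ρ D B u Z (k + 1) = ρ (1 / 2) • ∑ a ∈ range D,
      ∑ b ∈ range D, u a b • (Fock.der a (Fock.der b (graphPart ρ D B u Z k))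
        + ∑ q ∈ Finset.HasAntidiagonal.antidiagonal k, Fock.der a (graphPart ρ D B u Z q.1)
          * Fock.der b (graphPart ρ D B u Z q.2)) := by
  have e1 : ∀ a b, ∑ q ∈ Finset.HasAntidiagonal.antidiagonal k, Fock.der a (graphPart ρ D B u Z q.1)
          * Fock.der b (graphPart ρ D B u Z q.2)
      = ∑ N ∈ range B, ∑ p ∈ Finset.HasAntidiagonal.antidiagonal N, ∑ q ∈ Finset.HasAntidiagonal.antidiagonal k,
        ρ (graphCoef p.1 q.1 * graphCoef p.2 q.2) •
          (Fock.der a (graphSum (Fin p.1) (Fin q.1) D u Z)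
            * Fock.der b (graphSum (Fin p.2) (Fin q.2) D u Z)) := by
    intro a b
    rw [← sum_range_mul_range B fun i j => ∑ q ∈ Finset.HasAntidiagonal.antidiagonal k,
        ρ (graphCoef i q.1 * graphCoef j q.2) •
          (Fock.der a (graphSum (Fin i) (Fin q.1) D u Z)
            * Fock.der b (graphSum (Fin j) (Fin q.2) D u Z))]
    · rw [sum_congr rfl fun i _ => sum_comm, sum_comm]
      refine sum_congr rfl fun q _ => ?_
      simp only [graphPart, map_sum, Derivation.map_smul]
      rw [Finset.sum_mul_sum]
      refine sum_congr₂ fun i _ j _ => ?_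
      rw [smul_mul_smul_comm, map_mul]
    · intro i j hij
      exact sum_eq_zero fun q _ => by rw [h0 i j _ _ hij, smul_zero]
  simp only [e1]
  simp only [Finset.sum_range (n := D)]
  rw [graphPart, Finset.smul_sum]
  simp only [graphPart, map_sum, Derivation.map_smul, ← sum_add_distrib]
  simp only [Finset.smul_sum (s := range B)]
  rw [sum_congr rfl fun a _ => sum_comm, sum_comm, Finset.smul_sum]
  refine sum_congr rfl fun N _ => ?_
  rw [graphSum_fin_succ]
  simp only [Finset.smul_sum (s := univ)]
  refine sum_congr₂ fun a _ b _ => ?_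
  rw [smul_comm _ (u a b), smul_comm _ (u a b), smul_comm _ (u a b)]
  congr 1
  rw [← mul_smul, ← map_mul, smul_add, smul_add]
  congr 1
  · rw [← mul_smul, ← map_mul]
    congr 2
    simp only [graphCoef, Nat.factorial_succ]
    push_cast
    field_simp
    ring
  · simp only [Finset.smul_sum]
    refine sum_congr₂ fun p hp q hq => ?_
    rw [← Nat.cast_smul_eq_nsmul R, ← mul_smul, ← mul_smul, ← map_natCast ρ, ← map_mul, ← map_mul,
      graphCoef_succ (Finset.HasAntidiagonal.mem_antidiagonal.1 hp) (Finset.HasAntidiagonal.mem_antidiagonal.1 hq)]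

theorem graphSum_zero_edges (D : ℕ) (u : ℕ → ℕ → R) (Z : Fock ℕ R) (N : ℕ) :
    graphSum (Fin N) (Fin 0) D u Z = if N ≤ 1 then Z ^ N else 0 := by
  classical
  rw [graphSum_eq, Fintype.sum_unique]
  have hc : ∀ ε : Fin 0 → DecEdge (Fin N) D, EdgeConnected ε ↔ N ≤ 1 := by
    intro ε
    constructor
    · intro h
      by_contra! hN
      rcases h {⟨0, by omega⟩} (fun e => e.elim0) with h | h
      · exact Set.singleton_ne_empty _ h
      · have : (⟨1, hN⟩ : Fin N) ∈ ({⟨0, by omega⟩} : Set (Fin N)) := h ▸ Set.mem_univ _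
        simp at this
    · intro h A _
      have : Subsingleton (Fin N) := Fin.subsingleton_iff_le_one.2 h
      exact (Set.eq_empty_or_nonempty A).imp id fun h => Subsingleton.eq_univ_of_nonempty h
  simp only [hc]
  refine if_congr Iff.rfl ?_ rfl
  simp [graphTerm, vertexDeco, Fock.shift_zero]

theorem graphPart_zero (ρ : ℝ →+* R) (D : ℕ) {B : ℕ} (hB : 2 ≤ B) (u : ℕ → ℕ → R) (Z : Fock ℕ R) :
    graphPart ρ D B u Z 0 = 1 + Z := by
  obtain ⟨B, rfl⟩ := Nat.exists_eq_add_of_le hB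
  rw [graphPart, Finset.sum_range_add, sum_eq_zero (s := range B), add_zero]
  · simp [Finset.sum_range_succ, graphSum_zero_edges, graphCoef]
  · intro i _
    rw [graphSum_zero_edges, if_neg (by omega), smul_zero]

end Flow


section TwistedRecursion

variable {R : Type*} [CommRing R]

def twistB (u : ℕ → ℕ → ℝ) (σ : ℕ → ℝ) (a b c : ℕ) : ℝ :=
  tensB σ a b c + if a = 0 ∧ b = 0 then σ 0 * u 0 c else 0

def twistC (u : ℕ → ℕ → ℝ) (σ : ℕ → ℝ) (D a c e : ℕ) : ℝ :=
  tensC σ a c e + ∑ b ∈ range D, (tensB σ a b c * u b e + tensB σ a b e * u b c)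
    + if a = 0 then σ 0 * u 0 c * u 0 e else 0

def twistD (u : ℕ → ℕ → ℝ) (σ : ℕ → ℝ) (a : ℕ) : ℝ :=
  tensD σ a + if a = 0 then σ 0 * u 0 0 / 2 else 0

/-- The twisted recursion for the derivatives of a potential. -/
def IsTwistedSol (ρ : ℝ →+* R) (u : ℕ → ℕ → ℝ) (σ : ℕ → ℝ) (D : ℕ) (x : R) (f : ℕ → Fock ℕ R) :
    Prop :=
  ∀ a, f a = x • (tAlpha ρ σ a + kst ρ (twistD u σ a)
    + ∑ c ∈ range D, Fock.lin (fun m => ρ (twistB u σ a m c)) * f c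
    + kst ρ (1 / 2) * ∑ c ∈ range D, ∑ e ∈ range D,
        kst ρ (twistC u σ D a c e) * (Fock.der e (f c) + f c * f e))

/-- The coefficientwise derivative of a polynomial. -/
def polyDer (a : ℕ) : Derivation R (Polynomial (Fock ℕ R)) (Polynomial (Fock ℕ R)) :=
  PolynomialModule.equivPolynomialSelf.compDer (Fock.der a).mapCoeffs

theorem coeff_polyDer (a n : ℕ) (P : Polynomial (Fock ℕ R)) :
    (polyDer a P).coeff n = Fock.der a (P.coeff n) := rfl

theorem polyDer_C (a : ℕ) (f : Fock ℕ R) :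
    polyDer a (Polynomial.C f) = Polynomial.C (Fock.der a f) := by
  ext1 n
  rw [coeff_polyDer, Polynomial.coeff_C, Polynomial.coeff_C]
  split_ifs <;> simp

theorem polyDer_X (a : ℕ) : polyDer a (Polynomial.X : Polynomial (Fock ℕ R)) = 0 := by
  ext1 n
  rw [coeff_polyDer, Polynomial.coeff_X, Polynomial.coeff_zero]
  split_ifs <;> simp

theorem polyDer_mul (a : ℕ) (P Q : Polynomial (Fock ℕ R)) :
    polyDer a (P * Q) = P * polyDer a Q + polyDer a P * Q := by
  rw [Derivation.leibniz, smul_eq_mul, smul_eq_mul, mul_comm Q]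

theorem eval_polyDer {t : Fock ℕ R} (ht : ∀ a, Fock.der a t = 0) (a : ℕ)
    (P : Polynomial (Fock ℕ R)) : (polyDer a P).eval t = Fock.der a (P.eval t) := by
  induction P using Polynomial.induction_on with
  | C f => rw [polyDer_C]; simp
  | add P Q hP hQ => simp only [map_add, Polynomial.eval_add, hP, hQ]
  | monomial n f h =>
    rw [pow_succ, ← mul_assoc, polyDer_mul, polyDer_X]
    simp only [Polynomial.eval_add, Polynomial.eval_mul, Polynomial.eval_X, h, mul_zero, zero_add]
    rw [Fock.der_mul a _ t, ht]; ring

theorem isTwistedSol_of_flow {ρ : ℝ →+* R} {u : ℕ → ℕ → ℝ} {σ : ℕ → ℝ} {D : ℕ} {x : R}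
    (hD : 0 < D) (hus : ∀ a b, u a b = u b a) (GP : ℕ → Fock ℕ R) {K : ℕ} (hK : ∀ k, K ≤ k → GP k = 0)
    (hflow : ∀ k : ℕ, ρ (k + 1) • GP (k + 1) = ρ (1 / 2) • ∑ a ∈ range D,
      ∑ b ∈ range D, ρ (u a b) • (Fock.der a (Fock.der b (GP k))
        + ∑ q ∈ Finset.HasAntidiagonal.antidiagonal k, Fock.der a (GP q.1) * Fock.der b (GP q.2)))
    (h0 : IsAirySol ρ σ D x fun a => Fock.der a (GP 0)) :
    IsTwistedSol ρ u σ D x fun a => Fock.der a (∑ k ∈ range K, GP k) := by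
  set c : ℝ → Polynomial (Fock ℕ R) := fun r => Polynomial.C (kst ρ r) with hc
  have cadd : ∀ r s, c (r + s) = c r + c s := fun r s => by simp [hc]
  have cmul : ∀ r s, c (r * s) = c r * c s := fun r s => by simp [hc]
  have csum : ∀ f : ℕ → ℝ, c (∑ b ∈ range D, f b) = ∑ b ∈ range D, c (f b) :=
    fun f => by simp [hc]
  have dc : ∀ i r, polyDer i (c r) = 0 := fun i r => by rw [hc, polyDer_C, der_kst, map_zero]
  have dx : ∀ i, polyDer i (Polynomial.X : Polynomial (Fock ℕ R)) = 0 := polyDer_X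
  set δ : Derivation R (Polynomial (Fock ℕ R)) (Polynomial (Fock ℕ R)) :=
    (Polynomial.derivative' (R := Fock ℕ R)).restrictScalars R with hδ
  have δa : ∀ P, δ P = Polynomial.derivative P := fun P => rfl
  have δc : ∀ f, δ (Polynomial.C f) = 0 := fun f => by rw [δa, Polynomial.derivative_C]
  have δX : δ (Polynomial.X) = 1 := by rw [δa, Polynomial.derivative_X]
  have δXmul : ∀ f, δ (Polynomial.X * Polynomial.C f) = Polynomial.C f := fun f => by
    rw [Derivation.leibniz, δX, δc]; simp
  set X : Polynomial (Fock ℕ R) := Polynomial.X with hX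
  set G : Polynomial (Fock ℕ R) := ∑ k ∈ range K, Polynomial.monomial k (GP k) with hG
  have Gc : ∀ n, G.coeff n = GP n := by
    intro n
    rw [hG, Polynomial.finsetSum_coeff]
    simp only [Polynomial.coeff_monomial]
    rw [Finset.sum_ite_eq']
    split_ifs with h
    · rfl
    · exact (hK n (by simpa using h)).symm
  set B : ℕ → ℕ → ℕ → Polynomial (Fock ℕ R) := fun a b e => c (tensB σ a b e)
    + X * c (if a = 0 ∧ b = 0 then σ 0 * u 0 e else 0) with hB
  set β : ℕ → ℕ → Polynomial (Fock ℕ R) := fun a e => Polynomial.C (tBeta ρ σ a e)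
    + X * Polynomial.C (kst ρ (if a = 0 then σ 0 * u 0 e else 0) * xZero) with hβ
  set Ct : ℕ → ℕ → ℕ → Polynomial (Fock ℕ R) := fun a b e => c (tensC σ a b e)
    + X * c (∑ i ∈ range D, (tensB σ a i b * u i e + tensB σ a i e * u i b))
    + X ^ 2 * c (if a = 0 then σ 0 * u 0 b * u 0 e else 0) with hCt
  set Dt : ℕ → Polynomial (Fock ℕ R) := fun a => c (tensD σ a)
    + X * c (if a = 0 then σ 0 * u 0 0 / 2 else 0) with hDt
  set E : ℕ → Polynomial (Fock ℕ R) := fun a => polyDer a G - Polynomial.C (algebraMap R _ x) *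
    (Polynomial.C (tAlpha ρ σ a) + Dt a + ∑ e ∈ range D, β a e * polyDer e G
      + c (1 / 2) * ∑ b ∈ range D, ∑ e ∈ range D, Ct a b e *
        (polyDer e (polyDer b G) + polyDer b G * polyDer e G)) with hE
  have hDmem : (0 : ℕ) ∈ range D := mem_range.2 hD
  have key := twist_flow (R := R) polyDer
    (fun a b g => Polynomial.ext fun n => by simp only [coeff_polyDer]; exact Fock.der_comm _ _ _) δ
    (fun a g => Polynomial.ext fun n => by
      rw [coeff_polyDer, δa, δa, Polynomial.coeff_derivative, Polynomial.coeff_derivative,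
        coeff_polyDer, Fock.der_mul]
      have : Fock.der a ((n : Fock ℕ R) + 1) = 0 := by
        rw [← Nat.cast_succ, Derivation.map_natCast]
      rw [this]; ring)
    (range D) (Polynomial.C (algebraMap R _ x)) (c (1 / 2))
    (fun i => by rw [polyDer_C, Derivation.map_algebraMap, map_zero]) (δc _) (fun i => dc _ _) (δc _)
    (by rw [show (2 : Polynomial (Fock ℕ R)) = c 2 from
      (map_ofNat ((Polynomial.C).comp (kst ρ)) 2).symm, ← cmul]; simp [hc])
    (fun a b => c (u a b)) (fun i a b => dc _ _) (fun a b => by rw [hus]) G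
    ?_ (fun a => Polynomial.C (tAlpha ρ σ a)) Dt β (fun a b e => c (tensA σ a b e)) B Ct
    (fun i a b e => by simp only [hB, map_add, polyDer_mul, dc, dx]; ring)
    (fun i a b e => by simp only [hCt, map_add, polyDer_mul, dc, dx, pow_two]; ring)
    (fun i a => by simp only [hDt, map_add, polyDer_mul, dc, dx]; ring)
    ?_ (fun a b e => by rw [polyDer_C, polyDer_C, der_der_tAlpha]) (fun a => δc _) ?_ ?_ ?_ E
    (fun a => rfl)
  rotate_left
  · refine Polynomial.ext fun n => ?_
    have hn : ((n : Fock ℕ R) + 1) = kst ρ (n + 1) := by simp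
    rw [δa, Polynomial.coeff_derivative, Gc, hn, mul_comm, kst_mul, hflow]
    simp only [hc, Polynomial.coeff_C_mul, Polynomial.finsetSum_coeff, Polynomial.coeff_add,
      coeff_polyDer, Gc, kst_mul]
    simp only [Polynomial.coeff_mul, coeff_polyDer, Gc]
  · intro a b e
    simp only [hβ, hB, map_add, polyDer_mul, polyDer_C, dx, der_tBeta, Fock.der_mul, der_kst,
      der_xZero, zero_mul, add_zero, hc]
    by_cases ha : a = 0 <;> by_cases hb : b = 0 <;> simp [ha, hb]
  · intro a e
    rw [hβ, map_add, δc, zero_add, δXmul]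
    simp only [polyDer_C, der_tAlpha, hc, ← map_mul]
    rw [← map_sum, sum_eq_single_of_mem 0 hDmem]
    · by_cases ha : a = 0
      · simp only [ha, and_self, if_true, map_mul]; ring
      · simp [ha]
    · intro b _ hb
      rw [if_neg (fun h => hb h.2), zero_mul]
  · intro a b e
    have e1 : δ (Ct a b e) = c (∑ i ∈ range D, (tensB σ a i b * u i e + tensB σ a i e * u i b))
        + X * c (2 * if a = 0 then σ 0 * u 0 b * u 0 e else 0) := by
      rw [hCt, map_add, map_add, δc, δXmul, zero_add, Derivation.leibniz, δc, Derivation.leibniz_pow, δX,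
        smul_zero, cmul, show c 2 = (2 : Polynomial (Fock ℕ R)) from
          map_ofNat ((Polynomial.C).comp (kst ρ)) 2]
      simp only [smul_eq_mul, nsmul_eq_mul, Nat.cast_ofNat]
      ring
    have e2 : 2 * (if a = 0 then σ 0 * u 0 b * u 0 e else 0) = ∑ i ∈ range D,
        ((if a = 0 ∧ i = 0 then σ 0 * u 0 b else 0) * u i e
          + (if a = 0 ∧ i = 0 then σ 0 * u 0 e else 0) * u i b) := by
      rw [sum_eq_single_of_mem 0 hDmem]
      · by_cases ha : a = 0
        · simp [ha]; ring
        · simp [ha]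
      · intro i _ hi
        rw [if_neg (fun h => hi h.2), if_neg (fun h => hi h.2)]; simp
    rw [e1, e2, csum, csum, mul_sum, ← sum_add_distrib]
    refine sum_congr rfl fun i _ => ?_
    simp only [hB, cadd, cmul]
    ring
  · intro a
    have e2 : (if a = 0 then σ 0 * u 0 0 / 2 else 0)
        = 1 / 2 * ∑ b ∈ range D, ∑ e ∈ range D, u b e * tensA σ a e b := by
      rw [sum_eq_single_of_mem 0 hDmem, sum_eq_single_of_mem 0 hDmem]
      · by_cases ha : a = 0
        · simp [ha, tensA]; ring
        · simp [ha, tensA]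
      · intro i _ hi
        rw [tensA, if_neg (fun h => hi h.2.1), mul_zero]
      · intro i _ hi
        exact sum_eq_zero fun e _ => by rw [tensA, if_neg (fun h => hi h.2.2), mul_zero]
    rw [hDt, map_add, δc, zero_add, δXmul, e2]
    simp only [hc, map_mul, map_sum]
  have ev : ∀ t : Fock ℕ R, (∀ a, Fock.der a t = 0) → ∀ a, (E a).eval t
      = Fock.der a (G.eval t) - algebraMap R _ x * (tAlpha ρ σ a
        + (kst ρ (tensD σ a) + t * kst ρ (if a = 0 then σ 0 * u 0 0 / 2 else 0))
        + ∑ e ∈ range D, (tBeta ρ σ a e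
            + t * (kst ρ (if a = 0 then σ 0 * u 0 e else 0) * xZero)) * Fock.der e (G.eval t)
        + kst ρ (1 / 2) * ∑ b ∈ range D, ∑ e ∈ range D, (kst ρ (tensC σ a b e)
          + t * kst ρ (∑ i ∈ range D, (tensB σ a i b * u i e + tensB σ a i e * u i b))
          + t ^ 2 * kst ρ (if a = 0 then σ 0 * u 0 b * u 0 e else 0)) *
            (Fock.der e (Fock.der b (G.eval t)) + Fock.der b (G.eval t) * Fock.der e (G.eval t))) := by
    intro t ht a
    simp only [hE, hβ, hCt, hDt, hc, hX, Polynomial.eval_sub, Polynomial.eval_mul,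
      Polynomial.eval_add, Polynomial.eval_C, Polynomial.eval_X, Polynomial.eval_pow,
      Polynomial.eval_finsetSum, eval_polyDer ht]
  have E0 : ∀ a, (E a).coeff 0 = 0 := by
    intro a
    rw [Polynomial.coeff_zero_eq_eval_zero, ev 0 (fun _ => map_zero _),
      ← Polynomial.coeff_zero_eq_eval_zero, Gc, sub_eq_zero]
    refine (h0 a).trans ?_
    rw [Algebra.smul_def]
    congr 1
    simp only [zero_mul, add_zero, ne_eq, OfNat.ofNat_ne_zero, not_false_eq_true, zero_pow]
  have Ez : ∀ n a, (E a).coeff n = 0 := by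
    intro n
    induction n using Nat.strong_induction_on with
    | _ n ih =>
      rcases n with _ | n
      · exact E0
      intro a
      have hk := congrArg (fun P => Polynomial.coeff P n) (key a)
      have hn : ((n : Fock ℕ R) + 1) = kst ρ (n + 1) := by simp
      simp only [hc, δa, Polynomial.coeff_derivative, Polynomial.coeff_C_mul,
        Polynomial.finsetSum_coeff, Polynomial.coeff_add, coeff_polyDer, hn] at hk
      simp only [Polynomial.coeff_mul, coeff_polyDer] at hk
      rw [sum_eq_zero] at hk
      · have := congrArg (· * kst ρ ((n + 1 : ℝ)⁻¹)) hk
        simp only [zero_mul] at this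
        rwa [mul_assoc, ← map_mul, mul_inv_cancel₀ (by positivity), map_one, mul_one] at this
      · refine fun b _ => sum_eq_zero fun e _ => ?_
        rw [ih n (Nat.lt_succ_self n), map_zero, map_zero, mul_zero, zero_add, sum_eq_zero,
          mul_zero]
        rintro ⟨i, j⟩ hij
        have := Finset.HasAntidiagonal.mem_antidiagonal.1 hij
        simp only at this
        rw [ih i (by omega), map_zero, zero_mul]
  intro a
  have hEa : E a = 0 := Polynomial.ext fun n => by rw [Ez, Polynomial.coeff_zero]
  have h1 := ev 1 (fun _ => Derivation.map_one_eq_zero _) a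
  have hG1 : G.eval 1 = ∑ k ∈ range K, GP k := by
    simp [hG, Polynomial.eval_finsetSum]
  rw [hEa, Polynomial.eval_zero, eq_comm, sub_eq_zero, hG1] at h1
  refine h1.trans ?_
  rw [Algebra.smul_def]
  congr 1
  have elin : ∀ e, Fock.lin (fun m => ρ (twistB u σ a m e)) = tBeta ρ σ a e
      + (kst ρ (if a = 0 then σ 0 * u 0 e else 0) * xZero) := by
    intro e
    refine Fock.eq_of_der ?_ fun b => ?_
    · rw [Fock.add_apply, Fock.mul_apply_zero, tBeta, xZero, Fock.lin_apply_zero, Fock.lin_apply_zero,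
        Fock.lin_apply_zero]; simp
    · rw [Fock.der_lin, map_add, der_tBeta, Fock.der_mul, der_kst, der_xZero, ← kst_eq_smul, twistB,
        map_add]
      by_cases ha : a = 0 <;> by_cases hb : b = 0 <;> simp [ha, hb]
  simp only [one_mul, one_pow, elin, twistD, twistC, map_add]

end TwistedRecursion


section Order

/-- The coefficient of order `χ` at `M` vanishes if `c χ < m + d |M|`. -/
def HasOrder (c d m : ℕ) (f : Fock ℕ (PowerSeries ℝ)) : Prop :=
  ∀ (M : Multiset ℕ) (χ : ℕ), c * χ < m + d * M.card → coeff χ (f M) = 0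

variable {c d m m' : ℕ} {f g : Fock ℕ (PowerSeries ℝ)}

theorem HasOrder.mono (hf : HasOrder c d m f) (h : m' ≤ m) : HasOrder c d m' f :=
  fun M χ hχ => hf M χ (by omega)

theorem HasOrder.sum {α : Type*} {s : Finset α} {F : α → Fock ℕ (PowerSeries ℝ)}
    (h : ∀ i ∈ s, HasOrder c d m (F i)) : HasOrder c d m (∑ i ∈ s, F i) := fun M χ hχ => by
  rw [Fock.sum_apply, map_sum]
  exact sum_eq_zero fun i hi => h i hi M χ hχ

theorem HasOrder.smul (hf : HasOrder c d m f) (r : PowerSeries ℝ) : HasOrder c d m (r • f) :=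
  fun M χ hχ => by
    rw [Fock.smul_apply, PowerSeries.coeff_mul]
    refine sum_eq_zero fun p hp => ?_
    have := Finset.HasAntidiagonal.mem_antidiagonal.1 hp
    rw [hf M p.2 (lt_of_le_of_lt (Nat.mul_le_mul_left c (by omega)) hχ), mul_zero]

theorem HasOrder.mul (hf : HasOrder c d m f) (hg : HasOrder c d m' g) :
    HasOrder c d (m + m') (f * g) := fun M χ hχ => by
  rw [Fock.mul_apply, map_multiset_sum, Multiset.map_map]
  refine multiset_sum_eq_zero fun p hp => ?_
  rw [Function.comp_apply, PowerSeries.coeff_mul]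
  refine sum_eq_zero fun q hq => ?_
  have hq' := Finset.HasAntidiagonal.mem_antidiagonal.1 hq
  have hp' := Multiset.mem_antidiagonal.1 hp
  rw [← hp', Multiset.card_add, ← hq', mul_add, mul_add] at hχ
  rcases lt_or_ge (c * q.1) (m + d * p.1.card) with h | h
  · rw [hf _ _ h, zero_mul]
  · rw [hg _ _ (by omega), mul_zero]

theorem HasOrder.shift (hf : HasOrder c d m f) (K : Multiset ℕ) :
    HasOrder c d (m + d * K.card) (Fock.shift K f) := fun M χ hχ => by
  rw [Fock.shift_apply]
  exact hf _ _ (by rw [Multiset.card_add, mul_add]; omega)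

theorem HasOrder.der (hf : HasOrder c d m f) (a : ℕ) : HasOrder c d m (Fock.der a f) := by
  rw [← Fock.shift_singleton]
  exact (hf.shift _).mono (by omega)

theorem HasOrder.one : HasOrder c d 0 1 := fun M χ hχ => by
  rw [Fock.one_apply]
  split_ifs with h
  · rw [h] at hχ; omega
  · simp

theorem HasOrder.prod {α : Type*} {s : Finset α} {F : α → Fock ℕ (PowerSeries ℝ)} {μ : α → ℕ}
    (h : ∀ i ∈ s, HasOrder c d (μ i) (F i)) : HasOrder c d (∑ i ∈ s, μ i) (∏ i ∈ s, F i) := by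
  classical
  induction s using Finset.induction_on with
  | empty => simpa using HasOrder.one
  | insert i s hi ih =>
    rw [sum_insert hi, Finset.prod_insert hi]
    exact (h i (Finset.mem_insert_self _ _)).mul
      (ih fun j hj => h j (Finset.mem_insert_of_mem hj))

theorem sum_card_vertexDeco {V E : Type*} [Fintype V] [Fintype E] {D : ℕ} (ε : E → DecEdge V D) :
    ∑ v, (vertexDeco ε v).card = 2 * Fintype.card E := by
  classical
  have h : ∀ e, ∑ v, (edgeDeco (ε e) v).card = 2 := fun e => by
    simp only [edgeDeco, Multiset.card_add, sum_add_distrib, apply_ite Multiset.card,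
      Multiset.card_singleton, Multiset.card_zero, Finset.sum_ite_eq, mem_univ, if_true]
  simp only [vertexDeco, Multiset.card_sum]
  rw [sum_comm, sum_congr rfl fun e _ => h e]
  simp [mul_comm]

theorem HasOrder.graphSum {V E : Type*} [Fintype V] [Fintype E] {D : ℕ} (hf : HasOrder c d m f)
    (u : ℕ → ℕ → PowerSeries ℝ) :
    HasOrder c d (Fintype.card V * m + d * (2 * Fintype.card E)) (graphSum V E D u f) := by
  refine HasOrder.sum fun ε _ => ?_
  split_ifs
  · refine HasOrder.smul ?_ _
    have := HasOrder.prod (s := univ) fun v (_ : v ∈ univ) => hf.shift (vertexDeco ε v)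
    rwa [sum_add_distrib, ← mul_sum, sum_card_vertexDeco, Finset.sum_const,
      Finset.card_univ, smul_eq_mul] at this
  · exact fun M χ _ => by simp

end Order

section Map

variable {R S : Type*} [CommRing R] [CommRing S]

theorem map_graphSum {V E : Type*} [Fintype V] [Fintype E] {D : ℕ} (φ : R →+* S) (u : ℕ → ℕ → R)
    (Z : Fock ℕ R) : Fock.map φ (graphSum V E D u Z)
      = graphSum V E D (fun a b => φ (u a b)) (Fock.map φ Z) := by
  simp only [graphSum, map_sum]
  refine sum_congr rfl fun ε _ => ?_
  split_ifs
  · rw [graphTerm, graphTerm, Fock.map_smul, map_prod, map_prod]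
    simp only [Fock.map_shift]
  · rw [map_zero]

theorem map_graphPart (φ : R →+* S) (ρ : ℝ →+* R) (D B : ℕ) (u : ℕ → ℕ → R)
    (Z : Fock ℕ R) (k : ℕ) : Fock.map φ (graphPart ρ D B u Z k)
      = graphPart (φ.comp ρ) D B (fun a b => φ (u a b)) (Fock.map φ Z) k := by
  simp only [graphPart, map_sum, Fock.map_smul, map_graphSum, RingHom.comp_apply]

end Map

/-- The twisted potential, up to order `N`. -/
def twistZ (u : ℕ → ℕ → ℝ) (σ : ℕ → ℝ) (D N : ℕ) : Fock ℕ (PowerSeries ℝ) :=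
  ∑ k ∈ range (2 * N + 1), graphPart PowerSeries.C D (N + 2)
    (fun a b => PowerSeries.C (u a b)) (airyZ σ D N) k

theorem hasOrder_airyZ_one (σ : ℕ → ℝ) {D N : ℕ} (hD : 2 * N + 3 ≤ D) :
    HasOrder 1 0 1 (airyZ σ D N) := fun M χ hχ => by
  obtain rfl : χ = 0 := by omega
  exact coeff_zero_airyZ σ hD M

theorem hasOrder_airyZ_three (σ : ℕ → ℝ) {D N : ℕ} (hD : 2 * N + 3 ≤ D) :
    HasOrder 3 1 0 (airyZ σ D N) := fun M χ hχ => by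
  rcases χ with _ | χ
  · exact coeff_zero_airyZ σ hD M
  · exact coeff_airyZ_eq_zero σ hD (Or.inr fun ⟨h, hh⟩ => by omega)

/-- Agreement of the coefficients up to order `N`. -/
theorem map_truncMk_eq_iff {N : ℕ} {f g : Fock ℕ (PowerSeries ℝ)} :
    Fock.map (truncMk N) f = Fock.map (truncMk N) g
      ↔ ∀ K, ∀ χ ≤ N, coeff χ (f K) = coeff χ (g K) := by
  constructor
  · intro h K
    have := congrArg (fun f => f.toFun K) h
    exact truncMk_eq_iff.1 this
  · exact fun h => Fock.ext_apply fun K => truncMk_eq_iff.2 (h K)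

theorem isTwistedSol_twistZ {u : ℕ → ℕ → ℝ} (hus : ∀ a b, u a b = u b a) (σ : ℕ → ℝ) {D N : ℕ}
    (hD : 2 * N + 3 ≤ D) : IsTwistedSol ((truncMk N).comp PowerSeries.C) u σ D
      (truncMk N PowerSeries.X)
      (fun a => Fock.map (truncMk N) (Fock.der a (twistZ u σ D N))) := by
  set ρ := (truncMk N).comp PowerSeries.C with hρ
  have e1 : ∀ k, Fock.map (truncMk N) (graphPart PowerSeries.C D (N + 2)
      (fun a b => PowerSeries.C (u a b)) (airyZ σ D N) k) = graphPart ρ D (N + 2)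
        (fun a b => ρ (u a b)) (Fock.map (truncMk N) (airyZ σ D N)) k := fun k =>
    map_graphPart _ _ _ _ _ _ _
  have e2 : ∀ a, Fock.map (truncMk N) (Fock.der a (twistZ u σ D N))
      = Fock.der a (∑ k ∈ range (2 * N + 1), graphPart ρ D (N + 2)
        (fun a b => ρ (u a b)) (Fock.map (truncMk N) (airyZ σ D N)) k) := fun a => by
    rw [Fock.map_der, twistZ, map_sum]
    simp only [e1]
  simp only [e2]
  refine isTwistedSol_of_flow (by omega) hus _ ?_ ?_ ?_
  · intro k hk
    rw [← e1, ← map_zero (Fock.map (truncMk N)), map_truncMk_eq_iff]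
    intro K χ hχ
    have : HasOrder 3 1 (2 * k) (graphPart PowerSeries.C D (N + 2)
      (fun a b => PowerSeries.C (u a b)) (airyZ σ D N) k) := by
      refine HasOrder.sum fun M _ => HasOrder.smul ?_ _
      refine ((hasOrder_airyZ_three σ hD).graphSum _).mono ?_
      simp
    rw [this K χ (by omega)]; simp
  · intro k
    refine graphPart_succ ρ D (N + 2) (fun a b => ρ (u a b)) _ ?_ k
    intro i j m l hij a b
    have e3 : ∀ i m a, Fock.der a (graphSum (Fin i) (Fin m) D (fun a b => ρ (u a b))
        (Fock.map (truncMk N) (airyZ σ D N))) = Fock.map (truncMk N) (Fock.der a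
          (graphSum (Fin i) (Fin m) D (fun a b => PowerSeries.C (u a b)) (airyZ σ D N))) := by
      intro i m a
      rw [Fock.map_der, map_graphSum]; rfl
    rw [e3, e3, ← map_mul, ← map_zero (Fock.map (truncMk N)), map_truncMk_eq_iff]
    intro K χ hχ
    have h1 : ∀ i m a, HasOrder 1 0 i (Fock.der a
        (graphSum (Fin i) (Fin m) D (fun a b => PowerSeries.C (u a b)) (airyZ σ D N))) :=
      fun i m a => (((hasOrder_airyZ_one σ hD).graphSum _).mono (by simp)).der a
    rw [(h1 i m a).mul (h1 j l b) K χ (by omega)]; simp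
  · have := (isAirySol_airyP σ D).map (truncMk N)
    have e4 : ∀ a, Fock.der a (graphPart ρ D (N + 2) (fun a b => ρ (u a b))
        (Fock.map (truncMk N) (airyZ σ D N)) 0) = Fock.map (truncMk N) (airyP σ D a) := fun a => by
      rw [graphPart_zero ρ D (by omega), map_add, Derivation.map_one_eq_zero, zero_add,
        ← Fock.map_der, map_der_airyZ σ hD]
    simp only [e4]
    exact this

/-- The coefficients of a topological recursion of Airy type. -/
structure RecData where
  σ : ℕ → ℝ
  B : ℕ → ℕ → ℕ → ℝ
  C : ℕ → ℕ → ℕ → ℝ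
  Dt : ℕ → ℝ
  hB : ∀ a b c, c + 1 < a + b → B a b c = 0
  hC : ∀ a c e, c + e + 2 < a → C a c e = 0
  hDt : ∀ a, 1 < a → Dt a = 0

/-- `Z` satisfies the recursion up to order `N`. -/
def RecData.IsPotential (T : RecData) (D N : ℕ) (Z : Fock ℕ (PowerSeries ℝ)) : Prop :=
  ∀ (a : ℕ) (K : Multiset ℕ), ∀ χ ≤ N, coeff χ (Z (a ::ₘ K)) =
    coeff χ (((PowerSeries.X : PowerSeries ℝ) • (tAlpha PowerSeries.C T.σ a
      + kst PowerSeries.C (T.Dt a)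
      + ∑ c ∈ range D, Fock.lin (fun m => PowerSeries.C (T.B a m c)) * Fock.der c Z
      + kst PowerSeries.C (1 / 2) * ∑ c ∈ range D, ∑ e ∈ range D,
          kst PowerSeries.C (T.C a c e) * (Fock.der e (Fock.der c Z) + Fock.der c Z * Fock.der e Z))) K)

/-- The coefficients of the twisted recursion. -/
def twistData (u : ℕ → ℕ → ℝ) (σ : ℕ → ℝ) (D : ℕ) : RecData where
  σ := σ
  B := twistB u σ
  C := twistC u σ D
  Dt := twistD u σ
  hB a b c h := by
    rw [twistB, tensB, extZ_neg σ (by omega), if_neg (by omega)]; simp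
  hC a c e h := by
    rw [twistC, tensC, extZ_neg σ (by omega), if_neg (by omega), sum_eq_zero]
    · simp
    · intro b _
      rw [tensB, tensB, extZ_neg σ (by omega), extZ_neg σ (by omega)]; simp
  hDt a h := by
    rw [twistD, tensD, extZ_neg σ (by omega), if_neg (by omega)]; simp

/-- The coefficients of the recursion without twist. -/
def tensData (σ : ℕ → ℝ) : RecData where
  σ := σ
  B := tensB σ
  C := tensC σ
  Dt := tensD σ
  hB a b c h := by rw [tensB, extZ_neg σ (by omega)]; simp
  hC a c e h := by rw [tensC, extZ_neg σ (by omega)]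
  hDt a h := by rw [tensD, extZ_neg σ (by omega)]; simp

theorem isPotential_twistZ {u : ℕ → ℕ → ℝ} (hus : ∀ a b, u a b = u b a) (σ : ℕ → ℝ) {D N : ℕ}
    (hD : 2 * N + 3 ≤ D) : (twistData u σ D).IsPotential D N (twistZ u σ D N) := by
  intro a
  have h := isTwistedSol_twistZ hus σ hD a
  rw [← map_tAlpha, ← map_kst] at h
  have h2 : ∀ r, kst ((truncMk N).comp PowerSeries.C) r
      = Fock.map (truncMk N) (kst PowerSeries.C r) := fun r => (map_kst _ _ _).symm
  have h3 : ∀ c, (Fock.lin fun m => ((truncMk N).comp PowerSeries.C) (twistB u σ a m c))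
      = Fock.map (truncMk N) (Fock.lin fun m => PowerSeries.C (twistB u σ a m c)) := fun c => by
    rw [Fock.map_lin]; rfl
  simp only [h2, h3, ← Fock.map_der, ← map_mul, ← map_add, ← map_sum, ← Fock.map_smul] at h
  exact map_truncMk_eq_iff.1 h

theorem isPotential_airyZ (σ : ℕ → ℝ) {D N : ℕ} (hD : 2 * N + 3 ≤ D) :
    (tensData σ).IsPotential D N (airyZ σ D N) := by
  intro a
  have h := (isAirySol_airyP σ D).map (truncMk N) a
  rw [← map_tAlpha, ← map_kst] at h
  have h2 : ∀ r, kst ((truncMk N).comp PowerSeries.C) r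
      = Fock.map (truncMk N) (kst PowerSeries.C r) := fun r => (map_kst _ _ _).symm
  have h3 : ∀ c, tBeta ((truncMk N).comp PowerSeries.C) σ a c
      = Fock.map (truncMk N) (Fock.lin fun m => PowerSeries.C (tensB σ a m c)) := fun c => by
    rw [Fock.map_lin]; rfl
  simp only [h2, h3, ← map_der_airyZ σ hD] at h
  simp only [← Fock.map_der, ← map_mul, ← map_add, ← map_sum, ← Fock.map_smul] at h
  exact map_truncMk_eq_iff.1 h


section EvM

variable {S : Type*} [CommRing S] {ι κ : Type*} [Fintype ι] [Fintype κ] [DecidableEq ι]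
  [DecidableEq κ]

/-- The multilinear form with coefficients `z`, evaluated at the vectors `W i`. -/
def evM (D : ℕ) (W : ι → ℕ → S) (z : Multiset ℕ → S) : S :=
  ∑ b : ι → Fin D, (∏ i, W i (b i)) * z ((univ : Finset ι).val.map fun i => (b i : ℕ))

theorem evM_equiv (D : ℕ) (e : ι ≃ κ) (W : κ → ℕ → S) (z : Multiset ℕ → S) :
    evM D (fun i => W (e i)) z = evM D W z := by
  classical
  refine Fintype.sum_equiv (Equiv.arrowCongr e (Equiv.refl _)) _ _ fun b => ?_
  congr 1
  · refine Fintype.prod_equiv e _ _ fun i => ?_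
    simp
  · congr 1
    have : (univ : Finset κ) = (univ : Finset ι).map e.toEmbedding := by simp
    rw [this, Finset.map_val, Multiset.map_map]
    refine Multiset.map_congr rfl fun i _ => ?_
    simp

theorem evM_cons (D : ℕ) {n : ℕ} (w : ℕ → S) (W : Fin n → ℕ → S) (z : Multiset ℕ → S) :
    evM D (Fin.cons w W : Fin (n + 1) → ℕ → S) z
      = ∑ a ∈ range D, w a * evM D W fun K => z (a ::ₘ K) := by
  rw [evM, ← (Fin.consEquiv fun _ => Fin D).sum_comp, Fintype.sum_prod_type, Finset.sum_range]
  refine sum_congr rfl fun a _ => ?_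
  rw [evM, mul_sum]
  refine sum_congr rfl fun b _ => ?_
  rw [Fin.prod_univ_succ]
  simp only [Fin.consEquiv_apply, Fin.cons_zero, Fin.cons_succ]
  rw [mul_assoc]
  congr 3
  rw [Fin.univ_succ, Finset.cons_val, Multiset.map_cons, Finset.map_val, Multiset.map_map]
  simp [Function.comp_def]

theorem evM_zero_index (D : ℕ) (W : Fin 0 → ℕ → S) (z : Multiset ℕ → S) : evM D W z = z 0 := by
  rw [evM, Fintype.sum_unique]
  simp

theorem evM_add (D : ℕ) (W : ι → ℕ → S) (z z' : Multiset ℕ → S) :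
    evM D W (fun K => z K + z' K) = evM D W z + evM D W z' := by
  simp only [evM, mul_add, sum_add_distrib]

theorem evM_mul_left (D : ℕ) (W : ι → ℕ → S) (r : S) (z : Multiset ℕ → S) :
    evM D W (fun K => r * z K) = r * evM D W z := by
  simp only [evM, mul_sum]
  exact sum_congr rfl fun b _ => by ring

theorem evM_sum {α : Type*} (D : ℕ) (W : ι → ℕ → S) (s : Finset α) (z : α → Multiset ℕ → S) :
    evM D W (fun K => ∑ i ∈ s, z i K) = ∑ i ∈ s, evM D W (z i) := by
  simp only [evM, mul_sum]
  rw [sum_comm]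

theorem evM_congr (D : ℕ) (W : ι → ℕ → S) {z z' : Multiset ℕ → S}
    (h : ∀ K, K.card = Fintype.card ι → z K = z' K) : evM D W z = evM D W z' := by
  refine sum_congr rfl fun b _ => ?_
  rw [h _ (by simp)]

theorem evM_eq_zero (D : ℕ) (W : ι → ℕ → S) {z : Multiset ℕ → S}
    (h : ∀ K, K.card = Fintype.card ι → z K = 0) : evM D W z = 0 :=
  sum_eq_zero fun b _ => by rw [h _ (by simp), mul_zero]

theorem sum_map_antidiagonal {M : Type*} [AddCommMonoid M] (b : ι → ℕ)
    (F : Multiset ℕ × Multiset ℕ → M) (s : Finset ι) :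
    ((s.val.map b).antidiagonal.map F).sum
      = ∑ J ∈ s.powerset, F (J.val.map b, (s \ J).val.map b) := by
  induction s using Finset.induction_on generalizing F with
  | empty => simp
  | insert i s hi ih =>
    rw [Finset.insert_val_of_notMem hi, Multiset.map_cons, Multiset.antidiagonal_cons,
      Multiset.map_add, Multiset.sum_add, Multiset.map_map, Multiset.map_map, ih, ih,
      Finset.sum_powerset_insert hi]
    congr 1
    · refine sum_congr rfl fun J hJ => ?_
      have hJ' := Finset.mem_powerset.1 hJ
      rw [Finset.insert_sdiff_of_notMem s (fun h => hi (hJ' h)),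
        Finset.insert_val_of_notMem (fun h => hi (Finset.mem_sdiff.1 h).1), Multiset.map_cons]
      rfl
    · refine sum_congr rfl fun J hJ => ?_
      have hJ' := Finset.mem_powerset.1 hJ
      rw [Finset.insert_val_of_notMem (fun h => hi (hJ' h)), Multiset.map_cons,
        Finset.insert_sdiff_insert, Finset.sdiff_insert_of_notMem hi]
      rfl

variable {n : ℕ}

theorem evM_subTuple (D : ℕ) (W : Fin n → ℕ → S) (J : Finset (Fin n)) (z : Multiset ℕ → S) :
    evM D (subTuple W J) z = evM D (fun i : J => W i) z :=
  evM_equiv D (J.orderIsoOfFin rfl).toEquiv (fun i : J => W i) z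

theorem evM_split (D : ℕ) (W : Fin n → ℕ → S) (J : Finset (Fin n)) (z z' : Multiset ℕ → S) :
    ∑ b : Fin n → Fin D, (∏ i, W i (b i)) * (z (J.val.map fun i => (b i : ℕ))
      * z' (Jᶜ.val.map fun i => (b i : ℕ))) = evM D (subTuple W J) z * evM D (subTuple W Jᶜ) z' := by
  rw [evM_subTuple, evM_subTuple, evM, evM, Finset.sum_mul_sum]
  rw [← Fintype.sum_prod_type' (f := fun (b : J → Fin D) (b' : (Jᶜ : Finset (Fin n)) → Fin D) =>
    ((∏ i : J, W i (b i)) * z ((univ : Finset J).val.map fun i : J => (b i : ℕ)))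
    * ((∏ i : (Jᶜ : Finset (Fin n)), W i (b' i)) * z' ((univ :
      Finset (Jᶜ : Finset (Fin n))).val.map fun i : (Jᶜ : Finset (Fin n)) => (b' i : ℕ))))]
  let e : (Fin n → Fin D) ≃ (J → Fin D) × ((Jᶜ : Finset (Fin n)) → Fin D) :=
    (Equiv.piEquivPiSubtypeProd (· ∈ J) fun _ => Fin D).trans ((Equiv.refl _).prodCongr
      (Equiv.arrowCongr (Equiv.subtypeEquivRight fun i => by simp) (Equiv.refl _)))
  refine Fintype.sum_equiv e _ _ fun b => ?_
  have hm : ∀ s : Finset (Fin n), (univ : Finset s).val.map (fun i : s => (b i : ℕ))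
      = s.val.map fun i => (b i : ℕ) := fun s => by
    have := Multiset.attach_map_val' s.val fun i => (b i : ℕ)
    exact this
  have e1 : (e b).1 = fun i : J => b i := rfl
  have e2 : (e b).2 = fun i : (Jᶜ : Finset (Fin n)) => b i := rfl
  rw [e1, e2, hm, hm, ← Finset.prod_mul_prod_compl J, ← Finset.prod_coe_sort J,
    ← Finset.prod_coe_sort Jᶜ]
  ring

theorem evM_antidiagonal (D : ℕ) (W : Fin n → ℕ → S) (z z' : Multiset ℕ → S) :
    evM D W (fun K => (K.antidiagonal.map fun p => z p.1 * z' p.2).sum)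
      = ∑ J : Finset (Fin n), evM D (subTuple W J) z * evM D (subTuple W Jᶜ) z' := by
  simp only [← evM_split]
  rw [sum_comm, evM]
  refine sum_congr rfl fun b _ => ?_
  rw [sum_map_antidiagonal, Finset.powerset_univ, mul_sum]
  rfl

theorem evM_singleton (D : ℕ) (W : Fin n → ℕ → S) (m : Fin n) (f : ℕ → S) :
    evM D (subTuple W {m}) (fun K => (K.map f).sum) = ∑ b ∈ range D, W m b * f b := by
  rw [evM_subTuple, Finset.sum_range, evM]
  refine Fintype.sum_equiv (Equiv.funUnique _ _) _ _ fun b => ?_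
  rw [Fintype.prod_unique, Finset.univ_unique]
  simp

theorem evM_erase (D : ℕ) (W : Fin n → ℕ → S) (f : ℕ → S) (z : Multiset ℕ → S) :
    evM D W (fun K => (K.map fun m => f m * z (K.erase m)).sum)
      = ∑ m, (∑ b ∈ range D, W m b * f b) * evM D (subTuple W {m}ᶜ) z := by
  simp only [← evM_singleton, ← evM_split]
  rw [sum_comm, evM]
  refine sum_congr rfl fun b _ => ?_
  rw [← mul_sum]
  congr 1
  rw [Multiset.map_map]
  refine sum_congr rfl fun m _ => ?_
  simp only [Function.comp_apply, Finset.singleton_val, Multiset.map_singleton,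
    Multiset.sum_singleton]
  congr 2
  have : (univ : Finset (Fin n)).val = m ::ₘ ({m}ᶜ : Finset (Fin n)).val := by
    rw [← Finset.insert_val_of_notMem (by simp)]
    congr 1; ext i; simp [em]
  rw [this, Multiset.map_cons, Multiset.erase_cons_head]

end EvM

section Potential

variable {T : RecData} {D N : ℕ} {Z : Fock ℕ (PowerSeries ℝ)}

theorem RecData.IsPotential.coeff_zero (hZ : T.IsPotential D N Z) (a : ℕ) (K : Multiset ℕ) :
    coeff 0 (Z (a ::ₘ K)) = 0 := by
  rw [hZ a K 0 (Nat.zero_le _), Fock.smul_apply, PowerSeries.coeff_zero_X_mul]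

theorem RecData.IsPotential.coeff_succ (hZ : T.IsPotential D N Z) (a : ℕ) (K : Multiset ℕ) {χ : ℕ}
    (hχ : χ + 1 ≤ N) : coeff (χ + 1) (Z (a ::ₘ K)) =
      (if χ = 0 then (tAlpha (RingHom.id ℝ) T.σ a) K + (kst (RingHom.id ℝ) (T.Dt a)) K else 0)
      + ∑ c ∈ range D, (K.map fun m => T.B a m c * coeff χ (Z (c ::ₘ K.erase m))).sum
      + 1 / 2 * ∑ c ∈ range D, ∑ e ∈ range D, T.C a c e *
        (coeff χ (Z (c ::ₘ e ::ₘ K)) + (K.antidiagonal.map fun p =>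
          ∑ i ∈ range (χ + 1), coeff i (Z (c ::ₘ p.1)) * coeff (χ - i) (Z (e ::ₘ p.2))).sum) := by
  rw [hZ a K _ hχ, Fock.smul_apply, PowerSeries.coeff_succ_X_mul]
  have e0 : (PowerSeries.C (R := ℝ)).comp (RingHom.id ℝ) = PowerSeries.C := by
    ext; simp
  have h1 : coeff χ ((tAlpha PowerSeries.C T.σ a + kst PowerSeries.C (T.Dt a)) K)
      = if χ = 0 then (tAlpha (RingHom.id ℝ) T.σ a) K + (kst (RingHom.id ℝ) (T.Dt a)) K else 0 := by
    have : tAlpha PowerSeries.C T.σ a + kst PowerSeries.C (T.Dt a) = Fock.map PowerSeries.C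
        (tAlpha (RingHom.id ℝ) T.σ a + kst (RingHom.id ℝ) (T.Dt a)) := by
      rw [map_add, map_tAlpha, map_kst, e0]
    rw [this, Fock.map_apply, PowerSeries.coeff_C, Fock.add_apply]
  have h2 : ∀ c, coeff χ (((Fock.lin fun m => PowerSeries.C (T.B a m c)) * Fock.der c Z) K)
      = (K.map fun m => T.B a m c * coeff χ (Z (c ::ₘ K.erase m))).sum := by
    intro c
    rw [Fock.lin_mul_apply, map_multiset_sum, Multiset.map_map]
    congr 1
    refine Multiset.map_congr rfl fun m _ => ?_
    rw [Function.comp_apply, PowerSeries.coeff_C_mul, Fock.der_apply]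
  have h3 : ∀ c e, coeff χ ((kst PowerSeries.C (T.C a c e) *
      (Fock.der e (Fock.der c Z) + Fock.der c Z * Fock.der e Z)) K)
      = T.C a c e * (coeff χ (Z (c ::ₘ e ::ₘ K)) + (K.antidiagonal.map fun p =>
          ∑ i ∈ range (χ + 1),
            coeff i (Z (c ::ₘ p.1)) * coeff (χ - i) (Z (e ::ₘ p.2))).sum) := by
    intro c e
    rw [kst_mul, Fock.smul_apply, PowerSeries.coeff_C_mul, Fock.add_apply, map_add, Fock.der_apply,
      Fock.der_apply, Fock.mul_apply, map_multiset_sum, Multiset.map_map]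
    congr 3
    refine Multiset.map_congr rfl fun p _ => ?_
    rw [Function.comp_apply, PowerSeries.coeff_mul, Finset.Nat.sum_antidiagonal_eq_sum_range_succ
      (fun i j => coeff i (Fock.der c Z p.1) * coeff j (Fock.der e Z p.2))]
    rfl
  rw [← h1, Fock.add_apply _ (kst _ _ * _),
    Fock.add_apply _ (∑ _ ∈ _, _), map_add, map_add, kst_mul, Fock.smul_apply, PowerSeries.coeff_C_mul]
  simp only [Fock.sum_apply, map_sum, h2, h3]

theorem RecData.IsPotential.coeff_eq_zero (hZ : T.IsPotential D N Z) {χ : ℕ} (hχ : χ ≤ N) (a : ℕ)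
    (K : Multiset ℕ) (h : 2 * χ ≤ a + K.sum ∨ ¬ ∃ h, χ + 1 = 2 * h + K.card) :
    coeff χ (Z (a ::ₘ K)) = 0 := by
  induction χ using Nat.strong_induction_on generalizing a K with
  | _ χ ih =>
    rcases χ with _ | χ
    · exact hZ.coeff_zero a K
    rw [hZ.coeff_succ a K hχ]
    have h1 : (if χ = 0 then (tAlpha (RingHom.id ℝ) T.σ a) K + (kst (RingHom.id ℝ) (T.Dt a)) K
        else 0) = 0 := by
      split_ifs with hχ
      · subst hχ
        have h1 : (tAlpha (RingHom.id ℝ) T.σ a) K = 0 := tAlpha_apply _ _ fun h' => by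
          rcases h with h | h
          · omega
          · exact h ⟨0, by omega⟩
        have h2 : (kst (RingHom.id ℝ) (T.Dt a)) K = 0 := by
          rw [kst_apply]
          split_ifs with hK
          · rw [T.hDt, map_zero]
            rcases h with h | h
            · rw [Multiset.card_eq_zero.1 hK, Multiset.sum_zero] at h; omega
            · exact absurd ⟨1, by omega⟩ h
          · rfl
        rw [h1, h2, add_zero]
      · rfl
    have h2 : ∀ c ∈ range D,
        (K.map fun m => T.B a m c * coeff χ (Z (c ::ₘ K.erase m))).sum = 0 := by
      intro c _
      refine multiset_sum_eq_zero fun m hm => ?_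
      by_cases hB : c + 1 < a + m
      · rw [T.hB _ _ _ hB, zero_mul]
      · have e1 := congrArg Multiset.sum (Multiset.cons_erase hm)
        have e2 := congrArg Multiset.card (Multiset.cons_erase hm)
        rw [Multiset.sum_cons] at e1
        rw [Multiset.card_cons] at e2
        rw [ih χ (by omega) (by omega), mul_zero]
        refine h.imp (fun h => by omega) fun h ⟨t, ht⟩ => h ⟨t, by omega⟩
    have h3 : ∀ c ∈ range D, ∀ e ∈ range D, T.C a c e *
        (coeff χ (Z (c ::ₘ e ::ₘ K)) + (K.antidiagonal.map fun p =>
          ∑ i ∈ range (χ + 1),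
            coeff i (Z (c ::ₘ p.1)) * coeff (χ - i) (Z (e ::ₘ p.2))).sum) = 0 := by
      intro c _ e _
      by_cases hC : c + e + 2 < a
      · rw [T.hC _ _ _ hC, zero_mul]
      · rw [ih χ (by omega) (by omega), zero_add, multiset_sum_eq_zero, mul_zero]
        · intro p hp
          have hp' := Multiset.mem_antidiagonal.1 hp
          have e1 := congrArg Multiset.sum hp'
          have e2 := congrArg Multiset.card hp'
          rw [Multiset.sum_add] at e1
          rw [Multiset.card_add] at e2
          refine sum_eq_zero fun i hi => ?_
          rw [mem_range] at hi
          by_cases hi1 : (2 * (i : ℕ) ≤ c + p.1.sum ∨ ¬ ∃ h, (i : ℕ) + 1 = 2 * h + p.1.card)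
          · rw [ih i (by omega) (by omega) _ _ hi1, zero_mul]
          · rw [ih (χ - i) (by omega) (by omega), mul_zero]
            simp only [not_or, not_not] at hi1
            obtain ⟨hi1, t, ht⟩ := hi1
            refine h.imp (fun h => by omega) fun h ⟨t', ht'⟩ => h ⟨t + t', by omega⟩
        · rw [Multiset.sum_cons, Multiset.card_cons]
          refine h.imp (fun h => by omega) fun h ⟨t, ht⟩ => h ⟨t + 1, by omega⟩
    rw [h1, sum_eq_zero h2, sum_eq_zero fun c hc => sum_eq_zero (h3 c hc)]
    simp

theorem sum_mul_eq_sum_genus {S : Type*} [CommRing S] {F G : ℕ → S} {g j l χ : ℕ}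
    (hχ : χ + 2 = 2 * g + j + l)
    (hF : ∀ i ≤ χ, (¬ ∃ h, i + 1 = 2 * h + j) → F i = 0) (F0 : F 0 = 0)
    (hG : ∀ i ≤ χ, (¬ ∃ h, i + 1 = 2 * h + l) → G i = 0) (G0 : G 0 = 0) :
    ∑ i ∈ range (χ + 1), F i * G (χ - i)
      = ∑ h : Fin (g + 1), F (2 * h + j - 1) * G (2 * (g - h) + l - 1) := by
  rw [← Finset.sum_range fun h => F (2 * h + j - 1) * G (2 * (g - h) + l - 1),
    ← Finset.sum_filter_of_ne (s := range (g + 1))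
      (p := fun h => 0 < 2 * h + j ∧ 0 < 2 * (g - h) + l)]
  · symm
    refine Finset.sum_of_injOn (fun h => 2 * h + j - 1) ?_ ?_ ?_ ?_
    · intro h hh h' hh' he
      simp only [Finset.coe_filter, mem_range, Set.mem_ofPred_eq] at hh hh' he
      omega
    · intro h hh
      simp only [Finset.coe_filter, mem_range, Set.mem_ofPred_eq, Finset.coe_range,
        Set.mem_Iio] at hh ⊢
      omega
    · intro i hi hi'
      simp only [mem_range] at hi
      by_cases h1 : ∃ h, i + 1 = 2 * h + j
      · by_cases h2 : ∃ h, χ - i + 1 = 2 * h + l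
        · obtain ⟨h, hh⟩ := h1
          obtain ⟨h', hh'⟩ := h2
          exfalso
          apply hi'
          refine ⟨h, ?_, ?_⟩
          · simp only [Finset.coe_filter, mem_range, Set.mem_ofPred_eq]; omega
          · simp only; omega
        · rw [hG _ (by omega) h2, mul_zero]
      · rw [hF _ (by omega) h1, zero_mul]
    · intro h hh
      simp only [Finset.mem_filter, mem_range] at hh
      congr 2
      omega
  · intro h _ hne
    by_contra hcon
    apply hne
    rcases Nat.eq_zero_or_pos (2 * h + j) with h1 | h1
    · rw [h1, Nat.zero_sub, F0, zero_mul]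
    · have : 2 * (g - h) + l = 0 := by
        by_contra h2; exact hcon ⟨h1, Nat.pos_of_ne_zero h2⟩
      rw [this, Nat.zero_sub, G0, mul_zero]

end Potential


section Corr

variable {S : Type*} [CommRing S] (φ : ℝ →+* S) (D : ℕ) (Z : Fock ℕ (PowerSeries ℝ))

/-- The correlator of genus `g` with the indices `M`, evaluated at the vectors `W`. -/
def corr (g : ℕ) (M : Multiset ℕ) {n : ℕ} (W : Fin n → ℕ → S) : S :=
  evM D W fun K => φ (coeff (2 * g + (M.card + n) - 2) (Z (M + K)))

/-- The correlators of the surfaces obtained by removing a pair of pants with one outer boundary. -/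
def corrPair (g : ℕ) {n : ℕ} (W : Fin n → ℕ → S) (c e : ℕ) : S :=
  (if g = 0 then 0 else corr φ D Z (g - 1) {c, e} W)
    + ∑ h : Fin (g + 1), ∑ J : Finset (Fin n), corr φ D Z h {c} (subTuple W J)
      * corr φ D Z (g - h) {e} (subTuple W Jᶜ)

variable {φ D Z}

theorem corr_cons (g : ℕ) (M : Multiset ℕ) {n : ℕ} (w : ℕ → S) (W : Fin n → ℕ → S) :
    corr φ D Z g M (Fin.cons w W : Fin (n + 1) → ℕ → S)
      = ∑ a ∈ range D, w a * corr φ D Z g (a ::ₘ M) W := by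
  rw [corr, evM_cons]
  refine sum_congr rfl fun a _ => ?_
  rw [corr, Multiset.card_cons]
  congr 2
  funext K
  rw [Multiset.cons_add, Multiset.add_cons]
  congr 3
  omega

theorem evM_tAlpha (hD : 0 < D) (σ : ℕ → ℝ) (a : ℕ) (W : Fin 2 → ℕ → S) :
    evM D W (fun K => φ ((tAlpha (RingHom.id ℝ) σ a) K))
      = if a = 0 then φ (σ 0) * (W 0 0 * W 1 0) else 0 := by
  have hW : W = Fin.cons (W 0) (Fin.cons (W 1) (fun i : Fin 0 => i.elim0)) := by
    funext i; fin_cases i <;> rfl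
  have key : ∀ b c : ℕ, (tAlpha (RingHom.id ℝ) σ a) (b ::ₘ c ::ₘ 0)
      = if a = 0 ∧ c = 0 ∧ b = 0 then σ 0 else 0 := by
    intro b c
    have := congrArg (fun f => f.toFun 0) (der_der_tAlpha (RingHom.id ℝ) σ a c b)
    simp only [Fock.der_apply] at this
    rw [Multiset.cons_swap]
    refine this.trans ?_
    rw [kst_apply, if_pos (by simp), tensA]; rfl
  rw [hW, evM_cons]
  simp only [evM_cons, evM_zero_index, key]
  have h0 : (0 : ℕ) ∈ range D := mem_range.2 hD
  rw [sum_eq_single_of_mem 0 h0, sum_eq_single_of_mem 0 h0]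
  · by_cases ha : a = 0
    · simp [ha]; ring
    · simp [ha]
  · intro c _ hc; simp [hc]
  · intro b _ hb; simp [hb]

variable {T : RecData} {N : ℕ}

theorem RecData.IsPotential.corr_eq_zero (hZ : T.IsPotential D N Z) {g n a : ℕ}
    (M : Multiset ℕ) (hN : 2 * g + (M.card + 1 + n) ≤ N + 2)
    (h : 2 * N ≤ a ∨ (g = 0 ∧ M.card + n < 2)) (W : Fin n → ℕ → S) : corr φ D Z g (a ::ₘ M) W = 0 := by
  refine evM_eq_zero D W fun K hK => ?_
  rw [Fintype.card_fin] at hK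
  rw [Multiset.cons_add, hZ.coeff_eq_zero _ _ _ _, map_zero]
  · rw [Multiset.card_cons]; omega
  · rw [Multiset.card_cons, Multiset.card_add]
    rcases h with h | ⟨h, h'⟩
    · left; omega
    · left; omega

theorem sum_corrPair_mul (g : ℕ) {n : ℕ} (W : Fin n → ℕ → S) (v w : ℕ → S) :
    ∑ c ∈ range D, ∑ e ∈ range D, corrPair φ D Z g W c e * (v c * w e)
      = (if g = 0 then 0 else corr φ D Z (g - 1) 0 (Fin.cons v (Fin.cons w W) : Fin (n + 2) → ℕ → S))
        + ∑ h : Fin (g + 1), ∑ J : Finset (Fin n), (∑ c ∈ range D, v c * corr φ D Z h {c} (subTuple W J))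
          * ∑ e ∈ range D, w e * corr φ D Z (g - h) {e} (subTuple W Jᶜ) := by
  simp only [corrPair, add_mul, sum_add_distrib]
  congr 1
  · split_ifs with hg
    · simp
    · rw [corr_cons]
      refine sum_congr rfl fun c _ => ?_
      rw [corr_cons, mul_sum]
      refine sum_congr rfl fun e _ => ?_
      rw [show (e ::ₘ c ::ₘ 0 : Multiset ℕ) = {c, e} from Multiset.cons_swap _ _ _]
      ring
  · simp only [sum_mul]
    refine (sum_congr rfl fun c _ => sum_comm).trans ?_
    refine sum_comm.trans (sum_congr rfl fun h _ => ?_)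
    refine (sum_congr rfl fun c _ => sum_comm).trans ?_
    refine sum_comm.trans (sum_congr rfl fun J _ => ?_)
    simp only [mul_sum]
    exact sum_congr₂ fun c _ e _ => by ring

theorem RecData.IsPotential.corrPair_eq_zero (hZ : T.IsPotential D N Z) {g n c e : ℕ}
    (hN : 2 * g + n ≤ N + 1) (h : 2 * N ≤ c ∨ 2 * N ≤ e) (W : Fin n → ℕ → S) :
    corrPair φ D Z g W c e = 0 := by
  have hJ : ∀ J : Finset (Fin n), J.card + Jᶜ.card = n := fun J => by
    rw [Finset.card_add_card_compl, Fintype.card_fin]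
  rw [corrPair, sum_eq_zero, add_zero]
  · split_ifs with hg
    · rfl
    rcases h with h | h
    · exact hZ.corr_eq_zero {e} (by rw [Multiset.card_singleton]; omega) (Or.inl h) _
    · rw [Multiset.pair_comm]
      exact hZ.corr_eq_zero {c} (by rw [Multiset.card_singleton]; omega) (Or.inl h) _
  · intro k _
    have := k.2
    refine sum_eq_zero fun J _ => ?_
    have := hJ J
    rcases h with h' | h'
    · exact mul_eq_zero_of_left
        (hZ.corr_eq_zero 0 (by rw [Multiset.card_zero]; omega) (Or.inl h') _) _
    · exact mul_eq_zero_of_right _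
        (hZ.corr_eq_zero 0 (by rw [Multiset.card_zero]; omega) (Or.inl h') _)

theorem RecData.IsPotential.corr_rec (hZ : T.IsPotential D N Z) {g n : ℕ} (hst : 2 < 2 * g + n)
    (hN : 2 * g + n ≤ N + 1) (a : ℕ) (W : Fin n → ℕ → S) :
    corr φ D Z g {a} W = ∑ m, ∑ c ∈ range D,
        (∑ b ∈ range D, W m b * φ (T.B a b c)) * corr φ D Z g {c} (subTuple W {m}ᶜ)
      + φ (1 / 2) * ∑ c ∈ range D, ∑ e ∈ range D, φ (T.C a c e) *
        corrPair φ D Z g W c e := by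
  simp only [corrPair]
  obtain ⟨χ, hχ⟩ : ∃ χ, 2 * g + n = χ + 2 := ⟨2 * g + n - 2, by omega⟩
  have e0 : ∀ (c g n : ℕ) (W : Fin n → ℕ → S), corr φ D Z g {c} W
      = evM D W fun K => φ (coeff (2 * g + n - 1) (Z (c ::ₘ K))) := by
    intro c g n W
    simp only [corr, Multiset.card_singleton, Multiset.singleton_add]
    rw [show 2 * g + (1 + n) - 2 = 2 * g + n - 1 by omega]
  rw [e0, show 2 * g + n - 1 = χ + 1 by omega]
  simp only [hZ.coeff_succ a _ (show χ + 1 ≤ N by omega)]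
  rw [evM_congr D W (z' := fun K => (∑ c ∈ range D,
      (K.map fun m => φ (T.B a m c) * φ (coeff χ (Z (c ::ₘ K.erase m)))).sum)
      + φ (1 / 2) * ∑ c ∈ range D, ∑ e ∈ range D, φ (T.C a c e) *
        (φ (coeff χ (Z (c ::ₘ e ::ₘ K))) + (K.antidiagonal.map fun p =>
          φ (∑ i ∈ range (χ + 1),
            coeff i (Z (c ::ₘ p.1)) * coeff (χ - i) (Z (e ::ₘ p.2)))).sum))]
  · rw [evM_add, evM_mul_left, evM_sum, evM_sum]
    congr 1
    · rw [sum_comm]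
      refine sum_congr rfl fun c _ => ?_
      rw [evM_erase D W (fun m => φ (T.B a m c)) (fun K => φ (coeff χ (Z (c ::ₘ K))))]
      refine sum_congr rfl fun m _ => ?_
      rw [e0]
      have := Finset.card_add_card_compl ({m} : Finset (Fin n))
      rw [Finset.card_singleton, Fintype.card_fin] at this
      rw [show 2 * g + ({m}ᶜ : Finset (Fin n)).card - 1 = χ by omega]
    · congr 1
      refine sum_congr rfl fun c _ => ?_
      rw [evM_sum]
      refine sum_congr rfl fun e _ => ?_
      rw [evM_mul_left, evM_add]
      congr 2
      · split_ifs with hg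
        · refine evM_eq_zero D W fun K hK => ?_
          rw [Fintype.card_fin] at hK
          rw [hZ.coeff_eq_zero (by omega), map_zero]
          right
          rw [Multiset.card_cons]
          rintro ⟨h, hh⟩
          omega
        · rw [corr]
          congr 1
          funext K
          congr 3
          · simp only [Multiset.insert_eq_cons, Multiset.card_cons, Multiset.card_singleton]; omega
          · simp [Multiset.cons_add]
      · rw [sum_comm]
        have hsum : ∀ K : Multiset ℕ, K.card = Fintype.card (Fin n) →
            (K.antidiagonal.map fun p => φ (∑ i ∈ range (χ + 1),
              coeff i (Z (c ::ₘ p.1)) * coeff (χ - i) (Z (e ::ₘ p.2)))).sum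
            = ∑ h : Fin (g + 1), (K.antidiagonal.map fun p =>
              φ (coeff (2 * h + p.1.card - 1) (Z (c ::ₘ p.1)))
                * φ (coeff (2 * (g - h) + p.2.card - 1) (Z (e ::ₘ p.2)))).sum := by
          intro K hK
          rw [← Multiset.sum_map_sum]
          congr 1
          refine Multiset.map_congr rfl fun p hp => ?_
          have hp' := congrArg Multiset.card (Multiset.mem_antidiagonal.1 hp)
          rw [Multiset.card_add, hK, Fintype.card_fin] at hp'
          rw [sum_mul_eq_sum_genus (j := p.1.card) (l := p.2.card) (g := g) (by omega)
            (fun i hi h => hZ.coeff_eq_zero (by omega) _ _ (Or.inr h)) (hZ.coeff_zero _ _)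
            (fun i hi h => hZ.coeff_eq_zero (by omega) _ _ (Or.inr h)) (hZ.coeff_zero _ _)]
          simp only [map_sum, map_mul]
        rw [evM_congr D W hsum, evM_sum, sum_comm]
        refine sum_congr rfl fun h _ => ?_
        rw [evM_antidiagonal D W (fun K => φ (coeff (2 * h + K.card - 1) (Z (c ::ₘ K))))
          (fun K => φ (coeff (2 * (g - h) + K.card - 1) (Z (e ::ₘ K))))]
        refine sum_congr rfl fun J _ => ?_
        rw [e0, e0]
        congr 1
        · exact evM_congr _ _ fun K hK => by rw [hK, Fintype.card_fin]
        · exact evM_congr _ _ fun K hK => by rw [hK, Fintype.card_fin]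
  · intro K hK
    rw [Fintype.card_fin] at hK
    have h0 : (if χ = 0 then (tAlpha (RingHom.id ℝ) T.σ a) K + (kst (RingHom.id ℝ) (T.Dt a)) K
        else 0) = 0 := by
      rw [if_neg (by omega)]
    rw [h0, zero_add]
    simp only [map_add, map_mul, map_sum, map_multiset_sum, Multiset.map_map, Function.comp_def]

theorem RecData.IsPotential.corr_three (hZ : T.IsPotential D N Z) (hN : 1 ≤ N) (hD : 0 < D) (a : ℕ)
    (W : Fin 2 → ℕ → S) :
    corr φ D Z 0 {a} W = if a = 0 then φ (T.σ 0) * (W 0 0 * W 1 0) else 0 := by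
  rw [← evM_tAlpha hD, corr]
  refine evM_congr D W fun K hK => ?_
  rw [Fintype.card_fin] at hK
  rw [Multiset.singleton_add, Multiset.card_singleton, show 2 * 0 + (1 + 2) - 2 = 0 + 1 by rfl,
    hZ.coeff_succ a K (by omega), if_pos rfl, kst_apply, if_neg (by omega), add_zero,
    sum_eq_zero, sum_eq_zero, mul_zero, add_zero, add_zero]
  · intro c _
    refine sum_eq_zero fun e _ => ?_
    rw [hZ.coeff_zero, zero_add, multiset_sum_eq_zero, mul_zero]
    intro p _
    simp [hZ.coeff_zero]
  · intro c _
    exact multiset_sum_eq_zero fun m _ => by rw [hZ.coeff_zero, mul_zero]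

theorem RecData.IsPotential.corr_one (hZ : T.IsPotential D N Z) (hN : 1 ≤ N) (a : ℕ)
    (W : Fin 0 → ℕ → S) : corr φ D Z 1 {a} W = φ (T.Dt a) := by
  rw [corr, evM_zero_index, Multiset.singleton_add, Multiset.card_singleton,
    show 2 * 1 + (1 + 0) - 2 = 0 + 1 by rfl,
    hZ.coeff_succ a 0 (by omega), if_pos rfl, kst_apply, if_pos (by simp), tAlpha_apply _ _ (by simp),
    sum_eq_zero, sum_eq_zero, mul_zero, add_zero, add_zero, zero_add]
  · rfl
  · intro c _
    refine sum_eq_zero fun e _ => ?_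
    rw [hZ.coeff_zero, zero_add, multiset_sum_eq_zero, mul_zero]
    intro p _
    simp [hZ.coeff_zero]
  · intro c _
    exact multiset_sum_eq_zero fun m _ => by rw [hZ.coeff_zero, mul_zero]

end Corr


section EvList

variable {S : Type*} [CommRing S]

/-- The multilinear form with coefficients `z`, evaluated at a list of vectors. -/
def evL (D : ℕ) : List (ℕ → S) → (Multiset ℕ → S) → S
  | [], z => z 0
  | w :: l, z => ∑ a ∈ range D, w a * evL D l fun K => z (a ::ₘ K)

theorem evL_perm (D : ℕ) {l l' : List (ℕ → S)} (h : l.Perm l') (z : Multiset ℕ → S) :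
    evL D l z = evL D l' z := by
  induction h generalizing z with
  | nil => rfl
  | cons w _ ih => simp only [evL, ih]
  | swap w w' l =>
    simp only [evL, mul_sum]
    rw [sum_comm]
    refine sum_congr₂ fun a _ b _ => ?_
    rw [mul_left_comm]
    congr 3
    funext K
    rw [Multiset.cons_swap]
  | trans _ _ ih ih' => rw [ih, ih']

theorem evM_ofFn (D : ℕ) {m : ℕ} (W : Fin m → ℕ → S) (z : Multiset ℕ → S) :
    evM D W z = evL D (List.ofFn W) z := by
  induction m generalizing z with
  | zero => rw [evM_zero_index, List.ofFn_zero]; rfl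
  | succ m ih =>
    rw [← Fin.cons_self_tail W, evM_cons, List.ofFn_cons, evL]
    simp only [ih]

theorem exists_evM_eq_evL {ι : Type*} [Fintype ι] [DecidableEq ι] (D : ℕ) (W : ι → ℕ → S)
    (z : Multiset ℕ → S) : ∃ l : List (ℕ → S),
      (l : Multiset (ℕ → S)) = (univ : Finset ι).val.map W ∧ evM D W z = evL D l z := by
  let e := Fintype.equivFin ι
  refine ⟨List.ofFn fun i => W (e.symm i), ?_, ?_⟩
  · rw [← Fin.univ_val_map]
    have : (univ : Finset ι) = (univ : Finset (Fin (Fintype.card ι))).map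
      e.symm.toEmbedding := by simp
    rw [this, Finset.map_val, Multiset.map_map]
    rfl
  · rw [← evM_ofFn, evM_equiv D e.symm W]

theorem evM_eq_of_map_eq {ι κ : Type*} [Fintype ι] [Fintype κ] [DecidableEq ι] [DecidableEq κ]
    (D : ℕ) {W : ι → ℕ → S} {W' : κ → ℕ → S}
    (h : (univ : Finset ι).val.map W = (univ : Finset κ).val.map W')
    (z : Multiset ℕ → S) : evM D W z = evM D W' z := by
  obtain ⟨l, h1, h2⟩ := exists_evM_eq_evL D W z
  obtain ⟨l', h1', h2'⟩ := exists_evM_eq_evL D W' z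
  rw [h2, h2']
  exact evL_perm D (Multiset.coe_eq_coe.1 (h1.trans (h.trans h1'.symm))) z

/-- The indices over the fibre of `p` at `v`. -/
def fiberDeco {X V : Type*} [Fintype X] [DecidableEq V] (p : X → V) (b : X → ℕ) (v : V) :
    Multiset ℕ := ∑ x, if p x = v then {b x} else 0

theorem card_fiberDeco {X V : Type*} [Fintype X] [DecidableEq V] (p : X → V) (b : X → ℕ) (v : V) :
    (fiberDeco p b v).card = (univ.filter fun x => p x = v).card := by
  rw [fiberDeco, Multiset.card_sum, Finset.card_filter]
  exact sum_congr rfl fun x _ => by split_ifs <;> simp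

theorem fiberDeco_sum {X Y V : Type*} [Fintype X] [Fintype Y] [DecidableEq V] (p : X → V)
    (q : Y → V) (b : X ⊕ Y → ℕ) (v : V) : fiberDeco (Sum.elim p q) b v
      = fiberDeco p (fun x => b (Sum.inl x)) v + fiberDeco q (fun y => b (Sum.inr y)) v := by
  rw [fiberDeco, Fintype.sum_sum_type]; rfl

theorem prod_evM_fiber {X V : Type*} [Fintype X] [Fintype V] [DecidableEq X] [DecidableEq V] (D : ℕ)
    (p : X → V) (W : X → ℕ → S) (z : V → Multiset ℕ → S) :
    ∏ v, evM D (fun x : {x // p x = v} => W x) (z v)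
      = ∑ b : X → Fin D, (∏ x, W x (b x)) * ∏ v, z v (fiberDeco p (fun x => b x) v) := by
  simp only [evM]
  rw [Finset.prod_univ_sum, Fintype.piFinset_univ]
  let e : (X → Fin D) ≃ (∀ v, {x // p x = v} → Fin D) :=
    (Equiv.arrowCongr (Equiv.sigmaFiberEquiv p).symm (Equiv.refl _)).trans
      (Equiv.piCurry fun _ _ => Fin D)
  symm
  refine Fintype.sum_equiv e _ _ fun b => ?_
  have he : ∀ v (x : {x // p x = v}), e b v x = b x := fun v x => rfl
  rw [Finset.prod_mul_distrib]
  congr 1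
  · simp only [he]
    rw [← (Equiv.sigmaFiberEquiv p).prod_comp, Fintype.prod_sigma]
    rfl
  · refine Fintype.prod_congr _ _ fun v => ?_
    congr 1
    simp only [he, fiberDeco]
    rw [← Finset.sum_filter, ← Finset.sum_subtype_eq_sum_filter, Finset.subtype_univ,
      Finset.sum_eq_multiset_sum]
    refine Eq.trans ?_ (Multiset.sum_map_singleton _)
    rw [Multiset.map_map]
    rfl

theorem Fock.prod_apply_fiber {V : Type*} [Fintype V] [DecidableEq V] {n : ℕ}
    (f : V → Fock ℕ S) (c : Fin n → ℕ) :
    (∏ v, f v) ((univ : Finset (Fin n)).val.map c)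
      = ∑ leg : Fin n → V, ∏ v, f v (fiberDeco leg c v) := by
  induction n generalizing f with
  | zero =>
    rw [Fintype.sum_unique]
    exact Fock.prod_apply_zero _ _
  | succ n ih =>
    rw [Fin.univ_succ, Finset.cons_val, Multiset.map_cons, Finset.map_val, Multiset.map_map,
      ← Fock.der_apply, Fock.der_prod, Fock.sum_apply,
      ← (Fin.consEquiv fun _ => V).sum_comp, Fintype.sum_prod_type]
    refine sum_congr rfl fun x _ => ?_
    have := ih (fun v => if v = x then Fock.der (c 0) (f v) else f v) (fun i => c i.succ)
    refine this.trans (sum_congr rfl fun leg _ => prod_congr rfl fun v _ => ?_)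
    rw [fiberDeco, fiberDeco, Fin.sum_univ_succ]
    simp only [Fin.consEquiv_apply, Fin.cons_zero, Fin.cons_succ]
    by_cases h : v = x
    · rw [if_pos h, if_pos h.symm, Fock.der_apply, Multiset.singleton_add]
    · rw [if_neg h, if_neg (fun h' => h h'.symm), zero_add]

end EvList

/-- The coefficients of a product of series with parity, as a sum over genera. -/
theorem coeff_prod_genus {m G χ : ℕ} (P : Fin m → PowerSeries ℝ) (d : Fin m → ℕ) (hG : χ + 2 < G)
    (hP : ∀ v i, i ≤ χ → ¬ (0 < i ∧ ∃ h, i + 2 = 2 * h + d v) → coeff i (P v) = 0) :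
    coeff χ (∏ v, P v) = ∑ h : Fin m → Fin G,
      if ∑ v, (2 * (h v : ℕ) + d v) = χ + 2 * m ∧ ∀ v, 2 < 2 * (h v : ℕ) + d v then
        ∏ v, coeff (2 * (h v : ℕ) + d v - 2) (P v) else 0 := by
  classical
  rw [PowerSeries.coeff_prod, ← Finset.sum_filter]
  symm
  refine Finset.sum_of_injOn
    (fun h => Finsupp.equivFunOnFinite.symm fun v => 2 * (h v : ℕ) + d v - 2) ?_ ?_ ?_ ?_
  · intro h hh h' hh' he
    simp only [Finset.coe_filter, mem_univ, true_and, Set.mem_ofPred_eq] at hh hh'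
    funext v
    have h1 := hh.2 v
    have h2 := hh'.2 v
    have h3 := DFunLike.congr_fun he v
    simp only [Finsupp.equivFunOnFinite_symm_apply_apply] at h3
    ext
    omega
  · intro h hh
    simp only [Finset.coe_filter, mem_univ, true_and, Set.mem_ofPred_eq] at hh
    rw [Finset.mem_coe, Finset.mem_finsuppAntidiag]
    refine ⟨?_, Finset.subset_univ _⟩
    simp only [Finsupp.equivFunOnFinite_symm_apply_apply]
    have h1 : ∑ v, (2 * (h v : ℕ) + d v - 2) + ∑ v : Fin m, 2 = ∑ v, (2 * (h v : ℕ) + d v) := by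
      rw [← sum_add_distrib]
      exact sum_congr rfl fun v _ => by have := hh.2 v; omega
    rw [hh.1, Finset.sum_const, Finset.card_univ, Fintype.card_fin, smul_eq_mul] at h1
    omega
  · intro l hl hl'
    by_contra hne
    apply hl'
    rw [Finset.mem_finsuppAntidiag] at hl
    have hne' : ∀ v, 0 < l v ∧ ∃ h, l v + 2 = 2 * h + d v := by
      intro v
      by_contra hcon
      refine hne (Finset.prod_eq_zero (mem_univ v) (hP v _ ?_ hcon))
      rw [← hl.1]
      exact Finset.single_le_sum (fun _ _ => Nat.zero_le _) (mem_univ v)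
    have hle : ∀ v, l v ≤ χ := fun v => by
      rw [← hl.1]
      exact Finset.single_le_sum (f := fun v => l v) (fun _ _ => Nat.zero_le _) (mem_univ v)
    choose h0 h hh using hne'
    refine ⟨fun v => ⟨h v, by have := hh v; have := hle v; omega⟩, ?_, ?_⟩
    · simp only [Finset.coe_filter, mem_univ, true_and, Set.mem_ofPred_eq]
      refine ⟨?_, fun v => by have := hh v; have := h0 v; omega⟩
      rw [sum_congr rfl fun v _ => (hh v).symm, sum_add_distrib, hl.1]
      simp [mul_comm]
    · ext v
      simp only [Finsupp.equivFunOnFinite_symm_apply_apply]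
      have := hh v
      omega
  · intro h hh
    refine prod_congr rfl fun v _ => ?_
    simp


section HalfEdges

variable {k k' : ℕ}

/-- The map on edges induced by a bijection of half-edges. -/
def edgeMap (σ : Fin k × Bool ≃ Fin k' × Bool) (e : Fin k) : Fin k' := (σ (e, false)).1

theorem edgeMap_eq {σ : Fin k × Bool ≃ Fin k' × Bool}
    (hσ : ∀ h, σ (h.1, !h.2) = ((σ h).1, !(σ h).2)) (e : Fin k) (s : Bool) :
    σ (e, s) = (edgeMap σ e, xor s (σ (e, false)).2) := by
  cases s
  · simp [edgeMap]
  · have := hσ (e, false)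
    simp only [Bool.not_false] at this
    rw [this]; simp [edgeMap]

theorem edgeMap_bijective {σ : Fin k × Bool ≃ Fin k' × Bool}
    (hσ : ∀ h, σ (h.1, !h.2) = ((σ h).1, !(σ h).2)) : Function.Bijective (edgeMap σ) := by
  constructor
  · intro e e' h
    have h1 := edgeMap_eq hσ e' (xor (σ (e, false)).2 (σ (e', false)).2)
    have h2 := edgeMap_eq hσ e false
    rw [Bool.xor_assoc, Bool.xor_self, Bool.xor_false, ← h] at h1
    rw [Bool.false_xor, ← h1] at h2
    exact (Prod.mk.inj (σ.injective h2)).1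
  · intro e'
    refine ⟨(σ.symm (e', false)).1, ?_⟩
    have := edgeMap_eq hσ (σ.symm (e', false)).1 (σ.symm (e', false)).2
    rw [Prod.mk.eta, Equiv.apply_symm_apply] at this
    exact (congrArg Prod.fst this).symm

/-- The permutations of the half-edges that preserve the edges. -/
def HalfPerm (k : ℕ) : Type :=
  {σ : Equiv.Perm (Fin k × Bool) // ∀ h, σ (h.1, !h.2) = ((σ h).1, !(σ h).2)}

/-- The permutation of half-edges given by a permutation of the edges and flips. -/
def halfPermOf (p : Equiv.Perm (Fin k) × (Fin k → Bool)) : HalfPerm k :=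
  ⟨{ toFun := fun h => (p.1 h.1, xor h.2 (p.2 h.1))
     invFun := fun h => (p.1.symm h.1, xor h.2 (p.2 (p.1.symm h.1)))
     left_inv := fun h => by simp
     right_inv := fun h => by simp }, fun h => by simp⟩

theorem halfPermOf_bijective : Function.Bijective (halfPermOf (k := k)) := by
  constructor
  · rintro ⟨π, s⟩ ⟨π', s'⟩ h
    have h1 : ∀ e, (π e, s e) = (π' e, s' e) := fun e => by
      have := congrArg (fun σ : HalfPerm k => σ.1 (e, false)) h
      simpa [halfPermOf] using this
    exact Prod.ext (Equiv.ext fun e => (Prod.mk.inj (h1 e)).1)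
      (funext fun e => (Prod.mk.inj (h1 e)).2)
  · rintro ⟨σ, hσ⟩
    refine ⟨(Equiv.ofBijective _ (edgeMap_bijective hσ), fun e => (σ (e, false)).2), ?_⟩
    refine Subtype.ext (Equiv.ext fun h => ?_)
    exact (edgeMap_eq hσ h.1 h.2).symm

theorem card_halfPerm (k : ℕ) : Nat.card (HalfPerm k) = k.factorial * 2 ^ k := by
  rw [← Nat.card_congr (Equiv.ofBijective _ (halfPermOf_bijective (k := k)))]
  rw [Nat.card_prod, Nat.card_perm]
  simp

end HalfEdges

namespace StableGraph

variable {g n : ℕ}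

instance (Γ Δ : StableGraph g n) : Finite (Iso Γ Δ) :=
  Finite.of_injective (fun f : Iso Γ Δ => (f.vert, f.half)) fun f f' h => by
    cases f; cases f'
    simp only [Prod.mk.injEq] at h
    obtain ⟨rfl, rfl⟩ := h
    rfl

theorem Iso.N_eq {Γ Δ : StableGraph g n} (f : Iso Γ Δ) : Γ.N = Δ.N := by
  simpa using Fintype.card_congr f.vert

theorem Iso.k_eq {Γ Δ : StableGraph g n} (f : Iso Γ Δ) : Γ.k = Δ.k := by
  simpa using Fintype.card_congr f.half

/-- The graph obtained by relabelling the vertices and half-edges. -/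
def relabel (Γ : StableGraph g n) (π : Equiv.Perm (Fin Γ.N)) (σ : HalfPerm Γ.k) :
    StableGraph g n where
  N := Γ.N
  k := Γ.k
  genus v := Γ.genus (π.symm v)
  ends h := π (Γ.ends (σ.1.symm h))
  leg i := π (Γ.leg i)
  nonempty := Γ.nonempty
  connected u v := by
    have := Γ.connected (π.symm u) (π.symm v)
    have h := Relation.ReflTransGen.lift (p := fun a b => ∃ e s, π (Γ.ends (σ.1.symm (e, s))) = a ∧
      π (Γ.ends (σ.1.symm (e, !s))) = b) π (fun a b ⟨e, s, h1, h2⟩ => ⟨(σ.1 (e, s)).1,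
        (σ.1 (e, s)).2, by simp [h1], by rw [← σ.2 (e, s)]; simp [h2]⟩) _ _ this
    simp only [Function.onFun, Equiv.apply_symm_apply] at h
    exact h
  stable v := by
    have := Γ.stable (π.symm v)
    convert this using 2
    · refine Finset.card_equiv σ.1.symm fun h => ?_
      simp [Equiv.eq_symm_apply]
    · congr 1; ext i
      simp [Equiv.eq_symm_apply]
  genus_eq := by
    rw [π.symm.sum_comp]
    exact Γ.genus_eq

/-- The isomorphism to the relabelled graph. -/
def relabelIso (Γ : StableGraph g n) (π : Equiv.Perm (Fin Γ.N)) (σ : HalfPerm Γ.k) :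
    Iso Γ (Γ.relabel π σ) where
  vert := π
  half := σ.1
  flip := σ.2
  ends h := congrArg (fun h => π (Γ.ends h)) (σ.1.symm_apply_apply h)
  leg i := rfl
  genus v := congrArg Γ.genus (π.symm_apply_apply v)

/-- A graph with an isomorphism is the same as a relabelling. -/
def sigmaIsoEquiv (Γ : StableGraph g n) :
    Equiv.Perm (Fin Γ.N) × HalfPerm Γ.k ≃ Σ Δ, Iso Γ Δ where
  toFun p := ⟨Γ.relabel p.1 p.2, Γ.relabelIso p.1 p.2⟩
  invFun q := (q.2.vert.trans (finCongr q.2.N_eq.symm),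
    ⟨q.2.half.trans ((finCongr q.2.k_eq.symm).prodCongr (Equiv.refl _)), fun h => by
      simp [q.2.flip h]⟩)
  left_inv p := rfl
  right_inv q := by
    obtain ⟨Δ, f⟩ := q
    have hN := f.N_eq
    have hk := f.k_eq
    obtain ⟨N, k, genus, ends, leg, h1, h2, h3, h4⟩ := Γ
    obtain ⟨N', k', genus', ends', leg', h1', h2', h3', h4'⟩ := Δ
    simp only at hN hk
    subst hN hk
    obtain ⟨vert, half, flip, hends, hleg, hgenus⟩ := f
    simp only at vert half flip hends hleg hgenus
    obtain rfl : genus' = fun v => genus (vert.symm v) := funext fun v => by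
      rw [← hgenus]; simp
    obtain rfl : leg' = fun i => vert (leg i) := funext hleg
    obtain rfl : ends' = fun h => vert (ends (half.symm h)) := funext fun h => by
      rw [← hends]; simp
    rfl

theorem sum_card_iso [Fintype (StableGraph g n)] (Γ : StableGraph g n) :
    ∑ Δ, Nat.card (Iso Γ Δ) = Γ.N.factorial * (Γ.k.factorial * 2 ^ Γ.k) := by
  rw [← Nat.card_sigma, ← Nat.card_congr Γ.sigmaIsoEquiv, Nat.card_prod, card_halfPerm,
    Nat.card_perm, Nat.card_eq_fintype_card, Fintype.card_fin]

theorem card_iso_eq {Γ Δ : StableGraph g n} (f : Iso Γ Δ) : Nat.card (Iso Γ Δ) = Γ.autCard :=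
  Nat.card_congr ⟨fun f' => f'.trans f.symm, fun f' => f'.trans f, fun f' => by
    cases f'; cases f; simp [Iso.trans, Iso.symm, Equiv.trans_assoc], fun f' => by
    cases f'; cases f; simp [Iso.trans, Iso.symm, Equiv.trans_assoc]⟩

theorem finsum_eq_sum_graphCoef [Fintype (StableGraph g n)] (F : StableGraph g n → ℝ)
    (hF : ∀ Γ Δ, Iso Γ Δ → F Γ = F Δ) :
    ∑ᶠ c : Quotient (StableGraph.isoSetoid g n), ((c.out.autCard : ℝ))⁻¹ * F c.out
      = ∑ Γ : StableGraph g n, graphCoef Γ.N Γ.k * F Γ := by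
  classical
  haveI : Fintype (Quotient (StableGraph.isoSetoid g n)) := Fintype.ofFinite _
  rw [finsum_eq_sum_of_fintype, ← Finset.sum_fiberwise (s := univ)
    (g := fun Γ : StableGraph g n => (⟦Γ⟧ : Quotient (StableGraph.isoSetoid g n)))]
  refine sum_congr rfl fun q _ => ?_
  have hiso : ∀ Δ, ⟦Δ⟧ = q ↔ Nonempty (Iso q.out Δ) := fun Δ => by
    conv_lhs => rw [← q.out_eq]
    exact ⟨fun h => ⟨(Quotient.exact h).some.symm⟩, fun ⟨h⟩ => Quotient.sound ⟨h.symm⟩⟩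
  have e1 : ∀ Δ ∈ univ.filter (fun Δ : StableGraph g n => ⟦Δ⟧ = q),
      graphCoef Δ.N Δ.k * F Δ = graphCoef q.out.N q.out.k * F q.out := by
    intro Δ hΔ
    rw [Finset.mem_filter, hiso] at hΔ
    obtain ⟨f⟩ := hΔ.2
    rw [f.N_eq, f.k_eq, hF _ _ f]
  rw [sum_congr rfl e1, Finset.sum_const, nsmul_eq_mul, ← mul_assoc]
  congr 1
  have e2 := sum_card_iso q.out
  rw [← Finset.sum_filter_add_sum_filter_not _ (fun Δ : StableGraph g n => ⟦Δ⟧ = q),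
    sum_eq_zero (s := univ.filter fun Δ : StableGraph g n => ¬ ⟦Δ⟧ = q), add_zero,
    sum_congr rfl (g := fun _ => q.out.autCard), Finset.sum_const, smul_eq_mul] at e2
  · have hpos : (0 : ℝ) < q.out.autCard := by
      have : Nonempty (Iso q.out q.out) := ⟨Iso.refl _⟩
      exact_mod_cast Nat.card_pos
    rw [graphCoef, ← e2]
    have hc : (0 : ℝ) < (univ.filter fun Δ : StableGraph g n => ⟦Δ⟧ = q).card := by
      exact_mod_cast Finset.card_pos.2 ⟨q.out, by simp⟩
    push_cast
    field_simp
  · intro Δ hΔ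
    rw [Finset.mem_filter, hiso] at hΔ
    exact card_iso_eq hΔ.2.some
  · intro Δ hΔ
    rw [Finset.mem_filter, hiso] at hΔ
    have : IsEmpty (Iso q.out Δ) := not_nonempty_iff.1 hΔ.2
    exact Nat.card_of_isEmpty

end StableGraph


section HalfEdgeGraphs

variable {V : Type*} {m k n D : ℕ}

/-- The oriented edges given by the ends of the half-edges and their indices. -/
def mkEdges (ends : Fin k × Bool → V) (b : Fin k × Bool → Fin D) (e : Fin k) : DecEdge V D :=
  ((ends (e, false), b (e, false)), (ends (e, true), b (e, true)))

/-- Decorated oriented edges as pairs of functions on half-edges. -/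
def edgesEquiv (V : Type*) (k D : ℕ) :
    (Fin k × Bool → V) × (Fin k × Bool → Fin D) ≃ (Fin k → DecEdge V D) where
  toFun p := mkEdges p.1 p.2
  invFun ε := (fun h => bif h.2 then (ε h.1).2.1 else (ε h.1).1.1,
    fun h => bif h.2 then (ε h.1).2.2 else (ε h.1).1.2)
  left_inv p := by
    refine Prod.ext (funext fun h => ?_) (funext fun h => ?_) <;>
    · obtain ⟨e, s⟩ := h
      cases s <;> rfl
  right_inv ε := rfl

theorem vertexDeco_mkEdges [DecidableEq V] (ends : Fin k × Bool → V) (b : Fin k × Bool → Fin D)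
    (v : V) : vertexDeco (mkEdges ends b) v = fiberDeco ends (fun h => (b h : ℕ)) v := by
  rw [vertexDeco, fiberDeco, Fintype.sum_prod_type]
  refine sum_congr rfl fun e _ => ?_
  rw [Fintype.sum_bool, add_comm, edgeDeco]
  simp only [mkEdges]
  by_cases h1 : ends (e, false) = v <;> by_cases h2 : ends (e, true) = v <;> simp [h1, h2]

/-- Any two vertices are joined by a chain of edges. -/
def EndsConnected (ends : Fin k × Bool → V) : Prop := ∀ u v : V,
  Relation.ReflTransGen (fun a b => ∃ e s, ends (e, s) = a ∧ ends (e, !s) = b) u v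

theorem edgeConnected_mkEdges_iff (ends : Fin k × Bool → V) (b : Fin k × Bool → Fin D) :
    EdgeConnected (mkEdges ends b) ↔ EndsConnected ends := by
  constructor
  · intro h u v
    rcases h {v | Relation.ReflTransGen (fun a b => ∃ e s, ends (e, s) = a ∧ ends (e, !s) = b) u v}
      (fun e => ⟨fun h => h.tail ⟨e, false, rfl, rfl⟩, fun h => h.tail ⟨e, true, rfl, rfl⟩⟩)
      with h | h
    · have : u ∈ (∅ : Set V) := h ▸ Relation.ReflTransGen.refl
      exact this.elim
    · have : v ∈ {v | Relation.ReflTransGen (fun a b => ∃ e s, ends (e, s) = a ∧ ends (e, !s) = b) u v} :=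
        h ▸ Set.mem_univ v
      exact this
  · intro h A hA
    rcases Set.eq_empty_or_nonempty A with h' | ⟨u, hu⟩
    · exact Or.inl h'
    · right
      refine Set.eq_univ_of_forall fun v => ?_
      have := h u v
      induction this with
      | refl => exact hu
      | tail _ hab ih =>
        obtain ⟨e, s, rfl, rfl⟩ := hab
        cases s
        · exact (hA e).1 ih
        · exact (hA e).2 ih

/-- The contribution of a graph with legs, in terms of the expansion of the vertex weights. -/
def graphWeight (u : ℕ → ℕ → ℝ) (Z : Fock ℕ (PowerSeries ℝ)) (D : ℕ) (w : Fin n → ℕ → ℝ)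
    (genus : Fin m → ℕ) (ends : Fin k × Bool → Fin m) (leg : Fin n → Fin m) : ℝ :=
  ∑ b : Fin k × Bool → Fin D, ∑ c : Fin n → Fin D,
    (∏ e, u (b (e, false)) (b (e, true))) * (∏ i, w i (c i)) *
      ∏ v, coeff (2 * genus v + (fiberDeco ends (fun h => (b h : ℕ)) v
        + fiberDeco leg (fun i => (c i : ℕ)) v).card - 2)
        (Z (fiberDeco ends (fun h => (b h : ℕ)) v + fiberDeco leg (fun i => (c i : ℕ)) v))

theorem prod_halfPerm {k' : ℕ} {σ : Fin k × Bool ≃ Fin k' × Bool}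
    (hσ : ∀ h, σ (h.1, !h.2) = ((σ h).1, !(σ h).2)) (u : Fin k' × Bool → Fin k' × Bool → ℝ)
    (hu : ∀ x y, u x y = u y x) :
    ∏ e, u (σ (e, false)) (σ (e, true)) = ∏ e, u (e, false) (e, true) := by
  refine Fintype.prod_bijective _ (edgeMap_bijective hσ) _ _ fun e => ?_
  rw [edgeMap_eq hσ e true, edgeMap_eq hσ e false]
  cases (σ (e, false)).2
  · simp
  · simp [hu]

theorem graphWeight_iso {u : ℕ → ℕ → ℝ} (hu : ∀ a b, u a b = u b a) (Z : Fock ℕ (PowerSeries ℝ))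
    (D : ℕ) (w : Fin n → ℕ → ℝ) {g : ℕ} {Γ Δ : StableGraph g n} (f : StableGraph.Iso Γ Δ) :
    graphWeight u Z D w Γ.genus Γ.ends Γ.leg = graphWeight u Z D w Δ.genus Δ.ends Δ.leg := by
  refine Fintype.sum_equiv (Equiv.arrowCongr f.half (Equiv.refl _)) _ _ fun b => ?_
  refine sum_congr rfl fun c _ => ?_
  obtain ⟨b, rfl⟩ : ∃ b' : Fin Δ.k × Bool → Fin D, b = fun h => b' (f.half h) :=
    ⟨fun h => b (f.half.symm h), by simp⟩
  have hb : (Equiv.arrowCongr f.half (Equiv.refl (Fin D))) (fun h => b (f.half h)) = b := by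
    funext h; simp
  rw [hb, prod_halfPerm f.flip (fun x y => u (b x) (b y)) (fun x y => hu _ _)]
  congr 1
  refine Fintype.prod_equiv f.vert _ _ fun v => ?_
  have e1 : fiberDeco Γ.ends (fun h => (b (f.half h) : ℕ)) v
      = fiberDeco Δ.ends (fun h => (b h : ℕ)) (f.vert v) := by
    rw [fiberDeco, fiberDeco, ← f.half.sum_comp]
    refine sum_congr rfl fun h _ => ?_
    rw [f.ends]
    simp only [EmbeddingLike.apply_eq_iff_eq]
  have e2 : fiberDeco Γ.leg (fun i => (c i : ℕ)) v
      = fiberDeco Δ.leg (fun i => (c i : ℕ)) (f.vert v) := by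
    refine sum_congr rfl fun h _ => ?_
    rw [f.leg]
    simp only [EmbeddingLike.apply_eq_iff_eq]
  rw [e1, e2, f.genus]

/-- The number of half-edges and legs at a vertex. -/
def valence (ends : Fin k × Bool → Fin m) (leg : Fin n → Fin m) (v : Fin m) : ℕ :=
  (univ.filter fun h => ends h = v).card + (univ.filter fun i => leg i = v).card

theorem sum_valence (ends : Fin k × Bool → Fin m) (leg : Fin n → Fin m) :
    ∑ v, valence ends leg v = 2 * k + n := by
  have h1 := Finset.card_eq_sum_card_fiberwise (s := (univ : Finset (Fin k × Bool)))
    (t := univ) (f := ends) (fun _ _ => Finset.mem_coe.2 (mem_univ _))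
  have h2 := Finset.card_eq_sum_card_fiberwise (s := (univ : Finset (Fin n)))
    (t := univ) (f := leg) (fun _ _ => Finset.mem_coe.2 (mem_univ _))
  simp only [valence, sum_add_distrib, ← h1, ← h2]
  simp [mul_comm]

open Classical in
theorem sum_coeff_graphSum {u : ℕ → ℕ → ℝ} {Z : Fock ℕ (PowerSeries ℝ)} {χ : ℕ}
    (hZ : ∀ (K : Multiset ℕ) i, i ≤ χ → ¬ (0 < i ∧ ∃ h, i + 2 = 2 * h + K.card) → coeff i (Z K) = 0)
    (D : ℕ) (w : Fin n → ℕ → ℝ) (m k : ℕ) :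
    ∑ c : Fin n → Fin D, (∏ i, w i (c i)) * coeff χ (graphSum (Fin m) (Fin k) D
        (fun a b => PowerSeries.C (u a b)) Z ((univ : Finset (Fin n)).val.map
          fun i => (c i : ℕ)))
      = ∑ x : (Fin k × Bool → Fin m) × (Fin n → Fin m) × (Fin m → Fin (χ + 3)),
        if EndsConnected x.1 ∧ (∑ v, (2 * (x.2.2 v : ℕ) + valence x.1 x.2.1 v) = χ + 2 * m ∧
            ∀ v, 2 < 2 * (x.2.2 v : ℕ) + valence x.1 x.2.1 v) then
          graphWeight u Z D w (fun v => (x.2.2 v : ℕ)) x.1 x.2.1 else 0 := by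
  have hcard : ∀ (ends : Fin k × Bool → Fin m) (leg : Fin n → Fin m) (b : Fin k × Bool → Fin D)
      (c : Fin n → Fin D) v, (fiberDeco ends (fun h => (b h : ℕ)) v
        + fiberDeco leg (fun i => (c i : ℕ)) v).card = valence ends leg v := by
    intro ends leg b c v
    rw [Multiset.card_add, card_fiberDeco, card_fiberDeco, valence]
  have h1 : ∀ c : Fin n → Fin D, coeff χ (graphSum (Fin m) (Fin k) D
        (fun a b => PowerSeries.C (u a b)) Z ((univ : Finset (Fin n)).val.map
          fun i => (c i : ℕ)))
      = ∑ ends : Fin k × Bool → Fin m, ∑ b : Fin k × Bool → Fin D, ∑ leg : Fin n → Fin m,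
        ∑ h : Fin m → Fin (χ + 3),
        if EndsConnected ends ∧ (∑ v, (2 * (h v : ℕ) + valence ends leg v) = χ + 2 * m ∧
            ∀ v, 2 < 2 * (h v : ℕ) + valence ends leg v) then
          (∏ e, u (b (e, false)) (b (e, true))) * ∏ v, coeff (2 * (h v : ℕ) + (fiberDeco ends
            (fun h => (b h : ℕ)) v + fiberDeco leg (fun i => (c i : ℕ)) v).card - 2)
            (Z (fiberDeco ends (fun h => (b h : ℕ)) v + fiberDeco leg (fun i => (c i : ℕ)) v))
        else 0 := by
    intro c
    rw [graphSum_eq, ← (edgesEquiv (Fin m) k D).sum_comp, Fintype.sum_prod_type, Fock.sum_apply,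
      map_sum]
    refine sum_congr rfl fun ends _ => ?_
    rw [Fock.sum_apply, map_sum]
    refine sum_congr rfl fun b _ => ?_
    have hc : EdgeConnected (edgesEquiv (Fin m) k D (ends, b)) ↔ EndsConnected ends :=
      edgeConnected_mkEdges_iff ends b
    by_cases hcon : EndsConnected ends
    · rw [if_pos (hc.2 hcon), graphTerm, Fock.smul_apply, Fock.prod_apply_fiber, ← map_prod,
        PowerSeries.coeff_C_mul, map_sum, mul_sum]
      refine sum_congr rfl fun leg _ => ?_
      have hv : ∀ v, Fock.shift (vertexDeco (edgesEquiv (Fin m) k D (ends, b)) v) Z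
          (fiberDeco leg (fun i => (c i : ℕ)) v) = Z (fiberDeco ends (fun h => (b h : ℕ)) v
            + fiberDeco leg (fun i => (c i : ℕ)) v) := fun v => by
        rw [Fock.shift_apply, ← vertexDeco_mkEdges]; rfl
      simp only [hv]
      rw [coeff_prod_genus _ (fun v => valence ends leg v) (Nat.lt_succ_self _)
        (fun v i hi hn => hZ _ i hi (by rwa [hcard])), mul_sum]
      refine sum_congr rfl fun h _ => ?_
      simp only [hcon, true_and, mul_ite, mul_zero, hcard]
      rfl
    · rw [if_neg (fun h => hcon (hc.1 h))]
      simp [hcon]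
  simp only [h1, mul_sum]
  simp only [Fintype.sum_prod_type]
  rw [sum_comm]
  refine sum_congr rfl fun ends _ => ?_
  rw [sum_congr rfl fun c _ => sum_comm, sum_comm]
  refine sum_congr rfl fun leg _ => ?_
  rw [sum_congr rfl fun c _ => sum_comm, sum_comm]
  refine sum_congr rfl fun h _ => ?_
  split_ifs with hcond
  · rw [graphWeight, sum_comm]
    refine sum_congr₂ fun b _ c _ => ?_
    ring
  · simp

end HalfEdgeGraphs

theorem corr_twistZ_eq_sum {u : ℕ → ℕ → ℝ} {σ : ℕ → ℝ} {D N g n : ℕ} [Fintype (StableGraph g n)]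
    (hD : 2 * N + 3 ≤ D) (hn : 0 < n) (hN : 2 * g + n ≤ N + 2) (hst : Stable g n)
    (w : Fin n → ℕ → ℝ) : corr (RingHom.id ℝ) D (twistZ u σ D N) g 0 w
      = ∑ Γ : StableGraph g n, graphCoef Γ.N Γ.k *
          graphWeight u (airyZ σ D N) D w Γ.genus Γ.ends Γ.leg := by
  classical
  obtain ⟨χ, hχ⟩ : ∃ χ, 2 * g + n = χ + 2 := ⟨2 * g + n - 2, by unfold Stable at hst; omega⟩
  have hZ : ∀ (K : Multiset ℕ) i, i ≤ χ → ¬ (0 < i ∧ ∃ h, i + 2 = 2 * h + K.card) →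
      coeff i (airyZ σ D N K) = 0 := by
    intro K i hi h
    rcases Nat.eq_zero_or_pos i with rfl | h0
    · exact coeff_zero_airyZ σ hD K
    · exact coeff_airyZ_eq_zero σ hD (Or.inr fun h' => h ⟨h0, h'⟩)
  rw [corr, evM]
  simp only [zero_add, Multiset.card_zero, RingHom.id_apply]
  rw [show 2 * g + n - 2 = χ by omega]
  have e1 : ∀ K, coeff χ (twistZ u σ D N K) = ∑ k ∈ range (2 * N + 1),
      ∑ m ∈ range (N + 2), graphCoef m k * coeff χ (graphSum (Fin m) (Fin k) D
        (fun a b => PowerSeries.C (u a b)) (airyZ σ D N) K) := by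
    intro K
    simp only [twistZ, graphPart, Fock.sum_apply, map_sum, Fock.smul_apply, PowerSeries.coeff_C_mul]
  simp only [e1, mul_sum]
  rw [sum_comm, Finset.sum_range]
  have e2 : ∀ k : Fin (2 * N + 1), ∑ c : Fin n → Fin D, ∑ m ∈ range (N + 2),
      (∏ i, w i (c i)) * (graphCoef m k * coeff χ (graphSum (Fin m) (Fin k) D
        (fun a b => PowerSeries.C (u a b)) (airyZ σ D N)
          ((univ : Finset (Fin n)).val.map fun i => (c i : ℕ))))
      = ∑ m : Fin (N + 2), ∑ x : (Fin k × Bool → Fin m) × (Fin n → Fin m) × (Fin m → Fin (χ + 3)),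
        graphCoef m k * if EndsConnected x.1 ∧ (∑ v, (2 * (x.2.2 v : ℕ) + valence x.1 x.2.1 v)
            = χ + 2 * m ∧ ∀ v, 2 < 2 * (x.2.2 v : ℕ) + valence x.1 x.2.1 v) then
          graphWeight u (airyZ σ D N) D w (fun v => (x.2.2 v : ℕ)) x.1 x.2.1 else 0 := by
    intro k
    rw [sum_comm, Finset.sum_range]
    refine sum_congr rfl fun m _ => ?_
    rw [← mul_sum, ← sum_coeff_graphSum hZ D w m k, mul_sum]
    refine sum_congr rfl fun c _ => ?_
    ring
  rw [sum_congr rfl fun k _ => e2 k]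
  have key : ∀ Γ : StableGraph g n, Γ.k < 2 * N + 1 ∧ Γ.N < N + 2 ∧ (∀ v, Γ.genus v < χ + 3) ∧
      ∑ v, (2 * Γ.genus v + valence Γ.ends Γ.leg v) = χ + 2 * Γ.N := by
    intro Γ
    have h1 := sum_valence Γ.ends Γ.leg
    have h2 := Γ.genus_eq
    have h3 : ∑ v, (2 * Γ.genus v + valence Γ.ends Γ.leg v) = χ + 2 * Γ.N := by
      rw [sum_add_distrib, ← mul_sum, h1]; omega
    have hst' : ∀ v, 3 ≤ 2 * Γ.genus v + valence Γ.ends Γ.leg v := fun v => Γ.stable v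
    have h4 : ∑ v : Fin Γ.N, 3 ≤ ∑ v, (2 * Γ.genus v + valence Γ.ends Γ.leg v) :=
      Finset.sum_le_sum fun v _ => hst' v
    simp only [Finset.sum_const, Finset.card_univ, Fintype.card_fin, smul_eq_mul] at h4
    refine ⟨by omega, by omega, fun v => ?_, h3⟩
    have h5 : ∑ w ∈ univ.erase v, 3 ≤
        ∑ w ∈ univ.erase v, (2 * Γ.genus w + valence Γ.ends Γ.leg w) :=
      Finset.sum_le_sum fun v _ => hst' v
    have h6 := Finset.add_sum_erase univ (fun w => 2 * Γ.genus w + valence Γ.ends Γ.leg w)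
      (mem_univ v)
    simp only [Finset.sum_const, Finset.card_erase_of_mem (mem_univ v), Finset.card_univ,
      Fintype.card_fin, smul_eq_mul] at h5
    beta_reduce at h6
    have := Γ.nonempty
    omega
  rw [sum_congr rfl fun (k : Fin (2 * N + 1)) _ => (Fintype.sum_sigma' (fun (m : Fin (N + 2))
    (x : (Fin k × Bool → Fin m) × (Fin n → Fin m) × (Fin m → Fin (χ + 3))) => graphCoef m k *
      if EndsConnected x.1 ∧ (∑ v, (2 * (x.2.2 v : ℕ) + valence x.1 x.2.1 v)
            = χ + 2 * m ∧ ∀ v, 2 < 2 * (x.2.2 v : ℕ) + valence x.1 x.2.1 v) then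
          graphWeight u (airyZ σ D N) D w (fun v => (x.2.2 v : ℕ)) x.1 x.2.1 else 0)).symm,
    ← Fintype.sum_sigma']
  symm
  refine Fintype.sum_of_injective (fun Γ : StableGraph g n =>
    (⟨⟨Γ.k, (key Γ).1⟩, ⟨⟨Γ.N, (key Γ).2.1⟩, (Γ.ends, Γ.leg, fun v => ⟨Γ.genus v, (key Γ).2.2.1 v⟩)⟩⟩ :
      Σ (k : Fin (2 * N + 1)) (m : Fin (N + 2)),
        (Fin k × Bool → Fin m) × (Fin n → Fin m) × (Fin m → Fin (χ + 3)))) ?_ _ _ ?_ ?_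
  · rintro ⟨m, k, a, b, c, h1, h2, h3, h4⟩ ⟨m', k', a', b', c', h1', h2', h3', h4'⟩ h
    rw [Sigma.mk.inj_iff] at h
    obtain ⟨h0, h⟩ := h
    obtain rfl : k = k' := congrArg Fin.val h0
    rw [heq_eq_eq, Sigma.mk.inj_iff] at h
    obtain ⟨h0, h⟩ := h
    obtain rfl : m = m' := congrArg Fin.val h0
    rw [heq_eq_eq, Prod.mk.injEq, Prod.mk.injEq] at h
    obtain ⟨rfl, rfl, h⟩ := h
    obtain rfl : a = a' := funext fun v => by simpa using congrArg Fin.val (congrFun h v)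
    rfl
  · rintro ⟨k, m, ends, leg, h⟩ hx
    simp only
    split_ifs with hcond
    · exfalso
      apply hx
      obtain ⟨hc1, hc2, hc3⟩ := hcond
      refine ⟨⟨m, k, fun v => h v, ends, leg, ?_, hc1, hc3, ?_⟩, rfl⟩
      · exact Fin.pos (leg ⟨0, hn⟩)
      · rw [sum_add_distrib, ← mul_sum, sum_valence] at hc2
        omega
    · rw [mul_zero]
  · intro Γ
    simp only
    rw [if_pos ⟨Γ.connected, (key Γ).2.2.2, Γ.stable⟩]


/-- The normalised even powers. -/
def psi (L : ℝ) (a : ℕ) : ℝ := L ^ (2 * a) / (Nat.factorial (2 * a + 1) : ℝ)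

theorem univ_val_map_subtype {X Y : Type*} [Fintype X] (q : X → Prop) [DecidablePred q] (f : X → Y) :
    (univ : Finset {x // q x}).val.map (fun x : {x // q x} => f x.1)
      = (univ.filter q).val.map f := by
  have h := congrArg (fun s : Finset X => s.val.map f)
    (Finset.subtype_map (s := univ) q)
  simp only [Finset.map_val, Multiset.map_map, Finset.subtype_univ] at h
  exact h

namespace StableGraph

variable {g n : ℕ}

theorem map_lengths {Y : Type*} (Γ : StableGraph g n) (ℓ : Fin Γ.k → ℝ) (L : Fin n → ℝ) (v : Fin Γ.N)
    (f : ℝ → Y) : (((Γ.lengths ℓ L v).map f : List Y) : Multiset Y)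
      = (univ : Finset {x // Sum.elim Γ.ends Γ.leg x = v}).val.map
        fun x : {x // Sum.elim Γ.ends Γ.leg x = v} =>
          f (Sum.elim (fun h : Fin Γ.k × Bool => ℓ h.1) L x.1) := by
  rw [univ_val_map_subtype (fun x => Sum.elim Γ.ends Γ.leg x = v)
    fun x => f (Sum.elim (fun h : Fin Γ.k × Bool => ℓ h.1) L x)]
  have h1 : ((((List.finRange Γ.k).product [false, true]).filter fun h => Γ.ends h = v : List _) :
      Multiset (Fin Γ.k × Bool)) = (univ.filter fun h => Γ.ends h = v).val := by
    refine (Multiset.Nodup.ext ?_ (Finset.nodup _)).2 fun h => ?_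
    · exact Multiset.coe_nodup.2 (((List.nodup_finRange _).product (by simp)).filter _)
    · obtain ⟨e, s⟩ := h
      cases s <;> simp [List.product]
  have h2 : (((List.finRange n).filter fun i => Γ.leg i = v : List _) : Multiset (Fin n))
      = (univ.filter fun i => Γ.leg i = v).val := by
    refine (Multiset.Nodup.ext ?_ (Finset.nodup _)).2 fun h => ?_
    · exact Multiset.coe_nodup.2 ((List.nodup_finRange _).filter _)
    · simp
  have h3 : (univ.filter fun x => Sum.elim Γ.ends Γ.leg x = v).val
      = (univ.filter fun h => Γ.ends h = v).val.map Sum.inl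
        + (univ.filter fun i => Γ.leg i = v).val.map Sum.inr := by
    have : (univ.filter fun x => Sum.elim Γ.ends Γ.leg x = v)
        = (univ.filter fun h => Γ.ends h = v).disjSum
          (univ.filter fun i => Γ.leg i = v) := by
      ext x; cases x <;> simp
    rw [this]; rfl
  rw [h3, ← h1, ← h2]
  simp only [lengths, List.map_append, List.map_map, Multiset.map_add, Multiset.map_map,
    Multiset.map_coe, Multiset.coe_add]
  rfl

theorem length_lengths (Γ : StableGraph g n) (ℓ : Fin Γ.k → ℝ) (L : Fin n → ℝ) (v : Fin Γ.N) :
    (Γ.lengths ℓ L v).length = valence Γ.ends Γ.leg v := by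
  have := congrArg Multiset.card (Γ.map_lengths ℓ L v id)
  rw [Multiset.coe_card, List.length_map, Multiset.card_map, Finset.card_val, Finset.card_univ,
    Fintype.card_subtype] at this
  rw [this, valence]
  have : (univ.filter fun x => Sum.elim Γ.ends Γ.leg x = v)
        = (univ.filter fun h => Γ.ends h = v).disjSum
          (univ.filter fun i => Γ.leg i = v) := by
    ext x; cases x <;> simp
  rw [this, Finset.card_disjSum]

theorem lengths_pos (Γ : StableGraph g n) {ℓ : Fin Γ.k → ℝ} {L : Fin n → ℝ} (hℓ : ∀ e, 0 < ℓ e)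
    (hL : ∀ i, 0 < L i) (v : Fin Γ.N) : ∀ x ∈ Γ.lengths ℓ L v, 0 < x := by
  intro x hx
  simp only [lengths, List.mem_append, List.mem_map] at hx
  rcases hx with ⟨h, _, rfl⟩ | ⟨i, _, rfl⟩
  · exact hℓ _
  · exact hL _

theorem two_mul_genus_add_valence_le (Γ : StableGraph g n) (v : Fin Γ.N) :
    2 * Γ.genus v + valence Γ.ends Γ.leg v ≤ 2 * g + n := by
  have h1 := sum_valence Γ.ends Γ.leg
  have h2 := Γ.genus_eq
  have h3 : ∑ v, (2 * Γ.genus v + valence Γ.ends Γ.leg v) + 2 = 2 * g + n + 2 * Γ.N := by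
    rw [sum_add_distrib, ← mul_sum, h1]; omega
  have hst' : ∀ v, 3 ≤ 2 * Γ.genus v + valence Γ.ends Γ.leg v := fun v => Γ.stable v
  have h5 : ∑ w ∈ univ.erase v, 3 ≤
      ∑ w ∈ univ.erase v, (2 * Γ.genus w + valence Γ.ends Γ.leg w) :=
    Finset.sum_le_sum fun v _ => hst' v
  have h6 := Finset.add_sum_erase univ (fun w => 2 * Γ.genus w + valence Γ.ends Γ.leg w)
    (mem_univ v)
  simp only [Finset.sum_const, Finset.card_erase_of_mem (mem_univ v), Finset.card_univ,
    Fintype.card_fin, smul_eq_mul] at h5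
  beta_reduce at h6
  have := Γ.nonempty
  omega

variable {𝒟 : ABOData} {f : ℝ → ℝ} {σ : ℕ → ℝ} {D N : ℕ} {u : ℕ → ℕ → ℝ}

theorem prod_vol_eq (Γ : StableGraph g n) (hD : 2 * N + 3 ≤ D) (hN : 2 * g + n ≤ N + 2)
    (hvol : ∀ (g n : ℕ) (L : Fin n → ℝ), 0 < n → Stable g n → 2 * g + n ≤ N + 2 → (∀ i, 0 < L i) →
      vol 𝒟 g n L = corr (RingHom.id ℝ) D (airyZ σ D N) g 0 fun i => psi (L i))
    {ℓ : Fin Γ.k → ℝ} {L : Fin n → ℝ} (hℓ : ∀ e, 0 < ℓ e) (hL : ∀ i, 0 < L i) :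
    ∏ v, vol 𝒟 (Γ.genus v) (Γ.lengths ℓ L v).length (Γ.lengths ℓ L v).get
      = ∑ b : Fin Γ.k × Bool → Fin D, ∑ c : Fin n → Fin D,
        (∏ e, psi (ℓ e) (b (e, false)) * psi (ℓ e) (b (e, true))) * ((∏ i, psi (L i) (c i)) *
          ∏ v, coeff (2 * Γ.genus v + (fiberDeco Γ.ends (fun h => (b h : ℕ)) v
            + fiberDeco Γ.leg (fun i => (c i : ℕ)) v).card - 2)
            (airyZ σ D N (fiberDeco Γ.ends (fun h => (b h : ℕ)) v
              + fiberDeco Γ.leg (fun i => (c i : ℕ)) v))) := by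
  have h1 : ∀ v, vol 𝒟 (Γ.genus v) (Γ.lengths ℓ L v).length (Γ.lengths ℓ L v).get
      = evM D (fun x : {x // Sum.elim Γ.ends Γ.leg x = v} =>
          psi (Sum.elim (fun h : Fin Γ.k × Bool => ℓ h.1) L x))
        fun K => coeff (2 * Γ.genus v + K.card - 2) (airyZ σ D N K) := by
    intro v
    have e1 : vol 𝒟 (Γ.genus v) (Γ.lengths ℓ L v).length (Γ.lengths ℓ L v).get
        = evM D (fun i : Fin (Γ.lengths ℓ L v).length => psi ((Γ.lengths ℓ L v).get i))
          fun K => coeff (2 * Γ.genus v + K.card - 2) (airyZ σ D N K) := by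
      rcases Nat.eq_zero_or_pos (Γ.lengths ℓ L v).length with h0 | h0
      · have hnil := List.length_eq_zero_iff.1 h0
        rw [hnil]
        have : vol 𝒟 (Γ.genus v) 0 (([] : List ℝ).get) = 0 := by rw [vol]
        refine this.trans ?_
        exact ((evM_zero_index D _ _).trans (by rw [airyZ_zero]; simp)).symm
      · rw [hvol _ _ _ h0 _ _ _, corr]
        · refine evM_congr _ _ fun K hK => ?_
          rw [hK, Fintype.card_fin, zero_add, Multiset.card_zero, zero_add]; rfl
        · rw [length_lengths]; exact Γ.stable v
        · rw [length_lengths]; exact (Γ.two_mul_genus_add_valence_le v).trans hN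
        · exact fun i => Γ.lengths_pos hℓ hL v _ (List.get_mem _ _)
    rw [e1]
    refine evM_eq_of_map_eq D ?_ _
    rw [← Γ.map_lengths ℓ L v psi, Fin.univ_val_map]
    congr 1
    exact List.ext_get (by simp) (by simp)
  rw [prod_congr rfl fun v _ => h1 v,
    prod_evM_fiber D (Sum.elim Γ.ends Γ.leg) (fun x => psi (Sum.elim (fun h => ℓ h.1) L x)),
    ← (Equiv.sumArrowEquivProdArrow _ _ _).symm.sum_comp, Fintype.sum_prod_type]
  refine sum_congr₂ fun b _ c _ => ?_
  rw [Fintype.prod_sum_type, Fintype.prod_prod_type, mul_assoc]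
  simp only [Fintype.prod_bool, fiberDeco_sum]
  congr 1
  exact prod_congr rfl fun e _ => mul_comm _ _

theorem weight_eq_graphWeight (Γ : StableGraph g n) (hD : 2 * N + 3 ≤ D) (hN : 2 * g + n ≤ N + 2)
    (hvol : ∀ (g n : ℕ) (L : Fin n → ℝ), 0 < n → Stable g n → 2 * g + n ≤ N + 2 → (∀ i, 0 < L i) →
      vol 𝒟 g n L = corr (RingHom.id ℝ) D (airyZ σ D N) g 0 fun i => psi (L i))
    (hint : ∀ a b, IntegrableOn (fun ℓ => psi ℓ a * psi ℓ b * (f ℓ * ℓ)) (Set.Ioi 0))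
    (hu : ∀ a b, ∫ ℓ in Set.Ioi (0 : ℝ), psi ℓ a * psi ℓ b * (f ℓ * ℓ) = u a b)
    {L : Fin n → ℝ} (hL : ∀ i, 0 < L i) :
    Γ.weight 𝒟 f L = graphWeight u (airyZ σ D N) D (fun i => psi (L i)) Γ.genus Γ.ends Γ.leg := by
  have hm : (volume : Measure (Fin Γ.k → ℝ)).restrict (Set.univ.pi fun _ => Set.Ioi (0 : ℝ))
      = Measure.pi fun _ => (volume : Measure ℝ).restrict (Set.Ioi 0) := by
    rw [volume_pi, Measure.restrict_pi_pi]
  have hI : ∀ b : Fin Γ.k × Bool → Fin D, Integrable (fun ℓ : Fin Γ.k → ℝ =>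
      ∏ e, (psi (ℓ e) (b (e, false)) * psi (ℓ e) (b (e, true)) * (f (ℓ e) * ℓ e)))
      (Measure.pi fun _ => (volume : Measure ℝ).restrict (Set.Ioi 0)) := fun b =>
    Integrable.fintype_prod (f := fun e ℓ => psi ℓ (b (e, false)) * psi ℓ (b (e, true)) * (f ℓ * ℓ))
      fun e => hint _ _
  have hv : ∀ b : Fin Γ.k × Bool → Fin D, ∫ ℓ : Fin Γ.k → ℝ,
      ∏ e, (psi (ℓ e) (b (e, false)) * psi (ℓ e) (b (e, true)) * (f (ℓ e) * ℓ e))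
      ∂(Measure.pi fun _ => (volume : Measure ℝ).restrict (Set.Ioi 0))
      = ∏ e, u (b (e, false)) (b (e, true)) := fun b => by
    rw [integral_fintype_prod_eq_prod
      (f := fun e ℓ => psi ℓ (b (e, false)) * psi ℓ (b (e, true)) * (f ℓ * ℓ))]
    exact prod_congr rfl fun e _ => hu _ _
  rw [weight, setIntegral_congr_fun (g := fun ℓ : Fin Γ.k → ℝ =>
    ∑ b : Fin Γ.k × Bool → Fin D, ∑ c : Fin n → Fin D,
        (∏ e, (psi (ℓ e) (b (e, false)) * psi (ℓ e) (b (e, true)) * (f (ℓ e) * ℓ e)))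
          * ((∏ i, psi (L i) (c i)) *
          ∏ v, coeff (2 * Γ.genus v + (fiberDeco Γ.ends (fun h => (b h : ℕ)) v
            + fiberDeco Γ.leg (fun i => (c i : ℕ)) v).card - 2)
            (airyZ σ D N (fiberDeco Γ.ends (fun h => (b h : ℕ)) v
              + fiberDeco Γ.leg (fun i => (c i : ℕ)) v))))
    (MeasurableSet.univ_pi fun _ => measurableSet_Ioi), hm]
  · rw [integral_finsetSum _ fun b _ => integrable_finsetSum _ fun c _ => (hI b).mul_const _]
    refine sum_congr rfl fun b _ => ?_
    rw [integral_finsetSum _ fun c _ => (hI b).mul_const _]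
    refine sum_congr rfl fun c _ => ?_
    rw [integral_mul_const, hv, mul_assoc]
  · intro ℓ hℓ
    simp only
    rw [Γ.prod_vol_eq hD hN hvol (fun e => hℓ e (Set.mem_univ e)) hL, sum_mul]
    refine sum_congr rfl fun b _ => ?_
    rw [sum_mul]
    refine sum_congr rfl fun c _ => ?_
    rw [Finset.prod_mul_distrib (g := fun e => f (ℓ e) * ℓ e)]
    ring

end StableGraph

theorem twistedVol_eq_corr {𝒟 : ABOData} {f : ℝ → ℝ} {σ : ℕ → ℝ} {D N g n : ℕ} {u : ℕ → ℕ → ℝ}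
    (hD : 2 * N + 3 ≤ D) (hn : 0 < n) (hst : Stable g n) (hN : 2 * g + n ≤ N + 2)
    (hvol : ∀ (g n : ℕ) (L : Fin n → ℝ), 0 < n → Stable g n → 2 * g + n ≤ N + 2 → (∀ i, 0 < L i) →
      vol 𝒟 g n L = corr (RingHom.id ℝ) D (airyZ σ D N) g 0 fun i => psi (L i))
    (hint : ∀ a b, IntegrableOn (fun ℓ => psi ℓ a * psi ℓ b * (f ℓ * ℓ)) (Set.Ioi 0))
    (hu : ∀ a b, ∫ ℓ in Set.Ioi (0 : ℝ), psi ℓ a * psi ℓ b * (f ℓ * ℓ) = u a b)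
    {L : Fin n → ℝ} (hL : ∀ i, 0 < L i) :
    twistedVol 𝒟 f g n L
      = corr (RingHom.id ℝ) D (twistZ u σ D N) g 0 fun i => psi (L i) := by
  haveI : Fintype (StableGraph g n) := Fintype.ofFinite _
  have hus : ∀ a b, u a b = u b a := fun a b => by
    rw [← hu, ← hu]; simp only [mul_comm (psi _ a)]
  have hw : ∀ Γ : StableGraph g n, Γ.weight 𝒟 f L
      = graphWeight u (airyZ σ D N) D (fun i => psi (L i)) Γ.genus Γ.ends Γ.leg := fun Γ =>
    Γ.weight_eq_graphWeight hD hN hvol hint hu hL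
  rw [twistedVol, corr_twistZ_eq_sum hD hn hN hst]
  refine (StableGraph.finsum_eq_sum_graphCoef (fun Γ => Γ.weight 𝒟 f L) ?_).trans ?_
  · intro Γ Δ f
    rw [hw, hw]
    exact graphWeight_iso hus _ _ _ f
  · simp only [hw]


/-- The divided power `x ^ k / k!`. -/
def divPow (k : ℕ) (x : ℝ) : ℝ := x ^ k / (Nat.factorial k : ℝ)

theorem divPow_zero (x : ℝ) : divPow 0 x = 1 := by simp [divPow]

theorem divPow_succ_zero (k : ℕ) : divPow (k + 1) 0 = 0 := by simp [divPow]

theorem divPow_nonneg (k : ℕ) {x : ℝ} (hx : 0 ≤ x) : 0 ≤ divPow k x := by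
  unfold divPow; positivity

theorem continuous_divPow (k : ℕ) : Continuous (divPow k) := by unfold divPow; fun_prop

theorem hasDerivAt_divPow (k : ℕ) (x : ℝ) : HasDerivAt (divPow (k + 1)) (divPow k x) x := by
  refine ((hasDerivAt_pow (k + 1) x).div_const (Nat.factorial (k + 1) : ℝ)).congr_deriv ?_
  rw [divPow, Nat.factorial_succ]
  have := Nat.factorial_pos k
  push_cast
  field_simp

theorem divPow_neg_of_even {k : ℕ} (hk : Even k) (x : ℝ) : divPow k (-x) = divPow k x := by
  rw [divPow, hk.neg_pow, divPow]

theorem divPow_neg_of_odd {k : ℕ} (hk : Odd k) (x : ℝ) : divPow k (-x) = -divPow k x := by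
  rw [divPow, hk.neg_pow, neg_div, divPow]

/-- `∑_{i ≤ k} u^{-(k-i)-1} x^i / i!`, so that `-expPoly u k x * exp (-u x)` is a primitive of
`x ^ k / k! * exp (-u x)`. -/
def expPoly (u : ℝ) : ℕ → ℝ → ℝ
  | 0, _ => u⁻¹
  | k + 1, x => (divPow (k + 1) x + expPoly u k x) * u⁻¹

theorem expPoly_apply_zero (u : ℝ) (k : ℕ) : expPoly u k 0 = (u⁻¹) ^ (k + 1) := by
  induction k with
  | zero => simp [expPoly]
  | succ k ih => rw [expPoly, ih, divPow_succ_zero]; ring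

theorem hasDerivAt_expPoly {u : ℝ} (hu : u ≠ 0) (k : ℕ) (x : ℝ) :
    HasDerivAt (expPoly u k) (u * expPoly u k x - divPow k x) x := by
  induction k with
  | zero =>
    rw [divPow_zero, expPoly, mul_inv_cancel₀ hu, sub_self]
    exact hasDerivAt_const x _
  | succ k ih =>
    refine (((hasDerivAt_divPow k x).add ih).mul_const u⁻¹).congr_deriv ?_
    rw [expPoly]; field_simp; ring

theorem hasDerivAt_expPoly_mul_exp {u : ℝ} (hu : u ≠ 0) (k : ℕ) (x : ℝ) :
    HasDerivAt (fun x => -(expPoly u k x * Real.exp (-u * x))) (divPow k x * Real.exp (-u * x)) x := by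
  have h : HasDerivAt (fun x => Real.exp (-u * x)) (Real.exp (-u * x) * -u) x := by
    simpa using ((hasDerivAt_id x).const_mul (-u)).exp
  refine ((hasDerivAt_expPoly hu k x).mul h).neg.congr_deriv ?_
  ring

theorem tendsto_divPow_mul_exp {u : ℝ} (hu : 0 < u) (k : ℕ) :
    Tendsto (fun x => divPow k x * Real.exp (-u * x)) atTop (𝓝 0) := by
  have := (Real.tendsto_pow_mul_exp_neg_atTop_nhds_zero k).comp (tendsto_id.const_mul_atTop hu)
  have := this.mul_const (u⁻¹ ^ k / (Nat.factorial k : ℝ))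
  rw [zero_mul] at this
  refine this.congr fun x => ?_
  simp only [Function.comp, id, divPow, neg_mul, mul_pow, inv_pow]
  field_simp

theorem tendsto_expPoly_mul_exp {u : ℝ} (hu : 0 < u) (k : ℕ) :
    Tendsto (fun x => expPoly u k x * Real.exp (-u * x)) atTop (𝓝 0) := by
  induction k with
  | zero =>
    have := (tendsto_divPow_mul_exp hu 0).const_mul u⁻¹
    rw [mul_zero] at this
    exact this.congr fun x => by rw [divPow_zero, expPoly, one_mul]
  | succ k ih =>
    have := ((tendsto_divPow_mul_exp hu (k + 1)).add ih).mul_const u⁻¹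
    rw [add_zero, zero_mul] at this
    exact this.congr fun x => by rw [expPoly]; ring

theorem integrableOn_divPow_mul_exp {u : ℝ} (hu : 0 < u) (k : ℕ) {t : ℝ} (ht : 0 ≤ t) :
    IntegrableOn (fun x => divPow k x * Real.exp (-u * x)) (Set.Ioi t) := by
  have h0 := (tendsto_expPoly_mul_exp hu k).neg
  exact integrableOn_Ioi_deriv_of_nonneg' (fun x _ => hasDerivAt_expPoly_mul_exp hu.ne' k x)
    (fun x hx => mul_nonneg (divPow_nonneg k (ht.trans (le_of_lt hx))) (Real.exp_nonneg _)) h0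

theorem integral_Ioi_divPow_mul_exp {u : ℝ} (hu : 0 < u) (k : ℕ) {t : ℝ} (ht : 0 ≤ t) :
    ∫ x in Set.Ioi t, divPow k x * Real.exp (-u * x) = expPoly u k t * Real.exp (-u * t) := by
  have h0 := (tendsto_expPoly_mul_exp hu k).neg
  rw [integral_Ioi_of_hasDerivAt_of_nonneg' (fun x _ => hasDerivAt_expPoly_mul_exp hu.ne' k x)
    (fun x hx => mul_nonneg (divPow_nonneg k (ht.trans (le_of_lt hx))) (Real.exp_nonneg _)) h0]
  ring

theorem integral_divPow_mul_exp {u : ℝ} (hu : u ≠ 0) (k : ℕ) (t : ℝ) :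
    ∫ x in (0 : ℝ)..t, divPow k x * Real.exp (-u * x)
      = u⁻¹ ^ (k + 1) - expPoly u k t * Real.exp (-u * t) := by
  rw [intervalIntegral.integral_eq_sub_of_hasDerivAt
    (fun x _ => hasDerivAt_expPoly_mul_exp hu k x)
    (((continuous_divPow k).mul (by fun_prop)).intervalIntegrable _ _), expPoly_apply_zero]
  simp; ring

theorem expPoly_add_expPoly_neg (u : ℝ) (k : ℕ) (t : ℝ) :
    expPoly u (2 * k + 1) t + expPoly (-u) (2 * k + 1) t
      = ∑ l ∈ range (k + 1), 2 * u⁻¹ ^ (2 * (l + 1)) * divPow (2 * k - 2 * l) t := by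
  induction k with
  | zero => simp [expPoly, divPow]; ring
  | succ k ih =>
    rw [Finset.sum_range_succ']
    have : ∀ l, 2 * (k + 1) - 2 * (l + 1) = 2 * k - 2 * l := fun l => by omega
    simp only [this]
    have e : ∑ l ∈ range (k + 1), 2 * u⁻¹ ^ (2 * (l + 1 + 1)) * divPow (2 * k - 2 * l) t
        = u⁻¹ ^ 2 * ∑ l ∈ range (k + 1), 2 * u⁻¹ ^ (2 * (l + 1)) * divPow (2 * k - 2 * l) t := by
      rw [mul_sum]
      exact sum_congr rfl fun l _ => by ring
    rw [e, ← ih]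
    show (divPow (2 * k + 3) t + (divPow (2 * k + 2) t + expPoly u (2 * k + 1) t) * u⁻¹) * u⁻¹
      + (divPow (2 * k + 3) t + (divPow (2 * k + 2) t + expPoly (-u) (2 * k + 1) t) * (-u)⁻¹) * (-u)⁻¹
      = _
    rw [inv_neg]
    simp only [mul_zero, Nat.sub_zero, zero_add, mul_one]
    rw [show 2 * (k + 1) = 2 * k + 2 by ring]
    ring

theorem expPoly_sub_expPoly_neg (u : ℝ) (k : ℕ) (t : ℝ) :
    expPoly u (2 * k + 1) t - expPoly (-u) (2 * k + 1) t
      = ∑ l ∈ range (k + 1), 2 * u⁻¹ ^ (2 * l + 1) * divPow (2 * k + 1 - 2 * l) t := by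
  induction k with
  | zero => simp [expPoly, divPow]; ring
  | succ k ih =>
    rw [Finset.sum_range_succ']
    have : ∀ l, 2 * (k + 1) + 1 - 2 * (l + 1) = 2 * k + 1 - 2 * l := fun l => by omega
    simp only [this]
    have e : ∑ l ∈ range (k + 1), 2 * u⁻¹ ^ (2 * (l + 1) + 1) * divPow (2 * k + 1 - 2 * l) t
        = u⁻¹ ^ 2 *
          ∑ l ∈ range (k + 1), 2 * u⁻¹ ^ (2 * l + 1) * divPow (2 * k + 1 - 2 * l) t := by
      rw [mul_sum]
      exact sum_congr rfl fun l _ => by ring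
    rw [e, ← ih]
    show (divPow (2 * k + 3) t + (divPow (2 * k + 2) t + expPoly u (2 * k + 1) t) * u⁻¹) * u⁻¹
      - (divPow (2 * k + 3) t + (divPow (2 * k + 2) t + expPoly (-u) (2 * k + 1) t) * (-u)⁻¹) * (-u)⁻¹
      = _
    rw [inv_neg]
    simp only [mul_zero, Nat.sub_zero, zero_add, pow_one]
    rw [show 2 * (k + 1) + 1 = 2 * k + 3 by ring]
    ring

/-! ### Exponential kernels -/

theorem heaviside_of_pos {t : ℝ} (ht : 0 < t) : heaviside t = 1 := if_pos ht

theorem heaviside_of_nonpos {t : ℝ} (ht : t ≤ 0) : heaviside t = 0 := if_neg ht.not_gt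

theorem measurable_heaviside : Measurable heaviside :=
  Measurable.ite measurableSet_Ioi measurable_const measurable_const

/-- The even (`ε = 1`) or odd (`ε = -1`) extension of `exp (-u s)`. -/
def expKer (u ε s : ℝ) : ℝ :=
  Real.exp (-u * s) * heaviside s + ε * (Real.exp (u * s) * heaviside (-s))

theorem expKer_of_pos (u ε : ℝ) {s : ℝ} (hs : 0 < s) : expKer u ε s = Real.exp (-u * s) := by
  rw [expKer, heaviside_of_pos hs, heaviside_of_nonpos (by linarith)]; ring

theorem expKer_of_neg (u ε : ℝ) {s : ℝ} (hs : s < 0) : expKer u ε s = ε * Real.exp (u * s) := by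
  rw [expKer, heaviside_of_pos (by linarith : 0 < -s), heaviside_of_nonpos hs.le]; ring

theorem measurable_expKer (u ε : ℝ) : Measurable (expKer u ε) := by
  have := measurable_heaviside
  unfold expKer
  fun_prop

theorem abs_expKer_le (u : ℝ) {ε : ℝ} (hε : |ε| = 1) (s : ℝ) :
    |expKer u ε s| ≤ Real.exp (-u * |s|) := by
  rcases lt_trichotomy s 0 with h | h | h
  · rw [expKer_of_neg u ε h, abs_mul, hε, abs_of_neg h, abs_of_pos (Real.exp_pos _)]; simp
  · subst h; simp [expKer, heaviside]
  · rw [expKer_of_pos u ε h, abs_of_pos h, abs_of_pos (Real.exp_pos _)]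

/-- A kernel `H(x, t)` that decays exponentially in `x`, with odd moments `q`. -/
structure IsMomentKernel (H : ℝ → ℝ → ℝ) (q : ℕ → ℝ → ℝ) : Prop where
  meas : Measurable (Function.uncurry H)
  bound : ∃ C a c : ℝ, 0 ≤ C ∧ 0 < c ∧
    ∀ x t, 0 ≤ x → |H x t| ≤ C * Real.exp (a * |t|) * Real.exp (-c * x)
  moment : ∀ k t, ∫ x in Set.Ioi 0, divPow (2 * k + 1) x * H x t = q k t

theorem integrableOn_of_exp_bound {h : ℝ → ℝ} (hm : Measurable h) {C c : ℝ} (hc : 0 < c)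
    (hb : ∀ x, 0 ≤ x → |h x| ≤ C * Real.exp (-c * x)) (k : ℕ) :
    IntegrableOn (fun x => divPow k x * h x) (Set.Ioi 0) := by
  refine ((integrableOn_divPow_mul_exp hc k le_rfl).const_mul C).mono'
    (((continuous_divPow k).measurable.mul hm).aestronglyMeasurable) ?_
  filter_upwards [ae_restrict_mem measurableSet_Ioi] with x hx
  have hx0 : (0 : ℝ) ≤ x := le_of_lt hx
  rw [Real.norm_eq_abs, abs_mul, abs_of_nonneg (divPow_nonneg k hx0)]
  calc divPow k x * |h x| ≤ divPow k x * (C * Real.exp (-c * x)) :=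
        mul_le_mul_of_nonneg_left (hb x hx0) (divPow_nonneg k hx0)
    _ = _ := by ring

namespace IsMomentKernel

variable {H H' : ℝ → ℝ → ℝ} {q q' : ℕ → ℝ → ℝ}

theorem integrableOn (h : IsMomentKernel H q) (k : ℕ) (t : ℝ) :
    IntegrableOn (fun x => divPow k x * H x t) (Set.Ioi 0) := by
  obtain ⟨C, a, c, _, hc, hb⟩ := h.bound
  exact integrableOn_of_exp_bound (h.meas.comp (measurable_id.prodMk measurable_const)) hc
    (fun x hx => hb x t hx) k

theorem zero : IsMomentKernel (fun _ _ => 0) fun _ _ => 0 :=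
  ⟨measurable_const, ⟨0, 0, 1, le_rfl, one_pos, by simp⟩, by simp⟩

theorem const_mul (h : IsMomentKernel H q) (r : ℝ) :
    IsMomentKernel (fun x t => r * H x t) fun k t => r * q k t := by
  refine ⟨h.meas.const_mul r, ?_, fun k t => ?_⟩
  · obtain ⟨C, a, c, hC, hc, hb⟩ := h.bound
    refine ⟨|r| * C, a, c, by positivity, hc, fun x t hx => ?_⟩
    rw [abs_mul, mul_assoc, mul_assoc, ← mul_assoc C]
    exact mul_le_mul_of_nonneg_left (hb x t hx) (abs_nonneg r)
  · rw [← h.moment k t, ← integral_const_mul]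
    exact integral_congr_ae (Eventually.of_forall fun x => by ring)

theorem add (h : IsMomentKernel H q) (h' : IsMomentKernel H' q') :
    IsMomentKernel (fun x t => H x t + H' x t) fun k t => q k t + q' k t := by
  refine ⟨h.meas.add h'.meas, ?_, fun k t => ?_⟩
  · obtain ⟨C, a, c, hC, hc, hb⟩ := h.bound
    obtain ⟨C', a', c', hC', hc', hb'⟩ := h'.bound
    refine ⟨C + C', max a a', min c c', by positivity, lt_min hc hc', fun x t hx => ?_⟩
    have e1 : |H x t| ≤ C * Real.exp (max a a' * |t|) * Real.exp (-min c c' * x) := by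
      refine (hb x t hx).trans ?_
      gcongr
      · exact le_max_left _ _
      · exact min_le_left _ _
    have e2 : |H' x t| ≤ C' * Real.exp (max a a' * |t|) * Real.exp (-min c c' * x) := by
      refine (hb' x t hx).trans ?_
      gcongr
      · exact le_max_right _ _
      · exact min_le_right _ _
    refine (abs_add_le _ _).trans ((add_le_add e1 e2).trans (le_of_eq (by ring)))
  · rw [← h.moment k t, ← h'.moment k t, ← integral_add (h.integrableOn _ t) (h'.integrableOn _ t)]
    exact integral_congr_ae (Eventually.of_forall fun x => by ring)

theorem sum {ι : Type*} (s : Finset ι) {H : ι → ℝ → ℝ → ℝ} {q : ι → ℕ → ℝ → ℝ}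
    (h : ∀ i ∈ s, IsMomentKernel (H i) (q i)) :
    IsMomentKernel (fun x t => ∑ i ∈ s, H i x t) fun k t => ∑ i ∈ s, q i k t := by
  classical
  induction s using Finset.induction_on with
  | empty => simpa using zero
  | insert i s hi ih =>
    simp only [sum_insert hi]
    exact (h i (by simp)).add (ih fun j hj => h j (by simp [hj]))

theorem congr (h : IsMomentKernel H q) (hH : ∀ x t, H' x t = H x t)
    (hq : ∀ k t, q' k t = q k t) : IsMomentKernel H' q' := by
  have e1 : H' = H := by funext x t; exact hH x t
  have e2 : q' = q := by funext x t; exact hq x t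
  rwa [e1, e2]

end IsMomentKernel

theorem moment_expKer_of_nonneg {u ε : ℝ} (hu : 0 < u) (hε : ε * ε = 1) (k : ℕ) {t : ℝ} (ht : 0 ≤ t) :
    ∫ x in Set.Ioi 0, divPow (2 * k + 1) x * (expKer u ε (x - t) - ε * expKer u ε (x + t))
      = expPoly u (2 * k + 1) t - ε * expPoly (-u) (2 * k + 1) t := by
  have hε' : |ε| = 1 := by
    rcases mul_self_eq_one_iff.1 hε with h | h <;> simp [h]
  have hb : ∀ t x : ℝ, 0 ≤ x → |expKer u ε (x + t)| ≤ Real.exp (u * |t|) * Real.exp (-u * x) := by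
    intro t x hx
    refine (abs_expKer_le u hε' _).trans ?_
    rw [← Real.exp_add]
    refine Real.exp_le_exp.2 ?_
    have : x ≤ |x + t| + |t| := by
      have := abs_sub (x + t) t
      rw [add_sub_cancel_right, abs_of_nonneg hx] at this
      exact this
    nlinarith
  have hI : ∀ t : ℝ, IntegrableOn (fun x => divPow (2 * k + 1) x * expKer u ε (x + t)) (Set.Ioi 0) :=
    fun t => integrableOn_of_exp_bound ((measurable_expKer u ε).comp (measurable_id.add_const t)) hu
      (hb t) _
  have e1 : ∫ x in Set.Ioi 0, divPow (2 * k + 1) x * expKer u ε (x + t)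
      = u⁻¹ ^ (2 * k + 2) * Real.exp (-u * t) := by
    rw [setIntegral_congr_fun (g := fun x => divPow (2 * k + 1) x * Real.exp (-u * x)
      * Real.exp (-u * t)) measurableSet_Ioi, integral_mul_const,
      integral_Ioi_divPow_mul_exp hu _ le_rfl, expPoly_apply_zero]
    · simp
    · intro x hx
      have hx : 0 < x := hx
      simp only
      rw [expKer_of_pos u ε (by linarith), mul_assoc, ← Real.exp_add]
      ring_nf
  have e2 : ∫ x in Set.Ioi t, divPow (2 * k + 1) x * expKer u ε (x + -t)
      = expPoly u (2 * k + 1) t := by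
    rw [setIntegral_congr_fun (g := fun x => divPow (2 * k + 1) x * Real.exp (-u * x)
      * Real.exp (u * t)) measurableSet_Ioi, integral_mul_const,
      integral_Ioi_divPow_mul_exp hu _ ht, mul_assoc, ← Real.exp_add]
    · simp
    · intro x hx
      have hx : t < x := hx
      simp only
      rw [expKer_of_pos u ε (by linarith), mul_assoc, ← Real.exp_add]
      ring_nf
  have e3 : ∫ x in Set.Ioc 0 t, divPow (2 * k + 1) x * expKer u ε (x + -t)
      = ε * (u⁻¹ ^ (2 * k + 2) * Real.exp (-u * t) - expPoly (-u) (2 * k + 1) t) := by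
    rw [integral_Ioc_eq_integral_Ioo,
      setIntegral_congr_fun (g := fun x => divPow (2 * k + 1) x * Real.exp (-(-u) * x)
      * (ε * Real.exp (-u * t))) measurableSet_Ioo, integral_mul_const, ← integral_Ioc_eq_integral_Ioo,
      ← intervalIntegral.integral_of_le ht, integral_divPow_mul_exp (neg_ne_zero.2 hu.ne'), inv_neg,
      Even.neg_pow ⟨k + 1, by ring⟩]
    · have : Real.exp (-(-u) * t) * Real.exp (-u * t) = 1 := by rw [← Real.exp_add]; simp
      linear_combination (-ε * expPoly (-u) (2 * k + 1) t) * this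
    · intro x hx
      have hx : x < t := hx.2
      simp only
      rw [expKer_of_neg u ε (by linarith), neg_neg, mul_assoc, mul_left_comm (Real.exp _),
        ← Real.exp_add]
      ring_nf
  have e4 : ∫ x in Set.Ioi 0, divPow (2 * k + 1) x * expKer u ε (x + -t)
      = ε * (u⁻¹ ^ (2 * k + 2) * Real.exp (-u * t) - expPoly (-u) (2 * k + 1) t)
        + expPoly u (2 * k + 1) t := by
    rw [← e3, ← e2, ← setIntegral_union (Set.Ioc_disjoint_Ioi le_rfl) measurableSet_Ioi
      ((hI (-t)).mono_set Set.Ioc_subset_Ioi_self) ((hI (-t)).mono_set (Set.Ioi_subset_Ioi ht)),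
      Set.Ioc_union_Ioi_eq_Ioi ht]
  simp only [mul_sub, sub_eq_add_neg _ t, mul_left_comm _ ε]
  rw [integral_sub (hI (-t)) ((hI t).const_mul ε), integral_const_mul, e1, e4]
  ring

theorem isMomentKernel_expKer {u ε : ℝ} (hu : 0 < u) (hε : ε * ε = 1) {q : ℕ → ℝ → ℝ}
    (hq : ∀ k t, expPoly u (2 * k + 1) t - ε * expPoly (-u) (2 * k + 1) t = q k t)
    (hq' : ∀ k t, q k (-t) = -ε * q k t) :
    IsMomentKernel (fun x t => expKer u ε (x - t) - ε * expKer u ε (x + t)) q := by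
  have hε' : |ε| = 1 := by
    rcases mul_self_eq_one_iff.1 hε with h | h <;> simp [h]
  refine ⟨?_, ⟨2, u, u, by norm_num, hu, fun x t hx => ?_⟩, fun k t => ?_⟩
  · have h := measurable_expKer u ε
    exact (h.comp (measurable_fst.sub measurable_snd)).sub
      ((h.comp (measurable_fst.add measurable_snd)).const_mul ε)
  · have hb : ∀ t : ℝ, |expKer u ε (x + t)| ≤ Real.exp (u * |t|) * Real.exp (-u * x) := by
      intro t
      refine (abs_expKer_le u hε' _).trans ?_
      rw [← Real.exp_add]
      refine Real.exp_le_exp.2 ?_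
      have : x ≤ |x + t| + |t| := by
        have := abs_sub (x + t) t
        rw [add_sub_cancel_right, abs_of_nonneg hx] at this
        exact this
      nlinarith
    have h1 := hb t
    have h2 := hb (-t)
    rw [abs_neg, ← sub_eq_add_neg] at h2
    refine (abs_sub _ _).trans ?_
    rw [abs_mul, hε', one_mul]
    linarith
  · rcases le_total 0 t with h | h
    · rw [moment_expKer_of_nonneg hu hε k h, hq]
    · have := moment_expKer_of_nonneg hu hε k (neg_nonneg.2 h)
      rw [hq, hq'] at this
      have e : ∀ x, expKer u ε (x - t) - ε * expKer u ε (x + t)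
          = -ε * (expKer u ε (x - -t) - ε * expKer u ε (x + -t)) := fun x => by
        rw [sub_neg_eq_add, ← sub_eq_add_neg]
        linear_combination (-expKer u ε (x - t)) * hε
      simp only [e, mul_left_comm _ (-ε)]
      rw [integral_const_mul, this]
      linear_combination (q k t) * hε

theorem isMomentKernel_heaviside :
    IsMomentKernel (fun x t => heaviside (-x - t) + heaviside (t - x)) fun k t =>
      divPow (2 * k + 2) t := by
  have hle : ∀ s, 0 ≤ heaviside s ∧ heaviside s ≤ Real.exp s := by
    intro s
    by_cases hs : 0 < s
    · rw [heaviside_of_pos hs]; exact ⟨zero_le_one, Real.one_le_exp hs.le⟩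
    · rw [heaviside_of_nonpos (not_lt.1 hs)]; exact ⟨le_rfl, (Real.exp_pos _).le⟩
  have hpos : ∀ k t, 0 ≤ t → ∫ x in Set.Ioi 0,
      divPow (2 * k + 1) x * (heaviside (-x - t) + heaviside (t - x)) = divPow (2 * k + 2) t := by
    intro k t ht
    have e : ∀ x ∈ Set.Ioi (0 : ℝ), divPow (2 * k + 1) x * (heaviside (-x - t) + heaviside (t - x))
        = (Set.Iio t).indicator (divPow (2 * k + 1)) x := by
      intro x hx
      have hx : 0 < x := hx
      rw [heaviside_of_nonpos (by linarith : -x - t ≤ 0), zero_add, Set.indicator_apply, heaviside]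
      simp [Set.mem_Iio]
    rw [setIntegral_congr_fun measurableSet_Ioi e, setIntegral_indicator measurableSet_Iio,
      Set.Ioi_inter_Iio, ← integral_Ioc_eq_integral_Ioo, ← intervalIntegral.integral_of_le ht,
      intervalIntegral.integral_eq_sub_of_hasDerivAt (fun x _ => hasDerivAt_divPow (2 * k + 1) x)
      ((continuous_divPow _).intervalIntegrable _ _), divPow_succ_zero, sub_zero]
  refine ⟨?_, ⟨2, 1, 1, by norm_num, one_pos, fun x t hx => ?_⟩, fun k t => ?_⟩
  · have h := measurable_heaviside
    exact (h.comp (measurable_fst.neg.sub measurable_snd)).add (h.comp (measurable_snd.sub measurable_fst))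
  · rw [abs_of_nonneg (add_nonneg (hle _).1 (hle _).1), mul_assoc, ← Real.exp_add]
    have h1 : heaviside (-x - t) ≤ Real.exp (1 * |t| + -1 * x) :=
      (hle _).2.trans (Real.exp_le_exp.2 (by have := neg_abs_le t; linarith))
    have h2 : heaviside (t - x) ≤ Real.exp (1 * |t| + -1 * x) :=
      (hle _).2.trans (Real.exp_le_exp.2 (by have := le_abs_self t; linarith))
    linarith
  · rcases le_total 0 t with h | h
    · exact hpos k t h
    · rw [← divPow_neg_of_even ⟨k + 1, by ring⟩, ← hpos k (-t) (neg_nonneg.2 h)]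
      refine integral_congr_ae (Eventually.of_forall fun x => ?_)
      simp only
      rw [sub_neg_eq_add, neg_add_eq_sub, add_comm (heaviside (t - x)), neg_sub_left, ← neg_add',
        add_comm t x]


/-- The coefficients of `1 / y^M(p)`. -/
def coefM (p l : ℕ) : ℝ :=
  if l = 0 then 1 else ∑ j ∈ Icc 1 ((p - 1) / 2),
    -((-1) ^ j * Real.cos (Real.pi / p * j)) * (2 * (uM p j)⁻¹ ^ (2 * l))

/-- The residues of `1 / (z y^SM(p)(z))`. -/
def resSM (p j : ℕ) : ℝ :=
  1 / (2 * Real.pi) * ((-1) ^ j * Real.cos (Real.pi / p * (j - 1 / 2)) ^ 2)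

/-- The coefficients of `1 / y^SM(p)`. -/
def coefSM (p l : ℕ) : ℝ :=
  if p = 1 then if l = 0 then 1 else 0
  else ∑ j ∈ Icc 1 ((p - 1) / 2), -resSM p j * (2 * (uSM p j)⁻¹ ^ (2 * l + 1))

theorem uM_pos {p j : ℕ} (hj : j ∈ Icc 1 ((p - 1) / 2)) : 0 < uM p j := by
  rw [Finset.mem_Icc] at hj
  have hp : (0 : ℝ) < p := by exact_mod_cast (by omega : 0 < p)
  have hjp : (j : ℝ) < p := by exact_mod_cast (by omega : j < p)
  have h1 : (0 : ℝ) < j := by exact_mod_cast hj.1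
  have h2 : Real.pi / p * j < Real.pi := by
    rw [div_mul_eq_mul_div, div_lt_iff₀ hp]
    exact mul_lt_mul_of_pos_left hjp Real.pi_pos
  have := Real.sin_pos_of_pos_of_lt_pi (by positivity) h2
  have := Real.pi_pos
  unfold uM; positivity

theorem uSM_pos {p j : ℕ} (hj : j ∈ Icc 1 ((p - 1) / 2)) : 0 < uSM p j := by
  rw [Finset.mem_Icc] at hj
  have hp : (0 : ℝ) < p := by exact_mod_cast (by omega : 0 < p)
  have hjp : (j : ℝ) < p := by exact_mod_cast (by omega : j < p)
  have h1 : (1 : ℝ) ≤ j := by exact_mod_cast hj.1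
  have h2 : Real.pi / p * (j - 1 / 2) < Real.pi := by
    rw [div_mul_eq_mul_div, div_lt_iff₀ hp]
    exact mul_lt_mul_of_pos_left (by linarith) Real.pi_pos
  have h3 : (0 : ℝ) < j - 1 / 2 := by linarith
  have := Real.sin_pos_of_pos_of_lt_pi (by have := Real.pi_pos; positivity) h2
  have := Real.pi_pos
  unfold uSM; positivity

theorem isMomentKernel_HM (p : ℕ) : IsMomentKernel (HM p) fun k t =>
    ∑ l ∈ range (k + 2), coefM p l * divPow (2 * k + 2 - 2 * l) t := by
  refine (isMomentKernel_heaviside.add (IsMomentKernel.sum (Icc 1 ((p - 1) / 2))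
    fun j hj => (isMomentKernel_expKer (uM_pos hj) (ε := -1) (by norm_num)
      (q := fun k t => ∑ l ∈ range (k + 1),
        2 * (uM p j)⁻¹ ^ (2 * (l + 1)) * divPow (2 * k - 2 * l) t)
      (fun k t => by rw [← expPoly_add_expPoly_neg]; ring) (fun k t => ?_)).const_mul
        (-((-1) ^ j * Real.cos (Real.pi / p * j))))).congr (fun x t => ?_) fun k t => ?_
  · rw [neg_neg, one_mul]
    refine sum_congr rfl fun l _ => ?_
    rw [← Nat.mul_sub, divPow_neg_of_even (even_two_mul _)]
  · have hI : Icc 0 ((p - 1) / 2) = insert 0 (Icc 1 ((p - 1) / 2)) := by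
      ext i; simp only [Finset.mem_Icc, Finset.mem_insert]; omega
    have h0 : uM p 0 = 0 := by simp [uM]
    rw [HM, hI, sum_insert (by simp), h0]
    simp only [zero_mul, Real.exp_zero, pow_zero, Nat.cast_zero, mul_zero, Real.cos_zero, one_mul]
    rw [add_left_comm, ← Finset.sum_neg_distrib, ← sum_add_distrib]
    congr 1
    refine sum_congr rfl fun j _ => ?_
    simp only [expKer, neg_sub, neg_add']
    ring
  · rw [Finset.sum_range_succ', add_comm]
    congr 1
    · simp [coefM]
    · simp only [coefM, Nat.succ_ne_zero, if_false, sum_mul, mul_sum]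
      rw [sum_comm]
      refine sum_congr₂ fun j _ l _ => ?_
      rw [show 2 * k + 2 - 2 * (l + 1) = 2 * k - 2 * l by omega]
      ring

theorem isMomentKernel_HSM (p : ℕ) : IsMomentKernel (HSM p) fun k t =>
    if p = 1 then 0 else
      ∑ l ∈ range (k + 1), coefSM p l * divPow (2 * k + 1 - 2 * l) t := by
  refine (IsMomentKernel.sum (Icc 1 ((p - 1) / 2))
    fun j hj => (isMomentKernel_expKer (uSM_pos hj) (ε := 1) (by norm_num)
      (q := fun k t => ∑ l ∈ range (k + 1),
        2 * (uSM p j)⁻¹ ^ (2 * l + 1) * divPow (2 * k + 1 - 2 * l) t)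
      (fun k t => by rw [← expPoly_sub_expPoly_neg]; ring) (fun k t => ?_)).const_mul
        (-resSM p j)).congr (fun x t => ?_) fun k t => ?_
  · rw [neg_one_mul, ← Finset.sum_neg_distrib]
    refine sum_congr rfl fun l hl => ?_
    rw [mem_range] at hl
    rw [divPow_neg_of_odd ⟨k - l, by omega⟩]
    ring
  · rw [HSM, mul_sum]
    refine sum_congr rfl fun j _ => ?_
    simp only [expKer, neg_sub, neg_add', resSM]
    ring
  · split_ifs with h
    · subst h; simp
    · simp only [coefSM, if_neg h, sum_mul, mul_sum]
      rw [sum_comm]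
      refine sum_congr₂ fun j _ l _ => ?_
      ring

/-! ### Partial fractions -/

open Polynomial in
theorem one_div_eval_eq_sum {K ι : Type*} [Field K] [DecidableEq ι] {s : Finset ι} {v : ι → K} {P : K[X]}
    (hs : s.Nonempty) (hv : Set.InjOn v s) (hdeg : P.natDegree = s.card)
    (hP : ∀ i ∈ s, P.eval (v i) = 0) {x : K} (hx : ∀ i ∈ s, x ≠ v i) :
    1 / P.eval x = ∑ i ∈ s, (P.derivative.eval (v i))⁻¹ * (x - v i)⁻¹ := by
  have hc : 0 < s.card := hs.card_pos
  have hlead : P.leadingCoeff ≠ 0 := by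
    intro h
    rw [leadingCoeff_eq_zero] at h
    rw [h, natDegree_zero] at hdeg
    omega
  have hPn : P = C P.leadingCoeff * Lagrange.nodal s v := by
    refine Polynomial.eq_of_degree_sub_lt_of_eval_index_eq s hv ?_ fun i hi => ?_
    · have hP0 : P ≠ 0 := leadingCoeff_ne_zero.1 hlead
      have h2 : (C P.leadingCoeff * Lagrange.nodal s v).degree = P.degree := by
        rw [degree_C_mul hlead, Lagrange.degree_nodal, degree_eq_natDegree hP0, hdeg]
      rw [← hdeg, ← degree_eq_natDegree hP0]
      refine degree_sub_lt h2.symm hP0 ?_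
      rw [leadingCoeff_mul, leadingCoeff_C, (Lagrange.nodal_monic).leadingCoeff, mul_one]
    · rw [hP i hi, eval_mul, Lagrange.eval_nodal_at_node hi, mul_zero]
  have h1 := Lagrange.eval_interpolate_not_at_node (1 : ι → K) hx
  rw [Lagrange.interpolate_one hv hs, eval_one] at h1
  have hw : ∀ i ∈ s, (P.derivative.eval (v i))⁻¹ * (x - v i)⁻¹
      = P.leadingCoeff⁻¹ * (Lagrange.nodalWeight s v i * (x - v i)⁻¹ * (1 : ι → K) i) := by
    intro i hi
    rw [Lagrange.nodalWeight_eq_eval_derivative_nodal hi]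
    conv_lhs => rw [hPn]
    rw [derivative_C_mul, eval_mul, eval_C, mul_inv]
    simp; ring
  rw [sum_congr rfl hw, ← mul_sum]
  conv_lhs => rw [hPn, eval_mul, eval_C]
  have hn : (Lagrange.nodal s v).eval x ≠ 0 := by
    intro h; rw [h, zero_mul] at h1; exact one_ne_zero h1
  rw [one_div, mul_inv]
  congr 1
  exact (eq_inv_of_mul_eq_one_right h1.symm).symm

theorem sum_Icc_neg {M : Type*} [AddCommMonoid M] (f : ℤ → M) (m : ℕ) :
    ∑ j ∈ Icc (-(m : ℤ)) m, f j = f 0 + ∑ j ∈ Icc 1 m, (f j + f (-j)) := by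
  induction m with
  | zero => simp
  | succ m ih =>
    have h : Icc (-((m + 1 : ℕ) : ℤ)) (m + 1 : ℕ)
        = insert ((m : ℤ) + 1) (insert (-((m : ℤ) + 1)) (Icc (-(m : ℤ)) m)) := by
      ext j; simp only [Finset.mem_Icc, Finset.mem_insert]; omega
    rw [h, sum_insert, sum_insert, ih, Finset.sum_Icc_succ_top (by omega)]
    · push_cast; abel
    · simp
    · simp only [Finset.mem_Icc, Finset.mem_insert]; omega

theorem sum_Ioc_neg {M : Type*} [AddCommMonoid M] (f : ℤ → M) (m : ℕ) :
    ∑ j ∈ Finset.Ioc (-(m : ℤ)) m, f j = ∑ j ∈ Icc 1 m, (f j + f (1 - j)) := by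
  induction m with
  | zero => simp
  | succ m ih =>
    have h : Finset.Ioc (-((m + 1 : ℕ) : ℤ)) (m + 1 : ℕ)
        = insert ((m : ℤ) + 1) (insert (-(m : ℤ)) (Finset.Ioc (-(m : ℤ)) m)) := by
      ext j; simp only [Finset.mem_Ioc, Finset.mem_insert]; omega
    rw [h, sum_insert, sum_insert, ih, Finset.sum_Icc_succ_top (by omega)]
    · rw [show (1 : ℤ) - (m + 1 : ℕ) = -m by push_cast; ring]
      push_cast; abel
    · simp
    · simp only [Finset.mem_Ioc, Finset.mem_insert]; omega

section

open Polynomial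

theorem eval_T_sin (m : ℕ) (w : ℂ) :
    (Chebyshev.T ℂ (2 * m + 1)).eval (Complex.sin w) = (-1) ^ m * Complex.sin ((2 * m + 1) * w) := by
  rw [← Complex.cos_pi_div_two_sub w, Chebyshev.T_complex_cos]
  push_cast
  rw [show (2 * m + 1 : ℂ) * (Real.pi / 2 - w) = (Real.pi / 2 - (2 * m + 1) * w) + m * Real.pi by ring,
    Complex.cos_antiperiodic.add_nat_mul_eq, Complex.cos_pi_div_two_sub]

theorem eval_U_sin (m : ℕ) (w : ℂ) :
    (Chebyshev.U ℂ (2 * m)).eval (Complex.sin w) * Complex.cos w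
      = (-1) ^ m * Complex.cos ((2 * m + 1) * w) := by
  rw [← Complex.cos_pi_div_two_sub w, ← Complex.sin_pi_div_two_sub w, Chebyshev.U_complex_cos]
  push_cast
  rw [show (2 * m + 1 : ℂ) * (Real.pi / 2 - w) = (Real.pi / 2 - (2 * m + 1) * w) + m * Real.pi by ring,
    Complex.sin_antiperiodic.add_nat_mul_eq, Complex.sin_pi_div_two_sub]

theorem cos_int_mul_pi_complex (j : ℤ) : Complex.cos (j * Real.pi) = (-1) ^ j := by
  have := congrArg (fun x : ℝ => (x : ℂ)) (Real.cos_int_mul_pi j)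
  simpa using this

theorem angle_mem_Ioo {m : ℕ} {t : ℝ} (h1 : -(m : ℝ) ≤ t) (h2 : t ≤ m) :
    Real.pi / (2 * m + 1) * t ∈ Set.Ioo (-(Real.pi / 2)) (Real.pi / 2) := by
  have hm0 : (0 : ℝ) < 2 * m + 1 := by positivity
  have hpi := Real.pi_pos
  rw [div_mul_eq_mul_div]
  constructor
  · rw [lt_div_iff₀ hm0]; nlinarith
  · rw [div_lt_iff₀ hm0]; nlinarith

theorem injOn_sin_angle {m : ℕ} {s : Finset ℤ} {t : ℤ → ℝ} (ht : Function.Injective t)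
    (h : ∀ j ∈ s, Real.pi / (2 * m + 1) * t j ∈ Set.Ioo (-(Real.pi / 2)) (Real.pi / 2)) :
    Set.InjOn (fun j : ℤ => ((Real.sin (Real.pi / (2 * m + 1) * t j) : ℝ) : ℂ)) s := by
  intro i hi j hj hij
  have h := Real.injOn_sin (Set.Ioo_subset_Icc_self (h i hi)) (Set.Ioo_subset_Icc_self (h j hj))
    (Complex.ofReal_injective hij)
  have hpi := Real.pi_pos
  exact ht (mul_left_cancel₀ (by positivity) h)

theorem one_div_eval_T {m : ℕ} {x : ℂ}
    (hx : ∀ j ∈ Icc (-(m : ℤ)) m, x ≠ Real.sin (Real.pi / (2 * m + 1) * j)) :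
    1 / (Chebyshev.T ℂ (2 * m + 1)).eval x = ∑ j ∈ Icc (-(m : ℤ)) m,
      (-1) ^ m * ((-1) ^ j * Real.cos (Real.pi / (2 * m + 1) * j) / (2 * m + 1))
        * (x - Real.sin (Real.pi / (2 * m + 1) * j))⁻¹ := by
  have hm0 : (0 : ℝ) < 2 * m + 1 := by positivity
  have hmC : (2 * m + 1 : ℂ) ≠ 0 := by exact_mod_cast hm0.ne'
  have hang : ∀ j ∈ Icc (-(m : ℤ)) m,
      Real.pi / (2 * m + 1) * j ∈ Set.Ioo (-(Real.pi / 2)) (Real.pi / 2) := by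
    intro j hj
    rw [Finset.mem_Icc] at hj
    exact angle_mem_Ioo (by exact_mod_cast hj.1) (by exact_mod_cast hj.2)
  have hmul : ∀ j : ℤ, (2 * m + 1 : ℂ) * ((Real.pi / (2 * m + 1) * j : ℝ) : ℂ) = j * Real.pi := by
    intro j; push_cast; field_simp
  rw [one_div_eval_eq_sum (s := Icc (-(m : ℤ)) m) ⟨0, by simp⟩
    (injOn_sin_angle (t := fun j => (j : ℝ)) Int.cast_injective hang) _ _ hx]
  · refine sum_congr rfl fun j hj => ?_
    congr 1
    have hc : (Complex.cos ((Real.pi / (2 * m + 1) * j : ℝ) : ℂ)) ≠ 0 := by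
      rw [← Complex.ofReal_cos]
      exact_mod_cast (Real.cos_pos_of_mem_Ioo (hang j hj)).ne'
    have hU := eval_U_sin m ((Real.pi / (2 * m + 1) * j : ℝ) : ℂ)
    rw [hmul, cos_int_mul_pi_complex, ← eq_div_iff hc] at hU
    rw [Chebyshev.T_derivative_eq_U, eval_mul, show (2 * (m : ℤ) + 1 - 1) = 2 * m by ring,
      Complex.ofReal_sin, hU, Complex.ofReal_cos]
    have hj2 : ((-1 : ℂ) ^ j) * (-1) ^ j = 1 := by
      rw [← mul_zpow]; simp
    have hm2 : ((-1 : ℂ) ^ m) * (-1) ^ m = 1 := by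
      rw [← mul_pow]; simp
    refine inv_eq_of_mul_eq_one_right ?_
    simp only [eval_add, eval_mul, eval_intCast, eval_one, eval_ofNat, Int.cast_add, Int.cast_mul,
      Int.cast_ofNat, Int.cast_natCast, Int.cast_one, eval_natCast]
    generalize Complex.cos _ = c at hc
    field_simp
    linear_combination ((-1) ^ m * (-1) ^ m) * hj2 + hm2
  · rw [Chebyshev.natDegree_T, Int.card_Icc]; omega
  · intro j _
    rw [Complex.ofReal_sin, eval_T_sin, hmul, Complex.sin_int_mul_pi, mul_zero]

theorem one_div_eval_U {m : ℕ} (hm : 0 < m) {x : ℂ}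
    (hx : ∀ j ∈ Finset.Ioc (-(m : ℤ)) m, x ≠ Real.sin (Real.pi / (2 * m + 1) * (j - 1 / 2))) :
    1 / (Chebyshev.U ℂ (2 * m)).eval x = ∑ j ∈ Finset.Ioc (-(m : ℤ)) m,
      (-1) ^ m * ((-1) ^ j * Real.cos (Real.pi / (2 * m + 1) * (j - 1 / 2)) ^ 2 / (2 * m + 1))
        * (x - Real.sin (Real.pi / (2 * m + 1) * (j - 1 / 2)))⁻¹ := by
  have hm0 : (0 : ℝ) < 2 * m + 1 := by positivity
  have hmC : (2 * m + 1 : ℂ) ≠ 0 := by exact_mod_cast hm0.ne'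
  have hang : ∀ j ∈ Finset.Ioc (-(m : ℤ)) m,
      Real.pi / (2 * m + 1) * (j - 1 / 2) ∈ Set.Ioo (-(Real.pi / 2)) (Real.pi / 2) := by
    intro j hj
    rw [Finset.mem_Ioc] at hj
    have h1 : (-(m : ℝ)) + 1 ≤ j := by exact_mod_cast hj.1
    have h2 : (j : ℝ) ≤ m := by exact_mod_cast hj.2
    exact angle_mem_Ioo (by linarith) (by linarith)
  have hmul : ∀ j : ℤ, (2 * m + 1 : ℂ) * ((Real.pi / (2 * m + 1) * (j - 1 / 2) : ℝ) : ℂ)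
      = j * Real.pi - Real.pi / 2 := by
    intro j; push_cast; field_simp
  have hc : ∀ j ∈ Finset.Ioc (-(m : ℤ)) m,
      (Complex.cos ((Real.pi / (2 * m + 1) * (j - 1 / 2) : ℝ) : ℂ)) ≠ 0 := by
    intro j hj
    rw [← Complex.ofReal_cos]
    exact_mod_cast (Real.cos_pos_of_mem_Ioo (hang j hj)).ne'
  have hroot : ∀ j ∈ Finset.Ioc (-(m : ℤ)) m, (Chebyshev.U ℂ (2 * m)).eval
      ((Real.sin (Real.pi / (2 * m + 1) * (j - 1 / 2)) : ℝ) : ℂ) = 0 := by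
    intro j hj
    have := eval_U_sin m ((Real.pi / (2 * m + 1) * (j - 1 / 2) : ℝ) : ℂ)
    rw [hmul, Complex.cos_sub_pi_div_two, Complex.sin_int_mul_pi, mul_zero] at this
    rw [Complex.ofReal_sin]
    exact (mul_eq_zero.1 this).resolve_right (hc j hj)
  rw [one_div_eval_eq_sum (s := Finset.Ioc (-(m : ℤ)) m) ⟨m, by simp; omega⟩ (injOn_sin_angle
    (t := fun j => (j : ℝ) - 1 / 2) (fun i j h => Int.cast_injective (sub_left_injective h)) hang) _ hroot hx]
  · refine sum_congr rfl fun j hj => ?_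
    congr 1
    set w : ℂ := ((Real.pi / (2 * m + 1) * (j - 1 / 2) : ℝ) : ℂ) with hw
    have d1 : HasDerivAt (fun w => (Chebyshev.U ℂ (2 * m)).eval (Complex.sin w) * Complex.cos w)
        ((Chebyshev.U ℂ (2 * m)).derivative.eval (Complex.sin w) * Complex.cos w * Complex.cos w
          + (Chebyshev.U ℂ (2 * m)).eval (Complex.sin w) * -Complex.sin w) w :=
      (((Chebyshev.U ℂ (2 * m)).hasDerivAt (Complex.sin w)).comp w (Complex.hasDerivAt_sin w)).mul
        (Complex.hasDerivAt_cos w)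
    have d2 : HasDerivAt (fun w => (-1) ^ m * Complex.cos ((2 * m + 1) * w))
        ((-1) ^ m * (-Complex.sin ((2 * m + 1) * w) * (2 * m + 1))) w := by
      have := ((hasDerivAt_id w).const_mul (2 * m + 1 : ℂ)).ccos.const_mul ((-1 : ℂ) ^ m)
      simpa using this
    simp only [eval_U_sin] at d1
    have hd := d1.unique d2
    have hr := hroot j hj
    rw [Complex.ofReal_sin, ← hw] at hr
    rw [hr, hmul, Complex.sin_sub_pi_div_two, cos_int_mul_pi_complex, zero_mul, add_zero] at hd
    rw [Complex.ofReal_sin, Complex.ofReal_cos, ← hw]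
    have hj2 : ((-1 : ℂ) ^ j) * (-1) ^ j = 1 := by
      rw [← mul_zpow]; simp
    have hm2 : ((-1 : ℂ) ^ m) * (-1) ^ m = 1 := by
      rw [← mul_pow]; simp
    refine inv_eq_of_mul_eq_one_right ?_
    field_simp
    linear_combination ((-1) ^ m * (-1) ^ j) * hd + (2 * m + 1) * ((-1) ^ m * (-1) ^ m) * hj2
      + (2 * m + 1) * hm2
  · rw [show (2 * (m : ℤ)) = ((2 * m : ℕ) : ℤ) by push_cast; ring, Chebyshev.natDegree_U_natCast,
      Int.card_Ioc]
    omega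


theorem HasSum.of_eq {f g : ℕ → ℂ} {a b : ℂ} (h : HasSum f a) (hf : ∀ l, g l = f l) (ha : b = a) :
    HasSum g b := by
  rw [ha, show g = f from funext hf]; exact h

theorem hasSum_inv_sub_add_inv_add {u : ℝ} {z : ℂ} (hz : ‖z‖ < u) (r : ℝ) :
    HasSum (fun l : ℕ => ((-r * (2 * u⁻¹ ^ (2 * (l + 1))) : ℝ) : ℂ) * z ^ (2 * l + 1))
      (r * ((z - u)⁻¹ + (z + u)⁻¹)) := by
  have hu : 0 < u := (norm_nonneg z).trans_lt hz
  have huC : (u : ℂ) ≠ 0 := by exact_mod_cast hu.ne'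
  have hq : ‖z * (u : ℂ)⁻¹‖ < 1 := by
    rw [norm_mul, norm_inv, Complex.norm_real, Real.norm_of_nonneg hu.le, ← div_eq_mul_inv,
      div_lt_one hu]
    exact hz
  have hq2 : ‖(z * (u : ℂ)⁻¹) ^ 2‖ < 1 := by
    rw [norm_pow]; exact pow_lt_one₀ (norm_nonneg _) hq two_ne_zero
  have h1 : z - u ≠ 0 := fun h => by
    rw [sub_eq_zero.1 h, Complex.norm_real, Real.norm_of_nonneg hu.le] at hz
    exact lt_irrefl _ hz
  have h2 : z + u ≠ 0 := fun h => by
    rw [eq_neg_of_add_eq_zero_left h, norm_neg, Complex.norm_real, Real.norm_of_nonneg hu.le] at hz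
    exact lt_irrefl _ hz
  have h3 : 1 - (z * (u : ℂ)⁻¹) ^ 2 ≠ 0 := by
    intro h
    rw [← sub_eq_zero.1 h, norm_one] at hq2
    exact lt_irrefl _ hq2
  have hs := (hasSum_geometric_of_norm_lt_one hq2).mul_left (-r * (2 * (u : ℂ)⁻¹ ^ 2) * z)
  refine HasSum.of_eq hs (fun l => ?_) ?_
  · push_cast; ring
  · have h4 : (u : ℂ) ^ 2 * (1 - (z * (u : ℂ)⁻¹) ^ 2) = -((z - u) * (z + u)) := by
      have hh := mul_inv_cancel₀ huC
      linear_combination (-z ^ 2 * (u * (u : ℂ)⁻¹ + 1)) * hh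
    have h5 : (1 - (z * (u : ℂ)⁻¹) ^ 2)⁻¹ = -u ^ 2 * ((z - u)⁻¹ * (z + u)⁻¹) := by
      refine inv_eq_of_mul_eq_one_right ?_
      calc _ = -((u : ℂ) ^ 2 * (1 - (z * (u : ℂ)⁻¹) ^ 2)) * ((z - u)⁻¹ * (z + u)⁻¹) := by ring
        _ = 1 := by rw [h4]; field_simp
    rw [h5]
    field_simp
    ring


theorem eventually_norm_lt {ι : Type*} {s : Finset ι} {u : ι → ℝ} (hu : ∀ j ∈ s, 0 < u j) :
    ∀ᶠ z : ℂ in 𝓝[≠] 0, z ≠ 0 ∧ ∀ j ∈ s, ‖z‖ < u j := by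
  refine (eventually_mem_nhdsWithin).and ?_
  refine (Filter.eventually_all_finset s).2 fun j hj => ?_
  refine eventually_nhdsWithin_of_eventually_nhds ?_
  have : Tendsto (fun z : ℂ => ‖z‖) (𝓝 0) (𝓝 0) := by simpa using (continuous_norm (E := ℂ)).tendsto 0
  exact this.eventually_lt_const (hu j hj)

theorem ne_ofReal_of_norm_lt {u : ℝ} {z : ℂ} (hz : ‖z‖ < u) : z ≠ u ∧ z ≠ -u := by
  have hu : 0 < u := (norm_nonneg z).trans_lt hz
  constructor <;>
  · rintro rfl
    simp [abs_of_pos hu] at hz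

theorem one_div_yM {p : ℕ} (hp : Odd p) {z : ℂ} (hz : z ≠ 0)
    (hu : ∀ j ∈ Icc 1 ((p - 1) / 2), ‖z‖ < uM p j) :
    1 / yM p z = z⁻¹ + ∑ j ∈ Icc 1 ((p - 1) / 2),
      (((-1) ^ j * Real.cos (Real.pi / p * j) : ℝ) : ℂ) * ((z - uM p j)⁻¹ + (z + uM p j)⁻¹) := by
  obtain ⟨m, rfl⟩ := hp
  have hm : (2 * m + 1 - 1) / 2 = m := by omega
  rw [hm] at hu ⊢
  rw [yM, hm]
  have hp0 : ((2 * m + 1 : ℕ) : ℝ) ≠ 0 := by positivity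
  have hpC : ((2 * m + 1 : ℕ) : ℂ) ≠ 0 := by exact_mod_cast hp0
  have hpi : (Real.pi : ℂ) ≠ 0 := by exact_mod_cast Real.pi_ne_zero
  have key : ∀ j : ℤ, (2 * Real.pi / (2 * m + 1 : ℕ) * z : ℂ)
      - Real.sin (Real.pi / (2 * m + 1 : ℕ) * j)
      = 2 * Real.pi / (2 * m + 1 : ℕ) *
        (z - ((2 * m + 1 : ℕ) / (2 * Real.pi) * Real.sin (Real.pi / (2 * m + 1 : ℕ) * j) : ℝ)) := by
    intro j; push_cast at hpC ⊢; field_simp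
  have hne : ∀ j ∈ Icc (-(m : ℤ)) m,
      z ≠ ((2 * m + 1 : ℕ) / (2 * Real.pi) * Real.sin (Real.pi / (2 * m + 1 : ℕ) * j) : ℝ) := by
    intro j hj
    rw [Finset.mem_Icc] at hj
    rcases lt_trichotomy j 0 with h | h | h
    · have h' := (ne_ofReal_of_norm_lt (hu j.natAbs (Finset.mem_Icc.2 (by omega)))).2
      have e : (j : ℝ) = -(j.natAbs : ℝ) := by
        rw [Nat.cast_natAbs, abs_of_neg h, Int.cast_neg, neg_neg]
      rw [e, mul_neg, Real.sin_neg, mul_neg, Complex.ofReal_neg]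
      exact h'
    · simpa [h] using hz
    · have h' := (ne_ofReal_of_norm_lt (hu j.natAbs (Finset.mem_Icc.2 (by omega)))).1
      have e : (j : ℝ) = (j.natAbs : ℝ) := by
        rw [Nat.cast_natAbs, abs_of_pos h]
      rw [e]
      exact h'
  have hT := one_div_eval_T (m := m) (x := 2 * Real.pi / (2 * m + 1 : ℕ) * z) fun j hj h => hne j hj (by
    have k := key j
    have hpR : ((2 * m + 1 : ℕ) : ℝ) = 2 * m + 1 := by push_cast; ring
    rw [hpR] at k
    rw [h, sub_self] at k
    rw [hpR]
    exact sub_eq_zero.1 ((mul_eq_zero.1 k.symm).resolve_left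
      (div_ne_zero (mul_ne_zero two_ne_zero hpi) hpC)))
  have hpR : (2 * m + 1 : ℝ) = (2 * m + 1 : ℕ) := by push_cast; ring
  have hpC' : (2 * m + 1 : ℂ) = (2 * m + 1 : ℕ) := by push_cast; ring
  have hpZ : (2 * m + 1 : ℤ) = (2 * m + 1 : ℕ) := by push_cast; ring
  rw [hpR, hpC', hpZ, sum_Icc_neg] at hT
  have hm2 : ((-1 : ℂ) ^ m) * (-1) ^ m = 1 := by
    rw [← mul_pow]; simp
  have hm1 : (1 : ℂ) / (-1) ^ m = (-1) ^ m := by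
    rw [one_div]; exact inv_eq_of_mul_eq_one_right hm2
  rw [one_div, mul_inv, ← one_div (eval _ _), hT, mul_add, mul_sum]
  have conv : ∀ j : ℤ, ((-1) ^ m / (2 * Real.pi) : ℂ)⁻¹ * ((-1) ^ m * ((-1) ^ j *
      (Real.cos (Real.pi / (2 * m + 1 : ℕ) * j) : ℝ) / (2 * m + 1 : ℕ)) *
      (2 * Real.pi / (2 * m + 1 : ℕ) * z - (Real.sin (Real.pi / (2 * m + 1 : ℕ) * j) : ℝ))⁻¹)
      = (-1) ^ j * (Real.cos (Real.pi / (2 * m + 1 : ℕ) * j) : ℝ) *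
        (z - ((2 * m + 1 : ℕ) / (2 * Real.pi) * Real.sin (Real.pi / (2 * m + 1 : ℕ) * j) : ℝ))⁻¹ := by
    intro j
    rw [key j, mul_inv (2 * (Real.pi : ℂ) / _)]
    generalize (z - _)⁻¹ = Z
    rw [inv_div]
    field_simp
  congr 1
  · refine (conv 0).trans ?_
    simp
  · refine sum_congr rfl fun j _ => ?_
    rw [mul_add, conv j, conv (-j), mul_add]
    simp only [Int.cast_neg, Int.cast_natCast, mul_neg, Real.cos_neg, Real.sin_neg, zpow_neg,
      zpow_natCast, Complex.ofReal_neg, sub_neg_eq_add, uM, Complex.ofReal_mul, Complex.ofReal_pow,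
      Complex.ofReal_one]
    have hj2 : ((-1 : ℂ) ^ j)⁻¹ = (-1) ^ j := by
      refine inv_eq_of_mul_eq_one_right ?_
      rw [← mul_pow]; simp
    rw [hj2]

theorem one_div_ySM {p : ℕ} (hp : Odd p) (hp1 : p ≠ 1) {z : ℂ} (hz : z ≠ 0)
    (hu : ∀ j ∈ Icc 1 ((p - 1) / 2), ‖z‖ < uSM p j) :
    1 / ySM p z = ∑ j ∈ Icc 1 ((p - 1) / 2),
      (resSM p j : ℂ) * (z * ((z - uSM p j)⁻¹ - (z + uSM p j)⁻¹)) := by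
  obtain ⟨m, rfl⟩ := hp
  have hm : (2 * m + 1 - 1) / 2 = m := by omega
  rw [hm] at hu ⊢
  rw [ySM, hm]
  have hp0 : ((2 * m + 1 : ℕ) : ℝ) ≠ 0 := by positivity
  have hpC : ((2 * m + 1 : ℕ) : ℂ) ≠ 0 := by exact_mod_cast hp0
  have hpi : (Real.pi : ℂ) ≠ 0 := by exact_mod_cast Real.pi_ne_zero
  have key : ∀ j : ℤ, (2 * Real.pi / (2 * m + 1 : ℕ) * z : ℂ)
      - Real.sin (Real.pi / (2 * m + 1 : ℕ) * (j - 1 / 2))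
      = 2 * Real.pi / (2 * m + 1 : ℕ) * (z -
        ((2 * m + 1 : ℕ) / (2 * Real.pi) * Real.sin (Real.pi / (2 * m + 1 : ℕ) * (j - 1 / 2)) : ℝ)) := by
    intro j; push_cast at hpC ⊢; field_simp
  have hne : ∀ j ∈ Finset.Ioc (-(m : ℤ)) m, z ≠
      ((2 * m + 1 : ℕ) / (2 * Real.pi) * Real.sin (Real.pi / (2 * m + 1 : ℕ) * (j - 1 / 2)) : ℝ) := by
    intro j hj
    rw [Finset.mem_Ioc] at hj
    rcases le_or_gt j 0 with h | h
    · have h' := (ne_ofReal_of_norm_lt (hu (1 - j).natAbs (Finset.mem_Icc.2 (by omega)))).2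
      have e : (j : ℝ) - 1 / 2 = -(((1 - j).natAbs : ℝ) - 1 / 2) := by
        rw [Nat.cast_natAbs, abs_of_pos (by omega : 0 < 1 - j)]
        push_cast; ring
      rw [e, mul_neg, Real.sin_neg, mul_neg, Complex.ofReal_neg]
      exact h'
    · have h' := (ne_ofReal_of_norm_lt (hu j.natAbs (Finset.mem_Icc.2 (by omega)))).1
      have e : (j : ℝ) = (j.natAbs : ℝ) := by
        rw [Nat.cast_natAbs, abs_of_pos h]
      rw [e]
      exact h'
  have hT := one_div_eval_U (m := m) (by omega) (x := 2 * Real.pi / (2 * m + 1 : ℕ) * z)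
    fun j hj h => hne j hj (by
    have k := key j
    have hpR : ((2 * m + 1 : ℕ) : ℝ) = 2 * m + 1 := by push_cast; ring
    rw [hpR] at k
    rw [h, sub_self] at k
    rw [hpR]
    exact sub_eq_zero.1 ((mul_eq_zero.1 k.symm).resolve_left
      (div_ne_zero (mul_ne_zero two_ne_zero hpi) hpC)))
  have hpR : (2 * m + 1 : ℝ) = (2 * m + 1 : ℕ) := by push_cast; ring
  have hpC' : (2 * m + 1 : ℂ) = (2 * m + 1 : ℕ) := by push_cast; ring
  have hpZ : (2 * m : ℤ) = (2 * m + 1 : ℕ) - 1 := by push_cast; ring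
  rw [hpR, hpC', hpZ, sum_Ioc_neg] at hT
  have hm2 : ((-1 : ℂ) ^ m) * (-1) ^ m = 1 := by
    rw [← mul_pow]; simp
  rw [one_div, mul_inv, ← one_div (eval _ _), hT, mul_sum]
  have conv : ∀ j : ℤ, ((-1) ^ m / z : ℂ)⁻¹ * ((-1) ^ m * ((-1) ^ j *
      (Real.cos (Real.pi / (2 * m + 1 : ℕ) * (j - 1 / 2)) : ℝ) ^ 2 / (2 * m + 1 : ℕ)) *
      (2 * Real.pi / (2 * m + 1 : ℕ) * z
        - (Real.sin (Real.pi / (2 * m + 1 : ℕ) * (j - 1 / 2)) : ℝ))⁻¹)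
      = 1 / (2 * Real.pi) * ((-1) ^ j * (Real.cos (Real.pi / (2 * m + 1 : ℕ) * (j - 1 / 2)) : ℝ) ^ 2) *
        (z * (z - ((2 * m + 1 : ℕ) / (2 * Real.pi) *
          Real.sin (Real.pi / (2 * m + 1 : ℕ) * (j - 1 / 2)) : ℝ))⁻¹) := by
    intro j
    rw [key j, mul_inv (2 * (Real.pi : ℂ) / _)]
    generalize (z - _)⁻¹ = Z
    rw [inv_div]
    field_simp
  refine sum_congr rfl fun j _ => ?_
  rw [mul_add, conv j, conv (1 - j)]
  have e : ((1 - (j : ℤ) : ℤ) : ℝ) - 1 / 2 = -((j : ℝ) - 1 / 2) := by push_cast; ring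
  rw [e]
  have hj2 : ((-1 : ℂ) ^ (1 - (j : ℤ))) = -(-1) ^ j := by
    rw [sub_eq_add_neg, zpow_add₀ (by norm_num), zpow_one, zpow_neg, zpow_natCast, neg_one_mul]
    congr 1
    refine inv_eq_of_mul_eq_one_right ?_
    rw [← mul_pow]; simp
  rw [hj2]
  simp only [Int.cast_natCast, mul_neg, Real.cos_neg, Real.sin_neg,
      zpow_natCast, Complex.ofReal_neg, sub_neg_eq_add, uSM, resSM, Complex.ofReal_mul,
      Complex.ofReal_pow, Complex.ofReal_one, Complex.ofReal_div, Complex.ofReal_ofNat]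
  ring

theorem hasSum_one_div_yM {p : ℕ} (hp : Odd p) : ∀ᶠ z : ℂ in 𝓝[≠] 0,
    HasSum (fun l : ℕ => (coefM p l : ℂ) * z ^ (2 * (l : ℤ) - 1)) (1 / yM p z) := by
  filter_upwards [eventually_norm_lt fun j hj => uM_pos (p := p) hj] with z hz
  rw [one_div_yM hp hz.1 hz.2, add_comm, ← hasSum_nat_add_iff' 1]
  have := hasSum_sum fun j hj => hasSum_inv_sub_add_inv_add (hz.2 j hj)
    ((-1) ^ j * Real.cos (Real.pi / p * j))
  refine HasSum.of_eq this (fun l => ?_) ?_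
  · rw [coefM, if_neg (Nat.succ_ne_zero l), Complex.ofReal_sum, sum_mul]
    refine sum_congr rfl fun j _ => ?_
    rw [show (2 * ((l + 1 : ℕ) : ℤ) - 1) = ((2 * l + 1 : ℕ) : ℤ) by push_cast; ring, zpow_natCast]
  · simp [coefM]

theorem hasSum_one_div_ySM {p : ℕ} (hp : Odd p) : ∀ᶠ z : ℂ in 𝓝[≠] 0,
    HasSum (fun l : ℕ => (coefSM p l : ℂ) * z ^ (2 * l + 1)) (1 / ySM p z) := by
  by_cases hp1 : p = 1
  · subst hp1
    refine Eventually.of_forall fun z => ?_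
    have h := hasSum_single (f := fun l : ℕ => (coefSM 1 l : ℂ) * z ^ (2 * l + 1)) 0
      fun l hl => by simp [coefSM, hl]
    refine HasSum.of_eq h (fun _ => rfl) ?_
    simp [coefSM, ySM]
  · filter_upwards [eventually_norm_lt fun j hj => uSM_pos (p := p) hj] with z hz
    rw [one_div_ySM hp hp1 hz.1 hz.2]
    have := hasSum_sum fun j hj => (hasSum_inv_sub_add_inv_add (hz.2 j hj) (resSM p j)).mul_left
      (uSM p j : ℂ)
    refine HasSum.of_eq this (fun l => ?_) ?_
    · rw [coefSM, if_neg hp1, Complex.ofReal_sum, sum_mul]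
      refine sum_congr rfl fun j hj => ?_
      have : (uSM p j : ℂ) ≠ 0 := by exact_mod_cast (uSM_pos hj).ne'
      push_cast
      linear_combination (2 * (resSM p j : ℂ) * (uSM p j : ℂ)⁻¹ ^ (2 * l + 1) * z ^ (2 * l + 1))
        * mul_inv_cancel₀ this
    · refine sum_congr rfl fun j hj => ?_
      have h := ne_ofReal_of_norm_lt (hz.2 j hj)
      have h1 : z - uSM p j ≠ 0 := sub_ne_zero.2 h.1
      have h2 : z + uSM p j ≠ 0 := fun h0 => h.2 (eq_neg_of_add_eq_zero_left h0)
      field_simp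
      ring

end


theorem integral_divPow_mul_divPow (m n : ℕ) (z : ℝ) :
    ∫ x in (0 : ℝ)..z, divPow m x * divPow n (z - x) = divPow (m + n + 1) z := by
  have hd : ∀ n x, HasDerivAt (fun x => divPow (n + 1) (z - x)) (-divPow n (z - x)) x := by
    intro n x
    have := (hasDerivAt_divPow n (z - x)).comp x ((hasDerivAt_id x).const_sub z)
    exact this.congr_deriv (by ring)
  have hc : ∀ m n, IntervalIntegrable (fun x => divPow m x * divPow n (z - x)) volume 0 z := by
    intro m n
    exact ((continuous_divPow m).mul
      ((continuous_divPow n).comp (continuous_const.sub continuous_id))).intervalIntegrable _ _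
  induction m generalizing n with
  | zero =>
    simp only [divPow_zero, one_mul]
    rw [show (fun x => divPow n (z - x)) = fun x => - -divPow n (z - x) by simp,
      intervalIntegral.integral_neg, intervalIntegral.integral_eq_sub_of_hasDerivAt
      (f := fun x => divPow (n + 1) (z - x)) (fun x _ => hd n x)]
    · simp [divPow_succ_zero]
    · exact ((continuous_divPow n).comp (continuous_const.sub continuous_id)).neg.intervalIntegrable _ _
  | succ m ih =>
    have key := intervalIntegral.integral_eq_sub_of_hasDerivAt (a := (0 : ℝ)) (b := z)
      (f := fun x => divPow (m + 1) x * divPow (n + 1) (z - x))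
      (fun x _ => (hasDerivAt_divPow m x).mul (hd n x))
      (by simpa only [mul_neg, sub_eq_add_neg] using (hc m (n + 1)).sub (hc (m + 1) n))
    simp only [mul_neg, ← sub_eq_add_neg] at key
    rw [intervalIntegral.integral_sub (hc _ _) (hc _ _), ih,
      sub_self, divPow_succ_zero, divPow_succ_zero] at key
    rw [show m + 1 + n + 1 = m + (n + 1) + 1 by ring]
    linarith

/-- Exponential decay on the positive half-line. -/
structure ExpDecay (h : ℝ → ℝ) : Prop where
  meas : Measurable h
  bound : ∃ C c : ℝ, 0 ≤ C ∧ 0 < c ∧ ∀ x, 0 ≤ x → |h x| ≤ C * Real.exp (-c * x)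

namespace ExpDecay

variable {h h' : ℝ → ℝ}

theorem integrableOn (hh : ExpDecay h) (k : ℕ) : IntegrableOn (fun x => divPow k x * h x) (Set.Ioi 0) := by
  obtain ⟨C, c, _, hc, hb⟩ := hh.bound
  exact integrableOn_of_exp_bound hh.meas hc hb k

theorem integral_mul_sum (hh : ExpDecay h) (n : ℕ) (coef : ℕ → ℝ) {φ : ℝ → ℝ}
    (hφ : ∀ x, 0 < x → φ x = x * ∑ c ∈ range n, coef c * psi x c) :
    ∫ x in Set.Ioi 0, h x * φ x
      = ∑ c ∈ range n, coef c * ∫ x in Set.Ioi 0, divPow (2 * c + 1) x * h x := by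
  rw [setIntegral_congr_fun (g := fun x => ∑ c ∈ range n, coef c * (divPow (2 * c + 1) x * h x))
    measurableSet_Ioi]
  · rw [integral_finsetSum _ fun c _ => (hh.integrableOn _).const_mul _]
    simp only [integral_const_mul]
  · intro x hx
    simp only
    rw [hφ x hx, mul_sum, mul_sum]
    refine sum_congr rfl fun c _ => ?_
    rw [psi, divPow]; ring

theorem integrable_shear (hh : ExpDecay h) (m n : ℕ) :
    Integrable (Function.uncurry fun x y => divPow m x * divPow n y * h (x + y))
      ((volume.restrict (Set.Ioi 0)).prod (volume.restrict (Set.Ioi 0))) := by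
  obtain ⟨C, c, hC, hc, hb⟩ := hh.bound
  have h1 := ((integrableOn_divPow_mul_exp hc m le_rfl).integrable.const_mul C).mul_prod
    (integrableOn_divPow_mul_exp hc n le_rfl).integrable
  refine h1.mono' ?_ ?_
  · exact ((((continuous_divPow m).measurable.comp measurable_fst).mul
      ((continuous_divPow n).measurable.comp measurable_snd)).mul
      (hh.meas.comp (measurable_fst.add measurable_snd))).aestronglyMeasurable
  · rw [Measure.prod_restrict]
    filter_upwards [ae_restrict_mem (measurableSet_Ioi.prod measurableSet_Ioi)] with p hp
    have hx : (0 : ℝ) ≤ p.1 := le_of_lt hp.1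
    have hy : (0 : ℝ) ≤ p.2 := le_of_lt hp.2
    simp only [Function.uncurry]
    rw [Real.norm_eq_abs, abs_mul, abs_mul, abs_of_nonneg (divPow_nonneg m hx),
      abs_of_nonneg (divPow_nonneg n hy)]
    calc _ ≤ divPow m p.1 * divPow n p.2 * (C * Real.exp (-c * (p.1 + p.2))) :=
          mul_le_mul_of_nonneg_left (hb _ (add_nonneg hx hy))
            (mul_nonneg (divPow_nonneg m hx) (divPow_nonneg n hy))
      _ = _ := by rw [mul_add, Real.exp_add]; ring

theorem integral_shear (hh : ExpDecay h) (m n : ℕ) :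
    ∫ x in Set.Ioi 0, ∫ y in Set.Ioi 0, divPow m x * divPow n y * h (x + y)
      = ∫ z in Set.Ioi 0, divPow (m + n + 1) z * h z := by
  obtain ⟨C, c, hC, hc, hb⟩ := hh.bound
  set F : ℝ → ℝ → ℝ := fun x z => (Set.Iio z).indicator (fun x => divPow m x * divPow n (z - x) * h z) x
    with hF
  have hFm : Measurable (Function.uncurry F) := by
    have : Function.uncurry F = {p : ℝ × ℝ | p.1 < p.2}.indicator
        fun p => divPow m p.1 * divPow n (p.2 - p.1) * h p.2 := by
      funext p
      simp only [hF, Function.uncurry, Set.indicator_apply, Set.mem_Iio, Set.mem_ofPred_eq]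
    rw [this]
    exact ((((continuous_divPow m).measurable.comp measurable_fst).mul
      ((continuous_divPow n).measurable.comp (measurable_snd.sub measurable_fst))).mul
      (hh.meas.comp measurable_snd)).indicator (measurableSet_lt measurable_fst measurable_snd)
  have hFi : Integrable (Function.uncurry F)
      ((volume.restrict (Set.Ioi 0)).prod (volume.restrict (Set.Ioi 0))) := by
    have hc2 : 0 < c / 2 := half_pos hc
    refine (((integrableOn_divPow_mul_exp hc2 m le_rfl).integrable.const_mul C).mul_prod
      (integrableOn_divPow_mul_exp hc2 n le_rfl).integrable).mono' hFm.aestronglyMeasurable ?_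
    rw [Measure.prod_restrict]
    filter_upwards [ae_restrict_mem (measurableSet_Ioi.prod measurableSet_Ioi)] with p hp
    obtain ⟨x, z⟩ := p
    have hx : (0 : ℝ) ≤ x := le_of_lt hp.1
    have hz : (0 : ℝ) ≤ z := le_of_lt hp.2
    have h0 := divPow_nonneg m hx
    have h1 := divPow_nonneg n hz
    simp only [Function.uncurry, hF, Set.indicator_apply, Set.mem_Iio]
    split_ifs with hxz
    · have h2 : 0 ≤ divPow n (z - x) := divPow_nonneg n (by linarith)
      have h3 : divPow n (z - x) ≤ divPow n z := by
        unfold divPow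
        gcongr
        linarith
      rw [Real.norm_eq_abs, abs_mul, abs_mul, abs_of_nonneg h0, abs_of_nonneg h2]
      have h4 : |h z| ≤ C * (Real.exp (-(c / 2) * x) * Real.exp (-(c / 2) * z)) := by
        refine (hb z hz).trans (mul_le_mul_of_nonneg_left ?_ hC)
        rw [← Real.exp_add]
        exact Real.exp_le_exp.2 (by nlinarith)
      calc divPow m x * divPow n (z - x) * |h z|
          ≤ divPow m x * divPow n z * (C * (Real.exp (-(c / 2) * x) * Real.exp (-(c / 2) * z))) := by
            gcongr
        _ = _ := by ring
    · rw [norm_zero]; positivity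
  have e1 : ∀ x ∈ Set.Ioi (0 : ℝ), ∫ y in Set.Ioi 0, divPow m x * divPow n y * h (x + y)
      = ∫ z in Set.Ioi 0, F x z := by
    intro x hx
    have hx : 0 < x := hx
    have e : ∀ z, (Set.Ioi 0).indicator (F x) z
        = (Set.Ioi x).indicator (fun z => divPow m x * divPow n (z - x) * h z) z := by
      intro z
      simp only [hF, Set.indicator_apply, Set.mem_Ioi, Set.mem_Iio]
      by_cases hz : x < z
      · rw [if_pos hz, if_pos (hx.trans hz)]
      · simp [hz]
    rw [← integral_indicator measurableSet_Ioi, ← integral_indicator measurableSet_Ioi]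
    simp only [e]
    refine Eq.trans ?_ (integral_add_left_eq_self _ x)
    refine integral_congr_ae (Eventually.of_forall fun y => ?_)
    simp [Set.indicator_apply]
  rw [setIntegral_congr_fun measurableSet_Ioi e1, integral_integral_swap hFi]
  refine setIntegral_congr_fun measurableSet_Ioi fun z hz => ?_
  have hz : 0 < z := hz
  simp only [hF]
  rw [setIntegral_indicator measurableSet_Iio, Set.Ioi_inter_Iio, integral_mul_const,
    ← integral_Ioc_eq_integral_Ioo, ← intervalIntegral.integral_of_le hz.le,
    integral_divPow_mul_divPow]

theorem integral_integral_mul_sum (hh : ExpDecay h) (n : ℕ) (coef : ℕ → ℕ → ℝ) {Φ : ℝ → ℝ → ℝ}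
    (hΦ : ∀ x y, 0 < x → 0 < y → Φ x y
      = x * y * ∑ c ∈ range n, ∑ e ∈ range n, coef c e * (psi x c * psi y e)) :
    ∫ x in Set.Ioi 0, ∫ y in Set.Ioi 0, h (x + y) * Φ x y
      = ∑ c ∈ range n, ∑ e ∈ range n,
        coef c e * ∫ x in Set.Ioi 0, divPow (2 * (c + e + 1) + 1) x * h x := by
  have e1 : ∫ x in Set.Ioi 0, ∫ y in Set.Ioi 0, h (x + y) * Φ x y
      = ∫ x in Set.Ioi 0, ∫ y in Set.Ioi 0, ∑ c ∈ range n, ∑ e ∈ range n,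
        coef c e * (divPow (2 * c + 1) x * divPow (2 * e + 1) y * h (x + y)) := by
    refine setIntegral_congr_fun measurableSet_Ioi fun x hx =>
      setIntegral_congr_fun measurableSet_Ioi fun y hy => ?_
    beta_reduce
    rw [hΦ x y hx hy, mul_sum, mul_sum]
    refine sum_congr rfl fun c _ => ?_
    rw [mul_sum, mul_sum]
    refine sum_congr rfl fun e _ => ?_
    simp only [psi, divPow]; ring
  have hI : ∀ c e, Integrable (Function.uncurry fun x y => coef c e *
      (divPow (2 * c + 1) x * divPow (2 * e + 1) y * h (x + y)))
      ((volume.restrict (Set.Ioi 0)).prod (volume.restrict (Set.Ioi 0))) := fun c e =>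
    (hh.integrable_shear (2 * c + 1) (2 * e + 1)).const_mul (coef c e)
  have e2 := integral_finsetSum (range n) fun c (_ : c ∈ range n) =>
    integrable_finsetSum (range n) fun e (_ : e ∈ range n) => hI c e
  rw [e1, integral_integral (f := fun x y => ∑ c ∈ range n, ∑ e ∈ range n,
        coef c e * (divPow (2 * c + 1) x * divPow (2 * e + 1) y * h (x + y)))
    (integrable_finsetSum _ fun c _ => integrable_finsetSum _ fun e _ => hI c e)]
  refine e2.trans ?_
  refine sum_congr rfl fun c _ => ?_
  rw [integral_finsetSum _ fun e _ => hI c e]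
  refine sum_congr rfl fun e _ => ?_
  refine (integral_integral (hI c e)).symm.trans ?_
  simp only [integral_const_mul]
  rw [hh.integral_shear]
  congr 1
  rw [show 2 * c + 1 + (2 * e + 1) + 1 = 2 * (c + e + 1) + 1 by ring]

end ExpDecay

namespace IsMomentKernel

variable {H : ℝ → ℝ → ℝ} {q : ℕ → ℝ → ℝ}

theorem expDecay (h : IsMomentKernel H q) (t : ℝ) : ExpDecay fun x => H x t := by
  obtain ⟨C, a, c, hC, hc, hb⟩ := h.bound
  exact ⟨h.meas.comp (measurable_id.prodMk measurable_const),
    C * Real.exp (a * |t|), c, by positivity, hc, fun x hx => hb x t hx⟩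

theorem exists_bound_of_mem (h : IsMomentKernel H q) (L b : ℝ) :
    ∃ C c : ℝ, 0 ≤ C ∧ 0 < c ∧ ∀ x t, 0 ≤ x → t ∈ Set.Ioc 0 L →
      |H x (t + b)| ≤ C * Real.exp (-c * x) := by
  obtain ⟨C, a, c, hC, hc, hb⟩ := h.bound
  refine ⟨C * Real.exp (|a| * (|L| + |b|)), c, by positivity, hc, fun x t hx ht => ?_⟩
  refine (hb x _ hx).trans ?_
  have h1 : |t + b| ≤ |L| + |b| := (abs_add_le _ _).trans (by
    have := le_abs_self L
    have h2 := ht.2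
    rw [abs_of_pos ht.1]; linarith)
  gcongr
  · exact le_abs_self a

theorem expDecay_integral (h : IsMomentKernel H q) {L : ℝ} (hL : 0 ≤ L) (b : ℝ) :
    ExpDecay fun x => ∫ t in (0 : ℝ)..L, H x (t + b) := by
  obtain ⟨C, c, hC, hc, hb⟩ := h.exists_bound_of_mem L b
  refine ⟨?_, C * L, c, by positivity, hc, fun x hx => ?_⟩
  · simp only [intervalIntegral.integral_of_le hL]
    have : StronglyMeasurable (Function.uncurry fun x t => H x (t + b)) :=
      (h.meas.comp (measurable_fst.prodMk (measurable_snd.add_const b))).stronglyMeasurable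
    exact this.integral_prod_right.measurable
  · have := intervalIntegral.norm_integral_le_of_norm_le_const (a := (0 : ℝ)) (b := L)
      (f := fun t => H x (t + b)) (C := C * Real.exp (-c * x)) fun t ht => by
        rw [Set.uIoc_of_le hL] at ht
        exact hb x t hx ht
    rw [sub_zero, abs_of_nonneg hL, Real.norm_eq_abs] at this
    exact this.trans (le_of_eq (by ring))

theorem moment_integral (h : IsMomentKernel H q) {L : ℝ} (hL : 0 ≤ L) (b : ℝ) (k : ℕ) :
    ∫ x in Set.Ioi 0, divPow (2 * k + 1) x * ∫ t in (0 : ℝ)..L, H x (t + b)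
      = ∫ t in (0 : ℝ)..L, q k (t + b) := by
  obtain ⟨C, c, hC, hc, hb⟩ := h.exists_bound_of_mem L b
  have hI : Integrable (Function.uncurry fun x t => divPow (2 * k + 1) x * H x (t + b))
      ((volume.restrict (Set.Ioi 0)).prod (volume.restrict (Set.Ioc 0 L))) := by
    refine (((integrableOn_divPow_mul_exp hc (2 * k + 1) le_rfl).integrable.const_mul C).mul_prod
      (integrable_const (1 : ℝ))).mono' ?_ ?_
    · exact (((continuous_divPow _).measurable.comp measurable_fst).mul
        (h.meas.comp (measurable_fst.prodMk (measurable_snd.add_const b)))).aestronglyMeasurable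
    · rw [Measure.prod_restrict]
      filter_upwards [ae_restrict_mem (measurableSet_Ioi.prod measurableSet_Ioc)] with p hp
      have hx : (0 : ℝ) ≤ p.1 := le_of_lt hp.1
      simp only [Function.uncurry]
      rw [Real.norm_eq_abs, abs_mul, abs_of_nonneg (divPow_nonneg _ hx)]
      calc _ ≤ divPow (2 * k + 1) p.1 * (C * Real.exp (-c * p.1)) :=
            mul_le_mul_of_nonneg_left (hb _ _ hx hp.2) (divPow_nonneg _ hx)
        _ = _ := by ring
  simp only [intervalIntegral.integral_of_le hL, ← integral_const_mul]
  rw [integral_integral_swap hI]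
  simp only [h.moment]

end IsMomentKernel

/-- The odd polynomials `∑_l σ_l t^{2c+3-2l} / (2c+3-2l)!`. -/
def momentPrim (σ : ℕ → ℝ) (c : ℕ) (t : ℝ) : ℝ :=
  ∑ l ∈ range (c + 2), σ l * divPow (2 * c + 3 - 2 * l) t

theorem momentPrim_neg (σ : ℕ → ℝ) (c : ℕ) (t : ℝ) : momentPrim σ c (-t) = -momentPrim σ c t := by
  rw [momentPrim, momentPrim, ← Finset.sum_neg_distrib]
  refine sum_congr rfl fun l hl => ?_
  rw [mem_range] at hl
  rw [divPow_neg_of_odd ⟨c + 1 - l, by omega⟩, mul_neg]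

theorem integral_momentPrim (σ : ℕ → ℝ) (c : ℕ) (L b : ℝ) :
    ∫ t in (0 : ℝ)..L, ∑ l ∈ range (c + 2), σ l * divPow (2 * c + 2 - 2 * l) (t + b)
      = momentPrim σ c (L + b) - momentPrim σ c b := by
  rw [intervalIntegral.integral_eq_sub_of_hasDerivAt (f := fun t => momentPrim σ c (t + b)), zero_add]
  · intro t _
    refine HasDerivAt.comp_add_const t b ?_
    unfold momentPrim
    refine HasDerivAt.fun_sum fun l hl => ?_
    rw [mem_range] at hl
    rw [show 2 * c + 3 - 2 * l = 2 * c + 2 - 2 * l + 1 by omega]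
    exact (hasDerivAt_divPow _ _).const_mul _
  · refine Continuous.intervalIntegrable (continuous_finsetSum _ fun l _ => ?_) _ _
    exact ((continuous_divPow _).comp (continuous_add_const b)).const_mul _

/-- Initial data whose integrals against the normalised even powers are governed by `σ`. -/
structure IsTensorData (𝒟 : ABOData) (σ : ℕ → ℝ) : Prop where
  A_eq : ∀ x y z, 𝒟.A x y z = σ 0
  VD_eq : ∀ L, 𝒟.VD L = σ 1 / 8 + σ 0 * (L ^ 2 / 48)
  intR_eq : ∀ L₁ L₂ : ℝ, 0 < L₁ → 0 < L₂ → ∀ (n : ℕ) (coef : ℕ → ℝ) (φ : ℝ → ℝ),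
    (∀ x, 0 < x → φ x = x * ∑ c ∈ range n, coef c * psi x c) →
    𝒟.intR L₁ L₂ φ = ∑ c ∈ range n,
      coef c * ((momentPrim σ c (L₁ + L₂) + momentPrim σ c (L₁ - L₂)) / 2)
  intD_eq : ∀ L₁ : ℝ, 0 < L₁ → ∀ (n : ℕ) (coef : ℕ → ℕ → ℝ) (Φ : ℝ → ℝ → ℝ),
    (∀ x y, 0 < x → 0 < y → Φ x y
      = x * y * ∑ c ∈ range n, ∑ e ∈ range n, coef c e * (psi x c * psi y e)) →
    𝒟.intD L₁ Φ = ∑ c ∈ range n, ∑ e ∈ range n,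
      coef c e * momentPrim σ (c + e + 1) L₁

theorem momentPrim_zero (σ : ℕ → ℝ) (c : ℕ) : momentPrim σ c 0 = 0 := by
  have := momentPrim_neg σ c 0
  rw [neg_zero] at this
  linarith

theorem intR_minimalString (p : ℕ) {L₁ L₂ : ℝ} (h₁ : 0 < L₁) {n : ℕ} {coef : ℕ → ℝ} {φ : ℝ → ℝ}
    (hφ : ∀ x, 0 < x → φ x = x * ∑ c ∈ range n, coef c * psi x c) :
    (minimalString p).intR L₁ L₂ φ = ∑ c ∈ range n,
      coef c * ((momentPrim (coefM p) c (L₁ + L₂) + momentPrim (coefM p) c (L₁ - L₂)) / 2) := by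
  have hH := isMomentKernel_HM p
  have hint : ∀ b x, 0 ≤ x → IntervalIntegrable (fun t => HM p x (t + b)) volume 0 L₁ := by
    intro b x hx
    obtain ⟨C, c, hC, hc, hb⟩ := hH.exists_bound_of_mem L₁ b
    rw [intervalIntegrable_iff_integrableOn_Ioc_of_le h₁.le]
    refine Measure.integrableOn_of_bounded (M := C * Real.exp (-c * x)) (by simp)
      (hH.meas.comp (measurable_const.prodMk (measurable_id.add_const b))).aestronglyMeasurable ?_
    filter_upwards [ae_restrict_mem measurableSet_Ioc] with t ht
    exact hb x t hx ht
  have d1 := hH.expDecay_integral h₁.le L₂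
  have d2 := hH.expDecay_integral h₁.le (-L₂)
  have d : ExpDecay fun x => (1 / 2) * ((∫ t in (0 : ℝ)..L₁, HM p x (t + L₂))
      + ∫ t in (0 : ℝ)..L₁, HM p x (t + -L₂)) := by
    obtain ⟨C, c, hC, hc, hb⟩ := d1.bound
    obtain ⟨C', c', hC', hc', hb'⟩ := d2.bound
    refine ⟨(d1.meas.add d2.meas).const_mul _, C + C', min c c', by positivity, lt_min hc hc',
      fun x hx => ?_⟩
    have e1 := (hb x hx).trans (mul_le_mul_of_nonneg_left (Real.exp_le_exp.2
      (mul_le_mul_of_nonneg_right (neg_le_neg (min_le_left c c')) hx)) hC)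
    have e2 := (hb' x hx).trans (mul_le_mul_of_nonneg_left (Real.exp_le_exp.2
      (mul_le_mul_of_nonneg_right (neg_le_neg (min_le_right c c')) hx)) hC')
    have e3 := abs_add_le (∫ t in (0 : ℝ)..L₁, HM p x (t + L₂)) (∫ t in (0 : ℝ)..L₁, HM p x (t + -L₂))
    rw [abs_mul, abs_of_pos (by norm_num : (0 : ℝ) < 1 / 2)]
    have e4 := abs_nonneg (∫ t in (0 : ℝ)..L₁, HM p x (t + L₂))
    have e5 := abs_nonneg (∫ t in (0 : ℝ)..L₁, HM p x (t + -L₂))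
    rw [add_mul]
    linarith
  have hR : ∀ x, 0 ≤ x → RM p L₁ L₂ x = (1 / 2) * ((∫ t in (0 : ℝ)..L₁, HM p x (t + L₂))
      + ∫ t in (0 : ℝ)..L₁, HM p x (t + -L₂)) := by
    intro x hx
    rw [RM, ← intervalIntegral.integral_add (hint _ x hx) (hint _ x hx)]
    simp only [sub_eq_add_neg]
  show ∫ x in Set.Ioi (0 : ℝ), RM p L₁ L₂ x * φ x = _
  rw [setIntegral_congr_fun (g := fun x => (1 / 2) * ((∫ t in (0 : ℝ)..L₁, HM p x (t + L₂))
      + ∫ t in (0 : ℝ)..L₁, HM p x (t + -L₂)) * φ x) measurableSet_Ioi fun x hx => by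
    simp only; rw [hR x (le_of_lt hx)]]
  rw [d.integral_mul_sum n coef hφ]
  refine sum_congr rfl fun c _ => ?_
  congr 1
  simp only [mul_add, mul_left_comm _ (1 / 2 : ℝ)]
  rw [integral_add ((d1.integrableOn _).const_mul _) ((d2.integrableOn _).const_mul _),
    integral_const_mul, integral_const_mul, hH.moment_integral h₁.le, hH.moment_integral h₁.le,
    integral_momentPrim, integral_momentPrim, momentPrim_neg, sub_eq_add_neg L₁]
  ring

theorem intD_minimalString (p : ℕ) {L₁ : ℝ} (h₁ : 0 < L₁) {n : ℕ} {coef : ℕ → ℕ → ℝ} {Φ : ℝ → ℝ → ℝ}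
    (hΦ : ∀ x y, 0 < x → 0 < y → Φ x y
      = x * y * ∑ c ∈ range n, ∑ e ∈ range n, coef c e * (psi x c * psi y e)) :
    (minimalString p).intD L₁ Φ = ∑ c ∈ range n, ∑ e ∈ range n,
      coef c e * momentPrim (coefM p) (c + e + 1) L₁ := by
  have hH := isMomentKernel_HM p
  have d := hH.expDecay_integral h₁.le 0
  have := d.integral_integral_mul_sum n coef hΦ
  simp only [hH.moment_integral h₁.le, integral_momentPrim] at this
  simp only [momentPrim_zero, add_zero, sub_zero] at this
  exact this

/-- The coefficients of `1 / y^SM(p)`, with a leading zero. -/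
def sigmaSM (p : ℕ) : ℕ → ℝ
  | 0 => 0
  | l + 1 => coefSM p l

theorem minimalSuperstring_coefs (p c : ℕ) (t : ℝ) :
    ∑ l ∈ range (c + 1), coefSM p l * divPow (2 * c + 1 - 2 * l) t
      = momentPrim (sigmaSM p) c t := by
  conv_rhs => rw [momentPrim, Finset.sum_range_succ']
  simp only [sigmaSM, zero_mul, add_zero]
  exact sum_congr rfl fun l _ => by
    rw [show 2 * c + 3 - 2 * (l + 1) = 2 * c + 1 - 2 * l by omega]

theorem HSM_one (x y : ℝ) : HSM 1 x y = 0 := by simp [HSM]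

theorem momentPrim_one (c : ℕ) (t : ℝ) :
    momentPrim (sigmaSM 1) c t = divPow (2 * c + 1) t := by
  rw [← minimalSuperstring_coefs, Finset.sum_eq_single 0]
  · simp [coefSM]
  · intro l _ hl; simp [coefSM, hl]
  · simp

theorem kerIntSM_of_ne_one {p : ℕ} (hp : p ≠ 1) (φ : ℝ → ℝ) (a t : ℝ) :
    kerIntSM p φ a t = ∫ y in Set.Ioi (0 : ℝ), HSM p (a + y) t * φ y := by
  rw [kerIntSM, if_neg hp, add_zero]
  simp only [mul_comm]

open Classical in
theorem kerIntSM_one (φ : ℝ → ℝ) (a t : ℝ) :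
    kerIntSM 1 φ a t = (if 0 < t - a then φ (t - a) else 0) - if 0 < -t - a then φ (-t - a) else 0 := by
  rw [kerIntSM, if_pos rfl, setIntegral_dirac, setIntegral_dirac]
  simp [HSM_one, Set.mem_Ioi]

theorem kerIntSM_one_sum {n : ℕ} {coef : ℕ → ℝ} {φ : ℝ → ℝ}
    (hφ : ∀ x, 0 < x → φ x = x * ∑ c ∈ range n, coef c * psi x c) (t : ℝ) :
    kerIntSM 1 φ 0 t = ∑ c ∈ range n, coef c * divPow (2 * c + 1) t := by
  have h : ∀ x, x * ∑ c ∈ range n, coef c * psi x c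
      = ∑ c ∈ range n, coef c * divPow (2 * c + 1) x := by
    intro x
    rw [mul_sum]
    exact sum_congr rfl fun c _ => by rw [psi, divPow]; ring
  rw [kerIntSM_one, sub_zero, sub_zero]
  rcases lt_trichotomy t 0 with ht | ht | ht
  · rw [if_neg ht.not_gt, if_pos (by linarith), hφ _ (by linarith), h, zero_sub, ← Finset.sum_neg_distrib]
    exact sum_congr rfl fun c _ => by rw [divPow_neg_of_odd ⟨c, rfl⟩]; ring
  · subst ht; simp [divPow]
  · rw [if_pos ht, if_neg (by linarith), hφ _ ht, h, sub_zero]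

theorem kerIntSM_sum (p : ℕ) {n : ℕ} {coef : ℕ → ℝ} {φ : ℝ → ℝ}
    (hφ : ∀ x, 0 < x → φ x = x * ∑ c ∈ range n, coef c * psi x c) (t : ℝ) :
    kerIntSM p φ 0 t = ∑ c ∈ range n,
      coef c * momentPrim (sigmaSM p) c t := by
  by_cases hp : p = 1
  · subst hp
    simp only [kerIntSM_one_sum hφ, momentPrim_one]
  · have hH := isMomentKernel_HSM p
    simp only [kerIntSM_of_ne_one hp, zero_add]
    rw [(hH.expDecay t).integral_mul_sum n coef hφ]
    simp only [hH.moment, if_neg hp, minimalSuperstring_coefs]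

theorem intD_minimalSuperstring (p : ℕ) {L₁ : ℝ} (h₁ : 0 < L₁) {n : ℕ} {coef : ℕ → ℕ → ℝ}
    {Φ : ℝ → ℝ → ℝ} (hΦ : ∀ x y, 0 < x → 0 < y → Φ x y
      = x * y * ∑ c ∈ range n, ∑ e ∈ range n, coef c e * (psi x c * psi y e)) :
    (minimalSuperstring p).intD L₁ Φ = ∑ c ∈ range n, ∑ e ∈ range n,
      coef c e * momentPrim (sigmaSM p) (c + e + 1) L₁ := by
  show ∫ x in Set.Ioi (0 : ℝ), kerIntSM p (fun y => Φ x y) x L₁ = _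
  by_cases hp : p = 1
  · subst hp
    have e : ∀ x ∈ Set.Ioi (0 : ℝ), kerIntSM 1 (fun y => Φ x y) x L₁
        = (Set.Iio L₁).indicator (fun x => ∑ c ∈ range n, ∑ e ∈ range n,
          coef c e * (divPow (2 * c + 1) x * divPow (2 * e + 1) (L₁ - x))) x := by
      intro x hx
      have hx : 0 < x := hx
      rw [kerIntSM_one, if_neg (by linarith : ¬ 0 < -L₁ - x), sub_zero, Set.indicator_apply]
      simp only [sub_pos, Set.mem_Iio]
      split_ifs with hxL
      · rw [hΦ x _ hx (sub_pos.2 hxL), mul_sum]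
        refine sum_congr rfl fun c _ => ?_
        rw [mul_sum]
        exact sum_congr rfl fun e _ => by simp only [psi, divPow]; ring
      · rfl
    rw [setIntegral_congr_fun measurableSet_Ioi e, setIntegral_indicator measurableSet_Iio,
      Set.Ioi_inter_Iio, ← integral_Ioc_eq_integral_Ioo, ← intervalIntegral.integral_of_le h₁.le]
    have hc : ∀ c e, Continuous fun x => coef c e * (divPow (2 * c + 1) x * divPow (2 * e + 1) (L₁ - x)) :=
      fun c e => ((continuous_divPow _).mul
        ((continuous_divPow _).comp (continuous_const.sub continuous_id))).const_mul _
    rw [intervalIntegral.integral_finsetSum fun c _ =>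
      (continuous_finsetSum _ fun e _ => hc c e).intervalIntegrable _ _]
    refine sum_congr rfl fun c _ => ?_
    rw [intervalIntegral.integral_finsetSum fun e _ => (hc c e).intervalIntegrable _ _]
    refine sum_congr rfl fun e _ => ?_
    rw [intervalIntegral.integral_const_mul, integral_divPow_mul_divPow, momentPrim_one,
      show 2 * c + 1 + (2 * e + 1) + 1 = 2 * (c + e + 1) + 1 by ring]
  · have hH := isMomentKernel_HSM p
    simp only [kerIntSM_of_ne_one hp]
    rw [(hH.expDecay L₁).integral_integral_mul_sum n coef hΦ]
    simp only [hH.moment, if_neg hp, minimalSuperstring_coefs]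


open Polynomial in
theorem exists_eq_add_X_pow_four_mul (P : ℂ[X]) : ∃ Q : ℂ[X],
    P = C (P.coeff 0) + C (P.coeff 1) * X + C (P.coeff 2) * X ^ 2 + C (P.coeff 3) * X ^ 3 + X ^ 4 * Q := by
  refine ⟨P.divX.divX.divX.divX, ?_⟩
  have h0 := P.X_mul_divX_add
  have h1 := P.divX.X_mul_divX_add
  have h2 := P.divX.divX.X_mul_divX_add
  have h3 := P.divX.divX.divX.X_mul_divX_add
  simp only [coeff_divX] at h1 h2 h3
  linear_combination (-1 : ℂ[X]) * h0 - X * h1 - X ^ 2 * h2 - X ^ 3 * h3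

open Polynomial in
theorem T_odd_coeffs (m : ℕ) : (Chebyshev.T ℂ (2 * m + 1)).coeff 0 = 0 ∧
    (Chebyshev.T ℂ (2 * m + 1)).coeff 1 = (-1) ^ m * (2 * m + 1) ∧
    (Chebyshev.T ℂ (2 * m + 1)).coeff 2 = 0 ∧
    (Chebyshev.T ℂ (2 * m + 1)).coeff 3 = (1 - (2 * m + 1) ^ 2) * ((-1) ^ m * (2 * m + 1)) / 6 := by
  have h0 : (Chebyshev.T ℂ (2 * m + 1)).eval 0 = 0 := by
    have := eval_T_sin m 0
    simpa using this
  have hU : (Chebyshev.U ℂ (2 * m)).eval 0 = (-1) ^ m := by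
    have := eval_U_sin m 0
    simpa using this
  have h1 : (derivative (Chebyshev.T ℂ (2 * m + 1))).eval 0 = (-1) ^ m * (2 * m + 1) := by
    rw [Chebyshev.T_derivative_eq_U, eval_mul, show (2 * (m : ℤ) + 1 - 1) = 2 * m by ring, hU]
    simp [mul_comm]
  have h2 := Chebyshev.iterate_derivative_T_eval_zero_recurrence (R := ℂ) (2 * m + 1) 0
  have h3 := Chebyshev.iterate_derivative_T_eval_zero_recurrence (R := ℂ) (2 * m + 1) 1
  have hc : ∀ k, (derivative^[k] (Chebyshev.T ℂ (2 * m + 1))).eval 0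
      = (k.factorial : ℂ) * (Chebyshev.T ℂ (2 * m + 1)).coeff k := by
    intro k
    rw [← coeff_zero_eq_eval_zero, coeff_iterate_derivative, zero_add, Nat.descFactorial_self,
      nsmul_eq_mul]
  have h1' := hc 1
  have h0' := hc 0
  rw [hc, hc, ← h0', Function.iterate_zero_apply, h0] at h2
  rw [hc, hc, ← h1', Function.iterate_one, h1] at h3
  rw [Function.iterate_one, h1] at h1'
  rw [Function.iterate_zero_apply, h0] at h0'
  simp [Nat.factorial] at h0' h1' h2 h3
  refine ⟨by simp [h0'], h1'.symm, h2, ?_⟩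
  rw [eq_div_iff (by norm_num)]
  linear_combination h3


theorem tendsto_one_div_yM {p : ℕ} (hp : Odd p) :
    Tendsto (fun z => (1 / yM p z - z⁻¹) / z) (𝓝[≠] 0) (𝓝 (coefM p 1 : ℂ)) := by
  have h : Tendsto (fun z : ℂ => ∑ j ∈ Icc 1 ((p - 1) / 2),
      (((-1) ^ j * Real.cos (Real.pi / p * j) : ℝ) : ℂ) * (2 * ((z - uM p j) * (z + uM p j))⁻¹))
      (𝓝 0) (𝓝 (∑ j ∈ Icc 1 ((p - 1) / 2),
      (((-1) ^ j * Real.cos (Real.pi / p * j) : ℝ) : ℂ) * (2 * (((0 : ℂ) - uM p j) * (0 + uM p j))⁻¹))) := by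
    refine tendsto_finset_sum _ fun j hj => Tendsto.const_mul _ (Tendsto.const_mul _ ?_)
    have hu : (uM p j : ℂ) ≠ 0 := by exact_mod_cast (uM_pos hj).ne'
    refine Tendsto.inv₀ (Continuous.tendsto (by fun_prop) _) (by simpa using hu)
  have e : (coefM p 1 : ℂ) = ∑ j ∈ Icc 1 ((p - 1) / 2),
      (((-1) ^ j * Real.cos (Real.pi / p * j) : ℝ) : ℂ) *
        (2 * (((0 : ℂ) - uM p j) * (0 + uM p j))⁻¹) := by
    rw [coefM, if_neg one_ne_zero, Complex.ofReal_sum]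
    refine sum_congr rfl fun j _ => ?_
    have h : (-(uM p j : ℂ) * uM p j)⁻¹ = -((uM p j : ℂ)⁻¹ ^ 2) := by
      rw [neg_mul, ← sq, ← neg_inv, inv_pow]
    rw [zero_sub, zero_add, h]
    push_cast; ring
  rw [e]
  refine (h.mono_left nhdsWithin_le_nhds).congr' ?_
  filter_upwards [eventually_norm_lt fun j hj => uM_pos (p := p) hj] with z hz
  rw [one_div_yM hp hz.1 hz.2, add_sub_cancel_left, Finset.sum_div]
  refine sum_congr rfl fun j hj => ?_
  have h := ne_ofReal_of_norm_lt (hz.2 j hj)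
  have h1 : z - uM p j ≠ 0 := sub_ne_zero.2 h.1
  have h2 : z + uM p j ≠ 0 := fun h0 => h.2 (eq_neg_of_add_eq_zero_left h0)
  have h3 := hz.1
  field_simp
  ring

open Polynomial in
theorem coefM_one {p : ℕ} (hp : Odd p) : coefM p 1 = 2 * Real.pi ^ 2 / 3 * (1 - 1 / (p : ℝ) ^ 2) := by
  have h1 := tendsto_one_div_yM hp
  obtain ⟨m, rfl⟩ := hp
  have hm : (2 * m + 1 - 1) / 2 = m := by omega
  have hpC : ((2 * m + 1 : ℕ) : ℂ) ≠ 0 := by exact_mod_cast (by omega : 2 * m + 1 ≠ 0)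
  have hpC' : (2 * m + 1 : ℂ) ≠ 0 := by exact_mod_cast hpC
  have hpi : (Real.pi : ℂ) ≠ 0 := by exact_mod_cast Real.pi_ne_zero
  have hm2 : ((-1 : ℂ) ^ m) * (-1) ^ m = 1 := by rw [← mul_pow]; simp
  obtain ⟨Q, hQ⟩ := exists_eq_add_X_pow_four_mul (Chebyshev.T ℂ (2 * m + 1))
  obtain ⟨c0, c1, c2, c3⟩ := T_odd_coeffs m
  rw [c0, c1, c2, c3] at hQ
  set e : ℂ := 4 * Real.pi ^ 2 / 6 * (1 / (2 * m + 1) ^ 2 - 1) with he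
  set R : ℂ → ℂ := fun z => (-1) ^ m / (2 * Real.pi) * (2 * Real.pi / (2 * m + 1)) ^ 4
    * Q.eval (2 * Real.pi / (2 * m + 1) * z) with hR
  have hy : ∀ z, yM (2 * m + 1) z = z * (1 + z ^ 2 * (e + z * R z)) := by
    intro z
    rw [yM, hm, show (((2 * m + 1 : ℕ) : ℤ)) = 2 * m + 1 by push_cast; ring, hQ]
    rw [show z * (1 + z ^ 2 * (e + z * R z))
      = (-1) ^ m * (-1) ^ m * (z + z ^ 3 * e) + z ^ 4 * R z by rw [hm2]; ring]
    simp only [eval_add, eval_mul, eval_C, eval_X, eval_pow, hR, he]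
    push_cast
    generalize eval _ Q = q
    generalize ((-1 : ℂ) ^ m) = s
    field_simp
    ring
  have hRc : Continuous R := by
    have := Q.continuous
    simp only [hR]; fun_prop
  have t1 : Tendsto (fun z => 1 + z ^ 2 * (e + z * R z)) (𝓝 0) (𝓝 1) := by
    have : Continuous fun z => 1 + z ^ 2 * (e + z * R z) := by fun_prop
    simpa using this.tendsto 0
  have t2 : Tendsto (fun z => -(e + z * R z) / (1 + z ^ 2 * (e + z * R z))) (𝓝 0) (𝓝 (-e)) := by
    have : Continuous fun z => -(e + z * R z) := by fun_prop
    have := (this.tendsto 0).div t1 one_ne_zero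
    rwa [zero_mul, add_zero, div_one] at this
  have h2 : Tendsto (fun z => (1 / yM (2 * m + 1) z - z⁻¹) / z) (𝓝[≠] 0) (𝓝 (-e)) := by
    refine (t2.mono_left nhdsWithin_le_nhds).congr' ?_
    filter_upwards [eventually_mem_nhdsWithin, (t1.eventually_ne one_ne_zero).filter_mono
      nhdsWithin_le_nhds] with z hz hz'
    have hz : z ≠ 0 := hz
    rw [hy]
    generalize e + z * R z = A at hz' ⊢
    obtain ⟨D, hD⟩ : ∃ D, D = 1 + z ^ 2 * A := ⟨_, rfl⟩
    rw [← hD] at hz' ⊢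
    field_simp
    linear_combination hD
  have := tendsto_nhds_unique h1 h2
  have h3 : (coefM (2 * m + 1) 1 : ℂ)
      = ((2 * Real.pi ^ 2 / 3 * (1 - 1 / ((2 * m + 1 : ℕ) : ℝ) ^ 2) : ℝ) : ℂ) := by
    rw [this, he]; push_cast; ring
  exact_mod_cast h3

open Polynomial in
theorem coefSM_zero {p : ℕ} (hp : Odd p) : coefSM p 0 = 1 := by
  by_cases hp1 : p = 1
  · simp [coefSM, hp1]
  have h1 : Tendsto (fun z => 1 / ySM p z / z) (𝓝[≠] 0) (𝓝 (coefSM p 0 : ℂ)) := by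
    have h : Tendsto (fun z : ℂ => ∑ j ∈ Icc 1 ((p - 1) / 2),
        (resSM p j : ℂ) * ((z - uSM p j)⁻¹ - (z + uSM p j)⁻¹))
        (𝓝 0) (𝓝 (∑ j ∈ Icc 1 ((p - 1) / 2),
        (resSM p j : ℂ) * (((0 : ℂ) - uSM p j)⁻¹ - (0 + uSM p j : ℂ)⁻¹))) := by
      refine tendsto_finset_sum _ fun j hj => Tendsto.const_mul _ ?_
      have hu : (uSM p j : ℂ) ≠ 0 := by exact_mod_cast (uSM_pos hj).ne'
      exact (Tendsto.inv₀ (Continuous.tendsto (by fun_prop) _) (by simpa using hu)).sub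
        (Tendsto.inv₀ (Continuous.tendsto (by fun_prop) _) (by simpa using hu))
    have e : (coefSM p 0 : ℂ) = ∑ j ∈ Icc 1 ((p - 1) / 2),
        (resSM p j : ℂ) * (((0 : ℂ) - uSM p j)⁻¹ - (0 + uSM p j : ℂ)⁻¹) := by
      rw [coefSM, if_neg hp1, Complex.ofReal_sum]
      refine sum_congr rfl fun j _ => ?_
      rw [zero_sub, zero_add, ← neg_inv]
      push_cast; ring
    rw [e]
    refine (h.mono_left nhdsWithin_le_nhds).congr' ?_
    filter_upwards [eventually_norm_lt fun j hj => uSM_pos (p := p) hj] with z hz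
    rw [one_div_ySM hp hp1 hz.1 hz.2, Finset.sum_div]
    refine sum_congr rfl fun j hj => ?_
    have := hz.1
    rw [mul_div_assoc, mul_div_cancel_left₀ _ this]
  obtain ⟨m, rfl⟩ := hp
  have hm : (2 * m + 1 - 1) / 2 = m := by omega
  have hU : (Chebyshev.U ℂ (2 * m)).eval 0 = (-1) ^ m := by
    have := eval_U_sin m 0
    simpa using this
  have hm2 : ((-1 : ℂ) ^ m) * (-1) ^ m = 1 := by rw [← mul_pow]; simp
  have h2 : Tendsto (fun z => 1 / ySM (2 * m + 1) z / z) (𝓝[≠] 0) (𝓝 1) := by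
    have t : Tendsto (fun z : ℂ => ((-1) ^ m *
        (Chebyshev.U ℂ (2 * m)).eval (2 * Real.pi / (2 * m + 1 : ℕ) * z))⁻¹) (𝓝 0) (𝓝 (1 : ℂ)⁻¹) := by
      refine Tendsto.inv₀ ?_ one_ne_zero
      have hc : Continuous fun z : ℂ => (-1) ^ m *
        (Chebyshev.U ℂ (2 * m)).eval (2 * Real.pi / (2 * m + 1 : ℕ) * z) := by
        have := (Chebyshev.U ℂ (2 * m)).continuous
        fun_prop
      have := hc.tendsto 0
      rwa [mul_zero, hU, hm2] at this
    rw [inv_one] at t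
    refine (t.mono_left nhdsWithin_le_nhds).congr' ?_
    filter_upwards [eventually_mem_nhdsWithin] with z hz
    have hz : z ≠ 0 := hz
    rw [ySM, hm, show ((2 * m + 1 : ℕ) : ℤ) - 1 = 2 * m by push_cast; ring]
    generalize (Chebyshev.U ℂ (2 * (m : ℤ))).eval _ = q
    rw [one_div, mul_inv, mul_inv, inv_div]
    field_simp
  exact_mod_cast tendsto_nhds_unique h1 h2

theorem isTensorData_minimalString {p : ℕ} (hp : Odd p) :
    IsTensorData (minimalString p) (coefM p) where
  A_eq _ _ _ := by simp [minimalString, coefM]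
  VD_eq L := by
    rw [coefM_one hp]
    simp only [minimalString, coefM, if_pos]
    ring
  intR_eq _ _ h₁ _ _ _ _ hφ := intR_minimalString p h₁ hφ
  intD_eq _ h₁ _ _ _ hΦ := intD_minimalString p h₁ hΦ

theorem isTensorData_minimalSuperstring {p : ℕ} (hp : Odd p) :
    IsTensorData (minimalSuperstring p) (sigmaSM p) where
  A_eq _ _ _ := by simp [minimalSuperstring, sigmaSM]
  VD_eq L := by simp [minimalSuperstring, sigmaSM, coefSM_zero hp]
  intR_eq L₁ L₂ _ _ n coef φ hφ := by
    simp only [minimalSuperstring, kerIntSM_sum p hφ]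
    rw [← sum_add_distrib, mul_sum]
    exact sum_congr rfl fun c _ => by ring
  intD_eq _ h₁ _ _ _ hΦ := intD_minimalSuperstring p h₁ hΦ


theorem sum_range_two_mul {M : Type*} [AddCommMonoid M] (f : ℕ → M) (m : ℕ) :
    ∑ j ∈ range (2 * m), f j = ∑ i ∈ range m, (f (2 * i) + f (2 * i + 1)) := by
  induction m with
  | zero => simp
  | succ m ih =>
    rw [show 2 * (m + 1) = 2 * m + 1 + 1 by ring, Finset.sum_range_succ, Finset.sum_range_succ, ih,
      Finset.sum_range_succ, add_assoc]

theorem divPow_add (n : ℕ) (x y : ℝ) :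
    divPow n (x + y) = ∑ j ∈ range (n + 1), divPow (n - j) x * divPow j y := by
  rw [divPow, add_comm x y, add_pow, Finset.sum_div]
  refine sum_congr rfl fun j hj => ?_
  rw [mem_range] at hj
  rw [divPow, divPow, Nat.cast_choose ℝ (by omega : j ≤ n)]
  have h1 : (n.factorial : ℝ) ≠ 0 := by exact_mod_cast n.factorial_ne_zero
  field_simp

theorem divPow_add_add_divPow_sub (k : ℕ) (x y : ℝ) :
    (divPow (2 * k + 1) (x + y) + divPow (2 * k + 1) (x - y)) / 2
      = ∑ b ∈ range (k + 1), divPow (2 * (k - b) + 1) x * divPow (2 * b) y := by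
  rw [sub_eq_add_neg, divPow_add, divPow_add, ← sum_add_distrib,
    show 2 * k + 1 + 1 = 2 * (k + 1) by ring, sum_range_two_mul, Finset.sum_div]
  refine sum_congr rfl fun b hb => ?_
  rw [mem_range] at hb
  rw [divPow_neg_of_even (even_two_mul b), divPow_neg_of_odd ⟨b, rfl⟩,
    show 2 * k + 1 - 2 * b = 2 * (k - b) + 1 by omega]
  ring

theorem mul_psi (x : ℝ) (a : ℕ) : x * psi x a = divPow (2 * a + 1) x := by
  rw [psi, divPow]; ring

theorem two_mul_add_one_mul_psi (y : ℝ) (b : ℕ) : (2 * b + 1) * psi y b = divPow (2 * b) y := by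
  rw [psi, divPow, Nat.factorial_succ]
  have : ((2 * b).factorial : ℝ) ≠ 0 := by exact_mod_cast (2 * b).factorial_ne_zero
  push_cast
  field_simp

theorem extZ_eq_sum (σ : ℕ → ℝ) {K s : ℕ} : extZ σ ((K : ℤ) - s)
    = ∑ l ∈ range (K + 1), if l + s = K then σ l else 0 := by
  by_cases h : s ≤ K
  · rw [Finset.sum_eq_single (K - s), if_pos (by omega), ← extZ_natCast σ (K - s)]
    · congr 1; omega
    · intro l _ hl; rw [if_neg (by omega)]
    · intro h'; exact absurd (mem_range.2 (by omega)) h'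
  · rw [extZ_neg σ (by omega), sum_eq_zero]
    intro l _; rw [if_neg (by omega)]

theorem momentPrim_add_sub (σ : ℕ → ℝ) {D c : ℕ} (hc : c + 2 ≤ D) (x y : ℝ) :
    (momentPrim σ c (x + y) + momentPrim σ c (x - y)) / 2
      = x * ∑ a ∈ range D, ∑ b ∈ range D, tensB σ a b c * (psi x a * psi y b) := by
  have hR : x * ∑ a ∈ range D, ∑ b ∈ range D, tensB σ a b c * (psi x a * psi y b)
      = ∑ l ∈ range (c + 2), σ l * ∑ b ∈ range D, ∑ a ∈ range D,
        if l + (a + b) = c + 1 then divPow (2 * a + 1) x * divPow (2 * b) y else 0 := by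
    rw [mul_sum]
    simp only [mul_sum]
    rw [Finset.sum_comm' (s' := fun _ => range D) (t' := range D) (by simp [and_comm])]
    rw [Finset.sum_comm' (s := range (c + 2)) (s' := fun _ => range (c + 2))
      (t' := range D) (by simp [and_comm])]
    refine sum_congr rfl fun b _ => ?_
    rw [Finset.sum_comm' (s := range (c + 2)) (s' := fun _ => range (c + 2))
      (t' := range D) (by simp [and_comm])]
    refine sum_congr rfl fun a _ => ?_
    have e : ((c : ℤ) + 1 - a - b) = ((c + 1 : ℕ) : ℤ) - ((a + b : ℕ) : ℤ) := by push_cast; ring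
    rw [tensB, e, extZ_eq_sum, ← mul_psi, ← two_mul_add_one_mul_psi, mul_sum, sum_mul,
      mul_sum]
    refine sum_congr rfl fun l _ => ?_
    split_ifs <;> ring
  rw [hR, momentPrim, momentPrim, ← sum_add_distrib, Finset.sum_div]
  refine sum_congr rfl fun l hl => ?_
  rw [mem_range] at hl
  rw [← mul_add, mul_div_assoc, show 2 * c + 3 - 2 * l = 2 * (c + 1 - l) + 1 by omega,
    divPow_add_add_divPow_sub]
  congr 1
  refine Finset.sum_subset_zero_on_sdiff (Finset.range_subset_range.2 (by omega)) (fun b hb => ?_)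
    fun b hb => ?_
  · simp only [Finset.mem_sdiff, mem_range] at hb
    exact sum_eq_zero fun a _ => by rw [if_neg (by omega)]
  · rw [mem_range] at hb
    rw [Finset.sum_eq_single (c + 1 - l - b), if_pos (by omega)]
    · intro a _ ha; rw [if_neg (by omega)]
    · intro h'; exact absurd (mem_range.2 (by omega)) h'

theorem momentPrim_eq_sum (σ : ℕ → ℝ) {D c e : ℕ} (hc : c + e + 3 ≤ D) (x : ℝ) :
    momentPrim σ (c + e + 1) x = x * ∑ a ∈ range D, tensC σ a c e * psi x a := by
  rw [mul_sum, momentPrim, ← Finset.sum_range_reflect]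
  refine Finset.sum_subset_zero_on_sdiff (Finset.range_subset_range.2 (by omega)) (fun a ha => ?_)
    fun a ha => ?_
  · simp only [Finset.mem_sdiff, mem_range] at ha
    rw [tensC, extZ_neg σ (by omega)]; simp
  · rw [mem_range] at ha
    rw [mul_left_comm, mul_psi, tensC, show ((c : ℤ) + e + 2 - a) = ((c + e + 1 + 2 - 1 - a : ℕ) : ℤ) by omega,
      extZ_natCast]
    congr 2; omega

variable {𝒟 : ABOData} {σ : ℕ → ℝ} {D N : ℕ}

theorem corr_airyZ_three (hN : 1 ≤ N) (hD : 4 * N + 3 ≤ D) (L : Fin 3 → ℝ) :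
    corr (RingHom.id ℝ) D (airyZ σ D N) 0 0 (fun i => psi (L i)) = σ 0 := by
  have h := isPotential_airyZ σ (by omega : 2 * N + 3 ≤ D)
  rw [show (fun i => psi (L i)) = Fin.cons (psi (L 0)) (fun i : Fin 2 => psi (L i.succ)) by
    funext i; cases i using Fin.cases <;> rfl, corr_cons, Finset.sum_eq_single 0]
  · rw [show (0 ::ₘ 0 : Multiset ℕ) = {0} from rfl, h.corr_three hN (by omega), if_pos rfl]
    simp [psi, tensData]
  · intro a _ ha
    rw [show (a ::ₘ 0 : Multiset ℕ) = {a} from rfl, h.corr_three hN (by omega), if_neg ha, mul_zero]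
  · intro h'; exact absurd (mem_range.2 (by omega)) h'

theorem corr_airyZ_one (hN : 1 ≤ N) (hD : 4 * N + 3 ≤ D) (L : Fin 1 → ℝ) :
    corr (RingHom.id ℝ) D (airyZ σ D N) 1 0 (fun i => psi (L i)) = σ 1 / 8 + σ 0 * (L 0 ^ 2 / 48) := by
  have h := isPotential_airyZ σ (by omega : 2 * N + 3 ≤ D)
  rw [show (fun i => psi (L i)) = Fin.cons (psi (L 0)) (fun i : Fin 0 => psi (L i.succ)) by
    funext i; cases i using Fin.cases <;> rfl, corr_cons]
  have e : ∀ a, corr (RingHom.id ℝ) D (airyZ σ D N) 1 (a ::ₘ 0) (fun i : Fin 0 => psi (L i.succ))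
      = tensD σ a := fun a => h.corr_one hN a _
  simp only [e]
  rw [← Finset.sum_subset (Finset.range_subset_range.2 (by omega : 2 ≤ D)), Finset.sum_range_succ,
    Finset.sum_range_one]
  · simp [tensD, extZ, psi, Nat.factorial]; ring
  · intro a _ ha
    rw [mem_range] at ha
    rw [tensD, extZ_neg σ (by omega)]; simp

theorem vol_eq_corr (h𝒟 : IsTensorData 𝒟 σ) (hD : 4 * N + 3 ≤ D) (g n : ℕ) (L : Fin n → ℝ)
    (hn : 0 < n) (hst : Stable g n) (hN : 2 * g + n ≤ N + 2) (hL : ∀ i, 0 < L i) :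
    vol 𝒟 g n L = corr (RingHom.id ℝ) D (airyZ σ D N) g 0 fun i => psi (L i) := by
  induction hs : 2 * g + n using Nat.strong_induction_on generalizing g n with
  | _ s IH =>
  obtain ⟨n, rfl⟩ : ∃ m, n = m + 1 := ⟨n - 1, by omega⟩
  have hZ := isPotential_airyZ σ (by omega : 2 * N + 3 ≤ D)
  unfold Stable at hst
  rw [vol]
  by_cases h1 : g = 0 ∧ n = 2
  · rw [dif_pos h1]
    obtain ⟨rfl, rfl⟩ := h1
    rw [h𝒟.A_eq, corr_airyZ_three (by omega) hD]
  by_cases h2 : g = 1 ∧ n = 0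
  · rw [dif_neg h1, if_pos h2]
    obtain ⟨rfl, rfl⟩ := h2
    rw [h𝒟.VD_eq, corr_airyZ_one (by omega) hD]
  rw [dif_neg h1, if_neg h2, if_neg (not_not.2 (show Stable g (n + 1) from hst))]
  have hst' : 2 < 2 * g + n := by omega
  set W : Fin n → ℕ → ℝ := fun i => psi (Fin.tail L i) with hW
  have hL0 : 0 < L 0 := hL 0
  have hLt : ∀ i, 0 < Fin.tail L i := fun i => hL i.succ
  have hcons : ∀ (x : ℝ) {k : ℕ} (M : Fin k → ℝ), (fun i => psi ((Fin.cons x M : Fin (k + 1) → ℝ) i))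
      = Fin.cons (psi x) fun i => psi (M i) := by
    intro x k M; funext i; cases i using Fin.cases <;> rfl
  have hcard : ∀ J : Finset (Fin n), J.card + Jᶜ.card = n := fun J => by
    rw [Finset.card_add_card_compl, Fintype.card_fin]
  set Z := airyZ σ D N with hZdef
  have IH1 : ∀ (g' : ℕ) (J : Finset (Fin n)) (x : ℝ), 0 < x → Stable g' (J.card + 1) →
      2 * g' + (J.card + 1) < s → vol 𝒟 g' (J.card + 1) (Fin.cons x (subTuple (Fin.tail L) J))
        = ∑ c ∈ range D, psi x c * corr (RingHom.id ℝ) D Z g' {c} (subTuple W J) := by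
    intro g' J x hx hst hlt
    rw [IH _ hlt g' (J.card + 1) _ (by omega) hst (by omega) (fun i => ?_) rfl, hcons, corr_cons]
    · rfl
    · cases i using Fin.cases with
      | zero => exact hx
      | succ i => exact hLt _
  have hR : ∀ m : Fin n, (𝒟.intR (L 0) (Fin.tail L m) fun x =>
      x * vol 𝒟 g (({m}ᶜ : Finset (Fin n)).card + 1) (Fin.cons x (subTuple (Fin.tail L) {m}ᶜ)))
      = L 0 * ∑ a ∈ range D, psi (L 0) a * ∑ c ∈ range D,
        (∑ b ∈ range D, W m b * tensB σ a b c)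
          * corr (RingHom.id ℝ) D Z g {c} (subTuple W {m}ᶜ) := by
    intro m
    have hm := hcard {m}
    rw [Finset.card_singleton] at hm
    rw [h𝒟.intR_eq (L 0) (Fin.tail L m) hL0 (hLt m) D
      (fun c => corr (RingHom.id ℝ) D Z g {c} (subTuple W {m}ᶜ))]
    · simp only [mul_sum]
      rw [sum_comm (s := range D) (t := range D)]
      refine sum_congr rfl fun c hc => ?_
      by_cases hcN : 2 * N ≤ c
      · have h0 : corr (RingHom.id ℝ) D Z g {c} (subTuple W {m}ᶜ) = 0 :=
          hZ.corr_eq_zero 0 (by rw [Multiset.card_zero]; omega) (Or.inl hcN) _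
        simp [h0]
      · rw [momentPrim_add_sub σ (by omega : c + 2 ≤ D), mul_sum, mul_sum]
        refine sum_congr rfl fun a _ => ?_
        rw [mul_sum, mul_sum, sum_mul, mul_sum, mul_sum]
        refine sum_congr rfl fun b _ => ?_
        simp only [hW]; ring
    · intro x hx
      rw [IH1 g {m}ᶜ x hx (by unfold Stable; omega) (by omega)]
      simp only [mul_comm]
  set P := corrPair (RingHom.id ℝ) D Z g W with hP
  rw [h𝒟.intD_eq (L 0) hL0 D P]
  · rw [sum_congr rfl fun m _ => hR m, ← mul_sum]
    have hDD : ∑ c ∈ range D, ∑ e ∈ range D, P c e * momentPrim σ (c + e + 1) (L 0)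
        = L 0 * ∑ a ∈ range D, psi (L 0) a *
          ∑ c ∈ range D, ∑ e ∈ range D, tensC σ a c e * P c e := by
      simp only [mul_sum]
      rw [sum_comm (s := range D) (t := range D)]
      rw [sum_comm (s := range D) (t := range D)]
      rw [sum_comm (s := range D) (t := range D) (f := fun a c => ∑ e ∈ _, _)]
      refine sum_congr rfl fun c _ => ?_
      rw [sum_comm (s := range D) (t := range D)]
      refine sum_congr rfl fun e _ => ?_
      by_cases hce : 2 * N ≤ c ∨ 2 * N ≤ e
      · simp [hZ.corrPair_eq_zero (φ := RingHom.id ℝ) (by omega : 2 * g + n ≤ N + 1) hce W, hP]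
      · rw [momentPrim_eq_sum σ (by omega : c + e + 3 ≤ D), mul_sum, mul_sum]
        refine sum_congr rfl fun a _ => ?_
        ring
    rw [hDD, mul_left_comm (1 / 2 : ℝ), ← mul_add, inv_mul_cancel_left₀ hL0.ne']
    have e : (fun i => psi (L i)) = Fin.cons (psi (L 0)) W := by
      rw [← Fin.cons_self_tail L, hcons]; rfl
    rw [e, corr_cons, sum_comm, mul_sum, ← sum_add_distrib]
    refine sum_congr rfl fun a _ => ?_
    rw [show (a ::ₘ 0 : Multiset ℕ) = {a} from rfl, hZ.corr_rec hst' (by omega), ← mul_sum,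
      mul_left_comm (1 / 2 : ℝ), ← mul_add]
    rfl
  · intro x y hx hy
    congr 1
    rw [hP, sum_corrPair_mul]
    congr 1
    · by_cases hg : g = 0
      · rw [dif_pos hg, if_pos hg]
      · rw [dif_neg hg, if_neg hg, IH (2 * (g - 1) + (n + 2)) (by omega) (g - 1) (n + 2) _ (by omega)
          (by unfold Stable; omega) (by omega) (fun i => ?_) rfl, hcons, hcons]
        cases i using Fin.cases with
        | zero => exact hx
        | succ i => cases i using Fin.cases with
          | zero => exact hy
          | succ i => exact hLt _
    · refine sum_congr₂ fun h _ J _ => ?_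
      have hh := h.2
      have hJ := hcard J
      split_ifs with hs'
      · obtain ⟨s1, s2⟩ := hs'
        have s1' := s1
        have s2' := s2
        unfold Stable at s1' s2'
        rw [IH1 h J x hx s1 (by omega), IH1 (g - h) Jᶜ y hy s2 (by omega)]
      · unfold Stable at hs'
        by_cases s1 : 2 < 2 * (h : ℕ) + (J.card + 1)
        · refine (mul_eq_zero_of_right _ (sum_eq_zero fun e _ => mul_eq_zero_of_right _ ?_)).symm
          exact hZ.corr_eq_zero 0 (by rw [Multiset.card_zero]; omega)
            (Or.inr (by rw [Multiset.card_zero]; omega)) _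
        · refine (mul_eq_zero_of_left (sum_eq_zero fun c _ => mul_eq_zero_of_right _ ?_) _).symm
          exact hZ.corr_eq_zero 0 (by rw [Multiset.card_zero]; omega)
            (Or.inr (by rw [Multiset.card_zero]; omega)) _


theorem hasSum_one_div_sub_pow {x v : ℂ} (h : ‖v‖ < ‖x‖) (k : ℕ) :
    HasSum (fun n : ℕ => ((n + k).choose k : ℂ) * (1 / x ^ (n + k + 1)) * v ^ n)
      (1 / (x - v) ^ (k + 1)) := by
  have hx : x ≠ 0 := by rintro rfl; rw [norm_zero] at h; exact absurd h (norm_nonneg v).not_gt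
  have hq : ‖v / x‖ < 1 := by rw [norm_div, div_lt_one (norm_pos_iff.2 hx)]; exact h
  have := (hasSum_choose_mul_geometric_of_norm_lt_one k hq).mul_left (1 / x ^ (k + 1))
  refine HasSum.of_eq this (fun n => ?_) ?_
  · rw [div_pow]; field_simp; ring
  · have : x - v = x * (1 - v / x) := by field_simp
    rw [this, mul_pow, one_div_mul_one_div]

theorem summable_one_div_add_int_pow {z : ℂ} {r : ℝ} (hr : 0 < r) (h : ∀ m : {m : ℤ // m ≠ 0}, r ≤ ‖z + m.1‖)
    {k : ℕ} (hk : 2 ≤ k) : Summable fun m : {m : ℤ // m ≠ 0} => 1 / ‖z + m.1‖ ^ k := by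
  have h1 : Summable fun m : {m : ℤ // m ≠ 0} => (1 + ‖z‖ / r) ^ k * |1 / (m.1 : ℝ) ^ k| :=
    ((Real.summable_one_div_int_pow.2 (by omega : 1 < k)).abs.mul_left _).subtype _
  refine h1.of_nonneg_of_le (fun m => by positivity) fun m => ?_
  have hm : (0 : ℝ) < |(m.1 : ℝ)| := abs_pos.2 (by exact_mod_cast m.2)
  have hp := hr.trans_le (h m)
  have e : |(m.1 : ℝ)| ≤ (1 + ‖z‖ / r) * ‖z + m.1‖ := by
    have e1 : ‖((m.1 : ℤ) : ℂ)‖ ≤ ‖z + m.1‖ + ‖z‖ := by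
      have := norm_sub_le (z + m.1) z
      rwa [add_sub_cancel_left] at this
    rw [Complex.norm_intCast] at e1
    refine e1.trans ?_
    rw [add_mul, one_mul]
    refine add_le_add_right ?_ _ 
    rw [div_mul_eq_mul_div, le_div_iff₀ hr]
    exact mul_le_mul_of_nonneg_left (h m) (norm_nonneg z)
  rw [abs_div, abs_one, abs_pow, mul_one_div, div_le_div_iff₀ (by positivity) (by positivity), one_mul,
    ← mul_pow]
  exact pow_le_pow_left₀ hm.le e k

/-- `∑_{m ≠ 0} (z + m)^{-k}`. -/
def latSum (k : ℕ) (z : ℂ) : ℂ := ∑' m : {m : ℤ // m ≠ 0}, 1 / (z + (m.1 : ℂ)) ^ k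

theorem hasSum_latSum {z v : ℂ} {r : ℝ} (h : ∀ m : {m : ℤ // m ≠ 0}, r ≤ ‖z + m.1‖)
    (hv : ‖v‖ < r) {k : ℕ} (hk : 1 ≤ k) :
    HasSum (fun n : ℕ => ((n + k).choose k : ℂ) * latSum (n + k + 1) z * v ^ n)
      (latSum (k + 1) (z - v)) := by
  have hr : 0 < r := (norm_nonneg v).trans_lt hv
  set f : {m : ℤ // m ≠ 0} × ℕ → ℂ := fun p =>
    ((p.2 + k).choose k : ℂ) * (1 / (z + p.1.1) ^ (p.2 + k + 1)) * v ^ p.2 with hf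
  have hvm : ∀ m : {m : ℤ // m ≠ 0}, ‖v‖ < ‖z + m.1‖ := fun m => hv.trans_le (h m)
  have hnorm : ∀ m : {m : ℤ // m ≠ 0}, HasSum (fun n => ‖f (m, n)‖) (1 / (‖z + m.1‖ - ‖v‖) ^ (k + 1)) := by
    intro m
    have hx : ‖((‖v‖ : ℝ) : ℂ)‖ < ‖((‖z + m.1‖ : ℝ) : ℂ)‖ := by
      simpa using hvm m
    have := hasSum_one_div_sub_pow hx k
    rw [← Complex.hasSum_ofReal]
    refine HasSum.of_eq this (fun n => ?_) (by push_cast; ring)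
    simp only [hf, norm_mul, norm_div, norm_pow, norm_one, Complex.norm_natCast]
    push_cast
    ring
  have hsum : Summable f := by
    refine Summable.of_norm ((summable_prod_of_nonneg fun _ => norm_nonneg _).2
      ⟨fun m => (hnorm m).summable, ?_⟩)
    simp only [(hnorm _).tsum_eq]
    have hq : 0 < 1 - ‖v‖ / r := by rw [sub_pos, div_lt_one hr]; exact hv
    refine ((summable_one_div_add_int_pow hr h (by omega : 2 ≤ k + 1)).mul_left
      (1 / (1 - ‖v‖ / r) ^ (k + 1))).of_nonneg_of_le (fun m => ?_) fun m => ?_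
    · have := hvm m
      have : 0 < ‖z + m.1‖ - ‖v‖ := by linarith
      positivity
    · have hp := hr.trans_le (h m)
      rw [one_div_mul_one_div, ← mul_pow]
      refine one_div_le_one_div_of_le (pow_pos (mul_pos hq hp) _) (pow_le_pow_left₀ (by positivity) ?_ _)
      have : ‖v‖ ≤ ‖v‖ / r * ‖z + m.1‖ := by
        rw [div_mul_eq_mul_div, le_div_iff₀ hr]
        exact mul_le_mul_of_nonneg_left (h m) (norm_nonneg v)
      linarith
  have key := hsum.prod_symm.hasSum.prod_fiberwise fun n => (hsum.prod_symm.prod_factor n).hasSum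
  refine HasSum.of_eq key (fun n => ?_) ?_
  · rw [latSum, ← tsum_mul_left, ← tsum_mul_right]
    rfl
  · have e : ∑' p : ℕ × {m : ℤ // m ≠ 0}, f p.swap = ∑' p, f p :=
      (Equiv.prodComm ℕ {m : ℤ // m ≠ 0}).tsum_eq f
    refine Eq.trans ?_ e.symm
    rw [hsum.tsum_prod, latSum]
    refine tsum_congr fun m => ?_
    rw [(hasSum_one_div_sub_pow (hvm m) k).tsum_eq, sub_add_eq_add_sub]

theorem latSum_neg (k : ℕ) (z : ℂ) : latSum k (-z) = (-1) ^ k * latSum k z := by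
  rw [latSum, latSum, ← tsum_mul_left,
    ← (Equiv.subtypeEquiv (Equiv.neg ℤ) (by simp) : {m : ℤ // m ≠ 0} ≃ {m : ℤ // m ≠ 0}).tsum_eq]
  refine tsum_congr fun m => ?_
  simp only [Equiv.subtypeEquiv_apply, Equiv.neg_apply, Int.cast_neg]
  rw [← neg_add, neg_pow, one_div, mul_inv, ← inv_pow]
  norm_num

theorem zetaH_eq (d : ℕ) (z : ℂ) : zetaH d z = 1 / z ^ (2 * d) + 1 / 2 * latSum (2 * d) z := rfl

/-- `∑_b` of the regular part of `ζ_H(2a+2; z)` near `0`. -/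
theorem hasSum_zetaH (a : ℕ) {z : ℂ} (hz : ‖z‖ < 1) :
    HasSum (fun b : ℕ => (((2 * b + (2 * a + 1)).choose (2 * a + 1) : ℕ) : ℂ) *
      (1 / 2 * latSum (2 * b + (2 * a + 1) + 1) 0) * z ^ (2 * b))
      (zetaH (a + 1) z - 1 / z ^ (2 * a + 2)) := by
  have h : ∀ m : {m : ℤ // m ≠ 0}, (1 : ℝ) ≤ ‖(0 : ℂ) + m.1‖ := by
    intro m
    rw [zero_add, Complex.norm_intCast]
    exact_mod_cast Int.one_le_abs m.2
  have h1 := (hasSum_latSum h hz (by omega : 1 ≤ 2 * a + 1)).mul_left (1 / 2)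
  have h0 : ∀ b : ℕ, latSum (2 * b + 1 + (2 * a + 1) + 1) 0 = 0 := by
    intro b
    have := latSum_neg (2 * b + 1 + (2 * a + 1) + 1) 0
    rw [neg_zero, Odd.neg_one_pow ⟨b + a + 1, by ring⟩] at this
    linear_combination this / 2
  have h2 : HasSum (fun b : ℕ => 1 / 2 * (((2 * b + (2 * a + 1)).choose (2 * a + 1) : ℂ) *
      latSum (2 * b + (2 * a + 1) + 1) 0 * z ^ (2 * b))) (1 / 2 * latSum (2 * a + 1 + 1) (0 - z)) := by
    refine (Function.Injective.hasSum_iff (mul_right_injective₀ (two_ne_zero (α := ℕ))) ?_).2 h1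
    intro n hn
    rcases Nat.even_or_odd' n with ⟨b, rfl | rfl⟩
    · exact absurd ⟨b, rfl⟩ hn
    · rw [h0]; ring
  refine HasSum.of_eq h2 (fun b => by ring) ?_
  rw [zero_sub, latSum_neg, Even.neg_one_pow ⟨a + 1, by ring⟩, one_mul, zetaH_eq,
    show 2 * (a + 1) = 2 * a + 2 by ring]
  ring

/-! ### The twist -/

theorem integrableOn_divPow_mul_fMV {k : ℕ} (hk : 1 ≤ k) :
    IntegrableOn (fun x => divPow k x * fMV x) (Set.Ioi 0) := by
  obtain ⟨k, rfl⟩ : ∃ j, k = j + 1 := ⟨k - 1, by omega⟩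
  refine (integrableOn_divPow_mul_exp (half_pos one_pos) k le_rfl).mono' ?_ ?_
  · refine ((continuous_divPow _).measurable.mul ?_).aestronglyMeasurable
    unfold fMV; fun_prop
  · filter_upwards [ae_restrict_mem measurableSet_Ioi] with x hx
    have hx : 0 < x := hx
    have h1 : x * Real.exp (1 / 2 * x) ≤ Real.exp x - 1 := by
      have e1 : Real.exp x = Real.exp (1 / 2 * x) * Real.exp (1 / 2 * x) := by
        rw [← Real.exp_add]; ring_nf
      have e2 := Real.self_le_sinh_iff.2 (by positivity : 0 ≤ 1 / 2 * x)
      rw [Real.sinh_eq] at e2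
      have e3 : Real.exp (1 / 2 * x) * Real.exp (-(1 / 2 * x)) = 1 := by rw [← Real.exp_add]; simp
      nlinarith [Real.exp_pos (1 / 2 * x)]
    have h2 : 0 < Real.exp x - 1 := lt_of_lt_of_le (by positivity) h1
    have h3 : fMV x * x ≤ Real.exp (-(1 / 2) * x) := by
      rw [fMV, div_mul_eq_mul_div, one_mul, div_le_iff₀ h2]
      calc x = Real.exp (-(1 / 2) * x) * (x * Real.exp (1 / 2 * x)) := by
            rw [mul_left_comm, ← Real.exp_add]; simp
        _ ≤ _ := mul_le_mul_of_nonneg_left h1 (Real.exp_pos _).le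
    have h4 : 0 ≤ fMV x := by unfold fMV; positivity
    have h5 := divPow_nonneg k hx.le
    have h6 : divPow (k + 1) x = divPow k x * x / (k + 1) := by
      rw [divPow, divPow, Nat.factorial_succ]; push_cast; field_simp; ring
    rw [Real.norm_of_nonneg (mul_nonneg (divPow_nonneg _ hx.le) h4), h6]
    calc divPow k x * x / (k + 1) * fMV x = divPow k x * (fMV x * x) / (k + 1) := by ring
      _ ≤ divPow k x * (fMV x * x) := div_le_self (by positivity) (by linarith [(Nat.cast_nonneg k : (0:ℝ) ≤ k)])
      _ ≤ _ := mul_le_mul_of_nonneg_left h3 h5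

theorem hasSum_integral_divPow_mul_fMV {k : ℕ} (hk : 1 ≤ k) :
    HasSum (fun m : ℕ => ((m : ℝ) + 1)⁻¹ ^ (k + 1)) (∫ x in Set.Ioi 0, divPow k x * fMV x) := by
  have hm : ∀ m : ℕ, (0 : ℝ) < (m : ℝ) + 1 := fun m => by positivity
  have hval : ∀ m : ℕ, ∫ x in Set.Ioi 0, divPow k x * Real.exp (-((m : ℝ) + 1) * x)
      = ((m : ℝ) + 1)⁻¹ ^ (k + 1) := by
    intro m
    rw [integral_Ioi_divPow_mul_exp (hm m) k le_rfl, expPoly_apply_zero]; simp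
  have hsum : Summable fun m : ℕ => ((m : ℝ) + 1)⁻¹ ^ (k + 1) := by
    have := (summable_nat_add_iff 1).2 (Real.summable_nat_pow_inv.2 (by omega : 1 < k + 1))
    refine this.congr fun m => ?_
    push_cast; rw [inv_pow]
  have h := hasSum_integral_of_summable_integral_norm (μ := volume.restrict (Set.Ioi (0 : ℝ)))
    (F := fun (m : ℕ) x => divPow k x * Real.exp (-((m : ℝ) + 1) * x))
    (fun m => integrableOn_divPow_mul_exp (hm m) k le_rfl) (by
      refine hsum.congr fun m => ?_
      rw [← hval m]
      refine setIntegral_congr_fun measurableSet_Ioi fun x hx => ?_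
      exact (Real.norm_of_nonneg (mul_nonneg (divPow_nonneg k (le_of_lt hx)) (Real.exp_pos _).le)).symm)
  simp only [hval] at h
  suffices e : ∫ x in Set.Ioi (0 : ℝ), divPow k x * fMV x
      = ∫ x in Set.Ioi 0, ∑' m : ℕ, divPow k x * Real.exp (-((m : ℝ) + 1) * x) by rwa [e]
  refine setIntegral_congr_fun measurableSet_Ioi fun x hx => ?_
  have hx : 0 < x := hx
  have hq : Real.exp (-x) < 1 := by rw [Real.exp_lt_one_iff]; linarith
  have hg := (hasSum_geometric_of_lt_one (Real.exp_pos _).le hq).mul_left (divPow k x * Real.exp (-x))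
  have : ∀ m : ℕ, divPow k x * Real.exp (-((m : ℝ) + 1) * x)
      = divPow k x * Real.exp (-x) * Real.exp (-x) ^ m := by
    intro m
    rw [← Real.exp_nat_mul, mul_assoc, ← Real.exp_add]; ring_nf
  simp only [this]
  rw [hg.tsum_eq, fMV, Real.exp_neg]
  have := Real.exp_pos x
  have h1 : Real.exp x - 1 ≠ 0 := by have := Real.add_one_lt_exp hx.ne'; linarith
  field_simp

/-- `∫ ψ_a ψ_b f^MV(ℓ) ℓ dℓ`. -/
def uMV (a b : ℕ) : ℝ := ∫ ℓ in Set.Ioi (0 : ℝ), psi ℓ a * psi ℓ b * (fMV ℓ * ℓ)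

theorem psi_mul_psi_mul_fMV (a b : ℕ) (ℓ : ℝ) : psi ℓ a * psi ℓ b * (fMV ℓ * ℓ)
    = ((2 * a + 2 * b + 1).factorial : ℝ) / ((2 * a + 1).factorial * (2 * b + 1).factorial)
      * (divPow (2 * a + 2 * b + 1) ℓ * fMV ℓ) := by
  have : ((2 * a + 2 * b + 1).factorial : ℝ) ≠ 0 := by exact_mod_cast Nat.factorial_ne_zero _
  rw [psi, psi, divPow]
  field_simp
  ring

theorem integrableOn_psi_mul_psi_mul_fMV (a b : ℕ) :
    IntegrableOn (fun ℓ => psi ℓ a * psi ℓ b * (fMV ℓ * ℓ)) (Set.Ioi 0) := by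
  simp only [psi_mul_psi_mul_fMV]
  exact (integrableOn_divPow_mul_fMV (by omega)).const_mul _

theorem latSum_zero (k : ℕ) :
    1 / 2 * latSum (2 * k + 2) 0 = ((∫ x in Set.Ioi 0, divPow (2 * k + 1) x * fMV x : ℝ) : ℂ) := by
  have h := hasSum_integral_divPow_mul_fMV (by omega : 1 ≤ 2 * k + 1)
  have h' := Complex.hasSum_ofReal.2 h
  have e : latSum (2 * k + 2) 0 = ∑' m : ℤ, if m = 0 then 0 else 1 / (m : ℂ) ^ (2 * k + 2) := by
    rw [latSum]
    refine (tsum_subtype {m : ℤ | m ≠ 0} fun m : ℤ => 1 / ((0 : ℂ) + m) ^ (2 * k + 2)).trans ?_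
    refine tsum_congr fun m => ?_
    by_cases hm : m = 0 <;> simp [hm]
  have h1 : HasSum (fun m : ℤ => if m = 0 then 0 else 1 / (m : ℂ) ^ (2 * k + 2))
      (((∫ x in Set.Ioi 0, divPow (2 * k + 1) x * fMV x : ℝ) : ℂ)
        + ((∫ x in Set.Ioi 0, divPow (2 * k + 1) x * fMV x : ℝ) : ℂ)) := by
    have := HasSum.of_add_one_of_neg_add_one (f := fun m : ℤ => if m = 0 then 0 else 1 / (m : ℂ) ^ (2 * k + 2))
      (HasSum.of_eq h' (fun m => ?_) rfl) (HasSum.of_eq h' (fun m => ?_) rfl)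
    · simpa using this
    · rw [if_neg (by omega)]; push_cast; rw [one_div, inv_pow]
    · rw [if_neg (by omega)]; push_cast
      rw [Even.neg_pow ⟨k + 1, by ring⟩, one_div, inv_pow]
  rw [e, h1.tsum_eq]; ring

theorem uMV_eq (a b : ℕ) : (((2 * b + 1) * uMV a b : ℝ) : ℂ)
    = ((2 * b + (2 * a + 1)).choose (2 * a + 1) : ℂ) * (1 / 2 * latSum (2 * b + (2 * a + 1) + 1) 0) := by
  rw [show 2 * b + (2 * a + 1) + 1 = 2 * (a + b) + 2 by ring, latSum_zero, uMV]
  simp only [psi_mul_psi_mul_fMV]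
  rw [integral_const_mul, Nat.cast_choose ℂ (by omega : 2 * a + 1 ≤ 2 * b + (2 * a + 1)),
    Nat.add_sub_cancel, show 2 * (a + b) + 1 = 2 * a + 2 * b + 1 by ring,
    show 2 * b + (2 * a + 1) = 2 * a + 2 * b + 1 by ring, Nat.factorial_succ (2 * b)]
  push_cast
  have : ((2 * b).factorial : ℂ) ≠ 0 := by exact_mod_cast Nat.factorial_ne_zero _
  have : ((2 * a + 1).factorial : ℂ) ≠ 0 := by exact_mod_cast Nat.factorial_ne_zero _
  have : (2 * (b : ℂ) + 1) ≠ 0 := by exact_mod_cast (by omega : 2 * b + 1 ≠ 0)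
  field_simp

theorem hasSum_zetaH_uMV (a : ℕ) {z : ℂ} (hz : ‖z‖ < 1) :
    HasSum (fun b : ℕ => (((2 * b + 1) * uMV a b : ℝ) : ℂ) * z ^ (2 * b))
      (zetaH (a + 1) z - 1 / z ^ (2 * a + 2)) := by
  simp only [uMV_eq]
  exact hasSum_zetaH a hz


/-! ### Residues -/

theorem residue0_eq {F : ℂ → ℂ} {c : ℕ → ℂ} {e : ℕ → ℤ} {k : ℕ} (hk : e k = -1)
    (he : ∀ n, n ≠ k → e n ≠ -1)
    (hF : ∀ᶠ w in 𝓝[≠] 0, HasSum (fun n => c n * w ^ e n) (F w)) : residue0 F = c k := by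
  obtain ⟨ε, hε, hb⟩ := Metric.mem_nhdsWithin_iff.1 hF
  have hint : ∀ r : ℝ, 0 < r → r < ε → (∮ w in C(0, r), F w) = 2 * Real.pi * Complex.I * c k := by
    intro r hr hrε
    have hs : ∀ θ, HasSum (fun n => c n * circleMap 0 r θ ^ e n) (F (circleMap 0 r θ)) := by
      intro θ
      refine hb ⟨?_, circleMap_ne_center hr.ne'⟩
      rw [mem_ball_zero_iff, norm_circleMap_zero, abs_of_pos hr]; exact hrε
    have hnorm : ∀ θ n, ‖c n * circleMap 0 r θ ^ e n‖ = ‖c n‖ * r ^ e n := by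
      intro θ n
      rw [norm_mul, norm_zpow, norm_circleMap_zero, abs_of_pos hr]
    have hsum : Summable fun n => ‖c n‖ * r ^ e n := by
      have := (hs 0).summable.norm
      simpa only [hnorm] using this
    have key := intervalIntegral.hasSum_integral_of_dominated_convergence (a := 0) (b := 2 * Real.pi)
      (μ := volume) (F := fun n θ => deriv (circleMap 0 r) θ • (c n * circleMap 0 r θ ^ e n))
      (f := fun θ => deriv (circleMap 0 r) θ • F (circleMap 0 r θ))
      (fun n _ => r * (‖c n‖ * r ^ e n)) (fun n => ?_) (fun n => ?_) ?_ ?_ ?_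
    · have hterm : ∀ n, ∫ θ in (0 : ℝ)..2 * Real.pi, deriv (circleMap 0 r) θ •
          (c n * circleMap 0 r θ ^ e n) = if n = k then 2 * Real.pi * Complex.I * c k else 0 := by
        intro n
        have e1 : (∮ w in C(0, r), c n * (w - 0) ^ e n)
            = if n = k then 2 * Real.pi * Complex.I * c k else 0 := by
          rw [circleIntegral.integral_const_mul]
          split_ifs with h
          · subst h
            rw [hk]
            simp only [zpow_neg_one]
            rw [circleIntegral.integral_sub_center_inv 0 hr.ne']; ring
          · rw [circleIntegral.integral_sub_zpow_of_ne (he n h), mul_zero]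
        simpa only [circleIntegral, sub_zero] using e1
      simp only [hterm] at key
      exact key.unique (hasSum_ite_eq k _)
    · refine Continuous.aestronglyMeasurable ?_
      simp only [deriv_circleMap]
      refine ((continuous_circleMap 0 r).mul continuous_const).smul (continuous_const.mul ?_)
      exact (continuous_circleMap 0 r).zpow₀ _ fun θ => Or.inl (circleMap_ne_center hr.ne')
    · refine Eventually.of_forall fun θ _ => ?_
      rw [norm_smul, hnorm, deriv_circleMap]
      simp [abs_of_pos hr]
    · exact Eventually.of_forall fun θ _ => hsum.mul_left r
    · exact intervalIntegrable_const
    · exact Eventually.of_forall fun θ _ => (hs θ).const_smul _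
  refine Tendsto.limUnder_eq (tendsto_const_nhds.congr' ?_)
  filter_upwards [Ioo_mem_nhdsGT hε] with r hr
  rw [hint r hr.1 hr.2]
  have : (Real.pi : ℂ) ≠ 0 := by exact_mod_cast Real.pi_ne_zero
  field_simp

/-- `w ^ (2K) f(w)` is given near `0` by the power series `P` in `w ^ 2`. -/
def HasEven (K : ℕ) (P : PowerSeries ℂ) (f : ℂ → ℂ) : Prop :=
  ∀ᶠ w in 𝓝[≠] (0 : ℂ), HasSum (fun n => coeff n P * (w ^ 2) ^ n) ((w ^ 2) ^ K * f w)

namespace HasEven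

variable {K L : ℕ} {P Q : PowerSeries ℂ} {f g : ℂ → ℂ}

theorem mul (hf : HasEven K P f) (hg : HasEven L Q g) : HasEven (K + L) (P * Q) fun w => f w * g w := by
  filter_upwards [hf, hg] with w h1 h2
  have h := (summable_norm_sum_mul_antidiagonal_of_summable_norm h1.summable.norm h2.summable.norm).of_norm.hasSum
  rw [← tsum_mul_tsum_eq_tsum_sum_antidiagonal_of_summable_norm h1.summable.norm h2.summable.norm,
    h1.tsum_eq, h2.tsum_eq] at h
  refine HasSum.of_eq h (fun n => ?_) (by ring)
  rw [PowerSeries.coeff_mul, sum_mul]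
  refine sum_congr rfl fun p hp => ?_
  rw [← Finset.HasAntidiagonal.mem_antidiagonal.1 hp, pow_add]; ring

theorem X_pow {j : ℕ} (h : ∀ᶠ w in 𝓝[≠] 0, (w ^ 2) ^ K * f w = (w ^ 2) ^ j) :
    HasEven K (PowerSeries.X ^ j) f := by
  filter_upwards [h] with w hw
  rw [hw]
  refine HasSum.of_eq (hasSum_single (f := fun n => coeff n (PowerSeries.X ^ j : PowerSeries ℂ) * (w ^ 2) ^ n)
    j fun n hn => by rw [PowerSeries.coeff_X_pow, if_neg hn, zero_mul]) (fun _ => rfl) ?_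
  rw [PowerSeries.coeff_X_pow, if_pos rfl, one_mul]

theorem shift (hf : HasEven K P f) (j : ℕ) : HasEven (K + j) (P * PowerSeries.X ^ j) f := by
  simpa only [mul_one] using hf.mul
    (X_pow (K := j) (f := fun _ => 1) (Eventually.of_forall fun _ => mul_one _))

theorem congr (hf : HasEven K P f) (h : ∀ᶠ w in 𝓝[≠] 0, g w = f w) : HasEven K P g := by
  filter_upwards [hf, h] with w h1 h2
  rwa [h2]

end HasEven

/-- `r` is the residue at `0` of `f(w) dw / w`, where `f` is even and meromorphic at `0`. -/
def HasRes (f : ℂ → ℂ) (r : ℂ) : Prop := ∃ K P, HasEven K P f ∧ coeff K P = r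

namespace HasRes

variable {f g : ℂ → ℂ} {r s : ℂ}

theorem add (hf : HasRes f r) (hg : HasRes g s) : HasRes (fun w => f w + g w) (r + s) := by
  obtain ⟨K, P, h1, rfl⟩ := hf
  obtain ⟨L, Q, h2, rfl⟩ := hg
  refine ⟨K + L, P * PowerSeries.X ^ L + Q * PowerSeries.X ^ K, ?_, ?_⟩
  · have h2' := h2.shift K
    rw [add_comm L K] at h2'
    filter_upwards [h1.shift L, h2'] with w e1 e2
    refine HasSum.of_eq (e1.add e2) (fun n => ?_) (by ring)
    rw [map_add]; ring
  · rw [map_add, PowerSeries.coeff_mul_X_pow, add_comm K L, PowerSeries.coeff_mul_X_pow]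

theorem const_mul (hf : HasRes f r) (c : ℂ) : HasRes (fun w => c * f w) (c * r) := by
  obtain ⟨K, P, h1, rfl⟩ := hf
  refine ⟨K, PowerSeries.C c * P, ?_, by rw [PowerSeries.coeff_C_mul]⟩
  filter_upwards [h1] with w e1
  exact HasSum.of_eq (e1.mul_left c) (fun n => by rw [PowerSeries.coeff_C_mul]; ring) (by ring)

theorem sum {ι : Type*} (s : Finset ι) {f : ι → ℂ → ℂ} {r : ι → ℂ} (h : ∀ i ∈ s, HasRes (f i) (r i)) :
    HasRes (fun w => ∑ i ∈ s, f i w) (∑ i ∈ s, r i) := by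
  classical
  induction s using Finset.induction_on with
  | empty => exact ⟨0, 0, Eventually.of_forall fun w => by simpa using hasSum_zero, by simp⟩
  | insert i s hi ih =>
    simp only [sum_insert hi]
    exact (h i (by simp)).add (ih fun j hj => h j (by simp [hj]))

theorem residue0_eq (hf : HasRes f r) {F : ℂ → ℂ} (hF : ∀ᶠ w in 𝓝[≠] 0, F w = w⁻¹ * f w) :
    residue0 F = r := by
  obtain ⟨K, P, h1, rfl⟩ := hf
  refine TwistedTR.residue0_eq (e := fun n => 2 * n - 2 * K - 1) (c := fun n => coeff n P)
    (by ring) (fun n hn => by omega) ?_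
  filter_upwards [h1, hF, eventually_mem_nhdsWithin] with w e1 e2 hw
  have hw : w ≠ 0 := hw
  refine HasSum.of_eq (e1.mul_left (w⁻¹ * ((w ^ 2) ^ K)⁻¹)) (fun n => ?_) ?_
  · rw [zpow_sub₀ hw, zpow_sub₀ hw, zpow_one, zpow_mul, zpow_mul, zpow_natCast, zpow_natCast]
    rw [show w ^ (2 : ℤ) = w ^ 2 from zpow_ofNat w 2]
    field_simp
  · rw [e2]; field_simp

end HasRes

/-! ### Expansions of the twisted bidifferential -/

/-- `z^{-k} + (1/2) ∑_{m ≠ 0} (z + m)^{-k}`. -/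
def latZ (k : ℕ) (z : ℂ) : ℂ := 1 / z ^ k + 1 / 2 * latSum k z

theorem exists_le_norm_add_int {z : ℂ} (hz : ∀ m : ℤ, z ≠ m) : ∃ r > 0, ∀ m : ℤ, r ≤ ‖z + m‖ := by
  have h1 : z ∈ (Set.range ((↑) : ℤ → ℂ))ᶜ := by rintro ⟨m, hm⟩; exact hz m hm.symm
  obtain ⟨r, hr, hb⟩ := Metric.isOpen_iff.1 Complex.isOpen_compl_range_intCast z h1
  refine ⟨r, hr, fun m => le_of_not_gt fun h => hb (a := -(m : ℂ)) ?_ ⟨-m, by simp⟩⟩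
  rw [mem_ball_iff_norm', sub_neg_eq_add]; exact h

theorem hasSum_BMV {z v : ℂ} {r : ℝ} (h : ∀ m : ℤ, r ≤ ‖z + m‖) (hv : ‖v‖ < r) :
    HasSum (fun n : ℕ => ((n : ℂ) + 1) * latZ (n + 2) z * v ^ n) (BMV v z) := by
  have h0 := h 0
  rw [Int.cast_zero, add_zero] at h0
  have h1 := hasSum_one_div_sub_pow (hv.trans_le h0) 1
  have h2 := (hasSum_latSum (fun m => h m.1) hv le_rfl).mul_left (1 / 2)
  refine HasSum.of_eq (h1.add h2) (fun n => ?_) ?_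
  · rw [Nat.choose_one_right, latZ]; push_cast; ring
  · rw [BMV, zetaH_eq, ← neg_sub, latSum_neg]
    norm_num
    ring

theorem hasSum_segInt {B : ℂ → ℂ → ℂ} {c : ℕ → ℂ} {z a b : ℂ} {r : ℝ}
    (hB : ∀ v, ‖v‖ < r → HasSum (fun n : ℕ => ((n : ℂ) + 1) * c n * v ^ n) (B v z))
    (ha : ‖a‖ < r) (hb : ‖b‖ < r) :
    HasSum (fun n : ℕ => c n * (b ^ (n + 1) - a ^ (n + 1))) (segInt B a b z) := by
  set ρ := max ‖a‖ ‖b‖ with hρ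
  have hρ0 : 0 ≤ ρ := (norm_nonneg a).trans (le_max_left _ _)
  have hseg : ∀ s ∈ Set.Icc (0 : ℝ) 1, ‖a + s * (b - a)‖ ≤ ρ := by
    intro s hs
    calc ‖a + s * (b - a)‖ = ‖((1 - s : ℝ) : ℂ) * a + (s : ℂ) * b‖ := by
          congr 1; push_cast; ring
      _ ≤ (1 - s) * ‖a‖ + s * ‖b‖ := by
          refine (norm_add_le _ _).trans_eq ?_
          rw [norm_mul, norm_mul, Complex.norm_real, Complex.norm_real,
            Real.norm_of_nonneg hs.1, Real.norm_of_nonneg (sub_nonneg.2 hs.2)]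
      _ ≤ (1 - s) * ρ + s * ρ := by
          have := hs.1
          have := sub_nonneg.2 hs.2
          gcongr
          · exact le_max_left _ _
          · exact le_max_right _ _
      _ = ρ := by ring
  have hρr : ‖((ρ : ℝ) : ℂ)‖ < r := by
    rw [Complex.norm_real, Real.norm_of_nonneg hρ0]; exact max_lt ha hb
  have hsum := (hB _ hρr).summable.norm
  have key := intervalIntegral.hasSum_integral_of_dominated_convergence (a := 0) (b := 1) (μ := volume)
    (F := fun (n : ℕ) (s : ℝ) => ((n : ℂ) + 1) * c n * (a + s * (b - a)) ^ n)
    (f := fun s => B (a + s * (b - a)) z)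
    (fun n _ => ‖((n : ℂ) + 1) * c n * ((ρ : ℝ) : ℂ) ^ n‖) (fun n => ?_) (fun n => ?_) ?_ ?_ ?_
  · refine HasSum.of_eq (key.mul_left (b - a)) (fun n => ?_) rfl
    have hd : ∀ s : ℝ, HasDerivAt (fun s : ℝ => c n * (a + s * (b - a)) ^ (n + 1))
        ((b - a) * (((n : ℂ) + 1) * c n * (a + s * (b - a)) ^ n)) s := by
      intro s
      have h1 : HasDerivAt (fun s : ℝ => a + (s : ℂ) * (b - a)) (b - a) s := by
        simpa using ((Complex.ofRealCLM.hasDerivAt (x := s)).mul_const (b - a)).const_add a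
      refine ((h1.pow (n + 1)).const_mul (c n)).congr_deriv ?_
      push_cast [Nat.add_sub_cancel]; ring
    rw [← intervalIntegral.integral_const_mul,
      intervalIntegral.integral_eq_sub_of_hasDerivAt (fun s _ => hd s)
        (Continuous.intervalIntegrable (by fun_prop) _ _)]
    push_cast; ring
  · exact Continuous.aestronglyMeasurable (by fun_prop)
  · refine Eventually.of_forall fun s hs => ?_
    rw [Set.uIoc_of_le zero_le_one] at hs
    rw [norm_mul, norm_mul _ (((ρ : ℝ) : ℂ) ^ n), norm_pow, norm_pow, Complex.norm_real,
      Real.norm_of_nonneg hρ0]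
    have := hseg s ⟨hs.1.le, hs.2⟩
    gcongr
  · exact Eventually.of_forall fun _ _ => hsum
  · exact intervalIntegrable_const
  · refine Eventually.of_forall fun s hs => ?_
    rw [Set.uIoc_of_le zero_le_one] at hs
    exact hB _ ((hseg s ⟨hs.1.le, hs.2⟩).trans_lt (max_lt ha hb))

theorem eventually_norm_lt_of_pos {r : ℝ} (hr : 0 < r) : ∀ᶠ w : ℂ in 𝓝[≠] 0, w ≠ 0 ∧ ‖w‖ < r := by
  filter_upwards [eventually_norm_lt (s := ({()} : Finset Unit)) (u := fun _ => r) fun _ _ => hr] with w hw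
  exact ⟨hw.1, hw.2 () (by simp)⟩

theorem xi_eq {B : ℂ → ℂ → ℂ} {c : ℕ → ℂ} {z : ℂ} {r : ℝ} (hr : 0 < r)
    (hB : ∀ v, ‖v‖ < r → HasSum (fun n : ℕ => ((n : ℂ) + 1) * c n * v ^ n) (B v z)) (a : ℕ) :
    xi B a z = c (2 * a) := by
  refine residue0_eq (c := c) (e := fun n => n - 2 * a - 1) (k := 2 * a)
    (by push_cast; ring) (fun n hn => by omega) ?_
  filter_upwards [eventually_norm_lt_of_pos hr] with w hw
  refine HasSum.of_eq ((hasSum_segInt hB (by simpa using hr) hw.2).mul_left (1 / w ^ (2 * a + 2)))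
    (fun n => ?_) rfl
  have := hw.1
  rw [zpow_sub₀ this, zpow_sub₀ this, zpow_one, zpow_natCast,
    show (2 * (a : ℤ)) = ((2 * a : ℕ) : ℤ) by push_cast; ring, zpow_natCast, zero_pow (Nat.succ_ne_zero n)]
  field_simp
  ring

theorem xi_BMV (a : ℕ) {z : ℂ} (hz : ∀ m : ℤ, z ≠ m) : xi BMV a z = zetaH (a + 1) z := by
  obtain ⟨r, hr, h⟩ := exists_le_norm_add_int hz
  exact xi_eq (c := fun n => latZ (n + 2) z) hr (fun v hv => hasSum_BMV h hv) a

theorem xi_B₀ (a : ℕ) {z : ℂ} (hz : z ≠ 0) : xi B₀ a z = 1 / z ^ (2 * a + 2) := by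
  refine xi_eq (c := fun n => 1 / z ^ (n + 2)) (norm_pos_iff.2 hz) (fun v hv => ?_) a
  refine HasSum.of_eq (hasSum_one_div_sub_pow hv 1) (fun n => ?_) (by rw [B₀, ← neg_sub, neg_sq])
  rw [Nat.choose_one_right]; push_cast; ring

/-- Even and odd parts of a convergent power series. -/
theorem hasSum_even_odd {f : ℂ → ℂ} {c : ℕ → ℂ} {w : ℂ} (h : HasSum (fun n => c n * w ^ n) (f w))
    (h' : HasSum (fun n => c n * (-w) ^ n) (f (-w))) :
    HasSum (fun n => c (2 * n) * (w ^ 2) ^ n) ((f w + f (-w)) / 2) ∧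
      HasSum (fun n => c (2 * n + 1) * (w ^ 2) ^ n * w) ((f w - f (-w)) / 2) := by
  constructor
  · have := (Function.Injective.hasSum_iff (mul_right_injective₀ (two_ne_zero (α := ℕ))) (fun n hn => ?_)).2
      ((h.add h').div_const 2)
    · refine HasSum.of_eq this (fun n => ?_) rfl
      simp only [Function.comp]
      rw [Even.neg_pow (even_two_mul n), pow_mul]; ring
    · rcases Nat.even_or_odd' n with ⟨b, rfl | rfl⟩
      · exact absurd ⟨b, rfl⟩ hn
      · rw [Odd.neg_pow ⟨b, rfl⟩]; ring
  · have hi : Function.Injective fun n : ℕ => 2 * n + 1 := fun a b hab => by simpa using hab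
    have := (hi.hasSum_iff (fun n hn => ?_)).2 ((h.sub h').div_const 2)
    · refine HasSum.of_eq this (fun n => ?_) rfl
      simp only [Function.comp]
      rw [Odd.neg_pow ⟨n, rfl⟩, pow_succ w (2 * n), pow_mul]; ring
    · rcases Nat.even_or_odd' n with ⟨b, rfl | rfl⟩
      · rw [Even.neg_pow (even_two_mul b)]; ring
      · exact absurd ⟨b, rfl⟩ hn


/-! ### Residues of the recursion kernel -/

theorem HasEven.hasRes {K : ℕ} {P : PowerSeries ℂ} {f : ℂ → ℂ} (h : HasEven K P f) :
    HasRes f (coeff K P) := ⟨K, P, h, rfl⟩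

theorem hasEven_mk {c : ℕ → ℂ} {f : ℂ → ℂ} (h : ∀ᶠ w in 𝓝[≠] 0, HasSum (fun n => c n * (w ^ 2) ^ n) (f w)) :
    HasEven 0 (PowerSeries.mk c) f := by
  filter_upwards [h] with w hw
  exact HasSum.of_eq hw (fun n => by rw [PowerSeries.coeff_mk]) (by ring)

theorem coeff_mk_mul {M D : ℕ} (hM : M < D) (k : ℕ → ℂ) (P : PowerSeries ℂ) :
    coeff M (PowerSeries.mk k * P)
      = ∑ a ∈ range D, k a * if a ≤ M then coeff (M - a) P else 0 := by
  rw [PowerSeries.coeff_mul, Finset.Nat.sum_antidiagonal_eq_sum_range_succ_mk]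
  refine Finset.sum_subset_zero_on_sdiff (Finset.range_subset_range.2 (by omega)) (fun a ha => ?_)
    fun a ha => ?_
  · simp only [Finset.mem_sdiff, mem_range] at ha
    rw [if_neg (by omega), mul_zero]
  · rw [mem_range] at ha
    rw [if_pos (by omega), PowerSeries.coeff_mk]

/-- The sequence `σ` as a complex power series. -/
def serC (σ : ℕ → ℝ) : PowerSeries ℂ := PowerSeries.mk fun l => (σ l : ℂ)

theorem coeff_mk_mul_serC {M D : ℕ} (hM : M < D) (k : ℕ → ℂ) (σ : ℕ → ℝ) :
    coeff M (PowerSeries.mk k * serC σ)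
      = ∑ a ∈ range D, k a * (extZ σ ((M : ℤ) - a) : ℝ) := by
  rw [coeff_mk_mul hM]
  refine sum_congr rfl fun a _ => ?_
  split_ifs with h
  · rw [← Nat.cast_sub h, extZ_natCast, serC, PowerSeries.coeff_mk]
  · rw [extZ_neg σ (by omega), Complex.ofReal_zero]

theorem coeff_mk_mul_mk_mul_serC {M D : ℕ} (hM : M < D) (k v : ℕ → ℂ) (σ : ℕ → ℝ) :
    coeff M (PowerSeries.mk k * serC σ * PowerSeries.mk v)
      = ∑ a ∈ range D, k a * ∑ b ∈ range D, v b * (extZ σ ((M : ℤ) - a - b) : ℝ) := by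
  rw [mul_assoc, mul_comm (serC σ), coeff_mk_mul hM]
  refine sum_congr rfl fun a _ => ?_
  split_ifs with h
  · rw [coeff_mk_mul_serC (by omega : M - a < D), Nat.cast_sub h]
  · rw [sum_eq_zero fun b _ => by rw [extZ_neg σ (by omega), Complex.ofReal_zero, mul_zero]]

/-- The values at `z` of the functions `ξ_a`. -/
def xiMV (z : ℂ) (a : ℕ) : ℂ := zetaH (a + 1) z

theorem latZ_neg (k : ℕ) (z : ℂ) : latZ k (-z) = (-1) ^ k * latZ k z := by
  rw [latZ, latSum_neg, latZ, neg_pow z]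
  rcases neg_one_pow_eq_or ℂ k with h | h <;> simp [h]
  ring

theorem xiMV_eq (z : ℂ) (a : ℕ) : xiMV z a = latZ (2 * a + 2) z := rfl

theorem xiMV_neg (z : ℂ) (a : ℕ) : xiMV (-z) a = xiMV z a := by
  rw [xiMV_eq, latZ_neg, xiMV_eq, Even.neg_one_pow ⟨a + 1, by ring⟩, one_mul]

theorem uMV_comm (a b : ℕ) : uMV a b = uMV b a := by
  simp only [uMV, mul_comm (psi _ a)]

theorem tendsto_neg_nhdsNE : Tendsto (fun w : ℂ => -w) (𝓝[≠] 0) (𝓝[≠] 0) := by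
  refine tendsto_nhdsWithin_iff.2 ⟨?_, ?_⟩
  · simpa using (continuous_neg.tendsto (0 : ℂ)).mono_left nhdsWithin_le_nhds
  · filter_upwards [self_mem_nhdsWithin] with w hw
    exact neg_ne_zero.2 hw

theorem hasEven_recKernel {y : ℂ → ℂ} {σ : ℕ → ℝ}
    (hσ : ∀ᶠ w in 𝓝[≠] 0, HasSum (fun l => (σ l : ℂ) * w ^ (2 * (l : ℤ) - 1)) (1 / y w))
    {z : ℂ} (hz : ∀ m : ℤ, z ≠ m) :
    HasEven 0 (PowerSeries.mk (xiMV z) * serC σ) fun w => -2 * w * recKernel y BMV z w := by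
  obtain ⟨r, hr, h⟩ := exists_le_norm_add_int hz
  have h1 : HasEven 0 (PowerSeries.mk (xiMV z)) fun w => segInt BMV w (-w) z / (-2 * w) := by
    refine hasEven_mk ?_
    filter_upwards [eventually_norm_lt_of_pos hr] with w hw
    have hw0 := hw.1
    have hs := (hasSum_segInt (c := fun n => latZ (n + 2) z) (fun v hv => hasSum_BMV h hv) hw.2 (by rw [norm_neg]; exact hw.2)).div_const (-2 * w)
    have := (Function.Injective.hasSum_iff (mul_right_injective₀ (two_ne_zero (α := ℕ)))
      (fun n hn => ?_)).2 hs
    · refine HasSum.of_eq this (fun n => ?_) rfl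
      simp only [Function.comp, xiMV_eq]
      rw [Odd.neg_pow ⟨n, rfl⟩, pow_succ w (2 * n), pow_mul]
      field_simp
      ring
    · rcases Nat.even_or_odd' n with ⟨b, rfl | rfl⟩
      · exact absurd ⟨b, rfl⟩ hn
      · rw [Even.neg_pow ⟨b + 1, by ring⟩]; simp
  have h2 : HasEven 0 (serC σ) fun w => w * (1 / y w) := by
    refine hasEven_mk ?_
    filter_upwards [hσ, self_mem_nhdsWithin] with w hw hw0
    have hw0 : w ≠ 0 := hw0
    refine HasSum.of_eq (hw.mul_left w) (fun n => ?_) rfl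
    rw [zpow_sub₀ hw0, zpow_one, zpow_mul, zpow_natCast, show w ^ (2 : ℤ) = w ^ 2 from zpow_ofNat w 2]
    field_simp
  refine (h1.mul h2).congr ?_
  filter_upwards [hσ, tendsto_neg_nhdsNE.eventually hσ, self_mem_nhdsWithin] with w e1 e2 hw0
  have hw0 : w ≠ 0 := hw0
  have hy : y (-w) = -y w := by
    have e3 : HasSum (fun l => (σ l : ℂ) * w ^ (2 * (l : ℤ) - 1)) (-(1 / y (-w))) :=
      HasSum.of_eq e2.neg (fun l => by rw [Odd.neg_zpow ⟨(l : ℤ) - 1, by ring⟩]; ring) rfl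
    have := e1.unique e3
    rw [one_div, one_div, ← inv_neg, inv_inj] at this
    rw [this, neg_neg]
  rw [recKernel, hy, show 2 * (y w * w - -y w * (-w * -1)) = 4 * w * y w by ring]
  simp only [div_eq_mul_inv, mul_inv]
  field_simp
  ring

section

variable {κ : ℂ → ℂ} {z : ℂ} {σ : ℕ → ℝ} {D : ℕ}

theorem hasEven_polar (c : ℕ) : HasEven (c + 1) 1 fun w => 1 / w ^ (2 * c + 2) := by
  rw [← pow_zero PowerSeries.X]
  refine HasEven.X_pow ?_
  filter_upwards [self_mem_nhdsWithin] with w hw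
  have hw : w ≠ 0 := hw
  rw [← pow_mul]
  simp [show 2 * (c + 1) = 2 * c + 2 by ring, hw]

theorem hasEven_regular (c : ℕ) :
    HasEven 0 (PowerSeries.mk fun b => (((2 * b + 1) * uMV c b : ℝ) : ℂ))
      fun w => xiMV w c - 1 / w ^ (2 * c + 2) := by
  refine hasEven_mk ?_
  filter_upwards [eventually_norm_lt_of_pos one_pos] with w hw
  exact HasSum.of_eq (hasSum_zetaH_uMV c hw.2) (fun b => by rw [pow_mul]) rfl

theorem hasEven_BMV_even {x : ℂ} (hx : ∀ m : ℤ, x ≠ m) :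
    HasEven 0 (PowerSeries.mk fun b => (2 * b + 1) * xiMV x b) (fun w => (BMV w x + BMV (-w) x) / 2) ∧
      HasEven 0 (PowerSeries.mk fun b => (2 * b + 2) * latZ (2 * b + 3) x)
        (fun w => (BMV w x - BMV (-w) x) / (2 * w)) := by
  obtain ⟨r, hr, h⟩ := exists_le_norm_add_int hx
  constructor <;> refine hasEven_mk ?_ <;> filter_upwards [eventually_norm_lt_of_pos hr] with w hw
  all_goals
    have := hasSum_even_odd (f := fun w => BMV w x) (hasSum_BMV h hw.2)
      (hasSum_BMV h (v := -w) (by rw [norm_neg]; exact hw.2))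
  · exact HasSum.of_eq this.1 (fun n => by rw [xiMV_eq]; push_cast; ring) rfl
  · have hw0 := hw.1
    refine HasSum.of_eq (this.2.div_const w) (fun n => ?_) (by field_simp)
    push_cast
    field_simp
    ring

theorem hasRes_xi_xi (hκ : HasEven 0 (PowerSeries.mk (xiMV z) * serC σ) κ) {c e : ℕ} (h : c + e + 2 < D) :
    HasRes (fun w => κ w * (xiMV w c * xiMV w e))
      (∑ a ∈ range D, xiMV z a * (twistC uMV σ D a c e : ℝ)) := by
  have h1 := ((hκ.mul (hasEven_polar c)).mul (hasEven_polar e)).hasRes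
  have h2 := ((hκ.mul (hasEven_regular c)).mul (hasEven_polar e)).hasRes
  have h3 := ((hκ.mul (hasEven_regular e)).mul (hasEven_polar c)).hasRes
  have h4 := ((hκ.mul (hasEven_regular c)).mul (hasEven_regular e)).hasRes
  have := ((h1.add h2).add h3).add h4
  refine (congrArg₂ HasRes (funext fun w => ?_) ?_).mp this
  · ring
  · rw [mul_one, mul_one, mul_one, mul_one, coeff_mk_mul_serC (by omega : _ < D),
      coeff_mk_mul_mk_mul_serC (by omega : _ < D), coeff_mk_mul_mk_mul_serC (by omega : _ < D)]
    have h0 : coeff (0 + 0 + 0) (PowerSeries.mk (xiMV z) * serC σ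
        * PowerSeries.mk (fun b => (((2 * b + 1) * uMV c b : ℝ) : ℂ))
        * PowerSeries.mk fun b => (((2 * b + 1) * uMV e b : ℝ) : ℂ))
        = ∑ a ∈ range D, xiMV z a * ((if a = 0 then σ 0 * uMV 0 c * uMV 0 e else 0 : ℝ) : ℂ) := by
      rw [sum_eq_single_of_mem 0 (mem_range.2 (by omega)) fun a _ ha => by simp [ha]]
      simp [serC, PowerSeries.coeff_mk, uMV_comm 0]
      ring
    rw [h0, ← sum_add_distrib, ← sum_add_distrib, ← sum_add_distrib]
    refine sum_congr rfl fun a _ => ?_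
    rw [← mul_add, ← mul_add, ← mul_add, twistC, tensC, sum_add_distrib]
    push_cast
    rw [show (0 : ℤ) + (c + 1) + (e + 1) - a = c + e + 2 - a by ring]
    simp only [tensB, uMV_comm _ c, uMV_comm _ e, zero_add]
    rw [add_comm (∑ b ∈ range D, ((((2 * (b : ℝ) + 1) * extZ σ (c + 1 - a - b) : ℝ) : ℂ)) * _)]
    push_cast
    simp only [mul_right_comm _ _ ((extZ σ _ : ℝ) : ℂ)]
    ring

theorem hasRes_BMV_xi (hκ : HasEven 0 (PowerSeries.mk (xiMV z) * serC σ) κ) {x : ℂ}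
    (hx : ∀ m : ℤ, x ≠ m) {c : ℕ} (h : c + 1 < D) :
    HasRes (fun w => κ w * ((BMV w x + BMV (-w) x) / 2 * xiMV w c))
      (∑ a ∈ range D, xiMV z a *
        ∑ b ∈ range D, xiMV x b * (twistB uMV σ a b c : ℝ)) := by
  have h1 := ((hκ.mul (hasEven_BMV_even hx).1).mul (hasEven_polar c)).hasRes
  have h2 := ((hκ.mul (hasEven_BMV_even hx).1).mul (hasEven_regular c)).hasRes
  refine (congrArg₂ HasRes (funext fun w => ?_) ?_).mp (h1.add h2)
  · ring
  · rw [mul_one, coeff_mk_mul_mk_mul_serC (by omega : _ < D)]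
    have h0 : coeff (0 + 0 + 0) (PowerSeries.mk (xiMV z) * serC σ
        * PowerSeries.mk (fun b => (2 * b + 1) * xiMV x b)
        * PowerSeries.mk fun b => (((2 * b + 1) * uMV c b : ℝ) : ℂ))
        = ∑ a ∈ range D, xiMV z a * ∑ b ∈ range D, xiMV x b *
          ((if a = 0 ∧ b = 0 then σ 0 * uMV 0 c else 0 : ℝ) : ℂ) := by
      have hD := mem_range.2 (by omega : 0 < D)
      rw [sum_eq_single_of_mem 0 hD fun a _ ha => by simp [ha],
        sum_eq_single_of_mem 0 hD fun b _ hb => by simp [hb]]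
      simp [serC, PowerSeries.coeff_mk, uMV_comm 0]
      ring
    rw [h0, ← sum_add_distrib]
    refine sum_congr rfl fun a _ => ?_
    rw [← mul_add, ← sum_add_distrib]
    congr 1
    refine sum_congr rfl fun b _ => ?_
    rw [twistB, tensB]
    push_cast
    rw [zero_add]
    ring

end


/-! ### Topological recursion for the twisted bidifferential -/

theorem residue0_recKernel_mul {y S S' : ℂ → ℂ} {z r : ℂ}
    (h : HasRes (fun w => -2 * w * recKernel y BMV z w * S' w) r)
    (hS : ∀ᶠ w in 𝓝[≠] 0, S w = 2 * S' w) : residue0 (fun w => recKernel y BMV z w * -S w) = r := by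
  refine h.residue0_eq ?_
  filter_upwards [hS, self_mem_nhdsWithin] with w h1 hw
  have hw : w ≠ 0 := hw
  rw [h1]
  field_simp

theorem ceoW_singleton (y : ℂ → ℂ) (B : ℂ → ℂ → ℂ) {n : ℕ} (Z : Fin n → ℂ) (w : ℂ) {J : Finset (Fin n)}
    {m : Fin n} (hJ : J = {m}) {h : ℕ} (hh : h = 0) :
    ceoW y B h (J.card + 1) (Fin.cons w (subTuple Z J)) = B w (Z m) := by
  subst hJ hh
  rw [ceoW, dif_pos ⟨rfl, Finset.card_singleton m⟩]
  congr 1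
  exact congrArg Z (Finset.mem_singleton.1 (Finset.orderEmbOfFin_mem _ _ _))

theorem eventually_ne_int : ∀ᶠ w : ℂ in 𝓝[≠] 0, w ≠ 0 ∧ ∀ m : ℤ, w ≠ m := by
  filter_upwards [eventually_norm_lt_of_pos one_pos] with w hw
  refine ⟨hw.1, ?_⟩
  rintro m rfl
  have h1 := hw.2
  rw [Complex.norm_intCast, ← Int.cast_abs, ← Int.cast_one, Int.cast_lt, Int.abs_lt_one_iff] at h1
  exact hw.1 (by rw [h1, Int.cast_zero])

theorem hasRes_BMV_BMV {κ : ℂ → ℂ} {σ : ℕ → ℝ} {z : ℂ}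
    (hκ : HasEven 0 (PowerSeries.mk (xiMV z) * serC σ) κ) {x x' : ℂ}
    (hx : ∀ m : ℤ, x ≠ m) (hx' : ∀ m : ℤ, x' ≠ m) :
    HasRes (fun w => κ w * ((BMV w x * BMV (-w) x' + BMV w x' * BMV (-w) x) / 2))
      (xiMV z 0 * (σ 0 * (xiMV x 0 * xiMV x' 0))) := by
  have h1 := ((hκ.mul (hasEven_BMV_even hx).1).mul (hasEven_BMV_even hx').1).hasRes
  have h2 := (((hκ.mul (HasEven.X_pow (K := 0) (j := 1) (f := fun w => w ^ 2) (by simp))).mul (hasEven_BMV_even hx).2).mul (hasEven_BMV_even hx').2).hasRes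
  obtain ⟨K, P, h3, h4⟩ := h1.add (h2.const_mul (-1))
  refine ⟨K, P, h3.congr ?_, h4.trans ?_⟩
  · filter_upwards [self_mem_nhdsWithin] with w hw
    have hw : w ≠ 0 := hw
    field_simp
    ring
  · simp [serC, PowerSeries.coeff_mk]
    ring

theorem hasRes_BMV_neg {κ : ℂ → ℂ} {σ : ℕ → ℝ} {z : ℂ} {D : ℕ} (hD : 2 < D)
    (hκ : HasEven 0 (PowerSeries.mk (xiMV z) * serC σ) κ) :
    HasRes (fun w => κ w * (BMV w (-w) / 2))
      (∑ a ∈ range D, xiMV z a * (twistD uMV σ a : ℝ)) := by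
  have h0 : HasEven 0 (PowerSeries.mk fun b => (((2 * b + 1) * uMV 0 b : ℝ) : ℂ) * 4 ^ b)
      fun w => BMV w (-w) - 1 / (4 * w ^ 2) := by
    refine hasEven_mk ?_
    filter_upwards [eventually_norm_lt_of_pos (half_pos one_pos)] with w hw
    have h1 : ‖2 * w‖ < 1 := by
      rw [norm_mul, Complex.norm_ofNat]; linarith [hw.2]
    refine HasSum.of_eq (hasSum_zetaH_uMV 0 h1) (fun b => ?_) ?_
    · rw [pow_mul, mul_pow 2 w, mul_pow]; norm_num; ring
    · rw [BMV, sub_neg_eq_add, ← two_mul]; ring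
  have h1 := ((hκ.mul (hasEven_polar 0)).hasRes.const_mul (1 / 8)).add ((hκ.mul h0).hasRes.const_mul (1 / 2))
  refine (congrArg₂ HasRes (funext fun w => ?_) ?_).mp h1
  · ring
  · rw [mul_one, coeff_mk_mul_serC (by omega : _ < D)]
    have h2 : coeff (0 + 0) (PowerSeries.mk (xiMV z) * serC σ
        * PowerSeries.mk fun b => (((2 * b + 1) * uMV 0 b : ℝ) : ℂ) * 4 ^ b)
        = ∑ a ∈ range D, xiMV z a * ((if a = 0 then σ 0 * uMV 0 0 else 0 : ℝ) : ℂ) := by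
      rw [sum_eq_single_of_mem 0 (mem_range.2 (by omega)) fun a _ ha => by simp [ha]]
      simp [serC, PowerSeries.coeff_mk]
      ring
    rw [h2, mul_sum, mul_sum, ← sum_add_distrib]
    refine sum_congr rfl fun a _ => ?_
    rw [twistD, tensD]
    simp only [zero_add, Nat.cast_one]
    split_ifs <;> push_cast <;> ring

theorem ceoW_eq_corr {y : ℂ → ℂ} {σ : ℕ → ℝ} {D N : ℕ}
    (hσ : ∀ᶠ w in 𝓝[≠] 0, HasSum (fun l => (σ l : ℂ) * w ^ (2 * (l : ℤ) - 1)) (1 / y w))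
    (hD : 4 * N + 3 ≤ D) (g n : ℕ) (z : Fin n → ℂ) (hn : 0 < n) (hst : Stable g n)
    (hN : 2 * g + n ≤ N + 2) (hz : ∀ (i) (m : ℤ), z i ≠ m) :
    ceoW y BMV g n z = corr Complex.ofRealHom D (twistZ uMV σ D N) g 0 fun i => xiMV (z i) := by
  induction hs : 2 * g + n using Nat.strong_induction_on generalizing g n with
  | _ s IH =>
  obtain ⟨n, rfl⟩ : ∃ m, n = m + 1 := ⟨n - 1, by omega⟩
  have hZ := isPotential_twistZ uMV_comm σ (by omega : 2 * N + 3 ≤ D)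
  unfold Stable at hst
  set W : Fin n → ℕ → ℂ := fun i => xiMV (Fin.tail z i) with hW
  have hzt : ∀ (i) (m : ℤ), Fin.tail z i ≠ m := fun i => hz i.succ
  have hcons : ∀ (x : ℂ) {k : ℕ} (M : Fin k → ℂ), (fun i => xiMV ((Fin.cons x M : Fin (k + 1) → ℂ) i))
      = Fin.cons (xiMV x) fun i => xiMV (M i) := by
    intro x k M; funext i; cases i using Fin.cases <;> rfl
  have hcard : ∀ J : Finset (Fin n), J.card + Jᶜ.card = n := fun J => by
    rw [Finset.card_add_card_compl, Fintype.card_fin]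
  set Z := twistZ uMV σ D N with hZdef
  have hκ := hasEven_recKernel hσ (hz 0)
  have e : (fun i => xiMV (z i)) = Fin.cons (xiMV (z 0)) W := by
    rw [← Fin.cons_self_tail z, hcons]; rfl
  rw [e, corr_cons]
  simp only [Multiset.cons_zero]
  rw [ceoW, dif_neg (by omega), if_neg (not_not.2 (show Stable g (n + 1) from hst))]
  by_cases h1 : g = 0 ∧ n = 2
  · obtain ⟨rfl, rfl⟩ := h1
    refine residue0_recKernel_mul
      (S' := fun w => (BMV w (Fin.tail z 0) * BMV (-w) (Fin.tail z 1)
        + BMV w (Fin.tail z 1) * BMV (-w) (Fin.tail z 0)) / 2) ?_ ?_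
    · rw [sum_eq_single_of_mem 0 (mem_range.2 (by omega : 0 < D)),
        hZ.corr_three (by omega) (by omega), if_pos rfl]
      · exact hasRes_BMV_BMV hκ (hzt 0) (hzt 1)
      · intro a _ ha
        rw [hZ.corr_three (by omega) (by omega), if_neg ha, mul_zero]
    · refine Eventually.of_forall fun w => ?_
      rw [dif_pos rfl, zero_add, Fin.sum_univ_one,
        show (univ : Finset (Finset (Fin 2))) = {∅, {0}, {1}, {0, 1}} by decide,
        sum_insert (by decide), sum_insert (by decide), sum_insert (by decide),
        Finset.sum_singleton, dif_neg (by simp), dif_pos (by decide), dif_pos (by decide),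
        dif_neg (by decide)]
      simp only [Fin.val_zero, Nat.sub_zero]
      rw [ceoW_singleton y BMV _ w (rfl : ({0} : Finset (Fin 2)) = {0}) rfl,
        ceoW_singleton y BMV _ w (rfl : ({1} : Finset (Fin 2)) = {1}) rfl,
        ceoW_singleton y BMV _ (-w) (by decide : ({0}ᶜ : Finset (Fin 2)) = {1}) rfl,
        ceoW_singleton y BMV _ (-w) (by decide : ({1}ᶜ : Finset (Fin 2)) = {0}) rfl]
      ring
  by_cases h2 : g = 1 ∧ n = 0
  · obtain ⟨rfl, rfl⟩ := h2
    refine residue0_recKernel_mul (S' := fun w => BMV w (-w) / 2) ?_ ?_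
    · simp only [hZ.corr_one (by omega : 1 ≤ N)]
      exact hasRes_BMV_neg (by omega) hκ
    · refine Eventually.of_forall fun w => ?_
      rw [dif_neg one_ne_zero, sum_eq_zero, add_zero]
      · rw [ceoW, dif_pos ⟨rfl, rfl⟩]
        simp only [Fin.cons_zero]
        rw [show (Fin.cons w (Fin.cons (-w) (Fin.tail z) : Fin 1 → ℂ) : Fin 2 → ℂ) ⟨1, by omega⟩ = -w from rfl]
        ring
      · intro h _
        refine sum_eq_zero fun J _ => dif_neg ?_
        have := hcard J
        have := h.2
        omega
  have hst' : 2 < 2 * g + n := by omega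
  set P := corrPair Complex.ofRealHom D Z g W with hP
  set A : ℕ → Finset (Fin n) → ℂ → ℂ := fun h J w =>
    ∑ c ∈ range D, xiMV w c * corr Complex.ofRealHom D Z h {c} (subTuple W J) with hA
  set Bf : ℕ → Finset (Fin n) → ℂ → ℂ := fun h J w =>
    if h = 0 then ∑ m, if J = {m} then BMV w (Fin.tail z m) else 0 else 0 with hBf
  have hA0 : ∀ h J w, h ≤ g → ¬ 2 < 2 * h + (J.card + 1) → A h J w = 0 := by
    intro h J w hg hh
    have := hcard J
    exact sum_eq_zero fun c _ => mul_eq_zero_of_right _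
      (hZ.corr_eq_zero 0 (by rw [Multiset.card_zero]; omega) (Or.inr (by rw [Multiset.card_zero]; omega)) _)
  have hB0 : ∀ h J w, ¬ (h = 0 ∧ J.card = 1) → Bf h J w = 0 := by
    intro h J w hh
    simp only [hBf]
    split_ifs with h0
    · refine sum_eq_zero fun m _ => if_neg ?_
      rintro rfl
      exact hh ⟨h0, Finset.card_singleton m⟩
    · rfl
  have hceo : ∀ h J (w : ℂ), (∀ m : ℤ, w ≠ m) → 2 * h + (J.card + 1) < s → h ≤ g → ¬ (h = 0 ∧ J.card = 0) →
      ceoW y BMV h (J.card + 1) (Fin.cons w (subTuple (Fin.tail z) J)) = A h J w + Bf h J w := by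
    intro h J w hw hlt hg hh
    by_cases hs' : Stable h (J.card + 1)
    · rw [IH _ hlt h (J.card + 1) _ (by omega) hs' (by omega) (fun i => ?_) rfl, hcons, corr_cons,
        hB0 _ _ _ (by unfold Stable at hs'; omega), add_zero]
      · rfl
      · cases i using Fin.cases with
        | zero => exact hw
        | succ i => exact hzt _
    · unfold Stable at hs'
      obtain ⟨m, hm⟩ := Finset.card_eq_one.1 (by omega : J.card = 1)
      obtain rfl : h = 0 := by omega
      rw [ceoW_singleton y BMV _ w hm rfl, hA0 _ _ _ hg hs', zero_add]
      simp [hBf, hm]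
  have hsum : ∀ w : ℂ, (∀ m : ℤ, w ≠ m) → (∑ h : Fin (g + 1), ∑ J : Finset (Fin n),
      if hs : ¬ (h.1 = 0 ∧ J.card = 0) ∧ ¬ (g - h.1 = 0 ∧ Jᶜ.card = 0) then
        ceoW y BMV h.1 (J.card + 1) (Fin.cons w (subTuple (Fin.tail z) J))
          * ceoW y BMV (g - h.1) (Jᶜ.card + 1) (Fin.cons (-w) (subTuple (Fin.tail z) Jᶜ)) else 0)
      = (∑ h : Fin (g + 1), ∑ J : Finset (Fin n), A h J w * A (g - h) Jᶜ w)
        + ∑ m, (BMV w (Fin.tail z m) + BMV (-w) (Fin.tail z m)) * A g {m}ᶜ w := by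
    intro w hw
    have hw' : ∀ m : ℤ, -w ≠ m := fun m hm => hw (-m) (by rw [Int.cast_neg, ← hm, neg_neg])
    have hAneg : ∀ h J, A h J (-w) = A h J w := fun h J => by simp only [hA, xiMV_neg]
    have hterm : ∀ (h : Fin (g + 1)) (J : Finset (Fin n)),
        (if hs : ¬ (h.1 = 0 ∧ J.card = 0) ∧ ¬ (g - h.1 = 0 ∧ Jᶜ.card = 0) then
          ceoW y BMV h.1 (J.card + 1) (Fin.cons w (subTuple (Fin.tail z) J))
            * ceoW y BMV (g - h.1) (Jᶜ.card + 1) (Fin.cons (-w) (subTuple (Fin.tail z) Jᶜ)) else 0)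
        = A h J w * A (g - h) Jᶜ w + (Bf h J w * A (g - h) Jᶜ w + A h J w * Bf (g - h) Jᶜ (-w)) := by
      intro h J
      have hJ := hcard J
      have hh := h.2
      split_ifs with hs'
      · rw [hceo h J w hw (by omega) (by omega) hs'.1,
          hceo (g - h) Jᶜ (-w) hw' (by omega) (by omega) hs'.2, hAneg]
        have : Bf h J w * Bf (g - h) Jᶜ (-w) = 0 := by
          by_cases h3 : (h : ℕ) = 0 ∧ J.card = 1
          · rw [hB0 (g - h) Jᶜ _ (by omega), mul_zero]
          · rw [hB0 h J _ h3, zero_mul]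
        linear_combination this
      · by_cases h3 : (h : ℕ) = 0 ∧ J.card = 0
        · rw [hA0 h J w (by omega) (by omega), hB0 h J w (by omega)]; ring
        · rw [hA0 (g - h) Jᶜ w (by omega) (by omega), hB0 (g - h) Jᶜ _ (by omega)]; ring
    simp only [hterm, sum_add_distrib, add_mul]
    congr 2
    · rw [sum_eq_single_of_mem 0 (mem_univ _) fun h _ hh => sum_eq_zero fun J _ => by
        rw [hB0 h J w fun h' => hh (Fin.ext h'.1), zero_mul]]
      simp only [hBf, Fin.val_zero, if_pos, sum_mul, ite_mul, zero_mul]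
      rw [sum_comm]
      simp
    · rw [sum_eq_single_of_mem (Fin.last g) (mem_univ _) fun h _ hh =>
        sum_eq_zero fun J _ => by
          rw [hB0 (g - h) Jᶜ _ fun h' => hh (Fin.ext (by have := h.2; simp; omega)), mul_zero]]
      simp only [hBf, Fin.val_last, Nat.sub_self, if_pos, mul_sum, mul_ite, mul_zero]
      rw [sum_comm]
      refine sum_congr rfl fun m _ => ?_
      simp only [compl_eq_comm (y := ({m} : Finset (Fin n))), eq_comm (a := ({m} : Finset (Fin n))ᶜ)]
      simp [mul_comm]
  have hpair : ∀ w : ℂ, (∀ m : ℤ, w ≠ m) → ((if hg : g = 0 then 0 else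
        ceoW y BMV (g - 1) (n + 2) (Fin.cons w (Fin.cons (-w) (Fin.tail z))))
      + ∑ h : Fin (g + 1), ∑ J : Finset (Fin n), A h J w * A (g - h) Jᶜ w)
      = ∑ c ∈ range D, ∑ e ∈ range D, P c e * (xiMV w c * xiMV w e) := by
    intro w hw
    have hw' : ∀ m : ℤ, -w ≠ m := fun m hm => hw (-m) (by rw [Int.cast_neg, ← hm, neg_neg])
    rw [hP, sum_corrPair_mul]
    congr 1
    split_ifs with hg
    · rfl
    · rw [IH (2 * (g - 1) + (n + 2)) (by omega) (g - 1) (n + 2) _ (by omega)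
        (by unfold Stable; omega) (by omega) (fun i => ?_) rfl, hcons, hcons, funext (xiMV_neg w)]
      cases i using Fin.cases with
      | zero => exact hw
      | succ i => cases i using Fin.cases with
        | zero => exact hw'
        | succ i => exact hzt _
  have hr1 := (HasRes.sum (range D) fun c _ => HasRes.sum (range D) fun e _ =>
    show HasRes (fun w => P c e * (-2 * w * recKernel y BMV (z 0) w * (xiMV w c * xiMV w e)))
      (P c e * ∑ a ∈ range D, xiMV (z 0) a * (twistC uMV σ D a c e : ℝ)) by
    by_cases hce : 2 * N ≤ c ∨ 2 * N ≤ e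
    · rw [hP, hZ.corrPair_eq_zero (by omega) hce, zero_mul]
      simpa using HasRes.sum (∅ : Finset ℕ) (f := fun _ _ => 0) (r := fun _ => 0) (by simp)
    · exact (hasRes_xi_xi hκ (by omega)).const_mul _).const_mul (1 / 2)
  have hr2 := HasRes.sum univ fun m _ => HasRes.sum (range D) fun c _ =>
    show HasRes (fun w => corr Complex.ofRealHom D Z g {c} (subTuple W {m}ᶜ) *
        (-2 * w * recKernel y BMV (z 0) w * ((BMV w (Fin.tail z m) + BMV (-w) (Fin.tail z m)) / 2 * xiMV w c)))
      (corr Complex.ofRealHom D Z g {c} (subTuple W {m}ᶜ) * ∑ a ∈ range D, xiMV (z 0) a *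
        ∑ b ∈ range D, W m b * (twistB uMV σ a b c : ℝ)) by
    by_cases hc : 2 * N ≤ c
    · have hm := hcard {m}
      rw [Finset.card_singleton] at hm
      have h0 : corr Complex.ofRealHom D Z g {c} (subTuple W {m}ᶜ) = 0 :=
        hZ.corr_eq_zero 0 (by rw [Multiset.card_zero]; omega) (Or.inl hc) _
      rw [h0, zero_mul]
      simpa using HasRes.sum (∅ : Finset ℕ) (f := fun _ _ => 0) (r := fun _ => 0) (by simp)
    · exact (hasRes_BMV_xi hκ (hzt m) (by omega)).const_mul _
  refine residue0_recKernel_mul (S' := fun w =>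
    1 / 2 * (∑ c ∈ range D, ∑ e ∈ range D, P c e * (xiMV w c * xiMV w e))
      + ∑ m, (BMV w (Fin.tail z m) + BMV (-w) (Fin.tail z m)) / 2 * A g {m}ᶜ w) ?_ ?_
  · refine (congrArg₂ HasRes (funext fun w => ?_) ?_).mp (hr2.add hr1)
    · rw [mul_add, add_comm, mul_left_comm _ (1 / 2 : ℂ)]
      simp only [hA, mul_sum]
      congr 1
      · refine sum_congr₂ fun c _ e _ => ?_
        ring
      · refine sum_congr₂ fun c _ e _ => ?_
        ring
    · simp only [hZ.corr_rec hst' (by omega), mul_add, sum_add_distrib, mul_sum,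
        sum_mul]
      congr 1 <;> symm
      · refine sum_comm.trans (sum_congr rfl fun m _ => ?_)
        refine sum_comm.trans (sum_congr rfl fun c _ => ?_)
        refine sum_congr₂ fun a _ b _ => ?_
        simp only [Complex.ofRealHom_eq_coe, twistData]
        ring
      · refine sum_comm.trans (sum_congr rfl fun c _ => ?_)
        refine sum_comm.trans (sum_congr rfl fun e _ => ?_)
        refine sum_congr rfl fun a _ => ?_
        simp only [hP, Complex.ofRealHom_eq_coe, twistData]
        push_cast
        ring
  · filter_upwards [eventually_ne_int] with w hw
    rw [hsum w hw.2, ← add_assoc, hpair w hw.2, mul_add, mul_sum _ _ (2 : ℂ)]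
    congr 1
    · ring
    · exact sum_congr rfl fun m _ => by ring


/-! ### Twist elimination -/

theorem hasRes_xiMV (a b : ℕ) : HasRes (fun w => w ^ (2 * b + 2) * xiMV w a) (if a = b then 1 else 0) := by
  have hp : HasEven 0 (PowerSeries.X ^ (b + 1)) fun w => w ^ (2 * b + 2) :=
    HasEven.X_pow (Eventually.of_forall fun w => by ring)
  have h := (hp.mul (hasEven_polar a)).hasRes.add (hp.mul (hasEven_regular a)).hasRes
  refine (congrArg₂ HasRes (funext fun w => by ring) ?_).mp h
  rw [mul_one, PowerSeries.coeff_X_pow, PowerSeries.coeff_X_pow_mul', if_neg (by omega : ¬ b + 1 ≤ 0 + 0), add_zero]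
  split_ifs <;> first | rfl | omega

theorem HasRes.eq_zero {f : ℂ → ℂ} {r : ℂ} (h : HasRes f r) (hf : ∀ᶠ w in 𝓝[≠] 0, f w = 0) : r = 0 := by
  have h1 := h.residue0_eq (F := fun w => w⁻¹ * f w) (Eventually.of_forall fun _ => rfl)
  have h2 : HasRes f 0 := ⟨0, 0, by
    filter_upwards [hf] with w hw
    simp [hw, hasSum_zero], by simp⟩
  exact h1.symm.trans (h2.residue0_eq (Eventually.of_forall fun _ => rfl))

/-- The products of the `ξ_a[f^MV]` are linearly independent. -/
theorem sum_prod_xiMV_eq_zero {n : ℕ} {s : Finset (Fin n → ℕ)} {c : (Fin n → ℕ) → ℂ}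
    (h : ∀ z : Fin n → ℂ, (∀ i (m : ℤ), z i ≠ m) → ∑ a ∈ s, c a * ∏ i, xiMV (z i) (a i) = 0)
    {b : Fin n → ℕ} (hb : b ∈ s) : c b = 0 := by
  have key : ∀ T : Finset (Fin n), ∀ z : Fin n → ℂ, (∀ i (m : ℤ), z i ≠ m) →
      ∑ a ∈ s, c a * ∏ i, (if i ∈ T then if a i = b i then 1 else 0 else xiMV (z i) (a i)) = 0 := by
    intro T
    induction T using Finset.induction_on with
    | empty => simpa using h
    | insert j T hj ih =>
      intro z hz
      have hr := HasRes.sum s fun a _ => (hasRes_xiMV (a j) (b j)).const_mul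
        (c a * ∏ i ∈ univ.erase j, (if i ∈ T then if a i = b i then 1 else 0 else xiMV (z i) (a i)))
      refine (sum_congr rfl fun a _ => ?_).trans (hr.eq_zero ?_)
      · rw [← Finset.mul_prod_erase _ _ (mem_univ j), if_pos (Finset.mem_insert_self j T), mul_assoc,
          mul_comm (ite _ _ _)]
        congr 2
        refine prod_congr rfl fun i hi => ?_
        simp [Finset.mem_insert, Finset.ne_of_mem_erase hi]
      · filter_upwards [eventually_ne_int] with w hw
        have := ih (Function.update z j w) fun i m => by
          by_cases hij : i = j
          · subst hij; simpa using hw.2 m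
          · simpa [hij] using hz i m
        refine Eq.trans ?_ (mul_eq_zero_of_right (w ^ (2 * b j + 2)) this)
        rw [mul_sum]
        refine sum_congr rfl fun a _ => ?_
        rw [← Finset.mul_prod_erase _ _ (mem_univ j), if_neg hj, Function.update_self]
        rw [prod_congr rfl fun i hi =>
          congrArg (fun t => if i ∈ T then if a i = b i then (1 : ℂ) else 0 else xiMV t (a i))
            (Function.update_of_ne (Finset.ne_of_mem_erase hi) w z)]
        ring
  have hpt : ∃ x : ℂ, ∀ m : ℤ, x ≠ m := by
    obtain ⟨x, hx⟩ := eventually_ne_int.exists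
    exact ⟨x, hx.2⟩
  obtain ⟨x, hx⟩ := hpt
  have h1 := key univ (fun _ => x) fun _ => hx
  rw [sum_eq_single_of_mem b hb] at h1
  · simpa using h1
  · intro a _ hab
    obtain ⟨i, hi⟩ := Function.ne_iff.1 hab
    rw [Finset.prod_eq_zero (mem_univ i) (by simp [hi]), mul_zero]

theorem TwistExpansion.unique {n : ℕ} {F G : (Fin n → ℕ) →₀ ℂ} {W : (Fin n → ℂ) → ℂ}
    (hF : TwistExpansion F W) (hG : TwistExpansion G W) : F = G := by
  classical
  rw [← sub_eq_zero]
  ext b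
  by_contra hb
  refine hb (sum_prod_xiMV_eq_zero (s := (F - G).support) (fun z hz => ?_) (Finsupp.mem_support_iff.2 hb))
  have h1 := (hF.2 z hz).symm.trans (hG.2 z hz)
  rw [← sub_eq_zero, ← Finsupp.sum_sub_index fun a c d => by ring] at h1
  rw [← h1, Finsupp.sum]
  refine sum_congr rfl fun a _ => ?_
  congr 1
  exact prod_congr rfl fun i _ => (xi_BMV _ (hz i)).symm

/-- The coefficients of the multilinear form `evM`. -/
def coefsM (D n : ℕ) (Z : Multiset ℕ → ℂ) : (Fin n → ℕ) →₀ ℂ :=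
  Finsupp.onFinset (Fintype.piFinset fun _ => range D)
    (fun a => if ∀ i, a i < D then Z ((univ : Finset (Fin n)).val.map a) else 0)
    fun a ha => by
      rw [Fintype.mem_piFinset]
      by_contra h
      exact ha (if_neg fun h' => h fun i => mem_range.2 (h' i))

theorem coefsM_sum (D : ℕ) {n : ℕ} (Z : Multiset ℕ → ℂ) (W : Fin n → ℕ → ℂ) :
    ((coefsM D n Z).sum fun a c => c * ∏ i, W i (a i)) = evM D W Z := by
  rw [coefsM, Finsupp.onFinset_sum _ fun a => zero_mul _, evM]
  symm
  refine Finset.sum_bij (fun b _ i => (b i : ℕ)) (fun b _ => ?_) (fun b _ b' _ h => ?_) (fun a ha => ?_)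
    fun b _ => ?_
  · simp
  · funext i; exact Fin.ext (congrFun h i)
  · rw [Fintype.mem_piFinset] at ha
    exact ⟨fun i => ⟨a i, mem_range.1 (ha i)⟩, mem_univ _, rfl⟩
  · rw [if_pos fun i => (b i).2, mul_comm]

theorem twistExpansion_coefsM {D n : ℕ} {Z : Multiset ℕ → ℂ} {W : (Fin n → ℂ) → ℂ}
    (h : ∀ z : Fin n → ℂ, (∀ i (m : ℤ), z i ≠ m) → W z = evM D (fun i => xiMV (z i)) Z) :
    TwistExpansion (coefsM D n Z) W := by
  refine ⟨fun σ a => ?_, fun z hz => ?_⟩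
  · simp only [coefsM, Finsupp.onFinset_apply, Function.comp_apply, Function.comp_def]
    congr 1
    · exact propext ⟨fun h i => by simpa using h (σ.symm i), fun h i => h _⟩
    · congr 1
      rw [← Function.comp_def, ← Multiset.map_map]
      congr 1
      exact congrArg Finset.val (Finset.map_univ_equiv σ)
  · rw [h z hz, ← coefsM_sum]
    refine sum_congr rfl fun a _ => ?_
    beta_reduce
    congr 1
    exact prod_congr rfl fun i _ => (xi_BMV _ (hz i)).symm

theorem twistElim_eq_evM {D n : ℕ} {Z : Multiset ℕ → ℂ} {W : (Fin n → ℂ) → ℂ}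
    (h : ∀ z : Fin n → ℂ, (∀ i (m : ℤ), z i ≠ m) → W z = evM D (fun i => xiMV (z i)) Z)
    {z : Fin n → ℂ} (hz : ∀ i, z i ≠ 0) :
    twistElim univ W z = evM D (fun i a => 1 / z i ^ (2 * a + 2)) Z := by
  have hE := twistExpansion_coefsM h
  have hs : InTwistSpan W := ⟨_, hE⟩
  rw [twistElim, dif_pos hs, hs.choose_spec.unique hE, ← coefsM_sum D Z fun i a => 1 / z i ^ (2 * a + 2)]
  refine sum_congr rfl fun a _ => ?_
  beta_reduce
  congr 1
  refine prod_congr rfl fun i _ => ?_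
  rw [if_pos (mem_univ i), xi_B₀ _ (hz i)]

/-! ### The Laplace transform -/

theorem norm_divPow_mul_cexp {x : ℝ} (hx : 0 ≤ x) (k : ℕ) (z : ℂ) :
    ‖((divPow k x : ℝ) : ℂ) * Complex.exp (-(z * x))‖ = divPow k x * Real.exp (-z.re * x) := by
  rw [norm_mul, Complex.norm_real, Complex.norm_exp, Real.norm_of_nonneg (divPow_nonneg k hx)]
  simp

theorem integrableOn_divPow_mul_cexp {z : ℂ} (hz : 0 < z.re) (k : ℕ) :
    IntegrableOn (fun x : ℝ => ((divPow k x : ℝ) : ℂ) * Complex.exp (-(z * x))) (Set.Ioi 0) := by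
  refine (integrableOn_divPow_mul_exp hz k le_rfl).mono' ?_ ?_
  · have := continuous_divPow k
    exact Continuous.aestronglyMeasurable (by fun_prop)
  · filter_upwards [ae_restrict_mem measurableSet_Ioi] with x hx
    rw [norm_divPow_mul_cexp (le_of_lt hx)]

theorem integral_divPow_mul_cexp {z : ℂ} (hz : 0 < z.re) (k : ℕ) :
    ∫ x : ℝ in Set.Ioi 0, ((divPow k x : ℝ) : ℂ) * Complex.exp (-(z * x)) = 1 / z ^ (k + 1) := by
  have hz0 : z ≠ 0 := by rintro rfl; simp at hz
  induction k with
  | zero =>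
    have := integral_exp_mul_complex_Ioi (a := -z) (by simpa using hz) 0
    simpa [divPow_zero, neg_div] using this
  | succ k ih =>
    have hd : ∀ x : ℝ, HasDerivAt (fun x : ℝ => ((divPow (k + 1) x : ℝ) : ℂ) * Complex.exp (-(z * x)))
        (((divPow k x : ℝ) : ℂ) * Complex.exp (-(z * x))
          + -z * (((divPow (k + 1) x : ℝ) : ℂ) * Complex.exp (-(z * x)))) x := by
      intro x
      have h1 : HasDerivAt (fun x : ℝ => -(z * (x : ℂ))) (-(z * 1)) x :=
        (Complex.ofRealCLM.hasDerivAt.const_mul z).fun_neg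
      exact ((hasDerivAt_divPow k x).ofReal_comp.mul h1.cexp).congr_deriv (by ring)
    have hi := fun k => integrableOn_divPow_mul_cexp hz k
    have ht : Tendsto (fun x : ℝ => ((divPow (k + 1) x : ℝ) : ℂ) * Complex.exp (-(z * x))) atTop (𝓝 0) := by
      rw [tendsto_zero_iff_norm_tendsto_zero]
      refine (tendsto_divPow_mul_exp hz (k + 1)).congr' ?_
      filter_upwards [eventually_ge_atTop 0] with x hx
      rw [norm_divPow_mul_cexp hx]
    have := integral_Ioi_of_hasDerivAt_of_tendsto' (fun x _ => hd x) ((hi k).add ((hi (k + 1)).const_mul _)) ht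
    rw [integral_add (hi k) ((hi (k + 1)).const_mul _), integral_const_mul, ih] at this
    simp only [divPow, zero_pow (Nat.succ_ne_zero k), zero_div, Complex.ofReal_zero, zero_mul, sub_zero] at this ⊢
    rw [pow_succ z (k + 1)]
    field_simp at this ⊢
    linear_combination -this


theorem laplaceIntegrand_evM {D n : ℕ} {Z : Multiset ℕ → ℝ} {f : (Fin n → ℝ) → ℝ} {L : Fin n → ℝ}
    (hf : f L = evM D (fun i => psi (L i)) Z) (z : Fin n → ℂ) :
    laplaceIntegrand f z L = ∑ b : Fin n → Fin D,
      (Z ((univ : Finset (Fin n)).val.map fun i => (b i : ℕ)) : ℂ)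
        * ∏ i, (((divPow (2 * b i + 1) (L i) : ℝ) : ℂ) * Complex.exp (-(z i * L i))) := by
  rw [laplaceIntegrand, hf, evM, Complex.ofReal_sum, sum_mul, sum_mul]
  refine sum_congr rfl fun b _ => ?_
  rw [← Finset.sum_neg_distrib, Complex.exp_sum, Complex.ofReal_mul, Complex.ofReal_prod]
  simp only [← mul_psi, Complex.ofReal_mul, Finset.prod_mul_distrib]
  ring

theorem laplace_evM {D n : ℕ} {Z : Multiset ℕ → ℝ} {f : (Fin n → ℝ) → ℝ}
    (hf : ∀ L, (∀ i, 0 < L i) → f L = evM D (fun i => psi (L i)) Z) {z : Fin n → ℂ} (hz : ∀ i, 0 < (z i).re) :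
    IntegrableOn (laplaceIntegrand f z) (orthant n) ∧
      laplace f z = evM D (fun i a => 1 / z i ^ (2 * a + 2)) fun K => (Z K : ℂ) := by
  have hm : MeasurableSet (orthant n) := MeasurableSet.univ_pi fun _ => measurableSet_Ioi
  have hμ : (volume : Measure (Fin n → ℝ)).restrict (orthant n)
      = Measure.pi fun _ => volume.restrict (Set.Ioi 0) := by
    rw [orthant, volume_pi, Measure.restrict_pi_pi]
  have hi : ∀ b : Fin n → Fin D, Integrable (fun L : Fin n → ℝ =>
      (Z ((univ : Finset (Fin n)).val.map fun i => (b i : ℕ)) : ℂ)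
        * ∏ i, (((divPow (2 * b i + 1) (L i) : ℝ) : ℂ) * Complex.exp (-(z i * L i))))
      (Measure.pi fun _ => volume.restrict (Set.Ioi 0)) := fun b =>
    (Integrable.fintype_prod (f := fun i (x : ℝ) => ((divPow (2 * b i + 1) x : ℝ) : ℂ) * Complex.exp (-(z i * x)))
      fun i => integrableOn_divPow_mul_cexp (hz i) _).const_mul _
  have he : Set.EqOn (laplaceIntegrand f z) _ (orthant n) := fun L hL =>
    laplaceIntegrand_evM (hf L fun i => hL i (Set.mem_univ i)) z
  constructor
  · rw [integrableOn_congr_fun he hm, IntegrableOn, hμ]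
    exact integrable_finsetSum _ fun b _ => hi b
  · rw [laplace, setIntegral_congr_fun hm he, hμ, integral_finsetSum _ fun b _ => hi b, evM]
    refine sum_congr rfl fun b _ => ?_
    rw [integral_const_mul, integral_fintype_prod_eq_prod
      (f := fun i (x : ℝ) => ((divPow (2 * b i + 1) x : ℝ) : ℂ) * Complex.exp (-(z i * x))), mul_comm]
    simp only [integral_divPow_mul_cexp (hz _)]

theorem laplace_twistedVol_eq_twistElim {𝒟 : ABOData} {σ : ℕ → ℝ} {y : ℂ → ℂ} (h𝒟 : IsTensorData 𝒟 σ)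
    (hσ : ∀ᶠ w in 𝓝[≠] 0, HasSum (fun l => (σ l : ℂ) * w ^ (2 * (l : ℤ) - 1)) (1 / y w))
    {g n : ℕ} (hn : 0 < n) (hst : Stable g n) :
    InTwistSpan (ceoW y BMV g n) ∧ ∀ z : Fin n → ℂ, (∀ i, 0 < (z i).re) →
      IntegrableOn (laplaceIntegrand (twistedVol 𝒟 fMV g n) z) (orthant n) ∧
      laplace (twistedVol 𝒟 fMV g n) z = twistElim univ (ceoW y BMV g n) z := by
  have hW := fun z hz => ceoW_eq_corr hσ le_rfl g n z hn hst (Nat.le_add_right (2 * g + n) 2) hz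
  refine ⟨⟨_, twistExpansion_coefsM hW⟩, fun z hz => ?_⟩
  have hV := fun L hL => twistedVol_eq_corr (f := fMV) (u := uMV) (by omega) hn hst
    (Nat.le_add_right (2 * g + n) 2) (fun g n L hn hst hN hL => vol_eq_corr h𝒟 le_rfl g n L hn hst hN hL)
    integrableOn_psi_mul_psi_mul_fMV (fun _ _ => rfl) (L := L) hL
  have h := laplace_evM hV hz
  refine ⟨h.1, h.2.trans (twistElim_eq_evM hW fun i h0 => ?_).symm⟩
  have := hz i
  simp [h0] at this

theorem hasSum_one_div_ySM_sigma {p : ℕ} (hp : Odd p) :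
    ∀ᶠ w in 𝓝[≠] 0, HasSum (fun l => (sigmaSM p l : ℂ) * w ^ (2 * (l : ℤ) - 1)) (1 / ySM p w) := by
  filter_upwards [hasSum_one_div_ySM hp] with w hw
  refine (hasSum_nat_add_iff' 1).1 (HasSum.of_eq hw (fun l => ?_) (by simp [sigmaSM]))
  rw [sigmaSM, show 2 * ((l + 1 : ℕ) : ℤ) - 1 = ((2 * l + 1 : ℕ) : ℤ) by push_cast; ring, zpow_natCast]

end TwistedTR

end

theorem mainTheorem1 (p : ℕ) (hp : Odd p) :
    -- Laplace duality for the twisted `(2,p)` minimal string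
    (∀ g n : ℕ, 0 < n → Stable g n →
      InTwistSpan (ceoW (yM p) BMV g n) ∧
      ∀ z : Fin n → ℂ, (∀ i, 0 < (z i).re) →
        MeasureTheory.IntegrableOn
          (laplaceIntegrand (twistedVol (minimalString p) fMV g n) z) (orthant n) ∧
        laplace (twistedVol (minimalString p) fMV g n) z =
          twistElim Finset.univ (ceoW (yM p) BMV g n) z) ∧
    -- Laplace duality for the twisted `(2,2p-2)` minimal superstring
    (∀ g n : ℕ, 0 < n → Stable g n →
      InTwistSpan (ceoW (ySM p) BMV g n) ∧
      ∀ z : Fin n → ℂ, (∀ i, 0 < (z i).re) →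
        MeasureTheory.IntegrableOn
          (laplaceIntegrand (twistedVol (minimalSuperstring p) fMV g n) z) (orthant n) ∧
        laplace (twistedVol (minimalSuperstring p) fMV g n) z =
          twistElim Finset.univ (ceoW (ySM p) BMV g n) z) ∧
    -- the moments of the kernel of the minimal string are governed by `1 / y`
    (∃ s : ℕ → ℝ,
      (∀ᶠ z : ℂ in nhdsWithin 0 {0}ᶜ,
        HasSum (fun l : ℕ => (s l : ℂ) * z ^ (2 * (l : ℤ) - 1)) (1 / yM p z)) ∧
      ∀ (k : ℕ) (t : ℝ),
        MeasureTheory.IntegrableOn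
          (fun x => x ^ (2 * k + 1) / (Nat.factorial (2 * k + 1) : ℝ) * HM p x t)
          (Set.Ioi (0 : ℝ)) ∧
        ∫ x in Set.Ioi (0 : ℝ), x ^ (2 * k + 1) / (Nat.factorial (2 * k + 1) : ℝ) * HM p x t =
          ∑ l ∈ Finset.range (k + 2),
            s l * (t ^ (2 * k + 2 - 2 * l) / (Nat.factorial (2 * k + 2 - 2 * l) : ℝ))) ∧
    -- the moments of the kernel of the minimal superstring are governed by `1 / y`
    (∃ s : ℕ → ℝ,
      (∀ᶠ z : ℂ in nhdsWithin 0 {0}ᶜ,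
        HasSum (fun l : ℕ => (s l : ℂ) * z ^ (2 * l + 1)) (1 / ySM p z)) ∧
      ∀ (k : ℕ) (t : ℝ),
        MeasureTheory.IntegrableOn
          (fun x => x ^ (2 * k + 1) / (Nat.factorial (2 * k + 1) : ℝ) * HSM p x t)
          (Set.Ioi (0 : ℝ)) ∧
        kerIntSM p (fun x => x ^ (2 * k + 1) / (Nat.factorial (2 * k + 1) : ℝ)) 0 t =
          ∑ l ∈ Finset.range (k + 1),
            s l * (t ^ (2 * k + 1 - 2 * l) / (Nat.factorial (2 * k + 1 - 2 * l) : ℝ))) := by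
  refine ⟨fun g n hn hst => laplace_twistedVol_eq_twistElim (isTensorData_minimalString hp)
    (hasSum_one_div_yM hp) hn hst, fun g n hn hst => laplace_twistedVol_eq_twistElim
    (isTensorData_minimalSuperstring hp) (hasSum_one_div_ySM_sigma hp) hn hst,
    ⟨coefM p, hasSum_one_div_yM hp, fun k t => ⟨(isMomentKernel_HM p).integrableOn (2 * k + 1) t,
      (isMomentKernel_HM p).moment k t⟩⟩,
    ⟨coefSM p, hasSum_one_div_ySM hp, fun k t => ⟨(isMomentKernel_HSM p).integrableOn (2 * k + 1) t, ?_⟩⟩⟩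
  have h := kerIntSM_sum p (n := k + 1) (coef := fun c => if c = k then 1 else 0)
    (φ := divPow (2 * k + 1)) (fun x _ => by simp [mul_psi]) t
  refine h.trans (Eq.trans ?_ (minimalSuperstring_coefs p k t).symm)
  simp
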